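/- For an even integer $k$ write $k = 12\ell_k + r_k$ with $\ell_k\in\mathbb Z$ and $r_k\in\{0,4,6,8,10,14\}$. Let $\Gamma_0^+(3)=\Gamma_0(3)\cup\begin{pmatrix}0&-1/\sqrt3\\ \sqrt3&0\end{pmatrix}\Gamma_0(3)\subset SL_2(\mathbb R)$, let $\mathbb H$ be the upper half plane and $q=e^{2\pi i z}$. Let $M_k^!(\Gamma_0^+(3))$ be the space of holomorphic functions $f:\mathbb H\to\mathbb C$ such that $f\left(\frac{az+b}{cz+d}\right)=(cz+d)^k f(z)$ for all $\begin{pmatrix}a&b\\c&d\end{pmatrix}\in\Gamma_0^+(3)$ and $z\in\mathbb H$, and such that $f$ has an expansion $f(z)=\sum_{n\ge n_f}a_nq^n$ on $\mathbb H$ for some $n_f\in\mathbb Z$; let $S_k(\Gamma_0^+(3))$ be the subspace of those $f$ for which one can take $n_f\ge 1$, and put $\varepsilon_k=\dim_{\mathbb C} S_{r_k}(\Gamma_0^+(3))$ (which is $0$ for $r_k=0,4,6$ and $1$ for $r_k=8,10,14$). Let $m$ be an integer with $m\ge 18|\ell_k|+23$. Then there is exactly one $f_{k,m}\in M_k^!(\Gamma_0^+(3))$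 with $q$-expansion $$f_{k,m}(z)=q^{-m}+O\left(q^{2\ell_k+\varepsilon_k+1}\right)$$ (that is, the coefficient of $q^{-m}$ is $1$ and all other coefficients of $q^n$ with $n<2\ell_k+\varepsilon_k+1$ vanish), and every zero of $f_{k,m}$ in the fundamental domain $$\mathbb F^+(3)=\left\{z\in\mathbb H: |z|\ge\tfrac1{\sqrt3},\ -\tfrac12\le \mathrm{Re}(z)\le 0\right\}\cup\left\{z\in\mathbb H: |z|>\tfrac1{\sqrt3},\ 0<\mathrm{Re}(z)<\tfrac12\right\}$$ lies on the arc $$S=\left\{\tfrac1{\sqrt3}e^{i\theta}:\ \tfrac\pi2\le\theta\le\tfrac{5\pi}6\right\}.$$ -/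

import Mathlib

noncomputable section

namespace Fricke3

open CongruenceSubgroup
open scoped MatrixGroups Manifold UpperHalfPlane

/-- The Fricke involution matrix `(0, -1/√3; √3, 0)`. -/
def W : SL(2, ℝ) :=
  ⟨!![0, -(1 / √3); √3, 0], by
    have h : √3 ≠ 0 := by positivity
    simp [Matrix.det_fin_two, h]⟩

/-- The inclusion `SL(2, ℤ) → SL(2, ℝ)`. -/
abbrev toReal : SL(2, ℤ) →* SL(2, ℝ) := Matrix.SpecialLinearGroup.map (Int.castRingHom ℝ)

theorem W_mul_W : W * W = -1 := by
  have h : √3 ≠ 0 := by positivity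
  apply Subtype.ext
  rw [Matrix.SpecialLinearGroup.coe_mul, Matrix.SpecialLinearGroup.coe_neg,
    Matrix.SpecialLinearGroup.coe_one]
  ext i j
  fin_cases i <;> fin_cases j <;> simp [W, h]

/-- `W` normalizes `Γ₀(3)`. -/
theorem exists_mul_W (γ : SL(2, ℤ)) (hγ : γ ∈ Gamma0 3) :
    ∃ δ ∈ Gamma0 3, toReal γ * W = W * toReal δ := by
  obtain ⟨c, hc⟩ : (3 : ℤ) ∣ γ 1 0 := by
    rw [Gamma0_mem] at hγ
    exact (ZMod.intCast_zmod_eq_zero_iff_dvd _ 3).1 hγ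
  have hdet : γ 0 0 * γ 1 1 - γ 0 1 * γ 1 0 = 1 := by
    rw [← Matrix.det_fin_two]; exact γ.2
  have h : √3 ≠ 0 := by positivity
  have h3 : √3 * √3 = 3 := Real.mul_self_sqrt (by norm_num)
  have hc' : ((γ 1 0 : ℤ) : ℝ) = 3 * c := by rw [hc]; push_cast; ring
  let δ : SL(2, ℤ) := ⟨!![γ 1 1, -c; -3 * γ 0 1, γ 0 0], by
    rw [Matrix.det_fin_two_of]
    rw [hc] at hdet
    linarith⟩
  have h10 : δ 1 0 = -3 * γ 0 1 := rfl
  have h00 : δ 0 0 = γ 1 1 := rfl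
  have h01 : δ 0 1 = -c := rfl
  have h11 : δ 1 1 = γ 0 0 := rfl
  refine ⟨δ, ?_, ?_⟩
  · have : (3 : ZMod 3) = 0 := by decide
    rw [Gamma0_mem, h10]
    push_cast
    rw [this]
    simp
  · apply Subtype.ext
    rw [Matrix.SpecialLinearGroup.coe_mul, Matrix.SpecialLinearGroup.coe_mul]
    ext i j
    fin_cases i <;> fin_cases j <;>
      simp [W, Matrix.mul_apply, Fin.sum_univ_two, hc', h00, h01, h10, h11]
    · field_simp
      linear_combination ((γ 0 1 : ℤ) : ℝ) * h3
    · ring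
    · ring
    · field_simp
      linear_combination (-(c : ℝ)) * h3

/-- The Fricke group `Γ₀⁺(3) = Γ₀(3) ∪ W Γ₀(3)`, as a subgroup of `SL(2, ℝ)`. -/
def Gamma0Plus : Subgroup SL(2, ℝ) where
  carrier := {g | ∃ γ ∈ Gamma0 3, g = toReal γ ∨ g = W * toReal γ}
  one_mem' := ⟨1, one_mem _, Or.inl (map_one _).symm⟩
  mul_mem' := by
    rintro _ _ ⟨γ, hγ, rfl | rfl⟩ ⟨δ, hδ, rfl | rfl⟩
    · exact ⟨γ * δ, mul_mem hγ hδ, Or.inl (map_mul _ _ _).symm⟩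
    · obtain ⟨γ', hγ', h⟩ := exists_mul_W γ hγ
      exact ⟨γ' * δ, mul_mem hγ' hδ, Or.inr (by rw [map_mul, ← mul_assoc, h, mul_assoc])⟩
    · exact ⟨γ * δ, mul_mem hγ hδ, Or.inr (by rw [map_mul, mul_assoc])⟩
    · obtain ⟨γ', hγ', h⟩ := exists_mul_W γ hγ
      refine ⟨-(γ' * δ), by simpa using mul_mem hγ' hδ, Or.inl ?_⟩
      rw [mul_assoc, ← mul_assoc (toReal γ), h, mul_assoc, ← mul_assoc, W_mul_W, ← map_mul]
      ext i j
      simp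
  inv_mem' := by
    rintro _ ⟨γ, hγ, rfl | rfl⟩
    · exact ⟨γ⁻¹, inv_mem hγ, Or.inl (map_inv _ _).symm⟩
    · obtain ⟨γ', hγ', h⟩ := exists_mul_W γ⁻¹ (inv_mem hγ)
      refine ⟨-γ', by simpa using hγ', Or.inr ?_⟩
      rw [inv_eq_iff_mul_eq_one]
      have h1 : toReal (-γ') = -toReal γ' := by ext i j; simp
      rw [h1, mul_neg, ← h, mul_neg, map_inv, mul_assoc, mul_inv_cancel_left, W_mul_W, neg_neg]

/-- `f(τ) = ∑ a(n) qⁿ` on the whole upper half plane, `q = e^{2πiτ}`, with only finitely many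
negative exponents. -/
def HasQExpansion (f : ℍ → ℂ) (a : ℤ → ℂ) : Prop :=
  (∃ n₀ : ℤ, ∀ n < n₀, a n = 0) ∧
    ∀ τ : ℍ, HasSum (fun n : ℤ => a n * Complex.exp (2 * Real.pi * Complex.I * n * τ)) (f τ)

/-- The space `M_k^!(Γ₀⁺(3))` of weakly holomorphic modular forms of weight `k`. -/
def weaklyHolomorphic (k : ℤ) : Submodule ℂ (ℍ → ℂ) where
  carrier := {f | MDifferentiable 𝓘(ℂ) 𝓘(ℂ) f ∧
    (∀ γ ∈ Gamma0Plus, ∀ τ : ℍ, f (γ • τ) = ((γ 1 0 : ℂ) * τ + (γ 1 1 : ℂ)) ^ k * f τ) ∧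
    ∃ a : ℤ → ℂ, HasQExpansion f a}
  zero_mem' := ⟨mdifferentiable_const, by simp, 0, ⟨0, by simp⟩, by simp [hasSum_zero]⟩
  add_mem' := by
    rintro f g ⟨hf, hf', a, ⟨m, hm⟩, ha⟩ ⟨hg, hg', b, ⟨n, hn⟩, hb⟩
    refine ⟨hf.add hg, fun γ hγ τ => ?_, a + b, ⟨min m n, fun i hi => ?_⟩, fun τ => ?_⟩
    · simp only [Pi.add_apply, hf' γ hγ τ, hg' γ hγ τ]
      ring
    · rw [Pi.add_apply, hm i (by omega), hn i (by omega), add_zero]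
    · simpa only [Pi.add_apply, add_mul] using (ha τ).add (hb τ)
  smul_mem' := by
    rintro c f ⟨hf, hf', a, ⟨m, hm⟩, ha⟩
    refine ⟨hf.const_smul c, fun γ hγ τ => ?_, c • a, ⟨m, fun i hi => ?_⟩, fun τ => ?_⟩
    · simp only [Pi.smul_apply, smul_eq_mul, hf' γ hγ τ]
      ring
    · rw [Pi.smul_apply, hm i hi, smul_zero]
    · simpa only [Pi.smul_apply, smul_eq_mul, mul_assoc] using (ha τ).mul_left c

/-- The space `S_k(Γ₀⁺(3))` of cusp forms of weight `k`: the `q`-expansion starts at `q¹` or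
later. -/
def cuspForms (k : ℤ) : Submodule ℂ (ℍ → ℂ) where
  carrier := {f | f ∈ weaklyHolomorphic k ∧
    ∃ a : ℤ → ℂ, HasQExpansion f a ∧ ∀ n < 1, a n = 0}
  zero_mem' := ⟨zero_mem _, 0, ⟨⟨0, by simp⟩, by simp [hasSum_zero]⟩, by simp⟩
  add_mem' := by
    rintro f g ⟨hf, a, ⟨-, ha⟩, ha'⟩ ⟨hg, b, ⟨-, hb⟩, hb'⟩
    have h : ∀ n < (1 : ℤ), (a + b) n = 0 := fun n hn => by
      rw [Pi.add_apply, ha' n hn, hb' n hn, add_zero]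
    refine ⟨add_mem hf hg, a + b, ⟨⟨1, h⟩, fun τ => ?_⟩, h⟩
    simpa only [Pi.add_apply, add_mul] using (ha τ).add (hb τ)
  smul_mem' := by
    rintro c f ⟨hf, a, ⟨-, ha⟩, ha'⟩
    have h : ∀ n < (1 : ℤ), (c • a) n = 0 := fun n hn => by
      rw [Pi.smul_apply, ha' n hn, smul_zero]
    refine ⟨Submodule.smul_mem _ c hf, c • a, ⟨⟨1, h⟩, fun τ => ?_⟩, h⟩
    simpa only [Pi.smul_apply, smul_eq_mul, mul_assoc] using (ha τ).mul_left c

/-- `ε = dim S_r(Γ₀⁺(3))`. -/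
def eps (r : ℤ) : ℕ := Module.finrank ℂ (cuspForms r)

/-- For `k = 12ℓ + r`: `f` is a weakly holomorphic form of weight `k` on `Γ₀⁺(3)` with
`f = q^{-m} + O(q^{2ℓ+ε+1})`. -/
def IsCanonicalBasisElement (k ℓ r m : ℤ) (f : ℍ → ℂ) : Prop :=
  f ∈ weaklyHolomorphic k ∧
    ∃ a : ℤ → ℂ, HasQExpansion f a ∧
      ∀ n < 2 * ℓ + eps r + 1, a n = if n = -m then 1 else 0

/-- The fundamental domain `𝔽⁺(3)`. -/
def fundamentalDomain : Set ℍ :=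
  {z | 1 / √3 ≤ ‖(z : ℂ)‖ ∧ -(1 / 2) ≤ z.re ∧ z.re ≤ 0} ∪
    {z | 1 / √3 < ‖(z : ℂ)‖ ∧ 0 < z.re ∧ z.re < 1 / 2}

/-- The arc `S = {e^{iθ}/√3 : π/2 ≤ θ ≤ 5π/6}`. -/
def arc : Set ℂ :=
  {z | ∃ θ : ℝ, Real.pi / 2 ≤ θ ∧ θ ≤ 5 * Real.pi / 6 ∧ z = 1 / (√3 : ℝ) * Complex.exp (Complex.I * θ)}

end Fricke3

end

/-! ### The nome, Euler products, and modular forms as functions on the unit disc. -/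

noncomputable section

namespace Fricke3

open Complex Metric Set Filter Topology ComplexConjugate

/-! Write W for τ ↦ -1/(3τ) and u = (η(τ)/η(3τ))¹²/27 (`hauptU`). Then u∘W = 1/u, and j = 27(u +
1/u) (`hauptJ`) is a Hauptmodul with a simple pole at the cusp. Let B = η(τ)⁶η(3τ)⁶. For a suitable
seed A the form F = B^E A, with E = 2ℓ + ε, has weight k and order E at the cusp, and a companion F'
of weight 2 - k and order -E - 1 satisfies F F' = -q dj/dq (`IsSeed.dualPair`). A weight two form
holomorphic at the cusp is zero (`weight_two_eq_zero`). Multiplying the difference of two candidates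
by F' therefore gives uniqueness. The candidate itself is f = F P(j) with P real, monic, of degree N
= m + E (`DualPair.exists_canonical`).

The seeds vanish only where j = ±54, so everything depends on the roots of P. By the maximum
principle |u| > 1 in the fundamental domain off the arc (`one_lt_norm_hauptU`), so a point of the
domain with j in [-54, 54] lies on the arc. On the arc j = 54 Re u is real and strictly monotone
(`re_hauptU_strictAnti`). It is therefore enough to find N zeros of f on the open arc: they give N
distinct roots of P in [-54, 54], hence all of them.

On the arc W acts as the reflection τ ↦ -τ̄, so e^{ikθ/2} f is real there. The generating function
of the Faber polynomials and the residue theorem (`DualPair.faber_eq`) express P(j(z)) through the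
points over j(z) above some height a, plus an integral along Im τ = a. The points z and -z̄ together
contribute 2 cos Ψ · e^{2πmy}, where z = x + iy and Ψ = kθ/2 - 2πmx. Far from the corner ρ one takes
a = 2/5 and no other point occurs. Near ρ the points z/(3z+1) and -(z+1)/(3z+2) are almost as high
as z, so the contour is lowered to a = 1/9 and they are kept. At points whose phase is at least π/6
short of its value at ρ, `log_mul_add_ge` and `log_mul_add_mono` show that they cannot outweigh the
main term. The integral is at most a fifth of e^{2πmy} (`budget`), and this is where m ≥ 18|ℓ| + 23
is used.

Hence f has the sign of cos Ψ at the sample points where Ψ is a multiple of π. The phase is monotone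
and passes through N half-turns, which gives N zeros. Only for r = 0 is the last sample point the
corner itself. There the three points and their mirror images contribute equally (`corner_sign`). -/

/-- The nome `q = e^{2πiτ}`. -/
def nome (τ : ℂ) : ℂ := cexp (2 * Real.pi * I * τ)

/-- The Fricke involution `τ ↦ -1/(3τ)`. -/
def fricke (τ : ℂ) : ℂ := -1 / (3 * τ)

lemma nome_ne_zero (τ : ℂ) : nome τ ≠ 0 := exp_ne_zero _

lemma norm_nome (τ : ℂ) : ‖nome τ‖ = Real.exp (-(2 * Real.pi * τ.im)) := by
  rw [nome, norm_exp]
  congr 1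
  simp

lemma norm_nome_lt_one {τ : ℂ} (h : 0 < τ.im) : ‖nome τ‖ < 1 := by
  rw [norm_nome, Real.exp_lt_one_iff]
  have := Real.pi_pos
  have : 0 < 2 * Real.pi * τ.im := by positivity
  linarith

lemma nome_mem_ball {τ : ℂ} (h : 0 < τ.im) : nome τ ∈ ball (0 : ℂ) 1 := by
  simpa using norm_nome_lt_one h

lemma nome_add_one (τ : ℂ) : nome (τ + 1) = nome τ := by
  rw [nome, nome, mul_add, mul_one, exp_add, exp_two_pi_mul_I, mul_one]

lemma nome_add_int (τ : ℂ) (n : ℤ) : nome (τ + n) = nome τ := by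
  rw [nome, nome, mul_add, exp_add, mul_comm (2 * (Real.pi : ℂ) * I) n, exp_int_mul_two_pi_mul_I,
    mul_one]

lemma nome_eq_iff {a b : ℂ} : nome a = nome b ↔ ∃ n : ℤ, a = b + n := by
  rw [nome, nome, exp_eq_exp_iff_exists_int]
  refine exists_congr fun n => ?_
  have h : 2 * (Real.pi : ℂ) * I ≠ 0 := two_pi_I_ne_zero
  constructor
  · intro h'
    apply mul_left_cancel₀ h
    rw [h']
    ring
  · rintro rfl
    ring

lemma nome_neg_conj (τ : ℂ) : nome (-conj τ) = conj (nome τ) := by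
  rw [nome, nome, ← exp_conj]
  simp [map_ofNat]

lemma hasDerivAt_nome (τ : ℂ) : HasDerivAt nome (2 * Real.pi * I * nome τ) τ := by
  have := ((hasDerivAt_id τ).const_mul (2 * (Real.pi : ℂ) * I)).cexp
  refine this.congr_deriv ?_
  simp [nome, mul_comm]

lemma differentiable_nome : Differentiable ℂ nome := fun τ => (hasDerivAt_nome τ).differentiableAt

lemma continuous_nome : Continuous nome := differentiable_nome.continuous

/-- Every nonzero point of the unit disc is the nome of a point in the strip `|Re τ| ≤ 1/2`. -/
lemma exists_nome_eq {w : ℂ} (h0 : w ≠ 0) (h1 : ‖w‖ < 1) :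
    ∃ τ : ℂ, 0 < τ.im ∧ |τ.re| ≤ 1 / 2 ∧ nome τ = w := by
  have hpi := Real.pi_pos
  have h : 2 * (Real.pi : ℂ) * I ≠ 0 := two_pi_I_ne_zero
  refine ⟨log w / (2 * Real.pi * I), ?_, ?_, ?_⟩
  · have : (log w / (2 * Real.pi * I)) = ((log w).im / (2 * Real.pi) : ℝ) +
        (-(log w).re / (2 * Real.pi) : ℝ) * I := by
      conv_lhs => rw [← re_add_im (log w)]
      push_cast
      field_simp
      ring_nf
      simp
    rw [this]
    simp only [add_im, ofReal_im, mul_im, ofReal_re, I_im, I_re]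
    rw [log_re]
    have : Real.log ‖w‖ < 0 := Real.log_neg (norm_pos_iff.2 h0) h1
    simp only [mul_one, mul_zero, add_zero, zero_add]
    apply div_pos <;> linarith
  · have : (log w / (2 * Real.pi * I)) = ((log w).im / (2 * Real.pi) : ℝ) +
        (-(log w).re / (2 * Real.pi) : ℝ) * I := by
      conv_lhs => rw [← re_add_im (log w)]
      push_cast
      field_simp
      ring_nf
      simp
    rw [this]
    simp only [add_re, ofReal_re, mul_re, I_re, I_im, ofReal_im, mul_zero, zero_mul, sub_zero,
      add_zero]
    rw [abs_div, abs_of_pos (by positivity : 0 < 2 * Real.pi), div_le_iff₀ (by positivity)]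
    have := abs_arg_le_pi w
    rw [log_im]
    linarith
  · rw [nome, mul_div_cancel₀ _ h, exp_log h0]

lemma fricke_im (τ : ℂ) : (fricke τ).im = τ.im / (3 * normSq τ) := by
  rw [fricke, div_eq_mul_inv, mul_inv]
  simp [inv_im, inv_re, neg_mul]
  ring

lemma fricke_im_pos {τ : ℂ} (h : 0 < τ.im) : 0 < (fricke τ).im := by
  rw [fricke_im]
  have : τ ≠ 0 := by rintro rfl; simp at h
  have := normSq_pos.2 this
  positivity

lemma ne_zero_of_im_pos {τ : ℂ} (h : 0 < τ.im) : τ ≠ 0 := by rintro rfl; simp at h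

/-- The Euler product `∏ (1 - wⁿ)`. -/
def eulerProd (w : ℂ) : ℂ := ∏' n : ℕ, (1 - w ^ (n + 1))

lemma eulerProd_ne_zero {w : ℂ} (h : ‖w‖ < 1) : eulerProd w ≠ 0 := by
  have := tprod_one_add_ne_zero_of_summable (f := fun n : ℕ => -w ^ (n + 1)) ?_ ?_
  · simpa [eulerProd, ← sub_eq_add_neg] using! this
  · intro i hi
    have h1 : w ^ (i + 1) = 1 := by linear_combination -hi
    have h2 : ‖w‖ ^ (i + 1) < 1 := pow_lt_one₀ (norm_nonneg _) h (by omega)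
    rw [← norm_pow, h1] at h2
    simp at h2
  · simpa using (summable_nat_add_iff 1).mpr (summable_geometric_of_lt_one (norm_nonneg _) h)

lemma eulerProd_zero : eulerProd 0 = 1 := by simp [eulerProd]

lemma differentiableOn_eulerProd : DifferentiableOn ℂ eulerProd (ball 0 1) :=
  ModularForm.differentiableOn_tprod_one_sub_pow

lemma eulerProd_conj {w : ℂ} (h : ‖w‖ < 1) : eulerProd (conj w) = conj (eulerProd w) := by
  rw [eulerProd, eulerProd,
    (ModularForm.multipliable_one_sub_pow h).map_tprod (starRingEnd ℂ) continuous_conj]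
  simp

/-- Holomorphic functions on the unit disc that are real on the real axis. -/
structure DiscReal (g : ℂ → ℂ) : Prop where
  diff : DifferentiableOn ℂ g (ball 0 1)
  real : ∀ w ∈ ball (0 : ℂ) 1, g (conj w) = conj (g w)

lemma conj_mem_ball {w : ℂ} (h : w ∈ ball (0 : ℂ) 1) : conj w ∈ ball (0 : ℂ) 1 := by
  simpa using h

namespace DiscReal

variable {f g : ℂ → ℂ}

lemma differentiableAt (h : DiscReal g) {w : ℂ} (hw : ‖w‖ < 1) : DifferentiableAt ℂ g w :=
  h.diff.differentiableAt (isOpen_ball.mem_nhds (by simpa using hw))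

lemma const (c : ℝ) : DiscReal fun _ => (c : ℂ) := ⟨differentiableOn_const _, by simp⟩

lemma one : DiscReal fun _ => (1 : ℂ) := by simpa using const 1

lemma id' : DiscReal fun w => w := ⟨differentiableOn_id, by simp⟩

lemma mul (hf : DiscReal f) (hg : DiscReal g) : DiscReal fun w => f w * g w :=
  ⟨hf.diff.mul hg.diff, fun w hw => by rw [hf.real w hw, hg.real w hw, map_mul]⟩

lemma add (hf : DiscReal f) (hg : DiscReal g) : DiscReal fun w => f w + g w :=
  ⟨hf.diff.add hg.diff, fun w hw => by rw [hf.real w hw, hg.real w hw, map_add]⟩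

lemma sub (hf : DiscReal f) (hg : DiscReal g) : DiscReal fun w => f w - g w :=
  ⟨hf.diff.sub hg.diff, fun w hw => by rw [hf.real w hw, hg.real w hw, map_sub]⟩

lemma pow (hf : DiscReal f) (n : ℕ) : DiscReal fun w => f w ^ n :=
  ⟨hf.diff.pow n, fun w hw => by rw [hf.real w hw, map_pow]⟩

lemma inv (hf : DiscReal f) (h0 : ∀ w ∈ ball (0 : ℂ) 1, f w ≠ 0) : DiscReal fun w => (f w)⁻¹ :=
  ⟨hf.diff.inv h0, fun w hw => by rw [hf.real w hw, map_inv₀]⟩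

lemma div (hf : DiscReal f) (hg : DiscReal g) (h0 : ∀ w ∈ ball (0 : ℂ) 1, g w ≠ 0) :
    DiscReal fun w => f w / g w := by
  simpa only [div_eq_mul_inv] using hf.mul (hg.inv h0)

lemma zpow (hf : DiscReal f) (h0 : ∀ w ∈ ball (0 : ℂ) 1, f w ≠ 0) (n : ℤ) :
    DiscReal fun w => f w ^ n :=
  ⟨hf.diff.zpow (Or.inl h0), fun w hw => by rw [hf.real w hw, map_zpow₀]⟩

lemma deriv (hf : DiscReal f) : DiscReal (deriv f) := by
  refine ⟨hf.diff.deriv isOpen_ball, fun w hw => ?_⟩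
  have h1 := (hf.differentiableAt (w := w) (by simpa using hw)).hasDerivAt.conj_conj
  refine (HasDerivAt.congr_of_eventuallyEq h1 ?_).deriv
  filter_upwards [isOpen_ball.mem_nhds (conj_mem_ball hw)] with x hx
  simp only [Function.comp]
  rw [hf.real x hx, conj_conj]

/-- Orders of vanishing at the cusp are removed one factor `w` at a time, and the quotient must stay
in the class. -/
lemma dslope (hf : DiscReal f) : DiscReal (dslope f 0) := by
  refine ⟨(differentiableOn_dslope (ball_mem_nhds _ one_pos)).2 hf.diff, fun w hw => ?_⟩
  have h0 : (0 : ℂ) ∈ ball (0 : ℂ) 1 := mem_ball_self one_pos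
  by_cases h : w = 0
  · subst h
    have := hf.deriv.real 0 h0
    simpa using this
  · have h' : conj w ≠ 0 := by simpa using h
    have := hf.real 0 h0
    rw [dslope_of_ne _ h, dslope_of_ne _ h', slope_def_field, slope_def_field, hf.real w hw]
    simp only [map_zero] at this
    rw [map_div₀, map_sub, map_sub, ← this]
    simp

end DiscReal

lemma norm_pow_three_lt {w : ℂ} (h : w ∈ ball (0 : ℂ) 1) : w ^ 3 ∈ ball (0 : ℂ) 1 := by
  simp only [mem_ball_zero_iff, norm_pow] at h ⊢
  exact pow_lt_one₀ (norm_nonneg _) h (by norm_num)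

lemma discReal_eulerProd : DiscReal eulerProd :=
  ⟨differentiableOn_eulerProd, fun _ hw => eulerProd_conj (by simpa using hw)⟩

lemma discReal_eulerProd_cube : DiscReal fun w => eulerProd (w ^ 3) := by
  refine ⟨differentiableOn_eulerProd.comp (by fun_prop) fun w hw => norm_pow_three_lt hw,
    fun w hw => ?_⟩
  rw [← map_pow, eulerProd_conj (by simpa using norm_pow_three_lt hw)]

/-- `β`, where `qβ(q) = η(τ)⁶ η(3τ)⁶`. -/
def betaQ (w : ℂ) : ℂ := eulerProd w ^ 6 * eulerProd (w ^ 3) ^ 6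

/-- `υ`, where `υ(q)/q = (η(τ)/η(3τ))¹²`. -/
def upsQ (w : ℂ) : ℂ := (eulerProd w / eulerProd (w ^ 3)) ^ 12

/-- `ι`, where `ι(q)/q` is the Hauptmodul `(η(τ)/η(3τ))¹² + 729 (η(3τ)/η(τ))¹²`. -/
def hauptQ (w : ℂ) : ℂ := upsQ w + 729 * w ^ 2 / upsQ w

/-- The weight two form `(3 E₂(3τ) - E₂(τ))/2`. -/
def eisQ (w : ℂ) : ℂ := 1 - w * deriv upsQ w / upsQ w

/-- The weight six form vanishing at `i/√3`. -/
def oddQ (w : ℂ) : ℂ := betaQ w * (upsQ w - 729 * w ^ 2 / upsQ w)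

/-- The Serre derivative of the weight two form. -/
def thetaQ (w : ℂ) : ℂ :=
  eisQ w * (1 + w * deriv betaQ w / betaQ w) - 3 * (w * deriv eisQ w)

lemma betaQ_ne_zero {w : ℂ} (h : w ∈ ball (0 : ℂ) 1) : betaQ w ≠ 0 := by
  have h3 := norm_pow_three_lt h
  rw [mem_ball_zero_iff] at h h3
  exact mul_ne_zero (pow_ne_zero _ (eulerProd_ne_zero h)) (pow_ne_zero _ (eulerProd_ne_zero h3))

lemma upsQ_ne_zero {w : ℂ} (h : w ∈ ball (0 : ℂ) 1) : upsQ w ≠ 0 := by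
  have h3 := norm_pow_three_lt h
  rw [mem_ball_zero_iff] at h h3
  exact pow_ne_zero _ (div_ne_zero (eulerProd_ne_zero h) (eulerProd_ne_zero h3))

lemma discReal_betaQ : DiscReal betaQ :=
  (discReal_eulerProd.pow 6).mul (discReal_eulerProd_cube.pow 6)

lemma discReal_upsQ : DiscReal upsQ :=
  (discReal_eulerProd.div discReal_eulerProd_cube fun w hw =>
    eulerProd_ne_zero (by simpa using norm_pow_three_lt hw)).pow 12

lemma discReal_sq_div_upsQ : DiscReal fun w => 729 * w ^ 2 / upsQ w := by
  have := ((DiscReal.const 729).mul (DiscReal.id'.pow 2)).div discReal_upsQ fun w => upsQ_ne_zero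
  simpa using this

lemma discReal_hauptQ : DiscReal hauptQ := discReal_upsQ.add discReal_sq_div_upsQ

lemma discReal_eisQ : DiscReal eisQ :=
  DiscReal.one.sub ((DiscReal.id'.mul discReal_upsQ.deriv).div discReal_upsQ fun _ => upsQ_ne_zero)

lemma discReal_oddQ : DiscReal oddQ := discReal_betaQ.mul (discReal_upsQ.sub discReal_sq_div_upsQ)

lemma discReal_thetaQ : DiscReal thetaQ := by
  have := (discReal_eisQ.mul (DiscReal.one.add
    ((DiscReal.id'.mul discReal_betaQ.deriv).div discReal_betaQ fun w => betaQ_ne_zero))).sub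
    ((DiscReal.const 3).mul (DiscReal.id'.mul discReal_eisQ.deriv))
  simpa [thetaQ] using! this

lemma betaQ_zero : betaQ 0 = 1 := by simp [betaQ, eulerProd_zero]
lemma upsQ_zero : upsQ 0 = 1 := by simp [upsQ, eulerProd_zero]
lemma hauptQ_zero : hauptQ 0 = 1 := by simp [hauptQ, upsQ_zero]
lemma eisQ_zero : eisQ 0 = 1 := by simp [eisQ]
lemma oddQ_zero : oddQ 0 = 1 := by simp [oddQ, upsQ_zero, betaQ_zero]
lemma thetaQ_zero : thetaQ 0 = 1 := by simp [thetaQ, eisQ_zero]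

/-- `τ ↦ qⁿ g(q)`. -/
def qf (n : ℤ) (g : ℂ → ℂ) (τ : ℂ) : ℂ := nome τ ^ n * g (nome τ)

/-! ### Eta quotients and the Fricke involution. -/

lemma sqrt_sq (z : ℂ) : Complex.sqrt z ^ 2 = z := by
  rw [Complex.sqrt, ← cpow_nat_mul]
  norm_num

lemma eta_eq (τ : ℂ) : ModularForm.eta τ = cexp (2 * Real.pi * I * τ / 24) * eulerProd (nome τ) := by
  simp [ModularForm.eta, eulerProd, nome, ModularForm.eta_q, Function.Periodic.qParam]

lemma eta_neg_inv {τ : ℂ} (h : 0 < τ.im) :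
    ModularForm.eta (-1 / τ) = (Complex.sqrt I)⁻¹ * (Complex.sqrt τ * ModularForm.eta τ) := by
  simpa using ModularForm.eta_comp_eq_csqrt_I_inv (show τ ∈ UpperHalfPlane.upperHalfPlaneSet from h)

lemma three_mul_im_pos {τ : ℂ} (h : 0 < τ.im) : 0 < (3 * τ).im := by simpa using h

lemma nome_three_mul (τ : ℂ) : nome (3 * τ) = nome τ ^ 3 := by
  rw [nome, nome, ← exp_nat_mul]
  congr 1
  push_cast
  ring

lemma eta_pow_mul {τ : ℂ} :
    ModularForm.eta τ ^ 6 * ModularForm.eta (3 * τ) ^ 6 = nome τ * betaQ (nome τ) := by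
  rw [eta_eq, eta_eq, nome_three_mul, mul_pow, mul_pow, betaQ, ← exp_nat_mul, ← exp_nat_mul,
    mul_mul_mul_comm, ← exp_add, nome]
  congr 2
  push_cast
  ring

lemma eta_pow_div {τ : ℂ} :
    (ModularForm.eta τ / ModularForm.eta (3 * τ)) ^ 12 = (nome τ)⁻¹ * upsQ (nome τ) := by
  rw [eta_eq, eta_eq, nome_three_mul, mul_div_mul_comm, mul_pow, upsQ, ← exp_sub, ← exp_nat_mul,
    nome, ← exp_neg]
  congr 2
  push_cast
  ring

lemma eta_fricke {τ : ℂ} (h : 0 < τ.im) : ModularForm.eta (fricke τ) =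
    (Complex.sqrt I)⁻¹ * (Complex.sqrt (3 * τ) * ModularForm.eta (3 * τ)) := by
  rw [fricke, eta_neg_inv (three_mul_im_pos h)]

lemma eta_three_mul_fricke {τ : ℂ} (h : 0 < τ.im) : ModularForm.eta (3 * fricke τ) =
    (Complex.sqrt I)⁻¹ * (Complex.sqrt τ * ModularForm.eta τ) := by
  rw [← eta_neg_inv h, fricke]
  congr 1
  have := ne_zero_of_im_pos h
  field_simp

/-- Only even powers of the square roots in the transformation law of η survive, so no branch has to
be chosen. The sign is I⁻⁶ = -1. -/
lemma betaQ_fricke {τ : ℂ} (h : 0 < τ.im) :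
    qf 1 betaQ (fricke τ) = -(3 * τ ^ 2) ^ 3 * qf 1 betaQ τ := by
  rw [qf, qf, zpow_one, zpow_one, ← eta_pow_mul, ← eta_pow_mul, eta_fricke h,
    eta_three_mul_fricke h]
  have h1 : ((Complex.sqrt I)⁻¹) ^ 12 = -1 := by
    rw [inv_pow, show 12 = 2 * 6 by norm_num, pow_mul, sqrt_sq]
    have : I ^ 6 = -1 := by rw [show 6 = 4 + 2 by norm_num, pow_add, I_pow_four, I_sq]; ring
    rw [this]
    norm_num
  have h2 : Complex.sqrt (3 * τ) ^ 6 = (3 * τ) ^ 3 := by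
    rw [show 6 = 2 * 3 by norm_num, pow_mul, sqrt_sq]
  have h3 : Complex.sqrt τ ^ 6 = τ ^ 3 := by
    rw [show 6 = 2 * 3 by norm_num, pow_mul, sqrt_sq]
  calc _ = ((Complex.sqrt I)⁻¹) ^ 12 * Complex.sqrt (3 * τ) ^ 6 * Complex.sqrt τ ^ 6 *
        (ModularForm.eta τ ^ 6 * ModularForm.eta (3 * τ) ^ 6) := by ring
    _ = _ := by rw [h1, h2, h3]; ring

/-- The Hauptmodul of `Γ₀(3)` normalised by `u(-1/(3τ)) = 1/u(τ)`. -/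
def hauptU (τ : ℂ) : ℂ := upsQ (nome τ) / (27 * nome τ)

lemma hauptU_ne_zero {τ : ℂ} (h : 0 < τ.im) : hauptU τ ≠ 0 :=
  div_ne_zero (upsQ_ne_zero (nome_mem_ball h)) (mul_ne_zero (by norm_num) (nome_ne_zero _))

/-- W inverts the twelfth power of the eta quotient up to the factor 3⁶ = 27², which the
normalisation by 27 absorbs. -/
lemma hauptU_fricke {τ : ℂ} (h : 0 < τ.im) : hauptU (fricke τ) = (hauptU τ)⁻¹ := by
  have key : ∀ τ, hauptU τ = (ModularForm.eta τ / ModularForm.eta (3 * τ)) ^ 12 / 27 := fun τ => by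
    rw [eta_pow_div, hauptU]
    field_simp
  rw [key, key, eta_fricke h, eta_three_mul_fricke h]
  have hI : Complex.sqrt I ≠ 0 := by
    intro h0
    have := sqrt_sq I
    rw [h0, zero_pow two_ne_zero] at this
    exact I_ne_zero this.symm
  have hτ := ne_zero_of_im_pos h
  have h0 : Complex.sqrt τ ≠ 0 := by
    intro h0
    have := sqrt_sq τ
    rw [h0] at this
    exact hτ (by simpa using this.symm)
  have h2 : Complex.sqrt (3 * τ) ^ 12 = (3 * τ) ^ 6 := by
    rw [show 12 = 2 * 6 by norm_num, pow_mul, sqrt_sq]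
  have h3 : Complex.sqrt τ ^ 12 = τ ^ 6 := by
    rw [show 12 = 2 * 6 by norm_num, pow_mul, sqrt_sq]
  have e1 := ModularForm.eta_ne_zero (show τ ∈ UpperHalfPlane.upperHalfPlaneSet from h)
  have e2 := ModularForm.eta_ne_zero
    (show 3 * τ ∈ UpperHalfPlane.upperHalfPlaneSet from three_mul_im_pos h)
  rw [mul_div_mul_left _ _ (inv_ne_zero hI), div_pow, div_pow, mul_pow, mul_pow, h2, h3]
  field_simp
  norm_num

lemma hauptU_add_one (τ : ℂ) : hauptU (τ + 1) = hauptU τ := by rw [hauptU, hauptU, nome_add_one]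

lemma hauptU_add_int (τ : ℂ) (n : ℤ) : hauptU (τ + n) = hauptU τ := by
  rw [hauptU, hauptU, nome_add_int]

/-- The Hauptmodul `j = 27 (u + 1/u)` of `Γ₀⁺(3)`. -/
def hauptJ (τ : ℂ) : ℂ := 27 * (hauptU τ + (hauptU τ)⁻¹)

lemma hauptJ_eq {τ : ℂ} (h : 0 < τ.im) : hauptJ τ = qf (-1) hauptQ τ := by
  have h1 := upsQ_ne_zero (nome_mem_ball h)
  have h2 := nome_ne_zero τ
  rw [hauptJ, hauptU, qf, hauptQ, zpow_neg_one]
  field_simp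
  ring

lemma hauptJ_fricke {τ : ℂ} (h : 0 < τ.im) : hauptJ (fricke τ) = hauptJ τ := by
  rw [hauptJ, hauptJ, hauptU_fricke h, inv_inv, add_comm]

lemma oddQ_eq {τ : ℂ} (h : 0 < τ.im) :
    oddQ (nome τ) = 27 * qf 1 betaQ τ * (hauptU τ - (hauptU τ)⁻¹) := by
  have h1 := upsQ_ne_zero (nome_mem_ball h)
  have h2 := nome_ne_zero τ
  rw [hauptU, qf, oddQ, zpow_one]
  field_simp
  ring

end Fricke3

end

/-! ### Transformation laws under the Fricke involution, and the vanishing of weight two forms. -/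

noncomputable section

namespace Fricke3

open Complex Metric Set Filter Topology ComplexConjugate

/-- `τ ↦ qⁿ g(q)` transforms under the Fricke involution with weight `2κ` and sign `σ`. -/
structure QForm (κ : ℤ) (σ : ℂ) (n : ℤ) (g : ℂ → ℂ) : Prop extends DiscReal g where
  trans : ∀ τ : ℂ, 0 < τ.im → qf n g (fricke τ) = σ * (3 * τ ^ 2) ^ κ * qf n g τ

lemma three_sq_ne_zero {τ : ℂ} (h : 0 < τ.im) : 3 * τ ^ 2 ≠ 0 :=
  mul_ne_zero (by norm_num) (pow_ne_zero _ (ne_zero_of_im_pos h))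

lemma qf_mul (n n' : ℤ) (f g : ℂ → ℂ) (τ : ℂ) :
    qf (n + n') (fun w => f w * g w) τ = qf n f τ * qf n' g τ := by
  rw [qf, qf, qf, zpow_add₀ (nome_ne_zero τ)]
  ring

namespace QForm

variable {κ κ' n n' : ℤ} {σ σ' : ℂ} {f g : ℂ → ℂ}

lemma mul (hf : QForm κ σ n f) (hg : QForm κ' σ' n' g) :
    QForm (κ + κ') (σ * σ') (n + n') fun w => f w * g w :=
  ⟨hf.toDiscReal.mul hg.toDiscReal, fun τ h => by
    rw [qf_mul, qf_mul, hf.trans τ h, hg.trans τ h, zpow_add₀ (three_sq_ne_zero h)]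
    ring⟩

lemma zpow (hf : QForm κ σ n f) (h0 : ∀ w ∈ ball (0 : ℂ) 1, f w ≠ 0) (i : ℤ) :
    QForm (κ * i) (σ ^ i) (n * i) fun w => f w ^ i :=
  ⟨hf.toDiscReal.zpow h0 i, fun τ h => by
    have key : ∀ τ, qf (n * i) (fun w => f w ^ i) τ = qf n f τ ^ i := fun τ => by
      rw [qf, qf, mul_zpow, zpow_mul]
    rw [key, key, hf.trans τ h, mul_zpow, mul_zpow, zpow_mul]⟩

lemma one : QForm 0 1 0 fun _ => 1 := ⟨DiscReal.one, fun τ _ => by simp [qf]⟩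

lemma of_eq (hf : QForm κ σ n f) (h1 : κ = κ') (h2 : σ = σ') (h3 : n = n') : QForm κ' σ' n' f := by
  subst h1 h2 h3
  exact hf

end QForm

lemma qform_betaQ : QForm 3 (-1) 1 betaQ :=
  ⟨discReal_betaQ, fun τ h => by rw [betaQ_fricke h, zpow_ofNat]; ring⟩

/-- Both B and u - 1/u change sign under W, so their product has sign +1. -/
lemma qform_oddQ : QForm 3 1 0 oddQ :=
  ⟨discReal_oddQ, fun τ h => by
    rw [qf, qf, zpow_zero, zpow_zero, one_mul, one_mul, oddQ_eq h, oddQ_eq (fricke_im_pos h),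
      hauptU_fricke h, betaQ_fricke h]
    rw [inv_inv, zpow_ofNat]
    ring⟩

lemma hasDerivAt_comp_nome {g : ℂ → ℂ} (hg : DiscReal g) {τ : ℂ} (h : 0 < τ.im) :
    HasDerivAt (fun τ => g (nome τ)) (2 * Real.pi * I * (nome τ * deriv g (nome τ))) τ := by
  refine ((hg.differentiableAt (norm_nome_lt_one h)).hasDerivAt.comp τ
    (hasDerivAt_nome τ)).congr_deriv ?_
  ring

/-- The Eisenstein series of weight two is, up to -2πi, the logarithmic derivative of u. This is
where its weight and its role on the arc come from. -/
lemma hasDerivAt_hauptU {τ : ℂ} (h : 0 < τ.im) :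
    HasDerivAt hauptU (-(2 * Real.pi * I) * eisQ (nome τ) * hauptU τ) τ := by
  have h1 := upsQ_ne_zero (nome_mem_ball h)
  have h2 := nome_ne_zero τ
  refine ((hasDerivAt_comp_nome discReal_upsQ h).div ((hasDerivAt_nome τ).const_mul 27)
    (by simpa using h2)).congr_deriv ?_
  rw [hauptU, eisQ]
  field_simp
  ring

lemma hasDerivAt_fricke {τ : ℂ} (h : 0 < τ.im) : HasDerivAt fricke (1 / (3 * τ ^ 2)) τ := by
  have h0 := ne_zero_of_im_pos h
  refine ((hasDerivAt_const τ (-1 : ℂ)).div ((hasDerivAt_id τ).const_mul 3)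
    (by simpa using h0)).congr_deriv ?_
  simp
  field_simp

lemma eventually_im_pos {τ : ℂ} (h : 0 < τ.im) : ∀ᶠ t in 𝓝 τ, 0 < t.im :=
  (isOpen_lt continuous_const continuous_im).mem_nhds h

/-- Differentiate u(Wτ) u(τ) = 1 logarithmically; the derivative of W supplies the weight. -/
lemma qform_eisQ : QForm 1 (-1) 0 eisQ := by
  refine ⟨discReal_eisQ, fun τ h => ?_⟩
  have h0 := ne_zero_of_im_pos h
  have h1 := (hasDerivAt_hauptU (fricke_im_pos h)).comp τ (hasDerivAt_fricke h)
  have h2 := h1.mul (hasDerivAt_hauptU h)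
  have h3 : (hauptU ∘ fricke) * hauptU =ᶠ[𝓝 τ] fun _ => 1 := by
    filter_upwards [eventually_im_pos h] with t ht
    simp only [Pi.mul_apply, Function.comp]
    rw [hauptU_fricke ht, inv_mul_cancel₀ (hauptU_ne_zero ht)]
  have h4 := (h2.congr_of_eventuallyEq h3.symm).unique (hasDerivAt_const τ 1)
  have hU := hauptU_ne_zero h
  have hU' := hauptU_ne_zero (fricke_im_pos h)
  have hpi : (2 * Real.pi * I : ℂ) ≠ 0 := two_pi_I_ne_zero
  simp only [Function.comp] at h4
  have h5 : (2 * Real.pi * I) * (hauptU (fricke τ) * hauptU τ) *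
      (eisQ (nome (fricke τ)) + 3 * τ ^ 2 * eisQ (nome τ)) = 0 := by
    field_simp at h4
    linear_combination -h4
  have h6 := (mul_eq_zero.1 h5).resolve_left (mul_ne_zero hpi (mul_ne_zero hU' hU))
  simp only [qf, zpow_zero, zpow_one, one_mul]
  linear_combination h6

lemma hasDerivAt_qf_betaQ {τ : ℂ} (h : 0 < τ.im) : HasDerivAt (qf 1 betaQ)
    (2 * Real.pi * I * (1 + nome τ * deriv betaQ (nome τ) / betaQ (nome τ)) * qf 1 betaQ τ) τ := by
  have h1 := betaQ_ne_zero (nome_mem_ball h)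
  have h2 : qf 1 betaQ = fun τ => nome τ * betaQ (nome τ) := by ext; simp [qf]
  rw [h2]
  refine ((hasDerivAt_nome τ).mul (hasDerivAt_comp_nome discReal_betaQ h)).congr_deriv ?_
  field_simp

/-- The logarithmic derivative of B (weight 6) and the derivative of e (weight 2) each transform
with an extra term, `a4` and `b4`. The factor 3 = 6/2 in `thetaQ` makes these terms cancel. -/
lemma qform_thetaQ : QForm 2 (-1) 0 thetaQ := by
  refine ⟨discReal_thetaQ, fun τ h => ?_⟩
  have h0 := ne_zero_of_im_pos h
  have hpi : (2 * Real.pi * I : ℂ) ≠ 0 := two_pi_I_ne_zero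
  have hB : qf 1 betaQ τ ≠ 0 := by
    rw [qf]
    exact mul_ne_zero (zpow_ne_zero _ (nome_ne_zero _)) (betaQ_ne_zero (nome_mem_ball h))
  have a1 := (hasDerivAt_qf_betaQ (fricke_im_pos h)).comp τ (hasDerivAt_fricke h)
  have a2 : HasDerivAt (fun τ : ℂ => -(3 * τ ^ 2) ^ 3 * qf 1 betaQ τ) _ τ :=
    (((hasDerivAt_pow 2 τ).const_mul 3).pow 3).neg.mul (hasDerivAt_qf_betaQ h)
  have a3 := a1.unique (a2.congr_of_eventuallyEq
    ((eventually_im_pos h).mono fun t ht => betaQ_fricke ht))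
  rw [betaQ_fricke h] at a3
  set L := 1 + nome τ * deriv betaQ (nome τ) / betaQ (nome τ) with hL
  set L' := 1 + nome (fricke τ) * deriv betaQ (nome (fricke τ)) / betaQ (nome (fricke τ)) with hL'
  have a4 : 2 * Real.pi * I * L' = 3 * τ ^ 2 * (2 * Real.pi * I * L) + 18 * τ := by
    apply mul_left_cancel₀ (pow_ne_zero 4 h0)
    simp only [Pi.neg_apply, Pi.pow_apply] at a3
    field_simp at a3
    push_cast at a3
    linear_combination (-1 / 3) * a3
  have b1 := (hasDerivAt_comp_nome discReal_eisQ (fricke_im_pos h)).comp τ (hasDerivAt_fricke h)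
  have b2 : HasDerivAt (fun τ : ℂ => -(3 * τ ^ 2) * eisQ (nome τ)) _ τ :=
    ((hasDerivAt_pow 2 τ).const_mul 3).neg.mul (hasDerivAt_comp_nome discReal_eisQ h)
  have he : ∀ t : ℂ, 0 < t.im → eisQ (nome (fricke t)) = -(3 * t ^ 2) * eisQ (nome t) :=
    fun t ht => by
      have := qform_eisQ.trans t ht
      simpa [qf] using this
  have b3 := b1.unique (b2.congr_of_eventuallyEq ((eventually_im_pos h).mono fun t ht => he t ht))
  set D := nome τ * deriv eisQ (nome τ) with hD
  set D' := nome (fricke τ) * deriv eisQ (nome (fricke τ)) with hD'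
  have b4 : 2 * Real.pi * I * D' =
      -(9 * τ ^ 4) * (2 * Real.pi * I * D) - 18 * τ ^ 3 * eisQ (nome τ) := by
    simp only [Pi.neg_apply] at b3
    field_simp at b3
    push_cast at b3
    linear_combination b3
  simp only [qf, zpow_zero, one_mul]
  rw [thetaQ, thetaQ, ← hL, ← hL', ← hD, ← hD', he τ h]
  apply mul_left_cancel₀ hpi
  have : (3 * τ ^ 2) ^ (2 : ℤ) = 9 * τ ^ 4 := by norm_cast; ring
  rw [this]
  linear_combination -(3 * τ ^ 2) * eisQ (nome τ) * a4 - 3 * b4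

/-- The left side is -q · (q dj/dq). The identity is the chain rule dj = 27(u - 1/u) du/u. -/
lemma hauptQ_sub_deriv {w : ℂ} (hw : w ∈ ball (0 : ℂ) 1) :
    hauptQ w - w * deriv hauptQ w = eisQ w * (upsQ w - 729 * w ^ 2 / upsQ w) := by
  have h0 := upsQ_ne_zero hw
  have h1 := (discReal_upsQ.differentiableAt (by simpa using hw)).hasDerivAt
  have h2 : HasDerivAt hauptQ _ w := h1.add (((hasDerivAt_pow 2 w).const_mul 729).div h1 h0)
  rw [h2.deriv, hauptQ, eisQ]
  field_simp
  push_cast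
  ring

lemma im_I_div : (0 : ℝ) < (I / (√3 : ℝ)).im := by
  have : (I / (√3 : ℝ)).im = 1 / √3 := by
    rw [div_ofReal_im]; simp
  rw [this]
  positivity

lemma fricke_fixed : fricke (I / (√3 : ℝ)) = I / (√3 : ℝ) := by
  have h3 : ((√3 : ℝ) : ℂ) ^ 2 = 3 := by norm_cast; simp
  have h0 : ((√3 : ℝ) : ℂ) ≠ 0 := by
    intro h; rw [h] at h3; norm_num at h3
  rw [fricke]
  field_simp
  rw [h3, I_sq]
  ring

/-- The elliptic point of order six. -/
def rho : ℂ := ⟨-1 / 2, √3 / 6⟩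

lemma rho_im_pos : 0 < rho.im := by
  simp only [rho]; positivity

lemma sqrt3_sq : √3 * √3 = 3 := Real.mul_self_sqrt (by norm_num)

lemma fricke_rho : fricke rho = rho + 1 := by
  have h0 := ne_zero_of_im_pos rho_im_pos
  have h : 3 * (rho * (rho + 1)) = -1 := by
    apply Complex.ext
    · simp [rho]
      nlinarith [sqrt3_sq]
    · simp [rho]
      ring
  rw [fricke]
  field_simp
  linear_combination -h

lemma convex_upper : Convex ℝ {τ : ℂ | 0 < τ.im} := convex_halfSpace_im_gt 0

lemma isOpen_upper : IsOpen {τ : ℂ | 0 < τ.im} := isOpen_lt continuous_const continuous_im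

/-- A weight two form that is holomorphic at infinity vanishes there. -/
lemma constant_term_eq_zero {G : ℂ → ℂ} (hG : DifferentiableOn ℂ G (ball 0 1))
    (hW : ∀ τ : ℂ, 0 < τ.im → G (nome (fricke τ)) = 3 * τ ^ 2 * G (nome τ)) : G 0 = 0 := by
  have hpi : (2 * Real.pi * I : ℂ) ≠ 0 := two_pi_I_ne_zero
  -- `K` is a primitive of (G(w) - G(0))/w, so G(0)τ + K(q)/(2πi) is a primitive of G(q) in τ, the
  -- sum of a linear and a periodic function.
  obtain ⟨K, hK⟩ := ((differentiableOn_dslope (ball_mem_nhds _ one_pos)).2 hG).isExactOn_ball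
  have hΦ : ∀ τ : ℂ, 0 < τ.im →
      HasDerivAt (fun τ => G 0 * τ + K (nome τ) / (2 * Real.pi * I)) (G (nome τ)) τ := by
    intro τ h
    refine (((hasDerivAt_id τ).const_mul (G 0)).add
      (((hK _ (nome_mem_ball h)).comp τ (hasDerivAt_nome τ)).div_const _)).congr_deriv ?_
    rw [dslope_of_ne _ (nome_ne_zero τ), slope_def_field]
    have := nome_ne_zero τ
    field_simp
    ring
  set Φ : ℂ → ℂ := fun τ => G 0 * τ + K (nome τ) / (2 * Real.pi * I) with hΦdef
  have hΨ : ∀ τ : ℂ, 0 < τ.im → HasDerivAt (fun τ => Φ (fricke τ) - Φ τ) 0 τ := by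
    intro τ h
    refine (((hΦ _ (fricke_im_pos h)).comp τ (hasDerivAt_fricke h)).sub (hΦ τ h)).congr_deriv ?_
    rw [hW τ h]
    have := ne_zero_of_im_pos h
    field_simp
    ring
  -- G dτ is invariant under W, so Φ∘W - Φ is constant. It is 0 at the fixed point i/√3, and it is
  -- G(0) at ρ because Wρ = ρ + 1.
  have hconst := isOpen_upper.is_const_of_deriv_eq_zero convex_upper.isPreconnected
    (fun τ h => (hΨ τ h).differentiableAt.differentiableWithinAt) (fun τ h => (hΨ τ h).deriv)
    im_I_div rho_im_pos
  simp only [fricke_fixed, fricke_rho, sub_self] at hconst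
  simp only [hΦdef, nome_add_one] at hconst
  linear_combination -hconst

/-- Allows a factor to be cancelled from an identity knowing only that it is nonzero at the cusp,
whatever zeros it has in the disc. -/
lemma eq_zero_of_mul_eq_zero {f g : ℂ → ℂ} (hf : DifferentiableOn ℂ f (ball 0 1))
    (hg : DifferentiableOn ℂ g (ball 0 1)) (h0 : g 0 ≠ 0)
    (h : ∀ w ∈ ball (0 : ℂ) 1, f w * g w = 0) : ∀ w ∈ ball (0 : ℂ) 1, f w = 0 := by
  have hmem : (0 : ℂ) ∈ ball (0 : ℂ) 1 := mem_ball_self one_pos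
  have h1 : f =ᶠ[𝓝 0] 0 := by
    have hc : ContinuousAt g 0 := (hg.differentiableAt (isOpen_ball.mem_nhds hmem)).continuousAt
    filter_upwards [hc.eventually_ne h0, isOpen_ball.mem_nhds hmem] with w hw hw'
    exact (mul_eq_zero.1 (h w hw')).resolve_right hw
  exact (hf.analyticOnNhd isOpen_ball).eqOn_zero_of_preconnected_of_eventuallyEq_zero
    (convex_ball _ _).isPreconnected hmem h1

lemma eq_mul_dslope {f : ℂ → ℂ} (h : f 0 = 0) (w : ℂ) : f w = w * dslope f 0 w := by
  have := sub_smul_dslope f 0 w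
  simp only [sub_zero, h, smul_eq_mul] at this
  exact this.symm

/-- A weight two form that is holomorphic at infinity vanishes identically. -/
lemma weight_two_eq_zero {G : ℂ → ℂ} (hG : DifferentiableOn ℂ G (ball 0 1))
    (hW : ∀ τ : ℂ, 0 < τ.im → G (nome (fricke τ)) = 3 * τ ^ 2 * G (nome τ)) :
    ∀ w ∈ ball (0 : ℂ) 1, G w = 0 := by
  have hmem : (0 : ℂ) ∈ ball (0 : ℂ) 1 := mem_ball_self one_pos
  -- If G = wⁿH, then jⁿG is again a weight two form holomorphic at the cusp, with constant term
  -- H(0). So H(0) = 0 and the order of vanishing can be raised without end.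
  have key : ∀ n : ℕ, ∃ H : ℂ → ℂ, DifferentiableOn ℂ H (ball 0 1) ∧ ∀ w, G w = w ^ n * H w := by
    intro n
    induction n with
    | zero => exact ⟨G, hG, by simp⟩
    | succ n ih =>
      obtain ⟨H, hH, hGH⟩ := ih
      refine ⟨dslope H 0, (differentiableOn_dslope (ball_mem_nhds _ one_pos)).2 hH, fun w => ?_⟩
      have h0 : (fun w => hauptQ w ^ n * H w) 0 = 0 := by
        refine constant_term_eq_zero ((discReal_hauptQ.pow n).diff.mul hH) fun τ h => ?_
        have key : ∀ t : ℂ, 0 < t.im →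
            hauptQ (nome t) ^ n * H (nome t) = hauptJ t ^ n * G (nome t) := fun t ht => by
          have := nome_ne_zero t
          rw [hauptJ_eq ht, qf, hGH, zpow_neg_one, mul_pow, inv_pow]
          field_simp
        change hauptQ (nome (fricke τ)) ^ n * H (nome (fricke τ)) =
          3 * τ ^ 2 * (hauptQ (nome τ) ^ n * H (nome τ))
        rw [key τ h, key _ (fricke_im_pos h), hauptJ_fricke h, hW τ h]
        ring
      simp only [hauptQ_zero, one_pow, one_mul] at h0
      rw [hGH w, pow_succ, mul_assoc, ← eq_mul_dslope h0 w]
  have han : AnalyticAt ℂ G 0 := hG.analyticAt (isOpen_ball.mem_nhds hmem)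
  have h1 : ∀ᶠ w in 𝓝 0, G w = 0 := by
    by_contra hne
    obtain ⟨n, g, hg, hg0, hgeq⟩ := han.exists_eventuallyEq_pow_smul_nonzero_iff.2 hne
    obtain ⟨H, hH, hGH⟩ := key (n + 1)
    have hH' : ContinuousAt H 0 :=
      (hH.differentiableAt (isOpen_ball.mem_nhds hmem)).continuousAt
    have h2 : ∀ᶠ w in 𝓝[≠] (0 : ℂ), g w = w * H w := by
      filter_upwards [hgeq.filter_mono nhdsWithin_le_nhds, self_mem_nhdsWithin] with w hw hw0
      have hw0 : w ≠ 0 := hw0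
      rw [hGH, pow_succ, sub_zero, smul_eq_mul, mul_assoc] at hw
      exact (mul_left_cancel₀ (pow_ne_zero n hw0) hw).symm
    have h3 : Tendsto g (𝓝[≠] 0) (𝓝 (g 0)) := hg.continuousAt.tendsto.mono_left nhdsWithin_le_nhds
    have h4 : Tendsto (fun w => w * H w) (𝓝[≠] (0 : ℂ)) (𝓝 (0 * H 0)) :=
      (tendsto_id.mul hH'.tendsto).mono_left nhdsWithin_le_nhds
    have := tendsto_nhds_unique (h3.congr' h2) h4
    rw [zero_mul] at this
    exact hg0 this
  exact (hG.analyticOnNhd isOpen_ball).eqOn_zero_of_preconnected_of_eventuallyEq_zero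
    (convex_ball _ _).isPreconnected hmem h1

end Fricke3

end

/-! ### Bounds for the Euler product, and the algebraic relations between the forms. -/

noncomputable section

namespace Fricke3

open Complex Metric Set Filter Topology ComplexConjugate

lemma summable_pow_add {r : ℝ} (h0 : 0 ≤ r) (h1 : r < 1) (k : ℕ) :
    HasSum (fun n : ℕ => r ^ (n + k)) (r ^ k / (1 - r)) := by
  simpa [pow_add, div_eq_mul_inv, mul_comm] using
    (hasSum_geometric_of_lt_one h0 h1).mul_right (r ^ k)

lemma multipliable_one_sub_pow_add {w : ℂ} (hw : ‖w‖ < 1) (k : ℕ) :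
    Multipliable fun n : ℕ => 1 - w ^ (n + k) := by
  have : Multipliable fun n : ℕ => 1 + -w ^ (n + k) := by
    apply multipliable_one_add_of_summable
    simpa using (summable_pow_add (norm_nonneg w) hw k).summable
  simpa [sub_eq_add_neg] using this

lemma norm_tprod_sub_one_le {w : ℂ} (hw : ‖w‖ < 1) (k : ℕ) :
    ‖(∏' n : ℕ, (1 - w ^ (n + k))) - 1‖ ≤ Real.exp (‖w‖ ^ k / (1 - ‖w‖)) - 1 := by
  have h1 := ((multipliable_one_sub_pow_add hw k).hasProd.sub_const 1).norm
  refine le_of_tendsto h1 (Eventually.of_forall fun s => ?_)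
  have h2 := s.norm_prod_one_add_sub_one_le (fun n : ℕ => -w ^ (n + k))
  simp only [← sub_eq_add_neg, norm_neg, norm_pow] at h2
  refine h2.trans ?_
  have hs := summable_pow_add (norm_nonneg w) hw k
  have h3 := hs.summable.sum_le_tsum s (fun i _ => by positivity)
  rw [hs.tsum_eq] at h3
  gcongr

lemma norm_eulerProd_le {w : ℂ} (hw : ‖w‖ < 1) :
    ‖eulerProd w‖ ≤ Real.exp (‖w‖ / (1 - ‖w‖)) := by
  have h1 := norm_tprod_sub_one_le hw 1
  rw [pow_one] at h1
  have h2 := norm_sub_norm_le (eulerProd w) 1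
  rw [norm_one] at h2
  have : ‖eulerProd w - 1‖ ≤ Real.exp (‖w‖ / (1 - ‖w‖)) - 1 := h1
  linarith

/-- The Weierstrass product inequality. -/
lemma prod_one_sub_ge (s : Finset ℕ) (a : ℕ → ℝ) (h0 : ∀ n, 0 ≤ a n) (h1 : ∀ n, a n ≤ 1) :
    1 - ∑ n ∈ s, a n ≤ ∏ n ∈ s, (1 - a n) := by
  classical
  induction s using Finset.induction_on with
  | empty => simp
  | insert n s hn ih =>
    rw [Finset.sum_insert hn, Finset.prod_insert hn]
    have h2 : ∏ n ∈ s, (1 - a n) ≤ 1 :=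
      Finset.prod_le_one (fun i _ => by linarith [h1 i]) (fun i _ => by linarith [h0 i])
    nlinarith [h0 n, h1 n]

lemma le_norm_eulerProd {w : ℂ} (hw : ‖w‖ < 1) :
    1 - ‖w‖ / (1 - ‖w‖) ≤ ‖eulerProd w‖ := by
  have h1 := (ModularForm.multipliable_one_sub_pow hw).hasProd.norm
  refine ge_of_tendsto h1 (Eventually.of_forall fun s => ?_)
  have h2 := prod_one_sub_ge s (fun n => ‖w‖ ^ (n + 1)) (fun n => by positivity)
    (fun n => pow_le_one₀ (norm_nonneg _) hw.le)
  have hs := summable_pow_add (norm_nonneg w) hw 1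
  have h3 := hs.summable.sum_le_tsum s (fun i _ => by positivity)
  rw [hs.tsum_eq, pow_one] at h3
  have h4 : ∏ n ∈ s, (1 - ‖w‖ ^ (n + 1)) ≤ ∏ n ∈ s, ‖1 - w ^ (n + 1)‖ := by
    refine Finset.prod_le_prod (fun i _ => ?_) (fun i _ => ?_)
    · have : ‖w‖ ^ (i + 1) ≤ 1 := pow_le_one₀ (norm_nonneg _) hw.le
      linarith
    · have := norm_sub_norm_le (1 : ℂ) (w ^ (i + 1))
      rwa [norm_one, norm_pow] at this
  exact (by linarith : 1 - ‖w‖ / (1 - ‖w‖) ≤ ∏ n ∈ s, (1 - ‖w‖ ^ (n + 1))).trans h4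

lemma eulerProd_eq_mul {w : ℂ} (hw : ‖w‖ < 1) :
    eulerProd w = (1 - w) * ∏' n : ℕ, (1 - w ^ (n + 2)) := by
  have h := tprod_eq_zero_mul' (f := fun n => 1 - w ^ (n + 1)) (multipliable_one_sub_pow_add hw 2)
  rw [eulerProd, h]
  simp

lemma eulerProd_eq_mul_mul {w : ℂ} (hw : ‖w‖ < 1) :
    eulerProd w = (1 - w) * (1 - w ^ 2) * ∏' n : ℕ, (1 - w ^ (n + 3)) := by
  have h := tprod_eq_zero_mul' (f := fun n => 1 - w ^ (n + 2)) (multipliable_one_sub_pow_add hw 3)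
  rw [eulerProd_eq_mul hw, h]
  simp [mul_assoc]

/-- After the factor 1 - w is split off, the remaining product is 1 + O(w²). -/
lemma hasDerivAt_eulerProd_zero : HasDerivAt eulerProd (-1) 0 := by
  have h1 : HasDerivAt (fun w : ℂ => ∏' n : ℕ, (1 - w ^ (n + 2))) 0 0 := by
    rw [hasDerivAt_iff_isLittleO_nhds_zero]
    simp only [zero_add, ne_eq, Nat.add_eq_zero_iff, OfNat.ofNat_ne_zero, and_false,
      not_false_eq_true, zero_pow, sub_zero, tprod_one, smul_zero]
    have hO : (fun h : ℂ => (∏' n : ℕ, (1 - h ^ (n + 2))) - 1) =O[𝓝 0] fun h => ‖h‖ ^ 2 := by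
      refine Asymptotics.IsBigO.of_bound 4 ?_
      filter_upwards [ball_mem_nhds (0 : ℂ) (by norm_num : (0 : ℝ) < 1 / 2)] with w hw
      rw [mem_ball_zero_iff] at hw
      have h2 := norm_tprod_sub_one_le (w := w) (by linarith) 2
      have h0 := norm_nonneg w
      have h3 : ‖w‖ ^ 2 / (1 - ‖w‖) ≤ 2 * ‖w‖ ^ 2 := by
        rw [div_le_iff₀ (by linarith)]
        nlinarith [sq_nonneg ‖w‖]
      have h4 : 2 * ‖w‖ ^ 2 ≤ 1 := by nlinarith
      have h5 : Real.exp (2 * ‖w‖ ^ 2) - 1 ≤ 2 * (2 * ‖w‖ ^ 2) := by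
        have := Real.abs_exp_sub_one_le (x := 2 * ‖w‖ ^ 2) (by rwa [abs_of_nonneg (by positivity)])
        rw [abs_of_nonneg (by positivity : 0 ≤ 2 * ‖w‖ ^ 2)] at this
        exact (le_abs_self _).trans this
      have h6 := Real.exp_le_exp.2 h3
      rw [Real.norm_of_nonneg (by positivity)]
      linarith
    refine hO.trans_isLittleO ?_
    have : (fun h : ℂ => ‖h‖ ^ 2) =o[𝓝 0] fun h => ‖h‖ := by
      have h := (Asymptotics.isLittleO_pow_id (𝕜 := ℝ) (n := 2) (by norm_num)).comp_tendsto
        (tendsto_norm_zero (E := ℂ))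
      exact h
    exact this.of_norm_right
  have h2 : HasDerivAt (fun w : ℂ => (1 - w) * ∏' n : ℕ, (1 - w ^ (n + 2))) _ 0 :=
    ((hasDerivAt_id (0 : ℂ)).const_sub 1).mul h1
  refine (h2.congr_of_eventuallyEq ?_).congr_deriv (by simp)
  filter_upwards [ball_mem_nhds (0 : ℂ) one_pos] with w hw
  exact eulerProd_eq_mul (by simpa using hw)

lemma hasDerivAt_eulerProd_cube_zero : HasDerivAt (fun w => eulerProd (w ^ 3)) 0 0 := by
  have h : HasDerivAt eulerProd (-1) ((0 : ℂ) ^ 3) := by simpa using hasDerivAt_eulerProd_zero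
  have := h.comp (0 : ℂ) (hasDerivAt_pow 3 (0 : ℂ))
  exact this.congr_deriv (by simp)

/-- The linear coefficients at the cusp are needed because the cubic relation is compared up to
order two. -/
lemma hasDerivAt_betaQ_zero : HasDerivAt betaQ (-6) 0 := by
  refine ((hasDerivAt_eulerProd_zero.pow 6).mul
    (hasDerivAt_eulerProd_cube_zero.pow 6)).congr_deriv ?_
  simp [eulerProd_zero]

lemma hasDerivAt_upsQ_zero : HasDerivAt upsQ (-12) 0 := by
  refine ((hasDerivAt_eulerProd_zero.div hasDerivAt_eulerProd_cube_zero
    (by simp [eulerProd_zero])).pow 12).congr_deriv ?_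
  simp [eulerProd_zero]

lemma hasDerivAt_hauptQ_zero : HasDerivAt hauptQ (-12) 0 := by
  refine (hasDerivAt_upsQ_zero.add (((hasDerivAt_pow 2 (0 : ℂ)).const_mul 729).div
    hasDerivAt_upsQ_zero (by simp [upsQ_zero]))).congr_deriv ?_
  simp

lemma hasDerivAt_eisQ_zero : HasDerivAt eisQ 12 0 := by
  have h1 : HasDerivAt (deriv upsQ) (deriv (deriv upsQ) 0) 0 :=
    (discReal_upsQ.deriv.differentiableAt (by simp)).hasDerivAt
  refine ((((hasDerivAt_id (0 : ℂ)).mul h1).div hasDerivAt_upsQ_zero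
    (by simp [upsQ_zero])).const_sub 1).congr_deriv ?_
  simp [upsQ_zero, hasDerivAt_upsQ_zero.deriv]

/-- The cubic relation `e³ = B (j + 54)`. -/
lemma eisQ_cube {w : ℂ} (hw : w ∈ ball (0 : ℂ) 1) :
    eisQ w ^ 3 = betaQ w * (hauptQ w + 54 * w) := by
  set h : ℂ → ℂ := fun w => eisQ w ^ 3 - betaQ w * (hauptQ w + 54 * w) with hh
  have hd : DiscReal h := (discReal_eisQ.pow 3).sub (discReal_betaQ.mul
    (discReal_hauptQ.add (by simpa using (DiscReal.const 54).mul DiscReal.id')))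
  have h0 : h 0 = 0 := by simp [hh, eisQ_zero, betaQ_zero, hauptQ_zero]
  have h1 : dslope h 0 0 = 0 := by
    rw [dslope_same]
    have : HasDerivAt h _ 0 := (hasDerivAt_eisQ_zero.pow 3).sub (hasDerivAt_betaQ_zero.mul
      (hasDerivAt_hauptQ_zero.add ((hasDerivAt_id (0 : ℂ)).const_mul 54)))
    rw [this.deriv]
    simp [eisQ_zero, betaQ_zero, hauptQ_zero]
    norm_num
  set h2 := dslope (dslope h 0) 0 with hh2
  have hd2 : DiscReal h2 := hd.dslope.dslope
  have heq : ∀ w, h w = w ^ 2 * h2 w := fun w => by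
    rw [eq_mul_dslope h0 w, eq_mul_dslope h1 w, sq, mul_assoc]
  -- (e³ - B(j + 54)) e δ / B² has weight 6 + 2 + 6 - 12 = 2 and sign +1. The double pole of B⁻² is
  -- cancelled because the constant 54 makes the difference vanish to order two.
  have hd3 : DiscReal fun w => eisQ w * oddQ w / betaQ w ^ 2 :=
    (discReal_eisQ.mul discReal_oddQ).div (discReal_betaQ.pow 2)
      fun w hw => pow_ne_zero 2 (betaQ_ne_zero hw)
  have hz := weight_two_eq_zero (G := fun w => h2 w * (eisQ w * oddQ w / betaQ w ^ 2))
    (hd2.mul hd3).diff fun τ hτ => by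
      have key : ∀ t : ℂ, 0 < t.im → h2 (nome t) * (eisQ (nome t) * oddQ (nome t) /
          betaQ (nome t) ^ 2) = (eisQ (nome t) ^ 3 - qf 1 betaQ t * (hauptJ t + 54)) *
          (eisQ (nome t) * oddQ (nome t)) / (qf 1 betaQ t) ^ 2 := fun t ht => by
        have hn := nome_ne_zero t
        have hb := betaQ_ne_zero (nome_mem_ball ht)
        have e1 : eisQ (nome t) ^ 3 - qf 1 betaQ t * (hauptJ t + 54) =
            nome t ^ 2 * h2 (nome t) := by
          rw [← heq, hh, hauptJ_eq ht, qf, qf, zpow_one, zpow_neg_one]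
          field_simp
        rw [e1, qf, zpow_one]
        field_simp
      rw [key τ hτ, key _ (fricke_im_pos hτ), hauptJ_fricke hτ, betaQ_fricke hτ]
      have e1 := qform_eisQ.trans τ hτ
      have e2 := qform_oddQ.trans τ hτ
      simp only [qf, zpow_zero, one_mul, zpow_one] at e1 e2
      rw [e1, e2, zpow_ofNat]
      have hb : qf 1 betaQ τ ≠ 0 := by
        rw [qf]
        exact mul_ne_zero (zpow_ne_zero _ (nome_ne_zero _)) (betaQ_ne_zero (nome_mem_ball hτ))
      have := ne_zero_of_im_pos hτ
      field_simp
      ring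
  have hz2 := eq_zero_of_mul_eq_zero hd2.diff hd3.diff
    (by simp [eisQ_zero, oddQ_zero, betaQ_zero]) hz w hw
  have := heq w
  rw [hz2, mul_zero, hh] at this
  exact sub_eq_zero.1 this

/-- Differentiating e³ = B(j + 54) expresses the Serre derivative of e through dj/dτ, which factors
as e times a multiple of u - 1/u. Everything is multiplied by e once so that no division is needed.
-/
lemma eisQ_mul_thetaQ {w : ℂ} (hw : w ∈ ball (0 : ℂ) 1) : eisQ w * thetaQ w = oddQ w := by
  have key : ∀ w ∈ ball (0 : ℂ) 1, (eisQ w * thetaQ w - oddQ w) * eisQ w = 0 := by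
    intro w hw
    have hn : ‖w‖ < 1 := by simpa using hw
    have h1 := (discReal_eisQ.differentiableAt hn).hasDerivAt
    have h2 := (discReal_betaQ.differentiableAt hn).hasDerivAt
    have h3 := (discReal_hauptQ.differentiableAt hn).hasDerivAt
    have e1 : HasDerivAt (fun w => eisQ w ^ 3) _ w := h1.pow 3
    have e2 : HasDerivAt (fun w => betaQ w * (hauptQ w + 54 * w)) _ w :=
      h2.mul (h3.add ((hasDerivAt_id w).const_mul 54))
    have e3 : (fun w => eisQ w ^ 3) =ᶠ[𝓝 w] fun w => betaQ w * (hauptQ w + 54 * w) := by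
      filter_upwards [isOpen_ball.mem_nhds hw] with x hx
      exact eisQ_cube hx
    have e4 := e1.unique (e2.congr_of_eventuallyEq e3)
    have e5 := hauptQ_sub_deriv hw
    have e6 := eisQ_cube hw
    have hb := betaQ_ne_zero hw
    have hu := upsQ_ne_zero hw
    have e7 : oddQ w * eisQ w = betaQ w * (hauptQ w - w * deriv hauptQ w) := by
      rw [e5, oddQ]; ring
    push_cast at e4
    simp only [mul_one] at e4
    have e8 : betaQ w * (w * deriv betaQ w / betaQ w) = w * deriv betaQ w := by field_simp
    rw [sub_mul, e7, thetaQ]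
    set Lb := w * deriv betaQ w / betaQ w with hLb
    linear_combination (-w) * e4 + (1 + Lb) * e6 + (hauptQ w + 54 * w) * e8
  exact sub_eq_zero.1 (eq_zero_of_mul_eq_zero
    ((discReal_eisQ.mul discReal_thetaQ).sub discReal_oddQ).diff discReal_eisQ.diff
    (by simp [eisQ_zero]) key w hw)

/-- Square eθ = δ, use δ² = B²(j - 54)(j + 54), replace B(j + 54) by e³, and cancel e². -/
lemma thetaQ_sq {w : ℂ} (hw : w ∈ ball (0 : ℂ) 1) :
    thetaQ w ^ 2 = betaQ w * (hauptQ w - 54 * w) * eisQ w := by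
  have key : ∀ w ∈ ball (0 : ℂ) 1,
      (thetaQ w ^ 2 - betaQ w * (hauptQ w - 54 * w) * eisQ w) * eisQ w ^ 2 = 0 := by
    intro w hw
    have h1 := eisQ_mul_thetaQ hw
    have h2 := eisQ_cube hw
    have hu := upsQ_ne_zero hw
    have h3 : oddQ w ^ 2 = betaQ w ^ 2 * ((hauptQ w - 54 * w) * (hauptQ w + 54 * w)) := by
      rw [oddQ, hauptQ]
      field_simp
      ring
    have h4 : (eisQ w * thetaQ w) ^ 2 = oddQ w ^ 2 := by rw [h1]
    linear_combination h4 + h3 - betaQ w * (hauptQ w - 54 * w) * h2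
  have h54 : DiscReal fun w => 54 * w := by simpa using (DiscReal.const 54).mul DiscReal.id'
  exact sub_eq_zero.1 (eq_zero_of_mul_eq_zero
    ((discReal_thetaQ.pow 2).sub ((discReal_betaQ.mul (discReal_hauptQ.sub h54)).mul
      discReal_eisQ)).diff (discReal_eisQ.pow 2).diff (by simp [eisQ_zero]) key w hw)

end Fricke3

end

/-! ### The Hauptmodul on the fundamental domain and along its boundary arc. -/

noncomputable section

namespace Fricke3

open Complex Metric Set Filter Topology ComplexConjugate

lemma neg_conj_im (τ : ℂ) : (-conj τ).im = τ.im := by simp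

lemma DiscReal.comp_nome_neg_conj {g : ℂ → ℂ} (hg : DiscReal g) {τ : ℂ} (h : 0 < τ.im) :
    g (nome (-conj τ)) = conj (g (nome τ)) := by
  rw [nome_neg_conj, hg.real _ (nome_mem_ball h)]

lemma qf_neg_conj {g : ℂ → ℂ} (hg : DiscReal g) (n : ℤ) {τ : ℂ} (h : 0 < τ.im) :
    qf n g (-conj τ) = conj (qf n g τ) := by
  rw [qf, qf, hg.comp_nome_neg_conj h, nome_neg_conj, map_mul, map_zpow₀]

lemma hauptU_neg_conj {τ : ℂ} (h : 0 < τ.im) : hauptU (-conj τ) = conj (hauptU τ) := by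
  rw [hauptU, hauptU, discReal_upsQ.comp_nome_neg_conj h, nome_neg_conj, map_div₀, map_mul,
    map_ofNat]

/-- The source of all reality statements on the arc: there W coincides with the antiholomorphic
symmetry of the forms. -/
lemma fricke_eq_neg_conj {τ : ℂ} (h : normSq τ = 1 / 3) : fricke τ = -conj τ := by
  have h0 : τ ≠ 0 := by rintro rfl; norm_num at h
  have h1 : τ * conj τ = 1 / 3 := by rw [mul_conj, h]; norm_num
  rw [fricke]
  field_simp
  linear_combination 3 * h1

/-- On the circle, W gives u ↦ 1/u and the reflection gives u ↦ ū. The two agree. -/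
lemma norm_hauptU_eq_one {τ : ℂ} (h : 0 < τ.im) (h3 : normSq τ = 1 / 3) : ‖hauptU τ‖ = 1 := by
  have h1 := hauptU_fricke h
  rw [fricke_eq_neg_conj h3, hauptU_neg_conj h] at h1
  have h2 : hauptU τ * conj (hauptU τ) = 1 := by rw [h1, mul_inv_cancel₀ (hauptU_ne_zero h)]
  rw [mul_conj] at h2
  have h4 : normSq (hauptU τ) = 1 := by exact_mod_cast h2
  rw [normSq_eq_norm_sq] at h4
  exact (pow_eq_one_iff_of_nonneg (norm_nonneg _) two_ne_zero).1 h4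

lemma differentiableAt_hauptU {τ : ℂ} (h : 0 < τ.im) : DifferentiableAt ℂ hauptU τ :=
  (hasDerivAt_hauptU h).differentiableAt

lemma exists_norm_inv_hauptU_lt_one : ∃ Y : ℝ, ∀ τ : ℂ, Y ≤ τ.im → ‖(hauptU τ)⁻¹‖ < 1 := by
  have hc : ContinuousAt (fun w => 27 * w / upsQ w) 0 :=
    (continuousAt_const.mul continuousAt_id).div
      (discReal_upsQ.differentiableAt (by simp)).continuousAt (by simp [upsQ_zero])
  have h0 : ∀ᶠ w in 𝓝 (0 : ℂ), ‖27 * w / upsQ w‖ < 1 := by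
    have := hc.norm
    refine this.eventually_lt continuousAt_const ?_
    simp
  obtain ⟨r, hr, hr'⟩ := Metric.eventually_nhds_iff_ball.1 h0
  have ht : Tendsto (fun y : ℝ => Real.exp (-(2 * Real.pi * y))) atTop (𝓝 0) := by
    refine Real.tendsto_exp_neg_atTop_nhds_zero.comp ?_
    exact tendsto_id.const_mul_atTop (by positivity)
  obtain ⟨Y, hY⟩ := eventually_atTop.1 (ht.eventually (gt_mem_nhds hr))
  refine ⟨Y, fun τ hτ => ?_⟩
  have := hr' (nome τ) (by rw [mem_ball_zero_iff, norm_nome]; exact hY _ hτ)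
  rwa [hauptU, inv_div]

/-- On the interior of the fundamental domain the Hauptmodul `u` has modulus greater than one. -/
theorem one_lt_norm_hauptU {τ : ℂ} (him : 0 < τ.im) (hre : |τ.re| ≤ 1 / 2)
    (hn : 1 / 3 < normSq τ) : 1 < ‖hauptU τ‖ := by
  -- Maximum principle for V = 1/u, which tends to 0 at the cusp and has modulus 1 on the circle. A
  -- value of modulus at least 1 off the circle would make the maximum over the truncated domain K
  -- an unrestricted local maximum.
  by_contra hcon
  push Not at hcon
  have hV1 : 1 ≤ ‖(hauptU τ)⁻¹‖ := by
    rw [norm_inv]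
    exact (one_le_inv₀ (norm_pos_iff.2 (hauptU_ne_zero him))).2 hcon
  obtain ⟨Y, hY⟩ := exists_norm_inv_hauptU_lt_one
  set V : ℂ → ℂ := fun t => (hauptU t)⁻¹ with hV
  set Y' := max Y τ.im with hY'
  have im_ge : ∀ t : ℂ, 0 < t.im → |t.re| ≤ 1 / 2 → 1 / 3 ≤ normSq t → 1 / 4 ≤ t.im := by
    intro t h1 h2 h3
    rw [normSq_apply] at h3
    rw [abs_le] at h2
    nlinarith
  set K : Set ℂ := {t | |t.re| ≤ 1 / 2 ∧ 1 / 3 ≤ normSq t ∧ 1 / 4 ≤ t.im ∧ t.im ≤ Y'} with hK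
  have hKc : IsCompact K := by
    refine Metric.isCompact_of_isClosed_isBounded ?_ ?_
    · refine (isClosed_le (continuous_abs.comp continuous_re) continuous_const).inter
        ((isClosed_le continuous_const continuous_normSq).inter
        ((isClosed_le continuous_const continuous_im).inter
        (isClosed_le continuous_im continuous_const)))
    · refine (Metric.isBounded_closedBall (x := (0 : ℂ)) (r := 1 / 2 + Y')).subset fun t ht => ?_
      rw [mem_closedBall_zero_iff]
      refine (norm_le_abs_re_add_abs_im t).trans ?_
      rw [abs_of_nonneg (by linarith [ht.2.2.1] : 0 ≤ t.im)]
      linarith [ht.1, ht.2.2.2]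
  have hτK : τ ∈ K := ⟨hre, hn.le, im_ge τ him hre hn.le, le_max_right _ _⟩
  have hdiff : ∀ t : ℂ, 0 < t.im → DifferentiableAt ℂ V t := fun t ht =>
    (differentiableAt_hauptU ht).inv (hauptU_ne_zero ht)
  obtain ⟨p, hpK, hp⟩ := hKc.exists_isMaxOn ⟨τ, hτK⟩ (f := fun t => ‖V t‖) fun t ht =>
    ((hdiff t (by linarith [ht.2.2.1])).continuousAt.norm).continuousWithinAt
  have hM1 : 1 ≤ ‖V p‖ := hV1.trans (hp hτK)
  have hle : ∀ t : ℂ, 0 < t.im → |t.re| ≤ 1 / 2 → 1 / 3 ≤ normSq t → ‖V t‖ ≤ ‖V p‖ := by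
    intro t h1 h2 h3
    by_cases h4 : t.im ≤ Y'
    · exact hp (show t ∈ K from ⟨h2, h3, im_ge t h1 h2 h3, h4⟩)
    · exact ((hY t ((le_max_left _ _).trans (not_le.1 h4).le)).trans_le hM1).le
  -- A maximal point off the circle is impossible. If it lies on a vertical side, nearby points are
  -- brought back into the strip by ±1 and remain outside the circle. Then V is constant,
  -- contradicting its decay at the cusp.
  have key : ∀ p₀ : ℂ, 0 < p₀.im → |p₀.re| ≤ 1 / 2 → 1 / 3 < normSq p₀ →
      ‖V p₀‖ = ‖V p‖ → False := by
    intro p₀ h1 h2 h3 h4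
    have hadd : ∀ n : ℤ, ∀ t, V (t + n) = V t := fun n t => by rw [hV]; simp [hauptU_add_int]
    have hmax : IsLocalMax (norm ∘ V) p₀ := by
      have c1 : ∀ᶠ t in 𝓝 p₀, 1 / 3 < normSq t :=
        continuous_normSq.continuousAt.eventually_const_lt h3
      have c2 : ∀ᶠ t in 𝓝 p₀, 1 / 3 < normSq (t + 1) := by
        refine (continuous_normSq.comp (continuous_add_const 1)).continuousAt.eventually_const_lt ?_
        simp only [Function.comp, normSq_apply, add_re, add_im, one_re, one_im] at h3 ⊢
        rw [abs_le] at h2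
        nlinarith
      have c3 : ∀ᶠ t in 𝓝 p₀, 1 / 3 < normSq (t - 1) := by
        refine (continuous_normSq.comp (continuous_sub_right 1)).continuousAt.eventually_const_lt ?_
        simp only [Function.comp, normSq_apply, sub_re, sub_im, one_re, one_im] at h3 ⊢
        rw [abs_le] at h2
        nlinarith
      have c4 : ∀ᶠ t : ℂ in 𝓝 p₀, |t.re| < 3 / 2 :=
        (continuous_abs.comp continuous_re).continuousAt.eventually_lt_const
          (by simp only [Function.comp]; linarith)
      filter_upwards [c1, c2, c3, c4, eventually_im_pos h1] with t d1 d2 d3 d4 d5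
      simp only [Function.comp]
      rw [h4]
      rw [abs_lt] at d4
      by_cases e1 : |t.re| ≤ 1 / 2
      · exact hle t d5 e1 d1.le
      · rw [abs_le, not_and_or, not_le, not_le] at e1
        rcases e1 with e1 | e1
        · rw [← hadd 1 t]
          refine hle _ (by simpa using d5) ?_ (by simpa using d2.le)
          simp only [Int.cast_one, add_re, one_re, abs_le]
          constructor <;> linarith
        · rw [← hadd (-1) t]
          refine hle _ (by simpa using d5) ?_ (by simpa [← sub_eq_add_neg] using d3.le)
          simp only [Int.cast_neg, Int.cast_one, add_re, neg_re, one_re, abs_le]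
          constructor <;> linarith
    have hev := eventually_eq_of_isLocalMax_norm
      ((eventually_im_pos h1).mono fun t ht => hdiff t ht) hmax
    have han : AnalyticOnNhd ℂ V {t | 0 < t.im} :=
      (DifferentiableOn.analyticOnNhd (fun t ht => (hdiff t ht).differentiableWithinAt)
        isOpen_upper)
    have heq := han.eqOn_of_preconnected_of_eventuallyEq analyticOnNhd_const
      convex_upper.isPreconnected (show p₀ ∈ {t : ℂ | 0 < t.im} from h1) hev
    have hpos : 0 < Y' := lt_of_lt_of_le him (le_max_right _ _)
    have h5 := heq (show (Y' * I : ℂ) ∈ {t : ℂ | 0 < t.im} by simpa using hpos)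
    have h6 := hY (Y' * I) (by simp [hY'])
    change V (Y' * I) = V p₀ at h5
    have h7 : ‖V (Y' * I)‖ < 1 := h6
    rw [h5, h4] at h7
    linarith
  have hppos : 0 < p.im := by linarith [hpK.2.2.1]
  -- If the maximum is attained on the circle it equals 1, so τ, which lies off the circle, is
  -- maximal too.
  rcases hpK.2.1.lt_or_eq with h | h
  · exact key p hppos hpK.1 h rfl
  · have h1 : ‖V p‖ = 1 := by
      rw [hV]
      simp only [norm_inv, norm_hauptU_eq_one hppos h.symm, inv_one]
    exact key τ him hre hn (le_antisymm (hp hτK) (by rw [h1]; exact hV1))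

/-- Boundary Schwarz lemma: a holomorphic map of a disc into the unit disc has nonzero derivative
at a boundary point that it sends to the unit circle. -/
lemma deriv_ne_zero_of_mapsTo_ball {f : ℂ → ℂ} {c z : ℂ} {R : ℝ} {f' : ℂ}
    (hR : 0 < R) (hd : DifferentiableOn ℂ f (ball c R)) (hm : MapsTo f (ball c R) (ball 0 1))
    (hz : ‖z - c‖ = R) (hf : HasDerivAt f f' z) (hfz : ‖f z‖ = 1) : f' ≠ 0 := by
  rintro rfl
  set a := f c with ha
  have hca : ‖a‖ < 1 := by simpa using hm (mem_ball_self hR)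
  have hden : ∀ b : ℂ, ‖b‖ < 1 → 1 - conj a * b ≠ 0 := by
    intro b hb h0
    have h1 : conj a * b = 1 := (sub_eq_zero.1 h0).symm
    have h2 : ‖conj a * b‖ < 1 := by
      rw [norm_mul, norm_conj]
      exact mul_lt_one_of_nonneg_of_lt_one_left (norm_nonneg _) hca hb.le
    rw [h1, norm_one] at h2
    exact lt_irrefl _ h2
  -- A Blaschke factor moves f(c) to 0, so the Schwarz lemma bounds |g| by |w - c|/R.
  set g : ℂ → ℂ := fun w => (f w - a) / (1 - conj a * f w) with hg
  have hgd : DifferentiableOn ℂ g (ball c R) :=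
    (hd.sub_const _).div ((differentiableOn_const _).sub (hd.const_mul _))
      fun w hw => hden _ (by simpa using hm hw)
  have ident : ∀ b : ℂ, ‖1 - conj a * b‖ ^ 2 - ‖b - a‖ ^ 2 = (1 - ‖a‖ ^ 2) * (1 - ‖b‖ ^ 2) := by
    intro b
    simp only [← normSq_eq_norm_sq, normSq_apply, sub_re, sub_im, mul_re, mul_im, conj_re, conj_im,
      one_re, one_im]
    ring
  have hgm : MapsTo g (ball c R) (closedBall (g c) 1) := by
    intro w hw
    have hgc : g c = 0 := by simp [hg, ha]
    rw [hgc, mem_closedBall_zero_iff, hg]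
    simp only [norm_div]
    have hb : ‖f w‖ < 1 := by simpa using hm hw
    rw [div_le_one (norm_pos_iff.2 (hden _ hb))]
    have h1 := ident (f w)
    have h2 : 0 ≤ (1 - ‖a‖ ^ 2) * (1 - ‖f w‖ ^ 2) := by
      apply mul_nonneg <;> nlinarith [norm_nonneg a, norm_nonneg (f w)]
    exact le_of_sq_le_sq (by linarith) (norm_nonneg _)
  -- Along the radius ending at z, 1 - |f| decreases at most linearly to 0. This contradicts f(w) -
  -- f(z) = o(|w - z|), which a zero derivative would give.
  have hbound : ∀ s : ℝ, 0 < s → s < 1 →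
      (1 - ‖a‖) / 4 * s ≤ ‖f (z + (s : ℂ) * (c - z)) - f z‖ := by
    intro s hs0 hs1
    set w := z + (s : ℂ) * (c - z) with hw
    have hwc : ‖w - c‖ = (1 - s) * R := by
      have : w - c = ((1 - s : ℝ) : ℂ) * (z - c) := by rw [hw]; push_cast; ring
      rw [this, norm_mul, norm_real, Real.norm_of_nonneg (by linarith), hz]
    have hwb : w ∈ ball c R := by
      rw [mem_ball, dist_eq_norm, hwc]; nlinarith
    have hgw := dist_le_div_mul_dist_of_mapsTo_ball hgd hgm hwb
    have hgc : g c = 0 := by simp [hg, ha]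
    rw [hgc, dist_zero_right, dist_eq_norm, hwc] at hgw
    have hgw' : ‖g w‖ ≤ 1 - s := by
      calc _ ≤ _ := hgw
        _ = 1 - s := by field_simp
    have hb : ‖f w‖ < 1 := by simpa using hm hwb
    have hD := norm_pos_iff.2 (hden _ hb)
    have h1 : ‖f w - a‖ ≤ (1 - s) * ‖1 - conj a * f w‖ := by
      rw [hg] at hgw'
      simp only [norm_div] at hgw'
      exact (div_le_iff₀ hD).1 hgw'
    have h2 := ident (f w)
    have hD1 : 1 - ‖a‖ ≤ ‖1 - conj a * f w‖ := by
      have := norm_sub_norm_le (1 : ℂ) (conj a * f w)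
      rw [norm_one, norm_mul, norm_conj] at this
      nlinarith [norm_nonneg a]
    have hD2 : ‖f w - a‖ ^ 2 ≤ (1 - s) ^ 2 * ‖1 - conj a * f w‖ ^ 2 := by
      rw [← mul_pow]
      exact pow_le_pow_left₀ (norm_nonneg _) h1 2
    have h3 : s * (1 - ‖a‖) ^ 2 ≤ (1 - ‖a‖ ^ 2) * (1 - ‖f w‖ ^ 2) := by
      have e1 : (1 - ‖a‖) ^ 2 ≤ ‖1 - conj a * f w‖ ^ 2 :=
        pow_le_pow_left₀ (by linarith) hD1 2
      have e2 : s ≤ 1 - (1 - s) ^ 2 := by nlinarith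
      have e3 := mul_le_mul e2 e1 (by positivity) (by nlinarith)
      nlinarith
    have h4 : s * (1 - ‖a‖) ≤ 4 * (1 - ‖f w‖) := by
      have p1 : 0 < 1 - ‖a‖ := by linarith
      have p2 : (1 - ‖a‖) * (s * (1 - ‖a‖)) ≤ (1 - ‖a‖) * (4 * (1 - ‖f w‖)) := by
        calc _ = s * (1 - ‖a‖) ^ 2 := by ring
          _ ≤ _ := h3
          _ = (1 - ‖a‖) * ((1 + ‖a‖) * (1 + ‖f w‖) * (1 - ‖f w‖)) := by ring
          _ ≤ _ := by
            apply mul_le_mul_of_nonneg_left _ p1.le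
            apply mul_le_mul_of_nonneg_right _ (by linarith)
            nlinarith [norm_nonneg a, norm_nonneg (f w)]
      exact le_of_mul_le_mul_left p2 p1
    have h5 := norm_sub_norm_le (f z) (f w)
    rw [hfz, norm_sub_rev] at h5
    linarith
  have hlo := (hasDerivAt_iff_isLittleO_nhds_zero.1 hf)
  simp only [smul_zero, sub_zero] at hlo
  have hε : 0 < (1 - ‖a‖) / (8 * R) := by
    apply div_pos <;> linarith
  have hlo' := (Asymptotics.isLittleO_iff.1 hlo) hε
  have ht : Tendsto (fun s : ℝ => (s : ℂ) * (c - z)) (𝓝[>] 0) (𝓝 0) := by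
    have : Continuous fun s : ℝ => (s : ℂ) * (c - z) := by fun_prop
    have := this.tendsto 0
    simp only [ofReal_zero, zero_mul] at this
    exact this.mono_left nhdsWithin_le_nhds
  have h1 : ∀ᶠ s : ℝ in 𝓝[>] 0, s < 1 := by
    filter_upwards [Ioo_mem_nhdsGT (zero_lt_one' ℝ)] with s hs using hs.2
  obtain ⟨s, hs1, hs2, hs3⟩ := ((ht.eventually hlo').and (h1.and self_mem_nhdsWithin)).exists
  have hs0 : 0 < s := hs3
  have h2 := hbound s hs0 hs2
  rw [norm_mul, norm_real, Real.norm_of_nonneg hs0.le, norm_sub_rev c z, hz] at hs1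
  have h3 : (1 - ‖a‖) / (8 * R) * (s * R) = (1 - ‖a‖) / 8 * s := by field_simp
  rw [h3] at hs1
  have h4 : 0 < (1 - ‖a‖) * s := mul_pos (by linarith) hs0
  linarith

/-- A zero of e would be a critical point of 1/u. Since 1/u maps a disc tangent to the arc at τ into
the unit disc and τ to the unit circle, the boundary Schwarz lemma excludes this. At ρ no such disc
fits into the strip. -/
lemma eisQ_ne_zero_of_arc {τ : ℂ} (him : 0 < τ.im) (hn : normSq τ = 1 / 3) (hre : |τ.re| < 1 / 2) :
    eisQ (nome τ) ≠ 0 := by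
  have h0 := ne_zero_of_im_pos him
  have hnorm : ‖τ‖ ^ 2 = 1 / 3 := by rw [← normSq_eq_norm_sq, hn]
  have hnpos : 0 < ‖τ‖ := norm_pos_iff.2 h0
  -- The disc with centre (1 + s)τ and radius s|τ| touches the circle at τ from outside. This s
  -- keeps it inside the strip.
  set s : ℝ := (1 / 2 - |τ.re|) / 2 with hs
  have hs0 : 0 < s := by rw [hs]; linarith
  have hre0 := abs_nonneg τ.re
  have hs1 : s ≤ 1 / 4 := by rw [hs]; linarith
  have hτ1 : ‖τ‖ < 1 := by nlinarith
  have hsub : ∀ t ∈ ball (τ + s * τ) (s * ‖τ‖), 0 < t.im ∧ |t.re| ≤ 1 / 2 ∧ 1 / 3 < normSq t := by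
    intro t ht
    rw [mem_ball, dist_eq_norm] at ht
    have e : τ + s * τ = ((1 + s : ℝ) : ℂ) * τ := by push_cast; ring
    rw [e] at ht
    have h1 : ‖τ‖ < ‖t‖ := by
      have := norm_sub_norm_le (((1 + s : ℝ) : ℂ) * τ) t
      rw [norm_mul, norm_real, Real.norm_of_nonneg (by linarith), norm_sub_rev] at this
      linarith
    have h2 : 1 / 3 < normSq t := by
      rw [normSq_eq_norm_sq, ← hnorm]
      nlinarith
    have h3 : |t.re| ≤ 1 / 2 := by
      have h4 := (abs_re_le_norm (t - ((1 + s : ℝ) : ℂ) * τ)).trans ht.le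
      rw [sub_re, re_ofReal_mul] at h4
      have h5 := abs_sub_abs_le_abs_sub t.re ((1 + s) * τ.re)
      rw [abs_mul, abs_of_pos (by linarith : 0 < 1 + s)] at h5
      have h6 : s * ‖τ‖ ≤ s := by nlinarith
      have h7 : |t.re| ≤ |τ.re| + s * |τ.re| + s * ‖τ‖ := by linarith
      have h8 : ‖τ‖ ≤ 3 / 5 := by nlinarith
      nlinarith
    refine ⟨?_, h3, h2⟩
    have h4 := (abs_im_le_norm (t - ((1 + s : ℝ) : ℂ) * τ)).trans ht.le
    rw [sub_im, im_ofReal_mul] at h4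
    have h5 := (abs_le.1 h4).1
    have h6 : 1 / 12 < τ.im ^ 2 := by
      rw [normSq_apply] at hn
      have := (abs_lt.1 hre)
      nlinarith
    have h7 : 1 / 4 < τ.im := by nlinarith
    have h8 : ‖τ‖ ≤ 3 / 5 := by nlinarith
    nlinarith
  have hV : HasDerivAt (fun t => (hauptU t)⁻¹)
      (-(-(2 * Real.pi * I) * eisQ (nome τ) * hauptU τ) / hauptU τ ^ 2) τ :=
    (hasDerivAt_hauptU him).inv (hauptU_ne_zero him)
  have hne := deriv_ne_zero_of_mapsTo_ball (f := fun t => (hauptU t)⁻¹) (c := τ + s * τ) (R := s * ‖τ‖) (by positivity)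
    (fun t ht => ((differentiableAt_hauptU (hsub t ht).1).inv
      (hauptU_ne_zero (hsub t ht).1)).differentiableWithinAt)
    (fun t ht => by
      rw [mem_ball_zero_iff, norm_inv]
      obtain ⟨a, b, c⟩ := hsub t ht
      exact inv_lt_one_of_one_lt₀ (one_lt_norm_hauptU a b c))
    (by rw [sub_add_cancel_left, norm_neg, norm_mul, norm_real, Real.norm_of_nonneg hs0.le]) hV
    (by rw [norm_inv, norm_hauptU_eq_one him hn, inv_one])
  intro h
  rw [h] at hne
  simp at hne

/-- The point `e^{iθ}/√3`. -/
def arcPt (θ : ℝ) : ℂ := 1 / (√3 : ℝ) * Complex.exp (I * θ)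

lemma arcPt_re (θ : ℝ) : (arcPt θ).re = Real.cos θ / √3 := by
  have : arcPt θ = ((1 / √3 : ℝ) : ℂ) * Complex.exp (θ * I) := by
    rw [arcPt, mul_comm I]; push_cast; ring
  rw [this, re_ofReal_mul, exp_ofReal_mul_I_re]; ring

lemma arcPt_im (θ : ℝ) : (arcPt θ).im = Real.sin θ / √3 := by
  have : arcPt θ = ((1 / √3 : ℝ) : ℂ) * Complex.exp (θ * I) := by
    rw [arcPt, mul_comm I]; push_cast; ring
  rw [this, im_ofReal_mul, exp_ofReal_mul_I_im]; ring

lemma normSq_arcPt (θ : ℝ) : normSq (arcPt θ) = 1 / 3 := by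
  rw [normSq_apply, arcPt_re, arcPt_im]
  have h : √3 * √3 = (3 : ℝ) := Real.mul_self_sqrt (by norm_num)
  have h' : √3 ≠ (0 : ℝ) := by positivity
  have := Real.sin_sq_add_cos_sq θ
  rw [div_mul_div_comm, div_mul_div_comm, h]
  linarith

lemma sin_ge_half_of_arc {θ : ℝ} (h1 : Real.pi / 2 ≤ θ) (h2 : θ ≤ 5 * Real.pi / 6) :
    1 / 2 ≤ Real.sin θ := by
  have := Real.pi_pos
  rw [← Real.sin_pi_sub, ← Real.sin_pi_div_six]
  exact Real.sin_le_sin_of_le_of_le_pi_div_two (by linarith) (by linarith) (by linarith)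

lemma arcPt_im_pos {θ : ℝ} (h1 : Real.pi / 2 ≤ θ) (h2 : θ ≤ 5 * Real.pi / 6) :
    0 < (arcPt θ).im := by
  rw [arcPt_im]
  have := sin_ge_half_of_arc h1 h2
  positivity

lemma arcPt_re_nonpos {θ : ℝ} (h1 : Real.pi / 2 ≤ θ) (h2 : θ ≤ 5 * Real.pi / 6) :
    (arcPt θ).re ≤ 0 := by
  have := Real.pi_pos
  rw [arcPt_re]
  exact div_nonpos_of_nonpos_of_nonneg
    (Real.cos_nonpos_of_pi_div_two_le_of_le h1 (by linarith)) (by positivity)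

lemma arcPt_five : arcPt (5 * Real.pi / 6) = rho := by
  have h : √3 * √3 = (3 : ℝ) := Real.mul_self_sqrt (by norm_num)
  have h' : √3 ≠ (0 : ℝ) := by positivity
  have e : 5 * Real.pi / 6 = Real.pi - Real.pi / 6 := by ring
  apply Complex.ext
  · rw [arcPt_re, e, Real.cos_pi_sub, Real.cos_pi_div_six, rho]
    simp only
    field_simp
  · rw [arcPt_im, e, Real.sin_pi_sub, Real.sin_pi_div_six, rho]
    simp only
    field_simp
    nlinarith

lemma arcPt_re_strictAnti : StrictAntiOn (fun θ => (arcPt θ).re)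
    (Icc (Real.pi / 2) (5 * Real.pi / 6)) := by
  intro a ha b hb hab
  have := Real.pi_pos
  simp only [arcPt_re]
  have h := Real.strictAntiOn_cos (a := a) (b := b) ⟨by linarith [ha.1], by linarith [ha.2]⟩
    ⟨by linarith [hb.1], by linarith [hb.2]⟩ hab
  exact div_lt_div_of_pos_right h (by positivity)

lemma neg_half_le_arcPt_re {θ : ℝ} (h1 : Real.pi / 2 ≤ θ) (h2 : θ ≤ 5 * Real.pi / 6) :
    -(1 / 2) ≤ (arcPt θ).re := by
  have h := arcPt_re_strictAnti.antitoneOn ⟨h1, h2⟩ ⟨h1.trans h2, le_rfl⟩ h2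
  simp only [arcPt_five] at h
  have : rho.re = -1 / 2 := rfl
  linarith

lemma neg_half_lt_arcPt_re {θ : ℝ} (h1 : Real.pi / 2 ≤ θ) (h2 : θ < 5 * Real.pi / 6) :
    -(1 / 2) < (arcPt θ).re := by
  have h := arcPt_re_strictAnti ⟨h1, h2.le⟩ ⟨h1.trans h2.le, le_rfl⟩ h2
  simp only [arcPt_five] at h
  have : rho.re = -1 / 2 := rfl
  linarith

lemma abs_arcPt_re_lt {θ : ℝ} (h1 : Real.pi / 2 ≤ θ) (h2 : θ < 5 * Real.pi / 6) :
    |(arcPt θ).re| < 1 / 2 := by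
  rw [abs_lt]
  exact ⟨neg_half_lt_arcPt_re h1 h2, by linarith [arcPt_re_nonpos h1 h2.le]⟩

lemma hasDerivAt_arcPt (θ : ℝ) : HasDerivAt arcPt (I * arcPt θ) θ := by
  have h : HasDerivAt (fun t : ℂ => 1 / ((√3 : ℝ) : ℂ) * Complex.exp (I * t))
      (1 / ((√3 : ℝ) : ℂ) * (Complex.exp (I * θ) * (I * 1))) (θ : ℂ) :=
    (((hasDerivAt_id (θ : ℂ)).const_mul I).cexp).const_mul _
  have := h.comp_ofReal
  refine this.congr_deriv ?_
  rw [arcPt]; ring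

lemma continuous_arcPt : Continuous arcPt :=
  continuous_iff_continuousAt.2 fun θ => (hasDerivAt_arcPt θ).continuousAt

lemma qf_arc_conj {κ n : ℤ} {σ : ℂ} {g : ℂ → ℂ} (hg : QForm κ σ n g) {τ : ℂ} (him : 0 < τ.im)
    (hn : normSq τ = 1 / 3) : conj (qf n g τ) = σ * (3 * τ ^ 2) ^ κ * qf n g τ := by
  rw [← qf_neg_conj hg.toDiscReal n him, ← fricke_eq_neg_conj hn, hg.trans τ him]

/-- The real number `κ` with `2π z e(z) = iκ` for `z = e^{iθ}/√3`. -/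
def arcSpeed (θ : ℝ) : ℝ := (2 * Real.pi * arcPt θ * eisQ (nome (arcPt θ))).im

lemma arcSpeed_eq {θ : ℝ} (him : 0 < (arcPt θ).im) :
    2 * Real.pi * arcPt θ * eisQ (nome (arcPt θ)) = I * arcSpeed θ := by
  have h := qf_arc_conj qform_eisQ him (normSq_arcPt θ)
  rw [qf, zpow_zero, one_mul] at h
  have hz : arcPt θ * conj (arcPt θ) = 1 / 3 := by
    rw [mul_conj, normSq_arcPt]; push_cast; ring
  have : (2 * Real.pi * arcPt θ * eisQ (nome (arcPt θ))).re = 0 := by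
    have h2 : conj (2 * Real.pi * arcPt θ * eisQ (nome (arcPt θ))) =
        -(2 * Real.pi * arcPt θ * eisQ (nome (arcPt θ))) := by
      simp only [map_mul, h, conj_ofReal, map_ofNat]
      rw [zpow_one]
      linear_combination (-6 * Real.pi * arcPt θ * eisQ (nome (arcPt θ))) * hz
    have h3 := congrArg re h2
    rw [conj_re, neg_re] at h3
    linarith
  apply Complex.ext
  · rw [this]; simp
  · rw [arcSpeed]; simp

lemma arcSpeed_ne_zero {θ : ℝ} (h1 : Real.pi / 2 ≤ θ) (h2 : θ < 5 * Real.pi / 6) :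
    arcSpeed θ ≠ 0 := by
  have him := arcPt_im_pos h1 h2.le
  intro h
  have h3 := arcSpeed_eq him
  rw [h, ofReal_zero, mul_zero] at h3
  have h4 := eisQ_ne_zero_of_arc him (normSq_arcPt θ) (abs_arcPt_re_lt h1 h2)
  have h5 := ne_zero_of_im_pos him
  have : (Real.pi : ℂ) ≠ 0 := ofReal_ne_zero.2 Real.pi_ne_zero
  simp_all

lemma hasDerivAt_hauptU_arc {θ : ℝ} (him : 0 < (arcPt θ).im) :
    HasDerivAt (fun t : ℝ => hauptU (arcPt t)) (I * arcSpeed θ * hauptU (arcPt θ)) θ := by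
  have := (hasDerivAt_hauptU him).scomp θ (hasDerivAt_arcPt θ)
  refine this.congr_deriv ?_
  rw [← arcSpeed_eq him, smul_eq_mul]
  linear_combination (-2 * Real.pi * arcPt θ * eisQ (nome (arcPt θ)) * hauptU (arcPt θ)) * I_sq

lemma cubic_eis {τ : ℂ} (him : 0 < τ.im) :
    eisQ (nome τ) ^ 3 = qf 1 betaQ τ * (hauptJ τ + 54) := by
  have h0 : nome τ ≠ 0 := Complex.exp_ne_zero _
  rw [eisQ_cube (nome_mem_ball him), hauptJ_eq him, qf, qf, zpow_one, zpow_neg_one]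
  field_simp

lemma sq_theta {τ : ℂ} (him : 0 < τ.im) :
    thetaQ (nome τ) ^ 2 = qf 1 betaQ τ * (hauptJ τ - 54) * eisQ (nome τ) := by
  have h0 : nome τ ≠ 0 := Complex.exp_ne_zero _
  rw [thetaQ_sq (nome_mem_ball him), hauptJ_eq him, qf, qf, zpow_one, zpow_neg_one]
  field_simp

/-- u = -1 means j = -54, and the cubic relation would force e = 0. -/
lemma hauptU_ne_neg_one {θ : ℝ} (h1 : Real.pi / 2 ≤ θ) (h2 : θ < 5 * Real.pi / 6) :
    hauptU (arcPt θ) ≠ -1 := by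
  have him := arcPt_im_pos h1 h2.le
  intro h
  have h3 := cubic_eis him
  rw [hauptJ, h] at h3
  norm_num at h3
  exact eisQ_ne_zero_of_arc him (normSq_arcPt θ) (abs_arcPt_re_lt h1 h2) h3

lemma re_sq_add_im_sq_hauptU {θ : ℝ} (him : 0 < (arcPt θ).im) :
    (hauptU (arcPt θ)).re ^ 2 + (hauptU (arcPt θ)).im ^ 2 = 1 := by
  have h := norm_hauptU_eq_one him (normSq_arcPt θ)
  have h2 : normSq (hauptU (arcPt θ)) = 1 := by rw [normSq_eq_norm_sq, h]; norm_num
  rw [normSq_apply] at h2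
  linarith

lemma one_add_re_hauptU_pos {θ : ℝ} (h1 : Real.pi / 2 ≤ θ) (h2 : θ < 5 * Real.pi / 6) :
    0 < 1 + (hauptU (arcPt θ)).re := by
  have h := re_sq_add_im_sq_hauptU (arcPt_im_pos h1 h2.le)
  have h3 : -1 ≤ (hauptU (arcPt θ)).re := by nlinarith [sq_nonneg (hauptU (arcPt θ)).im]
  rcases h3.lt_or_eq with h4 | h4
  · linarith
  · exfalso
    apply hauptU_ne_neg_one h1 h2
    apply Complex.ext
    · rw [← h4]; simp
    · rw [← h4] at h
      have : (hauptU (arcPt θ)).im ^ 2 = 0 := by linarith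
      rw [pow_eq_zero_iff two_ne_zero] at this
      rw [this]; simp

/-- The stereographic coordinate `tan(φ/2)` of `u = e^{iφ}` along the arc. -/
def arcSlope (θ : ℝ) : ℝ := (hauptU (arcPt θ)).im / (1 + (hauptU (arcPt θ)).re)

lemma hasDerivAt_re_im {f : ℝ → ℂ} {f' : ℂ} {t : ℝ} (h : HasDerivAt f f' t) :
    HasDerivAt (fun x => (f x).re) f'.re t ∧ HasDerivAt (fun x => (f x).im) f'.im t :=
  ⟨(Complex.reCLM.hasFDerivAt.comp_hasDerivAt t h), (Complex.imCLM.hasFDerivAt.comp_hasDerivAt t h)⟩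

lemma hasDerivAt_arcSlope {θ : ℝ} (h1 : Real.pi / 2 ≤ θ) (h2 : θ < 5 * Real.pi / 6) :
    HasDerivAt arcSlope (arcSpeed θ / (1 + (hauptU (arcPt θ)).re)) θ := by
  have him := arcPt_im_pos h1 h2.le
  obtain ⟨hr, hi⟩ := hasDerivAt_re_im (hasDerivAt_hauptU_arc him)
  have hp := one_add_re_hauptU_pos h1 h2
  have := hi.div (hr.const_add 1) hp.ne'
  refine this.congr_deriv ?_
  have e := re_sq_add_im_sq_hauptU him
  have hr' : (I * arcSpeed θ * hauptU (arcPt θ)).re = -(arcSpeed θ * (hauptU (arcPt θ)).im) := by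
    simp [mul_re, mul_im]
  have hi' : (I * arcSpeed θ * hauptU (arcPt θ)).im = arcSpeed θ * (hauptU (arcPt θ)).re := by
    simp [mul_re, mul_im]
  rw [hr', hi']
  field_simp
  linear_combination arcSpeed θ * e

/-- The starting point i/√3 is fixed by W, so u² = 1 there; -1 has just been excluded. -/
lemma hauptU_arc_start : hauptU (arcPt (Real.pi / 2)) = 1 := by
  have hp := Real.pi_pos
  have h1 : Real.pi / 2 < 5 * Real.pi / 6 := by linarith
  have him := arcPt_im_pos le_rfl h1.le
  have hf : fricke (arcPt (Real.pi / 2)) = arcPt (Real.pi / 2) := by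
    rw [fricke_eq_neg_conj (normSq_arcPt _)]
    apply Complex.ext
    · rw [neg_re, conj_re, arcPt_re, Real.cos_pi_div_two]; simp
    · rw [neg_im, conj_im, neg_neg]
  have h2 := hauptU_fricke him
  rw [hf] at h2
  have h3 := hauptU_ne_zero him
  have h4 : (hauptU (arcPt (Real.pi / 2)) - 1) * (hauptU (arcPt (Real.pi / 2)) + 1) = 0 := by
    field_simp at h2
    linear_combination h2
  rcases mul_eq_zero.1 h4 with h | h
  · linear_combination h
  · exact absurd (eq_neg_of_add_eq_zero_left h) (hauptU_ne_neg_one le_rfl h1)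

lemma nome_rho_re_neg : ∃ r : ℝ, 0 < r ∧ nome rho = -r := by
  refine ⟨Real.exp (-(2 * Real.pi * (√3 / 6))), Real.exp_pos _, ?_⟩
  have : nome rho = Complex.exp (((-(2 * Real.pi * (√3 / 6)) : ℝ) : ℂ) + -(Real.pi * I)) := by
    rw [nome]
    congr 1
    have : rho = -1 / 2 + (√3 / 6 : ℝ) * I := by
      apply Complex.ext <;> simp [rho]
    rw [this]
    push_cast
    linear_combination (2 * Real.pi * ((√3 : ℝ) / 6)) * I_sq
  rw [this, Complex.exp_add, Complex.exp_neg, Complex.exp_pi_mul_I, ← ofReal_exp]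
  norm_num

/-- Wρ = ρ + 1 gives u² = 1. The nome at ρ is negative and the eta quotient enters through a twelfth
power of a real number, so u cannot be positive. -/
lemma hauptU_rho : hauptU rho = -1 := by
  obtain ⟨r, hr, hq⟩ := nome_rho_re_neg
  have hb := nome_mem_ball rho_im_pos
  have hb' : nome rho ^ 3 ∈ ball (0 : ℂ) 1 := norm_pow_three_lt hb
  rw [mem_ball_zero_iff] at hb hb'
  have hw : conj (nome rho) = nome rho := by rw [hq]; simp
  have h1 : conj (eulerProd (nome rho) / eulerProd (nome rho ^ 3)) =
      eulerProd (nome rho) / eulerProd (nome rho ^ 3) := by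
    rw [map_div₀, ← eulerProd_conj hb, ← eulerProd_conj hb', map_pow, hw]
  obtain ⟨t, ht⟩ := conj_eq_iff_real.1 h1
  have h2 : hauptU rho = ((-(t ^ 12 / (27 * r)) : ℝ) : ℂ) := by
    rw [hauptU, upsQ, ht, hq]
    push_cast
    rw [mul_neg, div_neg]
  have h3 : hauptU rho = (hauptU rho)⁻¹ := by
    rw [← hauptU_fricke rho_im_pos, fricke_rho, hauptU_add_one]
  have h0 := hauptU_ne_zero rho_im_pos
  have h4 : (hauptU rho - 1) * (hauptU rho + 1) = 0 := by
    field_simp at h3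
    linear_combination h3
  rcases mul_eq_zero.1 h4 with h | h
  · exfalso
    have h5 : hauptU rho = 1 := by linear_combination h
    rw [h2] at h5
    have h6 : -(t ^ 12 / (27 * r)) = 1 := by exact_mod_cast h5
    have : 0 ≤ t ^ 12 / (27 * r) := div_nonneg ((even_two_mul 6).pow_nonneg t) (by linarith)
    linarith
  · exact eq_neg_of_add_eq_zero_left h

lemma re_hauptU_eq_arcSlope {θ : ℝ} (h1 : Real.pi / 2 ≤ θ) (h2 : θ < 5 * Real.pi / 6) :
    (hauptU (arcPt θ)).re = 2 / (1 + arcSlope θ ^ 2) - 1 := by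
  have hp := one_add_re_hauptU_pos h1 h2
  have e := re_sq_add_im_sq_hauptU (arcPt_im_pos h1 h2.le)
  have h3 : 1 + arcSlope θ ^ 2 = 2 / (1 + (hauptU (arcPt θ)).re) := by
    rw [arcSlope]
    field_simp
    linear_combination e
  rw [h3, div_div_eq_mul_div]
  field_simp
  ring

/-- Re u is a decreasing function of the square of the slope t = tan(φ/2), where u = e^{iφ}. The
slope starts at 0 and has nowhere vanishing derivative, so t² increases. -/
theorem re_hauptU_strictAnti : StrictAntiOn (fun θ => (hauptU (arcPt θ)).re)
    (Icc (Real.pi / 2) (5 * Real.pi / 6)) := by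
  have hpi := Real.pi_pos
  have h0 : arcSlope (Real.pi / 2) = 0 := by rw [arcSlope, hauptU_arc_start]; simp
  have hder : ∀ θ ∈ Ico (Real.pi / 2) (5 * Real.pi / 6),
      HasDerivAt arcSlope (arcSpeed θ / (1 + (hauptU (arcPt θ)).re)) θ := fun θ h =>
    hasDerivAt_arcSlope h.1 h.2
  have hcont : ContinuousOn arcSlope (Ico (Real.pi / 2) (5 * Real.pi / 6)) := fun θ h =>
    (hder θ h).continuousAt.continuousWithinAt
  have hsq : ∀ a ∈ Ico (Real.pi / 2) (5 * Real.pi / 6), ∀ b ∈ Ico (Real.pi / 2) (5 * Real.pi / 6),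
      a < b → arcSlope a ^ 2 < arcSlope b ^ 2 := by
    intro a ha b hb hab
    have hle : Real.pi / 2 ∈ Ico (Real.pi / 2) (5 * Real.pi / 6) := ⟨le_rfl, by linarith⟩
    have hinter : ∀ x ∈ interior (Ico (Real.pi / 2) (5 * Real.pi / 6)),
        x ∈ Ico (Real.pi / 2) (5 * Real.pi / 6) := fun x hx => interior_subset hx
    -- By Darboux's theorem the derivative keeps one sign. Which sign is irrelevant for t².
    rcases hasDerivWithinAt_forall_lt_or_forall_gt_of_forall_ne (m := 0)
      (convex_Ico (Real.pi / 2) (5 * Real.pi / 6))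
      (fun θ h => (hder θ h).hasDerivWithinAt)
      (fun θ h => div_ne_zero (arcSpeed_ne_zero h.1 h.2) (one_add_re_hauptU_pos h.1 h.2).ne')
      with hs | hs
    · have hmono := strictAntiOn_of_deriv_neg (convex_Ico _ _) hcont fun x hx => by
        rw [(hder x (hinter x hx)).deriv]; exact hs x (hinter x hx)
      have h1 := hmono ha hb hab
      have h2 := hmono.antitoneOn hle ha ha.1
      rw [h0] at h2
      nlinarith
    · have hmono := strictMonoOn_of_deriv_pos (convex_Ico _ _) hcont fun x hx => by
        rw [(hder x (hinter x hx)).deriv]; exact hs x (hinter x hx)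
      have h1 := hmono ha hb hab
      have h2 := hmono.monotoneOn hle ha ha.1
      rw [h0] at h2
      nlinarith
  intro a ha b hb hab
  have ha' : a ∈ Ico (Real.pi / 2) (5 * Real.pi / 6) := ⟨ha.1, hab.trans_le hb.2⟩
  simp only
  rcases hb.2.lt_or_eq with h | h
  · rw [re_hauptU_eq_arcSlope ha'.1 ha'.2, re_hauptU_eq_arcSlope hb.1 h]
    have := hsq a ha' b ⟨hb.1, h⟩ hab
    have h3 := sq_nonneg (arcSlope a)
    have : 2 / (1 + arcSlope b ^ 2) < 2 / (1 + arcSlope a ^ 2) :=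
      div_lt_div_of_pos_left two_pos (by linarith) (by linarith)
    linarith
  -- The slope has a pole at the corner, so this endpoint uses Re u > -1 directly.
  · rw [h, arcPt_five, hauptU_rho]
    have := one_add_re_hauptU_pos ha'.1 ha'.2
    simp only [neg_re, one_re]
    linarith

lemma hauptJ_arc {θ : ℝ} (him : 0 < (arcPt θ).im) :
    hauptJ (arcPt θ) = ((54 * (hauptU (arcPt θ)).re : ℝ) : ℂ) := by
  have h1 : (hauptU (arcPt θ))⁻¹ = conj (hauptU (arcPt θ)) := by
    rw [inv_def, normSq_eq_norm_sq, norm_hauptU_eq_one him (normSq_arcPt θ)]; simp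
  rw [hauptJ, h1, add_conj]
  push_cast; ring

end Fricke3

end

/-! ### Generators of the group, and the passage between q-expansions and functions on the disc. -/

noncomputable section
namespace Fricke3
open Complex Metric Set Filter Topology ComplexConjugate
open CongruenceSubgroup
open scoped MatrixGroups Manifold UpperHalfPlane

lemma coe_smul_real (γ : SL(2, ℝ)) (τ : ℍ) :
    ((γ • τ : ℍ) : ℂ) = ((γ 0 0 : ℂ) * τ + (γ 0 1 : ℂ)) / ((γ 1 0 : ℂ) * τ + (γ 1 1 : ℂ)) := by
  rw [UpperHalfPlane.specialLinearGroup_apply]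
  rfl

lemma denom_ne_zero_real (γ : SL(2, ℝ)) (τ : ℍ) : (γ 1 0 : ℂ) * τ + (γ 1 1 : ℂ) ≠ 0 :=
  UpperHalfPlane.denom_ne_zero (γ : GL (Fin 2) ℝ) τ

lemma im_smul_real (γ : SL(2, ℝ)) (τ : ℍ) :
    (γ • τ : ℍ).im = τ.im / normSq ((γ 1 0 : ℂ) * τ + (γ 1 1 : ℂ)) := by
  have h := UpperHalfPlane.im_smul_eq_div_normSq (γ : GL (Fin 2) ℝ) τ
  rw [show ((Matrix.GeneralLinearGroup.det (γ : GL (Fin 2) ℝ) : ℝˣ) : ℝ) = 1 from γ.2, abs_one,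
    one_mul] at h
  exact h

lemma denom_mul_real (γ δ : SL(2, ℝ)) (τ : ℍ) :
    ((γ * δ) 1 0 : ℂ) * τ + ((γ * δ) 1 1 : ℂ) =
      ((γ 1 0 : ℂ) * (δ • τ : ℍ) + (γ 1 1 : ℂ)) * ((δ 1 0 : ℂ) * τ + (δ 1 1 : ℂ)) := by
  have h := denom_ne_zero_real δ τ
  rw [coe_smul_real, Matrix.SpecialLinearGroup.coe_mul, Matrix.mul_apply, Matrix.mul_apply,
    Fin.sum_univ_two, Fin.sum_univ_two]
  push_cast
  field_simp
  ring

/-- The elements of `SL(2, ℝ)` under which `f` transforms like a form of weight `k`. -/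
def transformGroup (f : ℍ → ℂ) (k : ℤ) : Subgroup SL(2, ℝ) where
  carrier := {γ | ∀ τ : ℍ, f (γ • τ) = ((γ 1 0 : ℂ) * τ + (γ 1 1 : ℂ)) ^ k * f τ}
  one_mem' := fun τ => by simp
  mul_mem' := by
    intro γ δ hγ hδ τ
    rw [mul_smul, hγ, hδ, denom_mul_real, mul_zpow, mul_assoc]
  inv_mem' := by
    intro γ hγ τ
    have h := hγ (γ⁻¹ • τ)
    have h2 := denom_mul_real γ γ⁻¹ τ
    rw [smul_inv_smul] at h
    rw [mul_inv_cancel] at h2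
    simp only [Matrix.SpecialLinearGroup.coe_one, Matrix.one_apply_eq, ofReal_one, ne_eq,
      not_false_eq_true, Matrix.one_apply_ne, one_ne_zero, ofReal_zero, zero_mul,
      zero_add] at h2
    rw [h, ← mul_assoc, ← mul_zpow, mul_comm (_ + _), ← h2, one_zpow, one_mul]

/-- Translation by `n` as an element of `SL(2, ℤ)`. -/
def transZ (n : ℤ) : SL(2, ℤ) := ⟨!![1, n; 0, 1], by simp⟩

/-- The matrix `(1, 0; 3n, 1)`. -/
def lowerZ (n : ℤ) : SL(2, ℤ) := ⟨!![1, 0; 3 * n, 1], by simp⟩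

lemma transZ_zero_zero (n : ℤ) : transZ n 0 0 = 1 := rfl
lemma transZ_zero_one (n : ℤ) : transZ n 0 1 = n := rfl
lemma transZ_one_zero (n : ℤ) : transZ n 1 0 = 0 := rfl
lemma transZ_one_one (n : ℤ) : transZ n 1 1 = 1 := rfl
lemma lowerZ_zero_zero (n : ℤ) : lowerZ n 0 0 = 1 := rfl
lemma lowerZ_zero_one (n : ℤ) : lowerZ n 0 1 = 0 := rfl
lemma lowerZ_one_zero (n : ℤ) : lowerZ n 1 0 = 3 * n := rfl
lemma lowerZ_one_one (n : ℤ) : lowerZ n 1 1 = 1 := rfl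

lemma mem_Gamma0_three {γ : SL(2, ℤ)} : γ ∈ Gamma0 3 ↔ ∃ c : ℤ, γ 1 0 = 3 * c := by
  rw [Gamma0_mem]
  exact ZMod.intCast_zmod_eq_zero_iff_dvd _ 3

lemma det_int (γ : SL(2, ℤ)) : γ 0 0 * γ 1 1 - γ 0 1 * γ 1 0 = 1 := by
  rw [← Matrix.det_fin_two]; exact γ.2

lemma exists_abs_add_mul_le (a b : ℤ) (hb : b ≠ 0) : ∃ n : ℤ, 2 * |a + n * b| ≤ |b| := by
  refine ⟨-((2 * a + |b|) / (2 * |b|)) * b.sign, ?_⟩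
  have hb' : 0 < |b| := abs_pos.2 hb
  have h1 := Int.mul_ediv_add_emod (2 * a + |b|) (2 * |b|)
  have h2 := Int.emod_nonneg (2 * a + |b|) (by omega : 2 * |b| ≠ 0)
  have h3 := Int.emod_lt_of_pos (2 * a + |b|) (by omega : 0 < 2 * |b|)
  have h4 : b.sign * b = |b| := by
    rw [Int.sign_mul_self_eq_natAbs, Int.natCast_natAbs]
  set t := (2 * a + |b|) / (2 * |b|) with ht
  have h5 : a + -t * b.sign * b = a - t * |b| := by rw [mul_assoc, h4]; ring
  rw [h5]
  have h6 : 2 * |b| * t = 2 * (t * |b|) := by ring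
  rw [h6] at h1
  set s := t * |b| with hs
  rcases abs_cases (a - s) with h | h <;> omega

/-- `Γ₀(3)` is generated by `-1`, `(1, 1; 0, 1)` and `(1, 0; 3, 1)`. -/
theorem Gamma0_three_le (H : Subgroup SL(2, ℤ)) (hneg : -1 ∈ H) (hT : ∀ n, transZ n ∈ H)
    (hL : ∀ n, lowerZ n ∈ H) : Gamma0 3 ≤ H := by
  have key : ∀ N : ℕ, ∀ γ : SL(2, ℤ), ∀ c : ℤ, γ 1 0 = 3 * c → c.natAbs ≤ N → γ ∈ H := by
    intro N
    induction N with
    | zero =>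
      intro γ c hc hN
      have hc0 : c = 0 := by omega
      rw [hc0, mul_zero] at hc
      have hdet := det_int γ
      rw [hc, mul_zero, sub_zero] at hdet
      rcases Int.mul_eq_one_iff_eq_one_or_neg_one.1 hdet with ⟨h1, h2⟩ | ⟨h1, h2⟩
      · have : γ = transZ (γ 0 1) := by
          ext i j
          fin_cases i <;> fin_cases j <;> simp [transZ, hc, h1, h2]
        rw [this]; exact hT _
      · have : γ = -1 * transZ (-γ 0 1) := by
          rw [neg_one_mul]
          ext i j
          rw [Matrix.SpecialLinearGroup.coe_neg, Matrix.neg_apply]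
          fin_cases i <;> fin_cases j <;>
            simp [transZ_zero_zero, transZ_zero_one, transZ_one_zero,
               transZ_one_one, hc, h1, h2]
        rw [this]; exact mul_mem hneg (hT _)
    | succ N ih =>
      intro γ c hc hN
      have hN' : |c| ≤ N + 1 := by zify at hN; exact hN
      by_cases hc0 : c = 0
      · exact ih γ c hc (by rw [hc0]; simp)
      -- Euclidean descent on the bottom row (3c, d). A translation makes |d| ≤ 3|c|/2, then a lower
      -- unipotent makes the new |c| at most |d|/2 ≤ 3|c|/4. The determinant forbids d = 0, since it
      -- would then be divisible by 3.
      obtain ⟨n, hn⟩ := exists_abs_add_mul_le (γ 1 1) (3 * c) (by omega)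
      set d := γ 1 1 + n * (3 * c) with hd
      have hdet := det_int γ
      have hd0 : d ≠ 0 := by
        intro h0
        have : γ 1 1 = -(n * (3 * c)) := by omega
        rw [this, hc] at hdet
        have : 3 * (-(γ 0 0 * n * c) - γ 0 1 * c) = 1 := by linear_combination hdet
        omega
      obtain ⟨i, hi⟩ := exists_abs_add_mul_le c d hd0
      have hlt : |c + i * d| < |c| := by
        rw [abs_mul] at hn
        have : |c| > 0 := abs_pos.2 hc0
        norm_num at hn
        omega
      have hmem : γ * transZ n * lowerZ i ∈ H := by
        refine ih _ (c + i * d) ?_ (by zify; linarith [Int.abs_eq_natAbs c, hN'])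
        rw [Matrix.SpecialLinearGroup.coe_mul, Matrix.SpecialLinearGroup.coe_mul]
        simp [transZ_zero_zero, transZ_zero_one, transZ_one_zero, transZ_one_one,
          lowerZ_zero_zero, lowerZ_one_zero, Matrix.mul_apply, Fin.sum_univ_two, hc, hd]
        ring
      have := mul_mem (mul_mem hmem (inv_mem (hL i))) (inv_mem (hT n))
      simpa [mul_assoc] using this
  intro γ hγ
  obtain ⟨c, hc⟩ := mem_Gamma0_three.1 hγ
  exact key _ γ c hc le_rfl

lemma toReal_apply (γ : SL(2, ℤ)) (i j : Fin 2) : (toReal γ) i j = (γ i j : ℝ) := rfl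

lemma W_mem : W ∈ Gamma0Plus := ⟨1, one_mem _, Or.inr (by simp)⟩

lemma toReal_mem {γ : SL(2, ℤ)} (h : γ ∈ Gamma0 3) : toReal γ ∈ Gamma0Plus := ⟨γ, h, Or.inl rfl⟩

lemma transZ_mem (n : ℤ) : transZ n ∈ Gamma0 3 := mem_Gamma0_three.2 ⟨0, rfl⟩

lemma coe_W_smul (τ : ℍ) : ((W • τ : ℍ) : ℂ) = fricke τ := by
  have h : (√3 : ℝ) ≠ 0 := by positivity
  have h' : ((√3 : ℝ) : ℂ) ≠ 0 := ofReal_ne_zero.2 h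
  have h3 : ((√3 : ℝ) : ℂ) * ((√3 : ℝ) : ℂ) = 3 := by
    rw [← ofReal_mul, sqrt3_sq]; norm_num
  have ht := ne_zero_of_im_pos τ.im_pos
  rw [coe_smul_real, fricke]
  simp only [W, Matrix.of_apply, Matrix.cons_val', Matrix.cons_val_zero, Matrix.cons_val_one,
    Matrix.cons_val_fin_one]
  push_cast
  field_simp
  linear_combination (τ : ℂ) * h3

lemma coe_transZ_smul (n : ℤ) (τ : ℍ) : ((toReal (transZ n) • τ : ℍ) : ℂ) = τ + n := by
  rw [coe_smul_real]
  simp only [toReal_apply, transZ_zero_zero, transZ_zero_one, transZ_one_zero, transZ_one_one]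
  simp

lemma W_denom (τ : ℍ) (κ : ℤ) :
    ((W 1 0 : ℂ) * τ + (W 1 1 : ℂ)) ^ (2 * κ) = (3 * (τ : ℂ) ^ 2) ^ κ := by
  have h3 : ((√3 : ℝ) : ℂ) ^ 2 = 3 := by
    rw [sq, ← ofReal_mul, sqrt3_sq]; norm_num
  rw [zpow_mul]
  congr 1
  simp only [W, Matrix.of_apply, Matrix.cons_val', Matrix.cons_val_zero, Matrix.cons_val_one,
    Matrix.cons_val_fin_one]
  rw [ofReal_zero, add_zero, zpow_ofNat, mul_pow, h3]

/-- Translations and W suffice: -1 = W², and the lower unipotents are W-conjugates of translations.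
-/
theorem transform_Gamma0Plus {f : ℍ → ℂ} {κ : ℤ}
    (hT : ∀ (n : ℤ) (τ : ℍ), f (toReal (transZ n) • τ) = f τ)
    (hW : ∀ τ : ℍ, f (W • τ) = (3 * (τ : ℂ) ^ 2) ^ κ * f τ) :
    Gamma0Plus ≤ transformGroup f (2 * κ) := by
  have hWm : W ∈ transformGroup f (2 * κ) := fun τ => by rw [hW, W_denom]
  have hTm : ∀ n, toReal (transZ n) ∈ transformGroup f (2 * κ) := fun n τ => by
    rw [hT]
    simp only [toReal_apply, transZ_one_zero, transZ_one_one]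
    simp
  have hneg : (-1 : SL(2, ℝ)) ∈ transformGroup f (2 * κ) := by
    rw [← W_mul_W]; exact mul_mem hWm hWm
  have hsqrt : √3 * √3 = (3 : ℝ) := sqrt3_sq
  have hs0 : √3 ≠ (0 : ℝ) := by positivity
  have hG : Gamma0 3 ≤ (transformGroup f (2 * κ)).comap toReal := by
    refine Gamma0_three_le _ ?_ (fun n => hTm n) fun n => ?_
    · rw [Subgroup.mem_comap]
      convert hneg
      ext i j
      fin_cases i <;> fin_cases j <;> simp
    · rw [Subgroup.mem_comap]
      have : toReal (lowerZ n) = W * toReal (transZ (-n)) * W⁻¹ := by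
        rw [eq_mul_inv_iff_mul_eq]
        apply Subtype.ext
        rw [Matrix.SpecialLinearGroup.coe_mul, Matrix.SpecialLinearGroup.coe_mul]
        ext i j
        rw [Matrix.mul_apply, Matrix.mul_apply, Fin.sum_univ_two, Fin.sum_univ_two]
        simp only [toReal_apply]
        fin_cases i <;> fin_cases j <;>
          simp [W, transZ_zero_zero, transZ_zero_one, transZ_one_zero, transZ_one_one,
            lowerZ_zero_zero, lowerZ_zero_one, lowerZ_one_zero, lowerZ_one_one]
        field_simp
        linear_combination (-(n : ℝ)) * hsqrt
      rw [this]
      exact mul_mem (mul_mem hWm (hTm _)) (inv_mem hWm)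
  rintro _ ⟨γ, hγ, rfl | rfl⟩
  · exact hG hγ
  · exact mul_mem hWm (hG hγ)

lemma exp_eq_nome_zpow (n : ℤ) (τ : ℂ) : Complex.exp (2 * Real.pi * I * n * τ) = nome τ ^ n := by
  rw [nome, ← Complex.exp_int_mul]
  congr 1; ring

lemma hasQExpansion_monomial (n : ℤ) :
    HasQExpansion (fun τ : ℍ => nome τ ^ n) (Pi.single n 1) := by
  refine ⟨⟨n, fun i hi => by rw [Pi.single_eq_of_ne hi.ne]⟩, fun τ => ?_⟩
  have := hasSum_single (f := fun i : ℤ => (Pi.single n 1 : ℤ → ℂ) i *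
    Complex.exp (2 * Real.pi * I * i * τ)) n (fun i hi => by rw [Pi.single_eq_of_ne hi, zero_mul])
  simpa [exp_eq_nome_zpow] using this

lemma HasQExpansion.add {f g : ℍ → ℂ} {a b : ℤ → ℂ} (hf : HasQExpansion f a)
    (hg : HasQExpansion g b) : HasQExpansion (f + g) (a + b) := by
  obtain ⟨⟨m, hm⟩, ha⟩ := hf
  obtain ⟨⟨n, hn⟩, hb⟩ := hg
  refine ⟨⟨min m n, fun i hi => ?_⟩, fun τ => ?_⟩
  · rw [Pi.add_apply, hm i (by omega), hn i (by omega), add_zero]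
  · simpa only [Pi.add_apply, add_mul] using (ha τ).add (hb τ)

lemma HasQExpansion.sub {f g : ℍ → ℂ} {a b : ℤ → ℂ} (hf : HasQExpansion f a)
    (hg : HasQExpansion g b) : HasQExpansion (f - g) (a - b) := by
  obtain ⟨⟨m, hm⟩, ha⟩ := hf
  obtain ⟨⟨n, hn⟩, hb⟩ := hg
  refine ⟨⟨min m n, fun i hi => ?_⟩, fun τ => ?_⟩
  · rw [Pi.sub_apply, hm i (by omega), hn i (by omega), sub_zero]
  · simpa only [Pi.sub_apply, sub_mul] using (ha τ).sub (hb τ)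

lemma add_natCast_injective (n : ℤ) : Function.Injective fun i : ℕ => n + (i : ℤ) := by
  intro i j h
  simpa using h

lemma exists_hasQExpansion {g : ℂ → ℂ} (hg : DifferentiableOn ℂ g (ball 0 1)) (n : ℤ) :
    ∃ a : ℤ → ℂ, HasQExpansion (fun τ : ℍ => qf n g τ) a ∧ ∀ i < n, a i = 0 := by
  set a : ℤ → ℂ := fun i => if i < n then 0 else
    (((i - n).toNat.factorial : ℂ))⁻¹ * iteratedDeriv (i - n).toNat g 0 with ha
  have ha0 : ∀ i < n, a i = 0 := fun i hi => by simp [ha, hi]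
  refine ⟨a, ⟨⟨n, ha0⟩, fun τ => ?_⟩, ha0⟩
  have hq := nome_mem_ball τ.im_pos
  have h := (Complex.hasSum_taylorSeries_on_ball hg hq).mul_left (nome τ ^ n)
  rw [← (add_natCast_injective n).hasSum_iff]
  · refine h.congr_fun fun i => ?_
    have h1 : ¬ n + (i : ℤ) < n := by omega
    have h2 : (n + (i : ℤ) - n).toNat = i := by omega
    simp only [Function.comp_apply, exp_eq_nome_zpow, ha, h1, if_false, h2, smul_eq_mul, sub_zero]
    rw [zpow_add₀ (nome_ne_zero _), zpow_natCast]
    ring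
  · intro i hi
    rw [ha0 i, zero_mul]
    by_contra hin
    exact hi ⟨(i - n).toNat, by simp; omega⟩

lemma differentiableOn_of_hasSum {c : ℕ → ℂ} {g : ℂ → ℂ}
    (h : ∀ w ∈ ball (0 : ℂ) 1, HasSum (fun n => c n * w ^ n) (g w)) :
    DifferentiableOn ℂ g (ball 0 1) := by
  set p := FormalMultilinearSeries.ofScalars ℂ c with hp
  have hr : 1 ≤ p.radius := by
    refine le_of_forall_lt fun r hr => ?_
    lift r to NNReal using (hr.trans ENNReal.one_lt_top).ne
    have hr1 : (r : ℝ) < 1 := by exact_mod_cast hr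
    obtain ⟨s, hs1, hs2⟩ := exists_between hr1
    have hs0 : 0 ≤ s := r.2.trans hs1.le
    have hmem : (s : ℂ) ∈ ball (0 : ℂ) 1 := by
      rw [mem_ball_zero_iff, norm_real, Real.norm_of_nonneg hs0]; exact hs2
    have hsum := (h _ hmem).summable.norm
    lift s to NNReal using hs0
    refine lt_of_lt_of_le (b := (s : ENNReal)) (by exact_mod_cast hs1) ?_
    apply p.le_radius_of_summable_norm
    refine hsum.congr fun n => ?_
    rw [hp, FormalMultilinearSeries.ofScalars_norm, norm_mul, norm_pow, norm_real, NNReal.norm_eq]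
  have hball := p.hasFPowerSeriesOnBall (zero_lt_one.trans_le hr)
  have hd : DifferentiableOn ℂ p.sum (ball 0 1) := by
    refine hball.differentiableOn.mono fun w hw => ?_
    rw [Metric.mem_eball, edist_zero_right]
    refine lt_of_lt_of_le ?_ hr
    rw [mem_ball_zero_iff] at hw
    rw [← ofReal_norm]
    exact_mod_cast (ENNReal.ofReal_lt_one.2 hw)
  refine hd.congr fun w hw => ?_
  rw [← (h w hw).tsum_eq]
  rw [FormalMultilinearSeries.sum]
  refine tsum_congr fun n => ?_
  rw [hp, FormalMultilinearSeries.ofScalars_apply_eq, smul_eq_mul]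

/-- The nome maps the upper half plane onto the punctured disc, so convergence at every τ is
convergence of the power series on the whole disc. -/
lemma HasQExpansion.exists_qf {f : ℍ → ℂ} {a : ℤ → ℂ} (hf : HasQExpansion f a) {n : ℤ}
    (hn : ∀ i < n, a i = 0) :
    ∃ g : ℂ → ℂ, DifferentiableOn ℂ g (ball 0 1) ∧ ∀ τ : ℍ, f τ = qf n g τ := by
  have hsum : ∀ τ : ℍ, HasSum (fun i : ℕ => a (n + i) * nome τ ^ i) (nome τ ^ (-n) * f τ) := by
    intro τ
    have h := hf.2 τ
    rw [← (add_natCast_injective n).hasSum_iff] at h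
    · refine (h.mul_left (nome τ ^ (-n))).congr_fun fun i => ?_
      simp only [Function.comp_apply, exp_eq_nome_zpow]
      rw [zpow_add₀ (nome_ne_zero _), zpow_natCast, zpow_neg]
      have := zpow_ne_zero n (nome_ne_zero τ)
      field_simp
    · intro i hi
      rw [hn i, zero_mul]
      by_contra hin
      exact hi ⟨(i - n).toNat, by simp; omega⟩
  set g : ℂ → ℂ := fun w => ∑' i : ℕ, a (n + i) * w ^ i with hg
  refine ⟨g, differentiableOn_of_hasSum (c := fun i => a (n + i)) fun w hw => ?_, fun τ => ?_⟩
  · refine Summable.hasSum ?_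
    by_cases hw0 : w = 0
    · refine summable_of_ne_finset_zero (s := {0}) fun i hi => ?_
      rw [hw0, zero_pow (by simpa using hi), mul_zero]
    · obtain ⟨τ, hτ, -, rfl⟩ := exists_nome_eq hw0 (mem_ball_zero_iff.1 hw)
      exact (hsum ⟨τ, hτ⟩).summable
  · rw [qf, hg]
    simp only
    rw [(hsum τ).tsum_eq, ← mul_assoc, ← zpow_add₀ (nome_ne_zero _)]
    simp

/-- A weakly holomorphic form whose expansion starts at `qⁿ` is `qⁿ g(q)` with `g` holomorphic on
the disc, and transforms under the Fricke involution. -/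
lemma exists_qf_of_mem {f : ℍ → ℂ} {κ n : ℤ} (hf : f ∈ weaklyHolomorphic (2 * κ)) {a : ℤ → ℂ}
    (ha : HasQExpansion f a) (hn : ∀ i < n, a i = 0) :
    ∃ g : ℂ → ℂ, DifferentiableOn ℂ g (ball 0 1) ∧ (∀ τ : ℍ, f τ = qf n g τ) ∧
      ∀ τ : ℂ, 0 < τ.im → qf n g (fricke τ) = (3 * τ ^ 2) ^ κ * qf n g τ := by
  obtain ⟨g, hg, hfg⟩ := ha.exists_qf hn
  refine ⟨g, hg, hfg, fun τ hτ => ?_⟩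
  have h := hf.2.1 W W_mem ⟨τ, hτ⟩
  rwa [W_denom, hfg, hfg, coe_W_smul] at h

theorem QForm.mem_weaklyHolomorphic {κ n : ℤ} {g : ℂ → ℂ} (hg : QForm κ 1 n g) :
    (fun τ : ℍ => qf n g τ) ∈ weaklyHolomorphic (2 * κ) := by
  obtain ⟨a, ha, -⟩ := exists_hasQExpansion hg.diff n
  refine ⟨?_, ?_, a, ha⟩
  · rw [UpperHalfPlane.mdifferentiable_iff]
    have : DifferentiableOn ℂ (qf n g) {z | 0 < z.im} := by
      intro τ hτ
      have h1 : DifferentiableAt ℂ (fun t => nome t ^ n) τ :=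
        (differentiable_nome τ).zpow (Or.inl (nome_ne_zero τ))
      have h2 : DifferentiableAt ℂ (fun t => g (nome t)) τ :=
        (hg.toDiscReal.differentiableAt (norm_nome_lt_one hτ)).comp τ (differentiable_nome τ)
      exact (h1.mul h2).differentiableWithinAt
    refine this.congr fun τ hτ => ?_
    simp only [Function.comp_apply]
    rw [UpperHalfPlane.ofComplex_apply_of_im_pos hτ]
  · intro γ hγ
    refine transform_Gamma0Plus (f := fun τ : ℍ => qf n g τ) (κ := κ) (fun n τ => ?_) (fun τ => ?_)
      hγ
    · simp only [coe_transZ_smul, qf, nome_add_int]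
    · simp only [coe_W_smul, hg.trans τ τ.im_pos, one_mul]

end Fricke3

end

/-! ### Reduction theory, and the points over a value of j on the arc. -/

noncomputable section
namespace Fricke3
open Complex Metric Set Filter Topology ComplexConjugate
open CongruenceSubgroup
open scoped MatrixGroups Manifold UpperHalfPlane

lemma coe_toReal_smul (γ : SL(2, ℤ)) (τ : ℍ) : ((toReal γ • τ : ℍ) : ℂ) =
    ((γ 0 0 : ℂ) * τ + (γ 0 1 : ℂ)) / ((γ 1 0 : ℂ) * τ + (γ 1 1 : ℂ)) := by
  rw [coe_smul_real]
  simp only [toReal_apply, ofReal_intCast]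

lemma im_toReal_smul (γ : SL(2, ℤ)) (τ : ℍ) : (toReal γ • τ : ℍ).im =
    τ.im / normSq ((γ 1 0 : ℂ) * τ + (γ 1 1 : ℂ)) := by
  rw [im_smul_real]
  simp only [toReal_apply, ofReal_intCast]

lemma im_W_smul (τ : ℍ) : (W • τ : ℍ).im = τ.im / (3 * normSq τ) := by
  rw [← UpperHalfPlane.coe_im, coe_W_smul, fricke_im, UpperHalfPlane.coe_im]

lemma num_ne_zero_int (γ : SL(2, ℤ)) (τ : ℍ) : (γ 0 0 : ℂ) * τ + (γ 0 1 : ℂ) ≠ 0 := by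
  have h := ne_zero_of_im_pos (toReal γ • τ : ℍ).im_pos
  change ((toReal γ • τ : ℍ) : ℂ) ≠ 0 at h
  rw [coe_toReal_smul] at h
  exact (div_ne_zero_iff.1 h).1

lemma denom_ne_zero_int (γ : SL(2, ℤ)) (τ : ℍ) : (γ 1 0 : ℂ) * τ + (γ 1 1 : ℂ) ≠ 0 := by
  have h := denom_ne_zero_real (toReal γ) τ
  simpa only [toReal_apply, ofReal_intCast] using h

lemma im_W_mul_smul (γ : SL(2, ℤ)) (τ : ℍ) : ((W * toReal γ) • τ : ℍ).im =
    τ.im / (3 * normSq ((γ 0 0 : ℂ) * τ + (γ 0 1 : ℂ))) := by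
  have h0 : normSq ((γ 1 0 : ℂ) * τ + (γ 1 1 : ℂ)) ≠ 0 :=
    (normSq_pos.2 (denom_ne_zero_int γ τ)).ne'
  have h1 : normSq ((γ 0 0 : ℂ) * τ + (γ 0 1 : ℂ)) ≠ 0 :=
    (normSq_pos.2 (num_ne_zero_int γ τ)).ne'
  rw [mul_smul, im_W_smul, coe_toReal_smul, im_toReal_smul, normSq_div]
  field_simp

/-- On Γ₀(3) the height is governed by |cτ + d|² over bottom rows; on the W-coset by 3|aτ + b|² over
top rows. Each of these norms attains its minimum over the integer rows that occur. -/
lemma exists_max_im_Gamma0Plus (τ : ℍ) :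
    ∃ γ ∈ Gamma0Plus, ∀ δ ∈ Gamma0Plus, (δ • τ : ℍ).im ≤ (γ • τ : ℍ).im := by
  have key : ∀ i : Fin 2, ∃ γ ∈ Gamma0 3, ∀ δ ∈ Gamma0 3,
      normSq ((γ i 0 : ℂ) * τ + (γ i 1 : ℂ)) ≤ normSq ((δ i 0 : ℂ) * τ + (δ i 1 : ℂ)) := by
    intro i
    obtain ⟨p, ⟨γ, hγ, rfl⟩, hp⟩ := Filter.Tendsto.exists_within_forall_le
      (s := {p : Fin 2 → ℤ | ∃ γ ∈ Gamma0 3, p = γ i}) ⟨_, 1, one_mem _, rfl⟩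
      (ModularGroup.tendsto_normSq_coprime_pair τ)
    exact ⟨γ, hγ, fun δ hδ => hp _ ⟨δ, hδ, rfl⟩⟩
  obtain ⟨γ₁, h₁, hm₁⟩ := key 1
  obtain ⟨γ₀, h₀, hm₀⟩ := key 0
  have le₁ : ∀ δ ∈ Gamma0 3, (toReal δ • τ : ℍ).im ≤ (toReal γ₁ • τ : ℍ).im := fun δ hδ => by
    rw [im_toReal_smul, im_toReal_smul]
    exact div_le_div_of_nonneg_left τ.im_pos.le (normSq_pos.2 (denom_ne_zero_int _ _)) (hm₁ δ hδ)
  have le₀ : ∀ δ ∈ Gamma0 3, ((W * toReal δ) • τ : ℍ).im ≤ ((W * toReal γ₀) • τ : ℍ).im :=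
    fun δ hδ => by
      rw [im_W_mul_smul, im_W_mul_smul]
      refine div_le_div_of_nonneg_left τ.im_pos.le ?_ ?_
      · exact mul_pos three_pos (normSq_pos.2 (num_ne_zero_int _ _))
      · linarith [hm₀ δ hδ]
  rcases le_total (toReal γ₁ • τ : ℍ).im ((W * toReal γ₀) • τ : ℍ).im with h | h
  · refine ⟨W * toReal γ₀, mul_mem W_mem (toReal_mem h₀), ?_⟩
    rintro _ ⟨δ, hδ, rfl | rfl⟩
    · exact (le₁ δ hδ).trans h
    · exact le₀ δ hδ
  · refine ⟨toReal γ₁, toReal_mem h₁, ?_⟩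
    rintro _ ⟨δ, hδ, rfl | rfl⟩
    · exact le₁ δ hδ
    · exact (le₀ δ hδ).trans h

/-- Every point is equivalent to one in the closed fundamental domain. -/
theorem exists_reduced (τ : ℍ) : ∃ γ ∈ Gamma0Plus, |((γ • τ : ℍ) : ℂ).re| ≤ 1 / 2 ∧
    1 / 3 ≤ normSq ((γ • τ : ℍ) : ℂ) := by
  obtain ⟨γ, hγ, hmax⟩ := exists_max_im_Gamma0Plus τ
  set n : ℤ := -round ((γ • τ : ℍ) : ℂ).re with hn
  have hcoe : (((toReal (transZ n) * γ) • τ : ℍ) : ℂ) = ((γ • τ : ℍ) : ℂ) + n := by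
    rw [mul_smul, coe_transZ_smul]
  have him : ((toReal (transZ n) * γ) • τ : ℍ).im = (γ • τ : ℍ).im := by
    rw [← UpperHalfPlane.coe_im, hcoe]; simp
  have hmem : toReal (transZ n) * γ ∈ Gamma0Plus := mul_mem (toReal_mem (transZ_mem n)) hγ
  refine ⟨_, hmem, ?_, ?_⟩
  · rw [hcoe, add_re, intCast_re, hn, Int.cast_neg, ← sub_eq_add_neg]
    exact abs_sub_round _
  -- W divides the height by 3|τ|², so maximality forces 3|τ|² ≥ 1.
  · have h := hmax _ (mul_mem W_mem hmem)
    rw [mul_smul, im_W_smul, him] at h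
    have hpos := (γ • τ : ℍ).im_pos
    have hns : 0 < normSq (((toReal (transZ n) * γ) • τ : ℍ) : ℂ) :=
      normSq_pos.2 (ne_zero_of_im_pos (UpperHalfPlane.im_pos _))
    rw [div_le_iff₀ (by linarith)] at h
    by_contra hlt
    push Not at hlt
    nlinarith

lemma exists_arcPt {τ : ℂ} (him : 0 < τ.im) (hn : normSq τ = 1 / 3) (h1 : -(1 / 2) ≤ τ.re)
    (h2 : τ.re ≤ 0) : ∃ θ ∈ Icc (Real.pi / 2) (5 * Real.pi / 6), τ = arcPt θ := by
  have hpi := Real.pi_pos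
  have hs : √3 * √3 = (3 : ℝ) := sqrt3_sq
  have hs0 : 0 < √3 := by positivity
  rw [normSq_apply] at hn
  have hle : (√3 * τ.re) ^ 2 ≤ 1 := by
    rw [mul_pow, sq √3, hs]; nlinarith
  have hb := abs_le.1 ((sq_le_one_iff_abs_le_one _).1 hle)
  have h5 : Real.cos (5 * Real.pi / 6) = -(√3 / 2) := by
    rw [show 5 * Real.pi / 6 = Real.pi - Real.pi / 6 by ring, Real.cos_pi_sub,
      Real.cos_pi_div_six]
  refine ⟨Real.arccos (√3 * τ.re), ⟨?_, ?_⟩, ?_⟩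
  · rw [← Real.arccos_zero]
    exact Real.arccos_le_arccos (by nlinarith)
  · rw [← Real.arccos_cos (x := 5 * Real.pi / 6) (by linarith) (by linarith), h5]
    exact Real.arccos_le_arccos (by nlinarith)
  · apply Complex.ext
    · rw [arcPt_re, Real.cos_arccos hb.1 hb.2]
      field_simp
    · rw [arcPt_im, Real.sin_arccos, eq_div_iff hs0.ne']
      symm
      rw [Real.sqrt_eq_iff_mul_self_eq (by nlinarith) (by positivity)]
      nlinarith

lemma hauptJ_smul {γ : SL(2, ℝ)} (hγ : γ ∈ Gamma0Plus) (τ : ℍ) :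
    hauptJ ((γ • τ : ℍ) : ℂ) = hauptJ (τ : ℂ) := by
  have := transform_Gamma0Plus (f := fun τ : ℍ => hauptJ τ) (κ := 0)
    (fun n τ => by simp only [coe_transZ_smul, hauptJ, hauptU_add_int])
    (fun τ => by simp only [coe_W_smul, hauptJ_fricke τ.im_pos, zpow_zero, one_mul]) hγ τ
  simpa using this

/-- u is a root of X² - 2cX + 1, whose roots lie on the unit circle when |c| ≤ 1. -/
lemma norm_eq_one_of_add_inv {u : ℂ} (hu : u ≠ 0) {c : ℝ} (hc : |c| ≤ 1)
    (h : u + u⁻¹ = ((2 * c : ℝ) : ℂ)) : ‖u‖ = 1 ∧ u.re = c := by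
  have h1 : u * u + 1 = ((2 * c : ℝ) : ℂ) * u := by
    field_simp at h
    linear_combination h
  have hre := congrArg re h1
  have him := congrArg im h1
  rw [re_ofReal_mul] at hre
  rw [im_ofReal_mul] at him
  simp only [add_re, add_im, mul_re, mul_im, one_re, one_im, add_zero] at hre him
  have hc' := abs_le.1 hc
  have hkey : u.re = c ∧ u.re ^ 2 + u.im ^ 2 = 1 := by
    have : u.im * (u.re - c) = 0 := by linarith
    rcases mul_eq_zero.1 this with h0 | h0
    · rw [h0] at hre
      have h2 : (u.re - c) ^ 2 = c ^ 2 - 1 := by linarith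
      have h3 : (u.re - c) ^ 2 = 0 := le_antisymm (by nlinarith) (sq_nonneg _)
      have h4 : u.re = c := by
        have := pow_eq_zero_iff (two_ne_zero) |>.1 h3
        linarith
      exact ⟨h4, by rw [h0, h4]; nlinarith⟩
    · have h4 : u.re = c := by linarith
      exact ⟨h4, by rw [← h4] at hre; linarith⟩
  refine ⟨?_, hkey.1⟩
  have : ‖u‖ ^ 2 = 1 := by rw [← normSq_eq_norm_sq, normSq_apply]; linarith [hkey.2]
  nlinarith [norm_nonneg u]

lemma norm_hauptU_of_hauptJ_eq {τ : ℂ} (him : 0 < τ.im) {θ : ℝ} (hθ : 0 < (arcPt θ).im)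
    (h : hauptJ τ = hauptJ (arcPt θ)) :
    ‖hauptU τ‖ = 1 ∧ (hauptU τ).re = (hauptU (arcPt θ)).re := by
  refine norm_eq_one_of_add_inv (hauptU_ne_zero him) ?_ ?_
  · rw [← norm_hauptU_eq_one hθ (normSq_arcPt θ)]
    exact abs_re_le_norm _
  · rw [hauptJ_arc hθ, hauptJ] at h
    push_cast at h ⊢
    linear_combination h / 27

/-- Two points of the closed fundamental domain, one of them on the arc, with the same `j`. -/
lemma eq_of_hauptJ_eq_of_reduced {τ : ℂ} (him : 0 < τ.im) (hre : |τ.re| ≤ 1 / 2)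
    (hn : 1 / 3 ≤ normSq τ) {θ : ℝ} (hθ : θ ∈ Icc (Real.pi / 2) (5 * Real.pi / 6))
    (h : hauptJ τ = hauptJ (arcPt θ)) : τ = arcPt θ ∨ τ = -conj (arcPt θ) := by
  have hθim := arcPt_im_pos hθ.1 hθ.2
  obtain ⟨h1, h2⟩ := norm_hauptU_of_hauptJ_eq him hθim h
  have hn3 : normSq τ = 1 / 3 := by
    rcases hn.lt_or_eq with h3 | h3
    · exact absurd h1 (one_lt_norm_hauptU him hre h3).ne'
    · exact h3.symm
  have hre' := abs_le.1 hre
  rcases le_total τ.re 0 with h0 | h0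
  · left
    obtain ⟨θ', hθ', rfl⟩ := exists_arcPt him hn3 hre'.1 h0
    rw [re_hauptU_strictAnti.injOn hθ' hθ h2]
  · right
    have him' : 0 < (-conj τ).im := by rwa [neg_conj_im]
    obtain ⟨θ', hθ', hτ⟩ := exists_arcPt him' (by rw [normSq_neg, normSq_conj, hn3])
      (by rw [neg_re, conj_re]; linarith) (by rw [neg_re, conj_re]; linarith)
    have h3 := hauptU_neg_conj him
    rw [hτ] at h3
    have h4 : θ' = θ := re_hauptU_strictAnti.injOn hθ' hθ (by rw [h3, conj_re, h2])
    rw [← h4, ← hτ]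
    simp

/-- Points at which `j` takes the value `j(z)`, `z` on the arc, are equivalent to `z`. -/
theorem exists_smul_of_hauptJ_eq (τ z : ℍ) {θ : ℝ}
    (hθ : θ ∈ Icc (Real.pi / 2) (5 * Real.pi / 6)) (hz : (z : ℂ) = arcPt θ)
    (h : hauptJ τ = hauptJ z) : ∃ γ ∈ Gamma0Plus, τ = γ • z := by
  obtain ⟨γ, hγ, h1, h2⟩ := exists_reduced τ
  have h3 : hauptJ ((γ • τ : ℍ) : ℂ) = hauptJ (arcPt θ) := by rw [hauptJ_smul hγ, h, hz]
  rcases eq_of_hauptJ_eq_of_reduced (γ • τ : ℍ).im_pos h1 h2 hθ h3 with h4 | h4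
  · refine ⟨γ⁻¹, inv_mem hγ, ?_⟩
    rw [eq_inv_smul_iff]
    apply UpperHalfPlane.ext
    rw [h4, hz]
  · refine ⟨γ⁻¹ * W, mul_mem (inv_mem hγ) W_mem, ?_⟩
    rw [mul_smul, eq_inv_smul_iff]
    apply UpperHalfPlane.ext
    rw [h4, coe_W_smul, hz, fricke_eq_neg_conj (normSq_arcPt θ)]

/-- Far from the elliptic point of order six, `j` takes the value `j(z)` above height `2/5` only at
`z` and its mirror image. -/
theorem nome_eq_of_hauptJ_eq_of_le_im {τ : ℂ} (him : 2 / 5 ≤ τ.im) {θ : ℝ}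
    (hθ : θ ∈ Icc (Real.pi / 2) (5 * Real.pi / 6)) (h : hauptJ τ = hauptJ (arcPt θ)) :
    nome τ = nome (arcPt θ) ∨ nome τ = nome (-conj (arcPt θ)) := by
  obtain ⟨t, ht, htre, htn⟩ := exists_nome_eq (nome_ne_zero τ)
    (norm_nome_lt_one (show 0 < τ.im by linarith))
  obtain ⟨n, hn⟩ := nome_eq_iff.1 htn
  have him' : t.im = τ.im := by rw [hn]; simp
  have hj : hauptJ t = hauptJ (arcPt θ) := by
    rw [← h, hauptJ, hauptJ, hauptU, hauptU, htn]
  have hθim := arcPt_im_pos hθ.1 hθ.2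
  -- Suppose t lies inside the circle. At height at least 2/5 its image under W is again in the
  -- strip and lies outside the circle, so |u(Wt)| > 1, whereas |u(t)| = 1.
  have hnorm : 1 / 3 ≤ normSq t := by
    by_contra hlt
    push Not at hlt
    have hns : 0 < normSq t := normSq_pos.2 (ne_zero_of_im_pos ht)
    have h1 : 1 < ‖hauptU (fricke t)‖ := by
      refine one_lt_norm_hauptU (fricke_im_pos ht) ?_ ?_
      · have : (fricke t).re = -t.re / (3 * normSq t) := by
          rw [fricke, div_re, normSq_mul]
          simp only [neg_re, one_re, neg_im, one_im, mul_re, mul_im, normSq_ofNat]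
          norm_num
          field_simp
          ring
        rw [this, abs_div, abs_neg, abs_of_pos (by linarith : 0 < 3 * normSq t),
          div_le_iff₀ (by linarith)]
        rw [normSq_apply]
        rcases abs_cases t.re with h | h <;> nlinarith [sq_nonneg (t.re - 1/3), sq_nonneg (t.re + 1/3)]
      · have : normSq (fricke t) = 1 / (9 * normSq t) := by
          rw [fricke, normSq_div, normSq_neg, normSq_mul, normSq_one, normSq_ofNat]; norm_num
        rw [this, lt_div_iff₀ (by linarith)]
        linarith
    rw [hauptU_fricke ht, norm_inv, (norm_hauptU_of_hauptJ_eq ht hθim hj).1] at h1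
    norm_num at h1
  rw [← htn]
  rcases eq_of_hauptJ_eq_of_reduced ht htre hnorm hθ hj with h1 | h1
  · exact Or.inl (by rw [h1])
  · exact Or.inr (by rw [h1])

/-- For x ≤ -1/5 a negative ab makes the form at least 1 + 6/5 + 3 > 5. For ab ≥ 0 the worst case x
= -1/2 is the definite form a² - 3ab + 3b², which leaves finitely many rows. The determinant
discards the non-primitive rows and those with 3 ∣ a. -/
lemma row_cases {a b r s : ℤ} (hdet : a * r - 3 * (b * s) = 1) {x : ℝ} (h1 : -(1 / 2) ≤ x)
    (h2 : x ≤ -(1 / 5)) (hQ : (a : ℝ) ^ 2 + 6 * a * b * x + 3 * b ^ 2 < 5) :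
    (a = 1 ∧ b = 0) ∨ (a = -1 ∧ b = 0) ∨ (a = 1 ∧ b = 1) ∨ (a = -1 ∧ b = -1) ∨
      (a = 2 ∧ b = 1) ∨ (a = -2 ∧ b = -1) := by
  have hab : 0 ≤ a * b := by
    by_contra hneg
    push Not at hneg
    have ha0 : a ≠ 0 := by rintro rfl; simp at hneg
    have hb0 : b ≠ 0 := by rintro rfl; simp at hneg
    have ha1 : 1 ≤ a ^ 2 := Int.add_one_le_of_lt (by positivity : 0 < a ^ 2)
    have hb1 : 1 ≤ b ^ 2 := Int.add_one_le_of_lt (by positivity : 0 < b ^ 2)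
    have hab1 : a * b ≤ -1 := by omega
    have ha1' : (1 : ℝ) ≤ (a : ℝ) ^ 2 := by exact_mod_cast ha1
    have hb1' : (1 : ℝ) ≤ (b : ℝ) ^ 2 := by exact_mod_cast hb1
    have hab1' : (a : ℝ) * b ≤ -1 := by exact_mod_cast hab1
    nlinarith
  have hab' : (0 : ℝ) ≤ (a : ℝ) * b := by exact_mod_cast hab
  have h3 : (a : ℝ) ^ 2 - 3 * (a * b) + 3 * b ^ 2 < 5 := by nlinarith
  have h4 : a ^ 2 - 3 * (a * b) + 3 * b ^ 2 < 5 := by exact_mod_cast h3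
  have hb : b ^ 2 ≤ 6 := by nlinarith [sq_nonneg (2 * a - 3 * b)]
  have hb1 : -2 ≤ b := by nlinarith
  have hb2 : b ≤ 2 := by nlinarith
  have ha1 : -5 ≤ a := by nlinarith
  have ha2 : a ≤ 5 := by nlinarith
  interval_cases b <;> interval_cases a <;> omega

/-- The point `z/(3z+1)`. -/
def pole₁ (z : ℂ) : ℂ := z / (3 * z + 1)

/-- The point `-(z+1)/(3z+2)`. -/
def pole₂ (z : ℂ) : ℂ := -(z + 1) / (3 * z + 2)

lemma three_mul_add_ne_zero {z : ℂ} (hz : 0 < z.im) (a : ℝ) : 3 * z + a ≠ 0 := by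
  intro h
  have := congrArg im h
  simp at this
  linarith

lemma two_mul_add_ne_zero {z : ℂ} (hz : 0 < z.im) : 2 * z + 1 ≠ 0 := by
  intro h
  have := congrArg im h
  simp at this
  linarith

lemma add_one_ne_zero' {z : ℂ} (hz : 0 < z.im) : z + 1 ≠ 0 := by
  intro h
  have := congrArg im h
  simp at this
  linarith

lemma conj_eq_of_arc {z : ℂ} (hn : normSq z = 1 / 3) : conj z = 1 / (3 * z) := by
  have h0 : z ≠ 0 := by rintro rfl; simp at hn
  have := mul_conj z
  rw [hn] at this
  push_cast at this
  field_simp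
  linear_combination 3 * this

lemma neg_conj_pole₁ {z : ℂ} (hz : 0 < z.im) (hn : normSq z = 1 / 3) :
    -conj (pole₁ z) = -1 / (3 * (z + 1)) := by
  have h0 := ne_zero_of_im_pos hz
  have h1 := add_one_ne_zero' hz
  rw [pole₁, map_div₀, map_add, map_mul, conj_eq_of_arc hn, map_ofNat, map_one]
  have h2 : 1 / z + 1 ≠ 0 := by
    rw [div_add_one h0]
    exact div_ne_zero (by rwa [add_comm]) h0
  have h3 : 3 * (1 / (3 * z)) + 1 = 1 / z + 1 := by field_simp
  rw [h3, neg_div, neg_inj, div_eq_div_iff h2 (mul_ne_zero three_ne_zero h1)]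
  field_simp
  ring

lemma neg_conj_pole₂ {z : ℂ} (hz : 0 < z.im) (hn : normSq z = 1 / 3) :
    -conj (pole₂ z) = (3 * z + 1) / (3 * (2 * z + 1)) := by
  have h0 := ne_zero_of_im_pos hz
  have h1 := two_mul_add_ne_zero hz
  rw [pole₂, map_div₀, map_neg, map_add, map_add, map_mul, conj_eq_of_arc hn, map_ofNat, map_one,
    map_ofNat]
  have h2 : 1 / z + 2 ≠ 0 := by
    have : 1 / z + 2 = (2 * z + 1) / z := by field_simp; ring
    rw [this]
    exact div_ne_zero h1 h0
  have h3 : 3 * (1 / (3 * z)) + 2 = 1 / z + 2 := by field_simp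
  rw [h3, neg_div, neg_neg, div_eq_div_iff h2 (mul_ne_zero three_ne_zero h1)]
  field_simp
  ring

lemma normSq_row {z : ℂ} (hn : normSq z = 1 / 3) (a b : ℝ) :
    normSq ((a : ℂ) * z + b) = a ^ 2 / 3 + 2 * a * b * z.re + b ^ 2 := by
  rw [normSq_apply] at hn
  rw [normSq_apply, add_re, add_im, re_ofReal_mul, im_ofReal_mul, ofReal_re, ofReal_im]
  linear_combination a ^ 2 * hn

/-- Near the elliptic point of order six, `j` takes the value `j(z)` above height `1/9` only at six
points modulo translations. -/
theorem nome_mem_of_hauptJ_eq {τ : ℂ} (him : 1 / 9 ≤ τ.im) {θ : ℝ}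
    (hθ : θ ∈ Icc (Real.pi / 2) (5 * Real.pi / 6)) (hx : (arcPt θ).re ≤ -(1 / 5))
    (h : hauptJ τ = hauptJ (arcPt θ)) :
    ∃ p ∈ ({arcPt θ, pole₁ (arcPt θ), pole₂ (arcPt θ)} : Set ℂ),
      nome τ = nome p ∨ nome τ = nome (-conj p) := by
  have hzim := arcPt_im_pos hθ.1 hθ.2
  have hn := normSq_arcPt θ
  have hx1 := neg_half_le_arcPt_re hθ.1 hθ.2
  have hτ : 0 < τ.im := by linarith
  obtain ⟨z, hz⟩ : ∃ z, z = arcPt θ := ⟨_, rfl⟩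
  rw [← hz] at hzim hn hx1 hx h ⊢
  obtain ⟨γ, hγ, hγτ⟩ := exists_smul_of_hauptJ_eq ⟨τ, hτ⟩ ⟨z, hzim⟩ hθ hz h
  -- With y² ≤ 1/3 - 1/25, a height of at least 1/9 for y/Q means Q < 5, the bound required by
  -- `row_cases`.
  have hy : 9 * z.im < 5 := by
    rw [normSq_apply] at hn
    nlinarith
  have hcoe := congrArg UpperHalfPlane.coe hγτ
  have himeq := congrArg UpperHalfPlane.im hγτ
  have hz0 := ne_zero_of_im_pos hzim
  have hz1 : 3 * z + 1 ≠ 0 := by simpa using three_mul_add_ne_zero hzim 1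
  have hz2 : 3 * z + 2 ≠ 0 := by simpa using three_mul_add_ne_zero hzim 2
  have hz3 := two_mul_add_ne_zero hzim
  have hz4 := add_one_ne_zero' hzim
  have bound : ∀ Q : ℝ, 0 < Q → τ.im = z.im / Q → Q < 5 := by
    intro Q hQ he
    rw [he, le_div_iff₀ hQ] at him
    linarith
  -- Both cosets lead to the same quadratic form: |3cz + d|² = d² + 6cdx + 3c² on Γ₀(3), and 3|az +
  -- b|² = a² + 6abx + 3b² on the W-coset. The W-coset produces the mirror images.
  obtain ⟨δ, hδ, rfl | rfl⟩ := hγ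
  · obtain ⟨c, hc⟩ := mem_Gamma0_three.1 hδ
    have hdet := det_int δ
    have hd := denom_ne_zero_int δ ⟨z, hzim⟩
    rw [im_toReal_smul] at himeq
    have hQ := bound _ (normSq_pos.2 hd) himeq
    rw [coe_toReal_smul] at hcoe
    rw [hc] at hQ hcoe hdet
    have e1 : (((3 * c : ℤ) : ℂ)) = (((3 * c : ℤ) : ℝ) : ℂ) := by push_cast; rfl
    have e2 : ((δ 1 1 : ℤ) : ℂ) = (((δ 1 1 : ℤ) : ℝ) : ℂ) := by push_cast; rfl
    rw [e1, e2] at hQ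
    simp only at hQ hcoe
    rw [normSq_row hn] at hQ
    push_cast at hQ hcoe
    rcases row_cases (a := δ 1 1) (b := c) (r := δ 0 0) (s := δ 0 1) (by linarith) hx1 hx
      (by linarith) with ⟨h1, h2⟩ | ⟨h1, h2⟩ | ⟨h1, h2⟩ | ⟨h1, h2⟩ | ⟨h1, h2⟩ | ⟨h1, h2⟩ <;>
      rw [h1, h2] at hcoe hdet
    · refine ⟨z, by simp, Or.inl (nome_eq_iff.2 ⟨δ 0 1, ?_⟩)⟩
      have : δ 0 0 = 1 := by linarith
      rw [hcoe, this]
      simp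
    · refine ⟨z, by simp, Or.inl (nome_eq_iff.2 ⟨-δ 0 1, ?_⟩)⟩
      have : δ 0 0 = -1 := by linarith
      rw [hcoe, this]
      simp
      ring
    · refine ⟨pole₁ z, by simp, Or.inl (nome_eq_iff.2 ⟨δ 0 1, ?_⟩)⟩
      have : δ 0 0 = 1 + 3 * δ 0 1 := by linarith
      rw [hcoe, this, pole₁]
      push_cast
      field_simp
      ring
    · refine ⟨pole₁ z, by simp, Or.inl (nome_eq_iff.2 ⟨-δ 0 1, ?_⟩)⟩
      have : δ 0 0 = -1 + 3 * δ 0 1 := by linarith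
      rw [hcoe, this, pole₁, show (3 * ((-1 : ℤ) : ℂ) * z + ((-1 : ℤ) : ℂ)) = -(3 * z + 1) by
        push_cast; ring]
      push_cast
      field_simp
      ring
    · refine ⟨pole₂ z, by simp, Or.inl (nome_eq_iff.2 ⟨δ 0 0 - δ 0 1, ?_⟩)⟩
      obtain ⟨n, hn0⟩ : ∃ n, n = δ 0 0 - δ 0 1 := ⟨_, rfl⟩
      have t1 : δ 0 0 = -1 + 3 * n := by omega
      have t2 : δ 0 1 = -1 + 2 * n := by omega
      rw [hcoe, ← hn0, t1, t2, pole₂]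
      push_cast
      rw [mul_one]
      field_simp
      ring
    · refine ⟨pole₂ z, by simp, Or.inl (nome_eq_iff.2 ⟨-(δ 0 0 - δ 0 1), ?_⟩)⟩
      obtain ⟨n, hn0⟩ : ∃ n, n = -(δ 0 0 - δ 0 1) := ⟨_, rfl⟩
      have t1 : δ 0 0 = 1 - 3 * n := by omega
      have t2 : δ 0 1 = 1 - 2 * n := by omega
      rw [hcoe, ← hn0, t1, t2, pole₂, show (3 * ((-1 : ℤ) : ℂ) * z + ((-2 : ℤ) : ℂ)) =
        -(3 * z + 2) by push_cast; ring]
      push_cast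
      field_simp
      ring
  · obtain ⟨c, hc⟩ := mem_Gamma0_three.1 hδ
    have hdet := det_int δ
    have hd := num_ne_zero_int δ ⟨z, hzim⟩
    have hd' := denom_ne_zero_int δ ⟨z, hzim⟩
    rw [im_W_mul_smul] at himeq
    have hQ := bound _ (mul_pos three_pos (normSq_pos.2 hd)) himeq
    rw [mul_smul, coe_W_smul, coe_toReal_smul, fricke] at hcoe
    rw [hc] at hcoe hdet hd'
    have e1 : ((δ 0 0 : ℤ) : ℂ) = (((δ 0 0 : ℤ) : ℝ) : ℂ) := by push_cast; rfl
    have e2 : ((δ 0 1 : ℤ) : ℂ) = (((δ 0 1 : ℤ) : ℝ) : ℂ) := by push_cast; rfl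
    rw [e1, e2] at hQ
    simp only at hQ hcoe hd hd'
    rw [normSq_row hn] at hQ
    push_cast at hcoe hd'
    have hcoe' : τ = -(3 * c * z + δ 1 1) / (3 * (δ 0 0 * z + δ 0 1)) := by
      rw [hcoe]
      field_simp
    clear hcoe
    have key : ∀ p : ℂ, p ∈ ({z, pole₁ z, pole₂ z} : Set ℂ) → (∃ n : ℤ, τ = -conj p + n) →
        ∃ p ∈ ({z, pole₁ z, pole₂ z} : Set ℂ), nome τ = nome p ∨ nome τ = nome (-conj p) :=
      fun p hp hn => ⟨p, hp, Or.inr (nome_eq_iff.2 hn)⟩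
    rcases row_cases (a := δ 0 0) (b := δ 0 1) (r := δ 1 1) (s := c) (by linarith) hx1 hx
      (by linarith) with ⟨h1, h2⟩ | ⟨h1, h2⟩ | ⟨h1, h2⟩ | ⟨h1, h2⟩ | ⟨h1, h2⟩ | ⟨h1, h2⟩ <;>
      rw [h1, h2] at hcoe' hdet
    · refine key z (by simp) ⟨-c, ?_⟩
      have : δ 1 1 = 1 := by linarith
      rw [hcoe', this, conj_eq_of_arc hn]
      push_cast
      rw [one_mul, add_zero]
      field_simp
      ring
    · refine key z (by simp) ⟨c, ?_⟩
      have : δ 1 1 = -1 := by linarith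
      rw [hcoe', this, conj_eq_of_arc hn]
      push_cast
      rw [neg_one_mul, add_zero]
      field_simp
      ring
    · refine key (pole₁ z) (by simp) ⟨-c, ?_⟩
      have : δ 1 1 = 1 + 3 * c := by linarith
      rw [hcoe', this, neg_conj_pole₁ hzim hn]
      push_cast
      rw [one_mul]
      field_simp
      ring
    · refine key (pole₁ z) (by simp) ⟨c, ?_⟩
      have : δ 1 1 = -1 + 3 * c := by linarith
      rw [hcoe', this, neg_conj_pole₁ hzim hn, show (((-1 : ℤ) : ℂ) * z + ((-1 : ℤ) : ℂ)) =
        -(z + 1) by push_cast; ring]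
      push_cast
      field_simp
      ring
    · refine key (pole₂ z) (by simp) ⟨c - δ 1 1, ?_⟩
      obtain ⟨n, hn0⟩ : ∃ n, n = c - δ 1 1 := ⟨_, rfl⟩
      have t1 : c = -1 - 2 * n := by omega
      have t2 : δ 1 1 = -1 - 3 * n := by omega
      rw [hcoe', ← hn0, t1, t2, neg_conj_pole₂ hzim hn]
      push_cast
      field_simp
      ring
    · refine key (pole₂ z) (by simp) ⟨-(c - δ 1 1), ?_⟩
      obtain ⟨n, hn0⟩ : ∃ n, n = -(c - δ 1 1) := ⟨_, rfl⟩
      have t1 : c = 1 + 2 * n := by omega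
      have t2 : δ 1 1 = 1 + 3 * n := by omega
      rw [hcoe', ← hn0, t1, t2, neg_conj_pole₂ hzim hn, show (((-2 : ℤ) : ℂ) * z + ((-1 : ℤ) : ℂ)) =
        -(2 * z + 1) by push_cast; ring]
      push_cast
      field_simp
      ring

end Fricke3

end

/-! ### Seeds, dual pairs, uniqueness, and the Faber polynomials. -/

noncomputable section
namespace Fricke3
open Complex Metric Set Filter Topology ComplexConjugate
open scoped UpperHalfPlane

/-- The pairs of holomorphic forms `A`, `A'` of weights `2ρ`, `8 - 2ρ` with `A A' = e δ`, indexed by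
`ρ` and by the dimension `ε` of the space of cusp forms of weight `2ρ + 6ε`. -/
inductive IsSeed : ℤ → ℤ → (ℂ → ℂ) → (ℂ → ℂ) → Prop
  | one : IsSeed 0 0 (fun _ => 1) fun w => eisQ w * oddQ w
  | sq : IsSeed 2 0 (fun w => eisQ w * eisQ w) thetaQ
  | odd : IsSeed 3 0 oddQ eisQ
  | eis : IsSeed 1 1 eisQ oddQ
  | theta : IsSeed 2 1 thetaQ fun w => eisQ w * eisQ w
  | prod : IsSeed 4 1 (fun w => eisQ w * oddQ w) fun _ => 1

namespace IsSeed

variable {ρ ε : ℤ} {A A' : ℂ → ℂ}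

lemma qform (h : IsSeed ρ ε A A') : QForm ρ ((-1) ^ ε) 0 A := by
  cases h with
  | one => exact QForm.one.of_eq rfl (by norm_num) rfl
  | sq => exact (qform_eisQ.mul qform_eisQ).of_eq (by norm_num) (by norm_num) (by norm_num)
  | odd => exact qform_oddQ.of_eq rfl (by norm_num) rfl
  | eis => exact qform_eisQ.of_eq rfl (by norm_num) rfl
  | theta => exact qform_thetaQ.of_eq rfl (by norm_num) rfl
  | prod => exact (qform_eisQ.mul qform_oddQ).of_eq (by norm_num) (by norm_num) (by norm_num)

lemma qform' (h : IsSeed ρ ε A A') : QForm (4 - ρ) ((-1) ^ (ε + 1)) 0 A' := by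
  cases h with
  | one => exact (qform_eisQ.mul qform_oddQ).of_eq (by norm_num) (by norm_num) (by norm_num)
  | sq => exact qform_thetaQ.of_eq (by norm_num) (by norm_num) (by norm_num)
  | odd => exact qform_eisQ.of_eq (by norm_num) (by norm_num) rfl
  | eis => exact qform_oddQ.of_eq (by norm_num) (by norm_num) rfl
  | theta => exact (qform_eisQ.mul qform_eisQ).of_eq (by norm_num) (by norm_num) (by norm_num)
  | prod => exact QForm.one.of_eq (by norm_num) (by norm_num) rfl

lemma zero (h : IsSeed ρ ε A A') : A 0 = 1 := by
  cases h <;> simp [eisQ_zero, oddQ_zero, thetaQ_zero]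

lemma zero' (h : IsSeed ρ ε A A') : A' 0 = 1 := by
  cases h <;> simp [eisQ_zero, oddQ_zero, thetaQ_zero]

lemma mul_eq (h : IsSeed ρ ε A A') {w : ℂ} (hw : w ∈ ball (0 : ℂ) 1) :
    A w * A' w = eisQ w * oddQ w := by
  have := eisQ_mul_thetaQ hw
  cases h <;> first | ring1 | (rw [← this]; ring1)

end IsSeed

/-- For r = 8, 10, 14 the seed has weight r - 6 and sign -1. One extra factor B, of weight 6 and
sign -1, restores the sign and makes the product a cusp form. -/
lemma exists_isSeed {r : ℤ} (hr : r ∈ ({0, 4, 6, 8, 10, 14} : Set ℤ)) :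
    ∃ ρ ε A A', IsSeed ρ ε A A' ∧ r = 2 * ρ + 6 * ε := by
  simp only [mem_insert_iff, mem_singleton_iff] at hr
  rcases hr with rfl | rfl | rfl | rfl | rfl | rfl
  · exact ⟨_, _, _, _, IsSeed.one, by norm_num⟩
  · exact ⟨_, _, _, _, IsSeed.sq, by norm_num⟩
  · exact ⟨_, _, _, _, IsSeed.odd, by norm_num⟩
  · exact ⟨_, _, _, _, IsSeed.eis, by norm_num⟩
  · exact ⟨_, _, _, _, IsSeed.theta, by norm_num⟩
  · exact ⟨_, _, _, _, IsSeed.prod, by norm_num⟩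

/-- `f = q^E φ₁(q)` of weight `2κ` and `f' = q^{-E-1} φ₂(q)` of weight `2 - 2κ` with
`f f' = -q dj/dq`. -/
structure DualPair (κ E : ℤ) (φ₁ φ₂ : ℂ → ℂ) : Prop where
  qform₁ : QForm κ 1 E φ₁
  qform₂ : QForm (1 - κ) 1 (-E - 1) φ₂
  zero₁ : φ₁ 0 = 1
  zero₂ : φ₂ 0 = 1
  mul_eq : ∀ w ∈ ball (0 : ℂ) 1, φ₁ w * φ₂ w = hauptQ w - w * deriv hauptQ w

/-- The powers of B multiply to B⁻¹ and A A' = e δ, so the product is e δ/B, which is -q dj/dq. The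
parity of ε is chosen so that both forms have sign +1. -/
lemma IsSeed.dualPair {ρ ε : ℤ} {A A' : ℂ → ℂ} (h : IsSeed ρ ε A A') (ℓ : ℤ) :
    DualPair (6 * ℓ + 3 * ε + ρ) (2 * ℓ + ε) (fun w => betaQ w ^ (2 * ℓ + ε) * A w)
      (fun w => betaQ w ^ (-(2 * ℓ + ε) - 1) * A' w) where
  qform₁ := by
    refine ((qform_betaQ.zpow (fun w hw => betaQ_ne_zero hw) (2 * ℓ + ε)).mul h.qform).of_eq
      (by ring) ?_ (by ring)
    rw [← zpow_add₀ (by norm_num), show 2 * ℓ + ε + ε = 2 * (ℓ + ε) by ring, zpow_mul]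
    norm_num
  qform₂ := by
    refine ((qform_betaQ.zpow (fun w hw => betaQ_ne_zero hw) (-(2 * ℓ + ε) - 1)).mul
      h.qform').of_eq (by ring) ?_ (by ring)
    rw [← zpow_add₀ (by norm_num), show -(2 * ℓ + ε) - 1 + (ε + 1) = 2 * (-ℓ) by ring, zpow_mul]
    norm_num
  zero₁ := by simp [betaQ_zero, h.zero]
  zero₂ := by simp [betaQ_zero, h.zero']
  mul_eq := fun w hw => by
    have h0 := betaQ_ne_zero hw
    have h1 : betaQ w ^ (2 * ℓ + ε) * betaQ w ^ (-(2 * ℓ + ε) - 1) = (betaQ w)⁻¹ := by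
      rw [← zpow_add₀ h0, show 2 * ℓ + ε + (-(2 * ℓ + ε) - 1) = -1 by ring, zpow_neg_one]
    rw [hauptQ_sub_deriv hw]
    calc betaQ w ^ (2 * ℓ + ε) * A w * (betaQ w ^ (-(2 * ℓ + ε) - 1) * A' w)
        = (betaQ w)⁻¹ * (A w * A' w) := by rw [← h1]; ring
      _ = _ := by
        rw [h.mul_eq hw, oddQ]
        field_simp

namespace DualPair

variable {κ E : ℤ} {φ₁ φ₂ : ℂ → ℂ}

/-- Multiplication by the dual form, of order -E - 1 and complementary weight, gives a weight two
form holomorphic at the cusp. -/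
lemma eq_zero (h : DualPair κ E φ₁ φ₂) {f : ℍ → ℂ} (hf : f ∈ weaklyHolomorphic (2 * κ))
    {a : ℤ → ℂ} (ha : HasQExpansion f a) (hn : ∀ i < E + 1, a i = 0) : f = 0 := by
  obtain ⟨g, hg, hfg, hgW⟩ := exists_qf_of_mem hf ha hn
  have key : ∀ τ : ℂ, qf (E + 1) g τ * qf (-E - 1) φ₂ τ = g (nome τ) * φ₂ (nome τ) := by
    intro τ
    rw [← qf_mul, qf, show E + 1 + (-E - 1) = 0 by ring, zpow_zero, one_mul]
  have h0 : ∀ w ∈ ball (0 : ℂ) 1, g w * φ₂ w = 0 := by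
    refine weight_two_eq_zero (G := fun w => g w * φ₂ w) (hg.mul h.qform₂.diff) fun τ hτ => ?_
    rw [← key, ← key, hgW τ hτ, h.qform₂.trans τ hτ, one_mul, zpow_sub₀ (three_sq_ne_zero hτ),
      zpow_one]
    have := zpow_ne_zero κ (three_sq_ne_zero hτ)
    field_simp
  have h1 := eq_zero_of_mul_eq_zero hg h.qform₂.diff (by rw [h.zero₂]; exact one_ne_zero) h0
  funext τ
  rw [hfg, qf, h1 _ (nome_mem_ball τ.im_pos), mul_zero, Pi.zero_apply]

lemma cuspForms_eq_bot (h : DualPair κ 0 φ₁ φ₂) : cuspForms (2 * κ) = ⊥ := by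
  rw [eq_bot_iff]
  rintro f ⟨hf, a, ha, ha0⟩
  exact h.eq_zero hf ha (by simpa using ha0)

/-- Subtracting the right multiple of the cusp form q φ₁ raises the order to 2, where the vanishing
lemma with E = 1 applies. -/
lemma finrank_cuspForms (h : DualPair κ 1 φ₁ φ₂) : Module.finrank ℂ (cuspForms (2 * κ)) = 1 := by
  obtain ⟨b, hb, hb0⟩ := exists_hasQExpansion h.qform₁.diff 1
  set v : cuspForms (2 * κ) := ⟨fun τ : ℍ => qf 1 φ₁ τ, h.qform₁.mem_weaklyHolomorphic, b, hb, hb0⟩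
    with hv
  refine (finrank_eq_one_iff_of_nonzero' v ?_).2 ?_
  · intro h0
    have h1 : ∀ τ : ℍ, qf 1 φ₁ τ = 0 := fun τ => congrFun (congrArg Subtype.val h0) τ
    have h2 : ∀ w ∈ ball (0 : ℂ) 1, φ₁ w * w = 0 := by
      intro w hw
      by_cases hw0 : w = 0
      · rw [hw0, mul_zero]
      obtain ⟨τ, hτ, -, rfl⟩ := exists_nome_eq hw0 (mem_ball_zero_iff.1 hw)
      have := h1 ⟨τ, hτ⟩
      rw [qf, zpow_one] at this
      rw [mul_comm]
      exact this
    have hc : ContinuousAt φ₁ 0 := (h.qform₁.toDiscReal.differentiableAt (by simp)).continuousAt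
    have h3 : ∀ᶠ w in 𝓝[≠] (0 : ℂ), φ₁ w = 0 := by
      filter_upwards [self_mem_nhdsWithin, nhdsWithin_le_nhds (ball_mem_nhds (0 : ℂ) one_pos)]
        with w hw hw'
      exact (mul_eq_zero.1 (h2 w hw')).resolve_right hw
    have h4 := tendsto_nhds_unique ((hc.tendsto.mono_left nhdsWithin_le_nhds).congr' h3)
      tendsto_const_nhds
    rw [h.zero₁] at h4
    exact one_ne_zero h4
  · rintro ⟨f, hf, a, ha, ha0⟩
    obtain ⟨g, hg, hfg, -⟩ := exists_qf_of_mem hf ha ha0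
    refine ⟨g 0, ?_⟩
    apply Subtype.ext
    change (g 0) • (fun τ : ℍ => qf 1 φ₁ τ) = f
    have hd : f - (g 0) • (fun τ : ℍ => qf 1 φ₁ τ) ∈ weaklyHolomorphic (2 * κ) :=
      sub_mem hf (Submodule.smul_mem _ _ h.qform₁.mem_weaklyHolomorphic)
    have hdiff : DifferentiableOn ℂ (fun w => g w - g 0 * φ₁ w) (ball 0 1) :=
      hg.sub (h.qform₁.diff.const_mul _)
    obtain ⟨c, hc, hc0⟩ := exists_hasQExpansion
      ((differentiableOn_dslope (ball_mem_nhds (0 : ℂ) one_pos)).2 hdiff) (1 + 1)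
    have heq : (fun τ : ℍ => qf (1 + 1) (dslope (fun w => g w - g 0 * φ₁ w) 0) τ) =
        f - (g 0) • (fun τ : ℍ => qf 1 φ₁ τ) := by
      funext τ
      have e := eq_mul_dslope (f := fun w => g w - g 0 * φ₁ w) (by simp [h.zero₁]) (nome τ)
      rw [Pi.sub_apply, Pi.smul_apply, hfg, qf, qf, qf, zpow_add₀ (nome_ne_zero _), zpow_one,
        smul_eq_mul]
      linear_combination (-nome τ) * e
    rw [heq] at hc
    exact (sub_eq_zero.1 (h.eq_zero hd hc hc0)).symm

end DualPair

/-- The dual pair with ℓ = 0 has weight r and order ε, so it determines the space of cusp forms of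
weight r. -/
lemma eps_eq {ρ ε r : ℤ} {A A' : ℂ → ℂ} (h : IsSeed ρ ε A A') (hr : r = 2 * ρ + 6 * ε) :
    (eps r : ℤ) = ε := by
  have hd := h.dualPair 0
  have e : r = 2 * (6 * 0 + 3 * ε + ρ) := by rw [hr]; ring
  have h01 : ε = 0 ∨ ε = 1 := by cases h <;> simp
  rw [eps, e]
  rcases h01 with rfl | rfl
  · rw [hd.cuspForms_eq_bot]; simp
  · rw [hd.finrank_cuspForms]; simp

lemma DiscReal.zero_real {g : ℂ → ℂ} (hg : DiscReal g) : ∃ c : ℝ, g 0 = c := by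
  have h := hg.real 0 (mem_ball_self one_pos)
  rw [map_zero] at h
  obtain ⟨c, hc⟩ := conj_eq_iff_real.1 h.symm
  exact ⟨c, hc⟩

/-- The Faber polynomial: a real monic `P` of degree `N` with `w^N P(ι/w) φ = 1 + O(w^{N+1})`. -/
lemma exists_faber {φ : ℂ → ℂ} (hφ : DiscReal φ) (h0 : φ 0 = 1) (N : ℕ) :
    ∃ P : Polynomial ℝ, P.Monic ∧ P.natDegree = N ∧ ∃ h : ℂ → ℂ, DiscReal h ∧
      ∀ w ∈ ball (0 : ℂ) 1, w ≠ 0 →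
        w ^ N * Polynomial.aeval (hauptQ w / w) P * φ w = 1 + w ^ (N + 1) * h w := by
  have key : ∀ k ≤ N, ∃ P : Polynomial ℝ, P.Monic ∧ P.natDegree = N ∧ ∃ h : ℂ → ℂ, DiscReal h ∧
      ∀ w ∈ ball (0 : ℂ) 1, w ≠ 0 →
        w ^ N * Polynomial.aeval (hauptQ w / w) P * φ w = 1 + w ^ (k + 1) * h w := by
    intro k
    induction k with
    | zero =>
      intro _
      have hd : DiscReal fun w => hauptQ w ^ N * φ w - 1 :=
        ((discReal_hauptQ.pow N).mul hφ).sub DiscReal.one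
      refine ⟨Polynomial.X ^ N, Polynomial.monic_X_pow N, Polynomial.natDegree_X_pow N, _,
        hd.dslope, fun w _ hw0 => ?_⟩
      have e := eq_mul_dslope (f := fun w => hauptQ w ^ N * φ w - 1)
        (by simp [hauptQ_zero, h0]) w
      rw [zero_add, pow_one, ← e, map_pow, Polynomial.aeval_X, div_pow]
      field_simp
      ring
    | succ k ih =>
      intro hk
      obtain ⟨P, hP, hdeg, h, hh, heq⟩ := ih (by omega)
      -- The leading error coefficient is real, since all functions involved are real on the real
      -- axis. Subtracting `c` times the power N - 1 - k of j removes it; the natural subtraction is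
      -- exact because k + 1 ≤ N.
      obtain ⟨c, hc⟩ := hh.zero_real
      have hd : DiscReal fun w => h w - (c : ℂ) * (hauptQ w ^ (N - 1 - k) * φ w) :=
        hh.sub ((DiscReal.const c).mul ((discReal_hauptQ.pow _).mul hφ))
      have hlt : (-(Polynomial.C c * Polynomial.X ^ (N - 1 - k)) : Polynomial ℝ).degree <
          P.degree := by
        rw [Polynomial.degree_neg, Polynomial.degree_eq_natDegree hP.ne_zero, hdeg]
        exact (Polynomial.degree_C_mul_X_pow_le _ _).trans_lt (by exact_mod_cast (by omega))
      refine ⟨P + -(Polynomial.C c * Polynomial.X ^ (N - 1 - k)), hP.add_of_left hlt, ?_, _,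
        hd.dslope, fun w hw hw0 => ?_⟩
      · rw [Polynomial.natDegree_add_eq_left_of_degree_lt hlt, hdeg]
      · have e := eq_mul_dslope (f := fun w => h w - (c : ℂ) * (hauptQ w ^ (N - 1 - k) * φ w))
          (by simp [hauptQ_zero, h0, hc]) w
        have e2 : w ^ N = w ^ (k + 1) * w ^ (N - 1 - k) := by
          rw [← pow_add]; congr 1; omega
        rw [pow_succ w (k + 1), mul_assoc (w ^ (k + 1)), ← e, map_add, mul_add, add_mul, heq w hw hw0,
          map_neg, map_mul, Polynomial.aeval_C, map_pow, Polynomial.aeval_X, div_pow, e2,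
          Complex.coe_algebraMap]
        field_simp
        ring
  exact key N le_rfl

/-- The form `f_k P(j)` with `P` the Faber polynomial, and its description. -/
theorem DualPair.exists_canonical {κ E : ℤ} {φ₁ φ₂ : ℂ → ℂ} (h : DualPair κ E φ₁ φ₂) {m : ℤ}
    {N : ℕ} (hN : (N : ℤ) = m + E) :
    ∃ P : Polynomial ℝ, P.Monic ∧ P.natDegree = N ∧
      (∃ g : ℂ → ℂ, DiscReal g ∧ ∀ w ∈ ball (0 : ℂ) 1, w ≠ 0 →
        w ^ N * Polynomial.aeval (hauptQ w / w) P * φ₁ w = 1 + w ^ (N + 1) * g w) ∧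
      (fun τ : ℍ => qf E φ₁ τ * Polynomial.aeval (hauptJ τ) P) ∈ weaklyHolomorphic (2 * κ) ∧
      ∃ a : ℤ → ℂ,
        HasQExpansion (fun τ : ℍ => qf E φ₁ τ * Polynomial.aeval (hauptJ τ) P) a ∧
        ∀ n < E + 1, a n = if n = -m then 1 else 0 := by
  obtain ⟨P, hP, hdeg, g, hg, heq⟩ := exists_faber h.qform₁.toDiscReal h.zero₁ N
  have hform : ∀ τ : ℂ, 0 < τ.im → qf E φ₁ τ * Polynomial.aeval (hauptJ τ) P =
      qf (-m) (fun w => 1 + w ^ (N + 1) * g w) τ := by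
    intro τ hτ
    have h0 := nome_ne_zero τ
    rw [qf, qf, ← heq _ (nome_mem_ball hτ) h0, hauptJ_eq hτ, qf, zpow_neg_one,
      show E = -m + N by omega, zpow_add₀ h0, zpow_natCast, inv_mul_eq_div]
    ring
  refine ⟨P, hP, hdeg, ⟨g, hg, heq⟩, ?_, ?_⟩
  · have hq : QForm κ 1 (-m) fun w => 1 + w ^ (N + 1) * g w := by
      refine ⟨DiscReal.one.add ((DiscReal.id'.pow (N + 1)).mul hg), fun τ hτ => ?_⟩
      rw [← hform τ hτ, ← hform _ (fricke_im_pos hτ), h.qform₁.trans τ hτ, hauptJ_fricke hτ]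
      ring
    have := hq.mem_weaklyHolomorphic
    convert this using 2 with τ
    exact hform τ τ.im_pos
  · obtain ⟨b, hb, hb0⟩ := exists_hasQExpansion hg.diff (E + 1)
    -- The error term begins at exponent -m + N + 1 = E + 1, so the gap has exactly the required
    -- length.
    refine ⟨Pi.single (-m) 1 + b, ?_, fun n hn => ?_⟩
    · convert (hasQExpansion_monomial (-m)).add hb using 1
      funext τ
      have h0 := nome_ne_zero τ
      rw [hform τ τ.im_pos, Pi.add_apply, qf, qf, show E + 1 = -m + ((N + 1 : ℕ) : ℤ) by
        push_cast; omega, zpow_add₀ h0, zpow_natCast]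
      ring
    · rw [Pi.add_apply, hb0 n hn, add_zero, Pi.single_apply]

end Fricke3

end

/-! ### The residue formula for the Faber polynomials. -/

noncomputable section
namespace Fricke3
open Complex Metric Set Filter Topology ComplexConjugate

/-- Makes one piece of the integrand an exact derivative, so that it integrates to zero over a
circle. -/
lemma exists_derivative_eq (Q : Polynomial ℂ) : ∃ T : Polynomial ℂ, Polynomial.derivative T = Q := by
  induction Q using Polynomial.induction_on' with
  | add p q hp hq =>
    obtain ⟨S, rfl⟩ := hp
    obtain ⟨T, rfl⟩ := hq
    exact ⟨S + T, Polynomial.derivative_add⟩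
  | monomial n a =>
    refine ⟨Polynomial.monomial (n + 1) (a / (n + 1)), ?_⟩
    rw [Polynomial.derivative_monomial]
    have : ((n : ℂ) + 1) ≠ 0 := by exact_mod_cast Nat.succ_ne_zero n
    push_cast
    rw [div_mul_cancel₀ _ this]

/-- Residue theorem on an annulus for a quotient with simple poles. -/
theorem circleIntegral_annulus_eq {F D : ℂ → ℂ} {U : Set ℂ} (hU : IsOpen U)
    (hF : DifferentiableOn ℂ F U) (hD : DifferentiableOn ℂ D U) {r R : ℝ} (hr : 0 < r)
    (hrR : r < R) (hsub : closedBall 0 R \ ball 0 r ⊆ U) (S : Finset ℂ)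
    (hS : ∀ s ∈ S, r < ‖s‖ ∧ ‖s‖ < R ∧ D s = 0 ∧ deriv D s ≠ 0)
    (hzero : ∀ w, r ≤ ‖w‖ → ‖w‖ ≤ R → D w = 0 → w ∈ S) :
    (∮ w in C(0, R), F w / D w) = (∮ w in C(0, r), F w / D w) +
      2 * Real.pi * I * ∑ s ∈ S, F s / deriv D s := by
  classical
  have hR : 0 < R := hr.trans hrR
  have hSU : ∀ s ∈ S, s ∈ U := fun s hs => hsub ⟨by simpa using (hS s hs).2.1.le, by
    simpa using (hS s hs).1.le⟩
  set c : ℂ → ℂ := fun s => F s / deriv D s with hc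
  set K : ℂ → ℂ → ℂ := fun s w => F w / dslope D s w with hK
  -- F/D minus all its principal parts. At a pole the value is chosen to be the removable one, so
  -- that Cauchy's theorem applies on the whole annulus.
  set Ext : ℂ → ℂ := fun w => if w ∈ S then dslope (K w) w w - ∑ s ∈ S.erase w, c s / (w - s)
    else F w / D w - ∑ s ∈ S, c s / (w - s) with hExt
  have hdiffS : ∀ s ∈ S, DifferentiableAt ℂ Ext s := by
    intro s hs
    obtain ⟨-, -, hs0, hs1⟩ := hS s hs
    have hds : DifferentiableOn ℂ (dslope D s) U :=
      (differentiableOn_dslope (hU.mem_nhds (hSU s hs))).2 hD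
    have hne : dslope D s s ≠ 0 := by rwa [dslope_same]
    have hcont : ContinuousAt (dslope D s) s :=
      (hds.differentiableAt (hU.mem_nhds (hSU s hs))).continuousAt
    have hev : ∀ᶠ w in 𝓝 s, w ∈ U ∧ dslope D s w ≠ 0 :=
      (hU.eventually_mem (hSU s hs)).and (hcont.eventually_ne hne)
    obtain ⟨V, hV, hVo, hsV⟩ := _root_.eventually_nhds_iff.1 hev
    have hKd : DifferentiableOn ℂ (K s) V := fun w hw =>
      ((hF.differentiableAt (hU.mem_nhds (hV w hw).1)).div
        (hds.differentiableAt (hU.mem_nhds (hV w hw).1)) (hV w hw).2).differentiableWithinAt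
    have hdsK : DifferentiableAt ℂ (dslope (K s) s) s :=
      ((differentiableOn_dslope (hVo.mem_nhds hsV)).2 hKd).differentiableAt (hVo.mem_nhds hsV)
    have hsum : DifferentiableAt ℂ (fun w => ∑ t ∈ S.erase s, c t / (w - t)) s := by
      refine DifferentiableAt.fun_sum fun t ht => ?_
      have : s - t ≠ 0 := sub_ne_zero.2 (Finset.ne_of_mem_erase ht).symm
      exact (differentiableAt_const _).div (differentiableAt_id.sub_const _) this
    refine (hdsK.sub hsum).congr_of_eventuallyEq ?_
    have hfin : ∀ᶠ w in 𝓝 s, w ∉ (S.erase s : Set ℂ) :=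
      (S.erase s).finite_toSet.isClosed.isOpen_compl.eventually_mem (by simp)
    filter_upwards [hfin] with w hw
    by_cases hws : w = s
    · subst hws
      simp only [hExt, hs, if_true]
      rfl
    · have hwS : w ∉ S := fun h => hw (by simp [hws, h])
      have hws' : w - s ≠ 0 := sub_ne_zero.2 hws
      simp only [hExt, hwS, if_false]
      change _ = dslope (K s) s w - ∑ t ∈ S.erase s, c t / (w - t)
      rw [← Finset.add_sum_erase S _ hs, dslope_of_ne _ hws, slope_def_field]
      simp only [hK, dslope_same, hc]
      rw [dslope_of_ne _ hws, slope_def_field, hs0, sub_zero, sub_div, div_div_eq_mul_div]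
      by_cases hDw : D w = 0
      · rw [hDw]; simp; ring
      · field_simp; ring
  have hdiff : ∀ w ∈ closedBall (0 : ℂ) R \ ball 0 r, DifferentiableAt ℂ Ext w := by
    intro w hw
    by_cases hwS : w ∈ S
    · exact hdiffS w hwS
    · have hwU := hU.mem_nhds (hsub hw)
      have hDw : D w ≠ 0 := fun h0 => hwS (hzero w (by simpa using hw.2) (by simpa using hw.1) h0)
      have hsum : DifferentiableAt ℂ (fun w => ∑ t ∈ S, c t / (w - t)) w := by
        refine DifferentiableAt.fun_sum fun t ht => ?_
        have : w - t ≠ 0 := sub_ne_zero.2 fun h => hwS (h ▸ ht)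
        exact (differentiableAt_const _).div (differentiableAt_id.sub_const _) this
      refine (((hF.differentiableAt hwU).div (hD.differentiableAt hwU) hDw).sub
        hsum).congr_of_eventuallyEq ?_
      have hfin : ∀ᶠ t in 𝓝 w, t ∉ (S : Set ℂ) :=
        S.finite_toSet.isClosed.isOpen_compl.eventually_mem (by simpa using hwS)
      filter_upwards [hfin] with t ht
      have ht' : t ∉ S := by simpa using ht
      simp only [hExt, ht', if_false]
      rfl
  have hann := circleIntegral_eq_of_differentiable_on_annulus_off_countable hr hrR.le
    countable_empty (fun w hw => (hdiff w hw).continuousAt.continuousWithinAt)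
    (fun w hw => hdiff w ⟨ball_subset_closedBall hw.1.1, fun h => hw.1.2 (ball_subset_closedBall h)⟩)
  have hsplit : ∀ ρ : ℝ, 0 < ρ → r ≤ ρ → ρ ≤ R → (∀ w ∈ sphere (0 : ℂ) ρ, w ∉ S) →
      (∮ w in C(0, ρ), Ext w) = (∮ w in C(0, ρ), F w / D w) -
        ∑ s ∈ S, c s * ∮ w in C(0, ρ), (w - s)⁻¹ := by
    intro ρ hρ h1 h2 hout
    have hci : ∀ s ∈ S, CircleIntegrable (fun w => c s / (w - s)) 0 ρ := fun s hs => by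
      refine ContinuousOn.circleIntegrable hρ.le ?_
      refine continuousOn_const.div (continuousOn_id.sub continuousOn_const) fun w hw => ?_
      exact sub_ne_zero.2 fun h => hout w hw (by rw [show w = s from h]; exact hs)
    have hFD : CircleIntegrable (fun w => F w / D w) 0 ρ := by
      refine ContinuousOn.circleIntegrable hρ.le fun w hw => ?_
      rw [mem_sphere_zero_iff_norm] at hw
      have hwU := hU.mem_nhds (hsub (show w ∈ closedBall 0 R \ ball 0 r by simp [hw, h1, h2]))
      have hDw : D w ≠ 0 := fun h0 => hout w (by simp [hw]) (hzero w (by linarith) (by linarith) h0)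
      exact ((hF.differentiableAt hwU).div (hD.differentiableAt hwU)
        hDw).continuousAt.continuousWithinAt
    have e1 : (∮ w in C(0, ρ), Ext w) =
        ∮ w in C(0, ρ), (F w / D w - ∑ s ∈ S, c s / (w - s)) := by
      refine circleIntegral.integral_congr hρ.le fun w hw => ?_
      simp only [hExt, hout w hw, if_false]
    rw [e1, circleIntegral.integral_sub hFD (CircleIntegrable.fun_sum S hci),
      circleIntegral.integral_fun_sum hci]
    congr 1
    refine Finset.sum_congr rfl fun s _ => ?_
    rw [← circleIntegral.integral_const_mul]
    simp only [div_eq_mul_inv]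
  rw [hsplit R hR hrR.le le_rfl fun w hw h => by
      have := (hS w h).2.1
      rw [mem_sphere_zero_iff_norm] at hw
      linarith,
    hsplit r hr le_rfl hrR.le fun w hw h => by
      have := (hS w h).1
      rw [mem_sphere_zero_iff_norm] at hw
      linarith] at hann
  have eR : ∑ s ∈ S, c s * ∮ w in C(0, R), (w - s)⁻¹ = 2 * Real.pi * I * ∑ s ∈ S, c s := by
    rw [Finset.mul_sum]
    refine Finset.sum_congr rfl fun s hs => ?_
    rw [circleIntegral.integral_sub_inv_of_mem_ball (by simpa using (hS s hs).2.1), mul_comm]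
  have er : ∑ s ∈ S, c s * ∮ w in C(0, r), (w - s)⁻¹ = 0 := by
    refine Finset.sum_eq_zero fun s hs => ?_
    have hne : ∀ w ∈ closedBall (0 : ℂ) r, w - s ≠ 0 := fun w hw => by
      refine sub_ne_zero.2 fun h => ?_
      have := (hS s hs).1
      rw [mem_closedBall_zero_iff, h] at hw
      linarith
    rw [circleIntegral_eq_zero_of_differentiable_on_off_countable (f := fun w => (w - s)⁻¹) hr.le
      countable_empty ((continuousOn_id.sub continuousOn_const).inv₀ hne)
      (fun w hw => (differentiableAt_id.sub_const s).inv (hne w (ball_subset_closedBall hw.1))),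
      mul_zero]
  rw [eR, er] at hann
  linear_combination hann

variable {κ E : ℤ} {φ₁ φ₂ : ℂ → ℂ}

/-- The generating function of the Faber polynomials, as an integral over a small circle. -/
lemma DualPair.circleIntegral_small (h : DualPair κ E φ₁ φ₂) {N : ℕ} {P : Polynomial ℝ}
    {g : ℂ → ℂ} (hg : DiscReal g)
    (hP : ∀ w ∈ ball (0 : ℂ) 1, w ≠ 0 →
      w ^ N * Polynomial.aeval (hauptQ w / w) P * φ₁ w = 1 + w ^ (N + 1) * g w) (x : ℂ)
    {r : ℝ} (hr : 0 < r) (hr1 : r < 1) (hne : ∀ w, ‖w‖ ≤ r → hauptQ w - x * w ≠ 0) :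
    (∮ w in C(0, r), φ₂ w / w ^ (N + 1) / (hauptQ w - x * w)) =
      2 * Real.pi * I * Polynomial.aeval x P := by
  set Pc : Polynomial ℂ := P.map (algebraMap ℝ ℂ) with hPc
  have hPe : ∀ y : ℂ, Polynomial.aeval y P = Pc.eval y := fun y => by
    rw [hPc, Polynomial.eval_map_algebraMap]
  obtain ⟨Q, hQ⟩ : Polynomial.X - Polynomial.C x ∣ Pc - Polynomial.C (Pc.eval x) :=
    Polynomial.X_sub_C_dvd_sub_C_eval
  have hQe : ∀ y : ℂ, Pc.eval y = Pc.eval x + (y - x) * Q.eval y := fun y => by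
    have := congrArg (Polynomial.eval y) hQ
    simp only [Polynomial.eval_sub, Polynomial.eval_C, Polynomial.eval_mul, Polynomial.eval_X] at this
    linear_combination this
  -- Let ι = `hauptQ`. With P(y) = P(x) + (y - x)T'(y) at y = ι/w and φ₁φ₂ = ι - wι', the integrand
  -- becomes P(x)/w, plus the derivative `L` of -T(ι/w), plus a function `G` holomorphic on the
  -- disc. Only P(x)/w contributes.
  obtain ⟨T, rfl⟩ := exists_derivative_eq Q
  have hball : ∀ w : ℂ, ‖w‖ ≤ r → ‖w‖ < 1 := fun w hw => hw.trans_lt hr1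
  have hιd : ∀ w, ‖w‖ ≤ r → HasDerivAt hauptQ (deriv hauptQ w) w := fun w hw =>
    (discReal_hauptQ.differentiableAt (hball w hw)).hasDerivAt
  have hι'd : ∀ w, ‖w‖ ≤ r → DifferentiableAt ℂ (deriv hauptQ) w := fun w hw =>
    discReal_hauptQ.deriv.differentiableAt (hball w hw)
  have hDd : ∀ w, ‖w‖ ≤ r → DifferentiableAt ℂ (fun w => hauptQ w - x * w) w := fun w hw =>
    (hιd w hw).differentiableAt.sub (differentiableAt_id.const_mul x)
  set G : ℂ → ℂ := fun w => -(Pc.eval x * ((deriv hauptQ w - x) / (hauptQ w - x * w))) -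
    g w * φ₂ w / (hauptQ w - x * w) with hG
  have hGd : ∀ w, ‖w‖ ≤ r → DifferentiableAt ℂ G w := fun w hw => by
    refine DifferentiableAt.sub (DifferentiableAt.neg (DifferentiableAt.const_mul ?_ _)) ?_
    · exact ((hι'd w hw).sub_const x).div (hDd w hw) (hne w hw)
    · exact ((hg.differentiableAt (hball w hw)).mul
        (h.qform₂.toDiscReal.differentiableAt (hball w hw))).div (hDd w hw) (hne w hw)
  have hG0 : (∮ w in C(0, r), G w) = 0 :=
    circleIntegral_eq_zero_of_differentiable_on_off_countable hr.le countable_empty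
      (fun w hw => (hGd w (by simpa using hw)).continuousAt.continuousWithinAt)
      (fun w hw => hGd w (le_of_lt (by simpa using hw.1)))
  set L : ℂ → ℂ := fun w =>
    (Polynomial.derivative T).eval (hauptQ w / w) * ((hauptQ w - w * deriv hauptQ w) / w ^ 2) with hL
  have hLd : ∀ w ∈ sphere (0 : ℂ) r, HasDerivAt (fun w => -T.eval (hauptQ w / w)) (L w) w := by
    intro w hw
    rw [mem_sphere_zero_iff_norm] at hw
    have hw0 : w ≠ 0 := by rintro rfl; simp at hw; linarith
    have h1 : HasDerivAt (fun w => hauptQ w / w)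
        ((deriv hauptQ w * w - hauptQ w * 1) / w ^ 2) w :=
      (hιd w hw.le).fun_div (hasDerivAt_id' w) hw0
    have h2 : HasDerivAt (fun y => T.eval y) ((Polynomial.derivative T).eval (hauptQ w / w))
      (hauptQ w / w) := T.hasDerivAt _
    have h3 := (HasDerivAt.comp w (h₂ := fun y => T.eval y) (h := fun w => hauptQ w / w) h2 h1).neg
    refine h3.congr_deriv ?_
    simp only [hL]
    ring
  have hL0 : (∮ w in C(0, r), L w) = 0 := by
    refine circleIntegral.integral_eq_zero_of_hasDerivWithinAt'
      (f := fun w => -T.eval (hauptQ w / w)) fun w hw => ?_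
    rw [abs_of_pos hr] at hw
    exact (hLd w hw).hasDerivWithinAt
  have hLc : CircleIntegrable L 0 r := by
    refine ContinuousOn.circleIntegrable hr.le fun w hw => ?_
    rw [mem_sphere_zero_iff_norm] at hw
    have hw0 : w ≠ 0 := by rintro rfl; simp at hw; linarith
    refine ContinuousAt.continuousWithinAt ?_
    refine ContinuousAt.mul ?_ ?_
    · exact ContinuousAt.comp (f := fun w => hauptQ w / w)
        (g := fun y => (Polynomial.derivative T).eval y) (Polynomial.continuous _).continuousAt
        ((hιd w hw.le).continuousAt.div continuousAt_id hw0)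
    · exact ((hιd w hw.le).continuousAt.sub
        (continuousAt_id.mul (hι'd w hw.le).continuousAt)).div (continuousAt_id.pow 2)
        (pow_ne_zero 2 hw0)
  have hGc : CircleIntegrable G 0 r := ContinuousOn.circleIntegrable hr.le fun w hw =>
    (hGd w (by rw [mem_sphere_zero_iff_norm] at hw; exact hw.le)).continuousAt.continuousWithinAt
  have hIc : CircleIntegrable (fun w => Pc.eval x * (w - 0)⁻¹) 0 r := by
    refine ContinuousOn.circleIntegrable hr.le ?_
    refine continuousOn_const.mul ((continuousOn_id.sub continuousOn_const).inv₀ fun w hw => ?_)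
    rw [mem_sphere_zero_iff_norm] at hw
    intro h0
    have : w = 0 := by simpa using h0
    rw [this] at hw; simp at hw; linarith
  have hcongr : (∮ w in C(0, r), φ₂ w / w ^ (N + 1) / (hauptQ w - x * w)) =
      ∮ w in C(0, r), ((Pc.eval x * (w - 0)⁻¹ + L w) + G w) := by
    refine circleIntegral.integral_congr hr.le fun w hw => ?_
    rw [mem_sphere_zero_iff_norm] at hw
    have hw0 : w ≠ 0 := by rintro rfl; simp at hw; linarith
    have hwb : w ∈ ball (0 : ℂ) 1 := by simpa using hball w hw.le
    have hD := hne w hw.le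
    have e1 := hP w hwb hw0
    rw [hPe, hQe] at e1
    have e2 := h.mul_eq w hwb
    simp only [hL, hG, sub_zero]
    have e3 : φ₂ w / w ^ (N + 1) / (hauptQ w - x * w) =
        (w ^ N * (Pc.eval x + (hauptQ w / w - x) * (Polynomial.derivative T).eval (hauptQ w / w)) *
          (φ₁ w * φ₂ w) - w ^ (N + 1) * g w * φ₂ w) / w ^ (N + 1) / (hauptQ w - x * w) := by
      congr 2
      linear_combination (-φ₂ w) * e1
    rw [e3, e2]
    have hwN : w ^ N ≠ 0 := pow_ne_zero _ hw0
    generalize (Polynomial.derivative T).eval (hauptQ w / w) = t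
    generalize Pc.eval x = p
    obtain ⟨d, hd⟩ : ∃ d, d = hauptQ w - x * w := ⟨_, rfl⟩
    have hd' : hauptQ w = d + x * w := by rw [hd]; ring
    rw [← hd] at hD ⊢
    rw [hd', pow_succ]
    field_simp
    ring
  have hIL : CircleIntegrable (fun w => Pc.eval x * (w - 0)⁻¹ + L w) 0 r := hIc.add hLc
  rw [hcongr, circleIntegral.integral_add hIL hGc, circleIntegral.integral_add hIc hLc,
    hG0, hL0, circleIntegral.integral_const_mul, circleIntegral.integral_sub_center_inv _ hr.ne', hPe]
  ring

/-- The Faber polynomial as a sum over the poles in a disc and an integral over its boundary. -/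
theorem DualPair.faber_eq (h : DualPair κ E φ₁ φ₂) {N : ℕ} {P : Polynomial ℝ}
    {g : ℂ → ℂ} (hg : DiscReal g)
    (hP : ∀ w ∈ ball (0 : ℂ) 1, w ≠ 0 →
      w ^ N * Polynomial.aeval (hauptQ w / w) P * φ₁ w = 1 + w ^ (N + 1) * g w) (x : ℂ)
    {R : ℝ} (hR : 0 < R) (hR1 : R < 1) (S : Finset ℂ)
    (hS : ∀ s ∈ S, ‖s‖ < R ∧ hauptQ s = x * s ∧ φ₁ s ≠ 0 ∧ φ₂ s ≠ 0)
    (hzero : ∀ w, ‖w‖ ≤ R → hauptQ w = x * w → w ∈ S) :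
    Polynomial.aeval x P = ∑ s ∈ S, (s ^ N * φ₁ s)⁻¹ + (2 * Real.pi * I)⁻¹ •
      ∮ w in C(0, R), φ₂ w / w ^ (N + 1) / (hauptQ w - x * w) := by
  have hs0 : ∀ s ∈ S, s ≠ 0 := by
    rintro s hs rfl
    have := (hS 0 hs).2.1
    rw [hauptQ_zero, mul_zero] at this
    exact one_ne_zero this
  obtain ⟨r, hr, hrR, hrS⟩ : ∃ r : ℝ, 0 < r ∧ r < R ∧ ∀ s ∈ S, r < ‖s‖ := by
    rcases S.eq_empty_or_nonempty with rfl | hne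
    · exact ⟨R / 2, by linarith, by linarith, by simp⟩
    · obtain ⟨t, ht, hmin⟩ := S.exists_min_image (fun s => ‖s‖) hne
      have h1 := norm_pos_iff.2 (hs0 t ht)
      refine ⟨‖t‖ / 2, by linarith, by linarith [(hS t ht).1], fun s hs => ?_⟩
      linarith [hmin s hs]
  have hDder : ∀ w, ‖w‖ < 1 → HasDerivAt (fun w => hauptQ w - x * w) (deriv hauptQ w - x) w := by
    intro w hw
    have := (discReal_hauptQ.differentiableAt hw).hasDerivAt.sub ((hasDerivAt_id w).const_mul x)
    rw [mul_one] at this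
    exact this
  have hsmall := h.circleIntegral_small hg hP x hr (hrR.trans hR1) fun w hw h0 => by
    have := hrS w (hzero w (hw.trans hrR.le) (sub_eq_zero.1 h0))
    linarith
  -- At a zero of ι - xw the relation φ₁φ₂ = ι - wι' says that the derivative of the denominator is
  -- -φ₁φ₂/s. So the pole is simple and φ₂ cancels from the residue.
  have hres : ∀ s ∈ S, φ₂ s / s ^ (N + 1) / deriv (fun w => hauptQ w - x * w) s =
      -(s ^ N * φ₁ s)⁻¹ := by
    intro s hs
    obtain ⟨h1, h2, h3, h4⟩ := hS s hs
    have hsb : ‖s‖ < 1 := h1.trans hR1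
    rw [(hDder s hsb).deriv]
    have e := h.mul_eq s (by simpa using hsb)
    have hs := hs0 s hs
    have e2 : deriv hauptQ s - x = -(φ₁ s * φ₂ s) / s := by
      rw [e, h2]
      field_simp
      ring
    rw [e2, pow_succ]
    field_simp
  have hmain := circleIntegral_annulus_eq (F := fun w => φ₂ w / w ^ (N + 1))
    (D := fun w => hauptQ w - x * w) (U := ball 0 1 \ {0})
    (isOpen_ball.sdiff isClosed_singleton)
    (fun w hw => ((h.qform₂.toDiscReal.differentiableAt (by simpa using hw.1)).div
      (differentiableAt_id.pow (N + 1)) (pow_ne_zero (a := w) _ hw.2)).differentiableWithinAt)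
    (fun w hw => (hDder w (by simpa using hw.1)).differentiableAt.differentiableWithinAt)
    hr hrR (fun w hw => by
      have h1 : ‖w‖ ≤ R := by simpa using hw.1
      have h2 : r ≤ ‖w‖ := by simpa using hw.2
      refine ⟨by simpa using h1.trans_lt hR1, fun h0 => ?_⟩
      rw [mem_singleton_iff] at h0
      rw [h0, norm_zero] at h2
      linarith) S
    (fun s hs => ⟨hrS s hs, (hS s hs).1, by simp [(hS s hs).2.1], by
      obtain ⟨h1, h2, h3, h4⟩ := hS s hs
      intro h0
      have := hres s hs
      rw [h0, div_zero, eq_comm, neg_eq_zero, inv_eq_zero] at this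
      exact mul_ne_zero (pow_ne_zero _ (hs0 s hs)) h3 this⟩)
    (fun w _ h2 h3 => hzero w h2 (sub_eq_zero.1 h3))
  rw [hmain, hsmall, Finset.sum_congr rfl hres, Finset.sum_neg_distrib, smul_eq_mul]
  have := two_pi_I_ne_zero
  field_simp
  ring

/-! ### Explicit bounds for the forms in terms of the size of the nome. -/

lemma norm_two_pi_I_inv_smul_circleIntegral_le {f : ℂ → ℂ} {R C : ℝ} (hR : 0 < R)
    (hC : ∀ w, ‖w‖ = R → ‖f w‖ ≤ C) :
    ‖(2 * Real.pi * I : ℂ)⁻¹ • ∮ w in C(0, R), f w‖ ≤ R * C :=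
  circleIntegral.norm_two_pi_i_inv_smul_integral_le_of_norm_le_const hR.le fun w hw =>
    hC w (by simpa using hw)

lemma norm_le_norm_sub_add' (a b : ℂ) : ‖a‖ ≤ ‖a - b‖ + ‖b‖ :=
  (congrArg norm (show a = (a - b) + b by ring)).le.trans (norm_add_le _ _)

/-- The remainder is majorised coefficient by coefficient by that of (1 + |w|)ⁿ. -/
lemma norm_one_sub_pow_sub_le (w : ℂ) (n : ℕ) :
    ‖(1 - w) ^ n - (1 - n * w)‖ ≤ (1 + ‖w‖) ^ n - (1 + n * ‖w‖) := by
  induction n with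
  | zero => simp
  | succ n ih =>
    have e : (1 - w) ^ (n + 1) - (1 - ((n + 1 : ℕ) : ℂ) * w) =
        (1 - w) * ((1 - w) ^ n - (1 - n * w)) + n * w ^ 2 := by push_cast; ring
    have h1 : ‖1 - w‖ ≤ 1 + ‖w‖ := by simpa using norm_sub_le (1 : ℂ) w
    have h0 := norm_nonneg w
    calc ‖(1 - w) ^ (n + 1) - (1 - ((n + 1 : ℕ) : ℂ) * w)‖
        ≤ ‖1 - w‖ * ‖(1 - w) ^ n - (1 - n * w)‖ + n * ‖w‖ ^ 2 := by
          rw [e]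
          refine (norm_add_le _ _).trans ?_
          rw [norm_mul, norm_mul, norm_pow, norm_natCast]
      _ ≤ (1 + ‖w‖) * ((1 + ‖w‖) ^ n - (1 + n * ‖w‖)) + n * ‖w‖ ^ 2 := by gcongr
      _ = _ := by push_cast; ring

lemma norm_one_sub_pow_twelve_sub_le (w : ℂ) :
    ‖(1 - w) ^ 12 - (1 - 12 * w + 66 * w ^ 2)‖ ≤
      (1 + ‖w‖) ^ 12 - (1 + 12 * ‖w‖ + 66 * ‖w‖ ^ 2) := by
  have key : ∀ n : ℕ, ‖(1 - w) ^ n - (1 - n * w + (n.choose 2 : ℕ) * w ^ 2)‖ ≤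
      (1 + ‖w‖) ^ n - (1 + n * ‖w‖ + (n.choose 2 : ℕ) * ‖w‖ ^ 2) := by
    intro n
    induction n with
    | zero => simp
    | succ n ih =>
      have hch : (n + 1).choose 2 = n.choose 2 + n := by
        rw [Nat.choose_succ_succ' n 1, Nat.choose_one_right, add_comm]
      have e : (1 - w) ^ (n + 1) - (1 - ((n + 1 : ℕ) : ℂ) * w + ((n + 1).choose 2 : ℕ) * w ^ 2) =
          (1 - w) * ((1 - w) ^ n - (1 - n * w + (n.choose 2 : ℕ) * w ^ 2)) -
            (n.choose 2 : ℕ) * w ^ 3 := by rw [hch]; push_cast; ring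
      have h1 : ‖1 - w‖ ≤ 1 + ‖w‖ := by simpa using norm_sub_le (1 : ℂ) w
      have h0 := norm_nonneg w
      rw [e]
      calc _ ≤ ‖1 - w‖ * ‖(1 - w) ^ n - (1 - n * w + (n.choose 2 : ℕ) * w ^ 2)‖ +
            (n.choose 2 : ℕ) * ‖w‖ ^ 3 := by
            refine (norm_sub_le _ _).trans ?_
            rw [norm_mul, norm_mul, norm_pow, norm_natCast]
        _ ≤ (1 + ‖w‖) * ((1 + ‖w‖) ^ n - (1 + n * ‖w‖ + (n.choose 2 : ℕ) * ‖w‖ ^ 2)) +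
            (n.choose 2 : ℕ) * ‖w‖ ^ 3 := by gcongr
        _ = _ := by rw [hch]; push_cast; ring
  have h := key 12
  have h2 : Nat.choose 12 2 = 66 := by decide
  rw [h2] at h
  exact_mod_cast h

lemma exp_sub_one_le {x : ℝ} (h0 : 0 ≤ x) (h1 : x ≤ 1 / 100) : Real.exp x - 1 ≤ 1.01 * x := by
  have h := Real.abs_exp_sub_one_sub_id_le (x := x) (by rw [abs_of_nonneg h0]; linarith)
  have := (abs_le.1 h).2
  nlinarith

/-- Once the factors with exponents 1 and 2 are removed, υ is (1 + O(w³))¹². The constant 26 is a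
rounding of 12 · 2.14. -/
lemma norm_tail_pow_sub_one_le {w : ℂ} (hw : ‖w‖ ≤ 1 / 12) :
    ‖((∏' n : ℕ, (1 - w ^ (n + 3))) / eulerProd (w ^ 3)) ^ 12 - 1‖ ≤ 26 * ‖w‖ ^ 3 := by
  set r := ‖w‖ with hr
  have h0 : 0 ≤ r := norm_nonneg w
  have hw1 : ‖w‖ < 1 := by linarith
  have hr3 : r ^ 3 ≤ 1 / 1728 := by
    calc r ^ 3 ≤ (1 / 12) ^ 3 := by gcongr
      _ = _ := by norm_num
  have hr30 : 0 ≤ r ^ 3 := by positivity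
  have hn3 : ‖w ^ 3‖ = r ^ 3 := by rw [norm_pow]
  have hw3 : ‖w ^ 3‖ < 1 := by rw [hn3]; linarith
  have a1 : ‖(∏' n : ℕ, (1 - w ^ (n + 3))) - 1‖ ≤ 1.11 * r ^ 3 := by
    refine (norm_tprod_sub_one_le hw1 3).trans ?_
    have e1 : r ^ 3 / (1 - r) ≤ 12 / 11 * r ^ 3 := by
      rw [div_le_iff₀ (by linarith)]; nlinarith
    have := exp_sub_one_le (x := 12 / 11 * r ^ 3) (by positivity) (by linarith)
    have := Real.exp_le_exp.2 e1
    linarith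
  have a2 : ‖eulerProd (w ^ 3) - 1‖ ≤ 1.02 * r ^ 3 := by
    have h := norm_tprod_sub_one_le hw3 1
    rw [hn3, pow_one] at h
    have e1 : r ^ 3 / (1 - r ^ 3) ≤ 1728 / 1727 * r ^ 3 := by
      rw [div_le_iff₀ (by linarith)]; nlinarith
    have := exp_sub_one_le (x := 1728 / 1727 * r ^ 3) (by positivity) (by linarith)
    have := Real.exp_le_exp.2 e1
    refine h.trans ?_
    linarith
  set p := ∏' n : ℕ, (1 - w ^ (n + 3)) with hp
  set e := eulerProd (w ^ 3) with he
  have hege : 0.999 ≤ ‖e‖ := by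
    have := norm_sub_norm_le (1 : ℂ) (1 - e)
    rw [sub_sub_cancel, norm_one, norm_sub_rev] at this
    linarith
  have he0 : e ≠ 0 := norm_pos_iff.1 (by linarith)
  obtain ⟨d, hd⟩ : ∃ d, d = 1 - p / e := ⟨_, rfl⟩
  have hdn : ‖d‖ ≤ 2.14 * r ^ 3 := by
    have : d = (e - p) / e := by rw [hd]; field_simp
    rw [this, norm_div, div_le_iff₀ (by linarith)]
    have : ‖e - p‖ ≤ ‖e - 1‖ + ‖p - 1‖ := by
      rw [show e - p = (e - 1) - (p - 1) by ring]; exact norm_sub_le _ _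
    nlinarith
  have hpe : p / e = 1 - d := by rw [hd]; ring
  rw [hpe]
  have hb := norm_one_sub_pow_sub_le d 12
  have hd0 := norm_nonneg d
  have hds : ‖d‖ ≤ 1 / 800 := by linarith
  have hpow : (1 + ‖d‖) ^ 12 ≤ 1 + 12 * ‖d‖ + 80 * ‖d‖ ^ 2 := by
    have : ∀ t : ℝ, 0 ≤ t → t ≤ 1 / 800 → (1 + t) ^ 12 ≤ 1 + 12 * t + 80 * t ^ 2 := by
      intro t h0 h1
      have e1 : (1 + t) ^ 2 ≤ 1 + 2.00125 * t := by nlinarith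
      have e3 : (1 + t) ^ 6 ≤ 1 + 6 * t + 16 * t ^ 2 := by
        have : (1 + t) ^ 6 = 1 + 6 * t + 15 * t ^ 2 + t ^ 2 * (20 * t + 15 * t ^ 2 + 6 * t ^ 3 + t ^ 4) := by
          ring
        rw [this]
        have h2 : t ^ 2 ≤ 1 := by nlinarith
        have : 20 * t + 15 * t ^ 2 + 6 * t ^ 3 + t ^ 4 ≤ 1 := by
          have : t ^ 2 ≤ t := by nlinarith
          have : t ^ 3 ≤ t := by nlinarith
          have : t ^ 4 ≤ t := by nlinarith
          linarith
        nlinarith [sq_nonneg t]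
      have : (1 + t) ^ 12 = ((1 + t) ^ 6) ^ 2 := by ring
      rw [this]
      have h3 : ((1 + t) ^ 6) ^ 2 ≤ (1 + 6 * t + 16 * t ^ 2) ^ 2 := by gcongr
      refine h3.trans ?_
      have : (1 + 6 * t + 16 * t ^ 2) ^ 2 = 1 + 12 * t + 68 * t ^ 2 + t ^ 2 * (192 * t + 256 * t ^ 2) := by
        ring
      rw [this]
      have : 192 * t + 256 * t ^ 2 ≤ 12 := by nlinarith
      nlinarith [sq_nonneg t]
    exact this _ hd0 hds
  calc ‖(1 - d) ^ 12 - 1‖ = ‖((1 - d) ^ 12 - (1 - (12 : ℕ) * d)) - 12 * d‖ := by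
        congr 1; push_cast; ring
    _ ≤ ‖(1 - d) ^ 12 - (1 - (12 : ℕ) * d)‖ + 12 * ‖d‖ := by
        refine (norm_sub_le _ _).trans ?_
        rw [norm_mul]; norm_num
    _ ≤ (1 + ‖d‖) ^ 12 - (1 + (12 : ℕ) * ‖d‖) + 12 * ‖d‖ := by gcongr
    _ ≤ 26 * r ^ 3 := by
        push_cast
        nlinarith

lemma upsQ_eq_mul {w : ℂ} (hw : ‖w‖ < 1) : upsQ w = (1 - w) ^ 12 * (1 - w ^ 2) ^ 12 *
    ((∏' n : ℕ, (1 - w ^ (n + 3))) / eulerProd (w ^ 3)) ^ 12 := by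
  rw [upsQ, eulerProd_eq_mul_mul hw]
  ring

/-- The first three terms of `υ`. -/
theorem norm_upsQ_sub_le {w : ℂ} (hw : ‖w‖ ≤ 1 / 12) :
    ‖upsQ w - (1 - 12 * w + 54 * w ^ 2)‖ ≤ 600 * ‖w‖ ^ 3 := by
  set r := ‖w‖ with hr
  have h0 : 0 ≤ r := norm_nonneg w
  have ha := norm_one_sub_pow_twelve_sub_le w
  have hb := norm_one_sub_pow_sub_le (w ^ 2) 12
  have ht := norm_tail_pow_sub_one_le hw
  rw [upsQ_eq_mul (by linarith)]
  rw [← hr] at ha ht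
  rw [norm_pow, ← hr] at hb
  push_cast at hb
  set F := ((∏' n : ℕ, (1 - w ^ (n + 3))) / eulerProd (w ^ 3)) ^ 12 with hF
  set a := (1 - w) ^ 12 with hadef
  set b := (1 - w ^ 2) ^ 12 with hbdef
  have hr2 : r ^ 2 ≤ 1 / 144 := by nlinarith
  have ha' : ‖a - (1 - 12 * w + 66 * w ^ 2)‖ ≤ 268 * r ^ 3 := by
    refine ha.trans ?_
    have e : (1 + r) ^ 12 - (1 + 12 * r + 66 * r ^ 2) = r ^ 3 * (220 + 495 * r + 792 * r ^ 2 +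
      924 * r ^ 3 + 792 * r ^ 4 + 495 * r ^ 5 + 220 * r ^ 6 + 66 * r ^ 7 + 12 * r ^ 8 + r ^ 9) := by
      ring
    rw [e, mul_comm]
    gcongr
    calc 220 + 495 * r + 792 * r ^ 2 + 924 * r ^ 3 + 792 * r ^ 4 + 495 * r ^ 5 + 220 * r ^ 6 +
          66 * r ^ 7 + 12 * r ^ 8 + r ^ 9
        ≤ 220 + 495 * (1 / 12) + 792 * (1 / 12) ^ 2 + 924 * (1 / 12) ^ 3 + 792 * (1 / 12) ^ 4 +
          495 * (1 / 12) ^ 5 + 220 * (1 / 12) ^ 6 + 66 * (1 / 12) ^ 7 + 12 * (1 / 12) ^ 8 +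
          (1 / 12) ^ 9 := by gcongr
      _ ≤ 268 := by norm_num
  have hb' : ‖b - (1 - 12 * w ^ 2)‖ ≤ 6 * r ^ 3 := by
    refine hb.trans ?_
    have e : ∀ s : ℝ, (1 + s) ^ 12 - (1 + 12 * s) = s ^ 2 * (66 + 220 * s + 495 * s ^ 2 +
      792 * s ^ 3 + 924 * s ^ 4 + 792 * s ^ 5 + 495 * s ^ 6 + 220 * s ^ 7 + 66 * s ^ 8 + 12 * s ^ 9 +
      s ^ 10) := by intro s; ring
    rw [e]
    have h4 : (r ^ 2) ^ 2 ≤ 1 / 12 * r ^ 3 := by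
      have : (r ^ 2) ^ 2 = r * r ^ 3 := by ring
      rw [this]; gcongr
    have h5 : 66 + 220 * r ^ 2 + 495 * (r ^ 2) ^ 2 + 792 * (r ^ 2) ^ 3 + 924 * (r ^ 2) ^ 4 +
        792 * (r ^ 2) ^ 5 + 495 * (r ^ 2) ^ 6 + 220 * (r ^ 2) ^ 7 + 66 * (r ^ 2) ^ 8 +
        12 * (r ^ 2) ^ 9 + (r ^ 2) ^ 10 ≤ 70 := by
      calc _ ≤ 66 + 220 * (1 / 144) + 495 * (1 / 144) ^ 2 + 792 * (1 / 144) ^ 3 +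
            924 * (1 / 144) ^ 4 + 792 * (1 / 144) ^ 5 + 495 * (1 / 144) ^ 6 + 220 * (1 / 144) ^ 7 +
            66 * (1 / 144) ^ 8 + 12 * (1 / 144) ^ 9 + (1 / 144 : ℝ) ^ 10 := by gcongr
        _ ≤ 70 := by norm_num
    calc _ ≤ (1 / 12 * r ^ 3) * 70 := by gcongr
      _ ≤ 6 * r ^ 3 := by nlinarith [pow_nonneg h0 3]
  have ha0 : ‖(1 - 12 * w + 66 * w ^ 2 : ℂ)‖ ≤ 2.46 := by
    have h1 : ‖(1 - 12 * w + 66 * w ^ 2 : ℂ)‖ ≤ 1 + 12 * r + 66 * r ^ 2 := by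
      refine (norm_add_le _ _).trans ?_
      refine add_le_add ((norm_sub_le _ _).trans ?_) ?_
      · rw [norm_mul, norm_one]; norm_num; rfl
      · rw [norm_mul, norm_pow]; norm_num; rfl
    nlinarith
  have hr3 : r ^ 3 ≤ 1 / 1728 := by
    calc r ^ 3 ≤ (1 / 12) ^ 3 := by gcongr
      _ = _ := by norm_num
  have hr30 : 0 ≤ r ^ 3 := by positivity
  have hbn : ‖b‖ ≤ 1.09 := by
    have h1 : ‖b‖ ≤ ‖b - (1 - 12 * w ^ 2)‖ + ‖(1 - 12 * w ^ 2 : ℂ)‖ :=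
      norm_le_norm_sub_add' _ _
    have h2 : ‖(1 - 12 * w ^ 2 : ℂ)‖ ≤ 1 + 12 * r ^ 2 := by
      refine (norm_sub_le _ _).trans ?_
      rw [norm_mul, norm_one, norm_pow]; norm_num; rfl
    linarith
  have han : ‖a‖ ≤ 2.62 := by
    have h1 : ‖a‖ ≤ ‖a - (1 - 12 * w + 66 * w ^ 2)‖ + ‖(1 - 12 * w + 66 * w ^ 2 : ℂ)‖ :=
      norm_le_norm_sub_add' _ _
    linarith
  -- (1 - 12w + 66w²)(1 - 12w²) = 1 - 12w + 54w² + 144w³ - 792w⁴; everything else carries one of the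
  -- three remainders.
  have hsplit : a * b * F - (1 - 12 * w + 54 * w ^ 2) = a * b * (F - 1) +
      ((a - (1 - 12 * w + 66 * w ^ 2)) * b +
        ((1 - 12 * w + 66 * w ^ 2) * (b - (1 - 12 * w ^ 2)) + (144 * w ^ 3 - 792 * w ^ 4))) := by
    ring
  have hlast : ‖(144 * w ^ 3 - 792 * w ^ 4 : ℂ)‖ ≤ 210 * r ^ 3 := by
    refine (norm_sub_le _ _).trans ?_
    rw [norm_mul, norm_mul, norm_pow, norm_pow, ← hr]
    have : r ^ 4 ≤ 1 / 12 * r ^ 3 := by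
      rw [show r ^ 4 = r * r ^ 3 by ring]; gcongr
    norm_num
    linarith
  rw [hsplit]
  calc _ ≤ ‖a‖ * ‖b‖ * ‖F - 1‖ + (‖a - (1 - 12 * w + 66 * w ^ 2)‖ * ‖b‖ +
        (‖(1 - 12 * w + 66 * w ^ 2 : ℂ)‖ * ‖b - (1 - 12 * w ^ 2)‖ +
          ‖(144 * w ^ 3 - 792 * w ^ 4 : ℂ)‖)) := by
        refine (norm_add_le _ _).trans (add_le_add (by rw [norm_mul, norm_mul]) ?_)
        refine (norm_add_le _ _).trans (add_le_add (by rw [norm_mul]) ?_)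
        refine (norm_add_le _ _).trans (add_le_add (by rw [norm_mul]) le_rfl)
    _ ≤ 2.62 * 1.09 * (26 * r ^ 3) + (268 * r ^ 3 * 1.09 + (2.46 * (6 * r ^ 3) + 210 * r ^ 3)) := by
        gcongr
    _ ≤ 600 * r ^ 3 := by nlinarith

lemma norm_hauptU_sub_le {τ : ℂ} (hr : ‖nome τ‖ ≤ 1 / 12) :
    ‖27 * hauptU τ - ((nome τ)⁻¹ - 12 + 54 * nome τ)‖ ≤ 600 * ‖nome τ‖ ^ 2 := by
  have h0 := nome_ne_zero τ
  have e : 27 * hauptU τ - ((nome τ)⁻¹ - 12 + 54 * nome τ) =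
      (upsQ (nome τ) - (1 - 12 * nome τ + 54 * nome τ ^ 2)) / nome τ := by
    rw [hauptU]
    field_simp
  rw [e, norm_div, div_le_iff₀ (norm_pos_iff.2 h0)]
  refine (norm_upsQ_sub_le hr).trans (le_of_eq ?_)
  ring

lemma norm_betaQ_le {w : ℂ} {r : ℝ} (hw : ‖w‖ ≤ r) (hr : r < 1) :
    ‖betaQ w‖ ≤ Real.exp (6 * (r / (1 - r) + r ^ 3 / (1 - r ^ 3))) := by
  have h0 := norm_nonneg w
  have hr0 : 0 ≤ r := h0.trans hw
  have hr3 : r ^ 3 < 1 := pow_lt_one₀ hr0 hr (by norm_num)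
  have hw3 : ‖w ^ 3‖ ≤ r ^ 3 := by rw [norm_pow]; gcongr
  have mono : ∀ {v : ℂ} {s : ℝ}, ‖v‖ ≤ s → s < 1 → ‖eulerProd v‖ ≤ Real.exp (s / (1 - s)) := by
    intro v s h1 h2
    refine (norm_eulerProd_le (h1.trans_lt h2)).trans (Real.exp_le_exp.2 ?_)
    have := norm_nonneg v
    apply div_le_div₀ (by linarith) h1 (by linarith) (by linarith)
  rw [betaQ, norm_mul, norm_pow, norm_pow]
  calc _ ≤ Real.exp (r / (1 - r)) ^ 6 * Real.exp (r ^ 3 / (1 - r ^ 3)) ^ 6 := by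
        gcongr
        · exact mono hw hr
        · exact mono hw3 hr3
    _ = _ := by rw [← Real.exp_nat_mul, ← Real.exp_nat_mul, ← Real.exp_add]; congr 1; push_cast; ring

lemma le_norm_eulerProd_of_le {v : ℂ} {s : ℝ} (h1 : ‖v‖ ≤ s) (h2 : s < 1) :
    1 - s / (1 - s) ≤ ‖eulerProd v‖ := by
  refine le_trans ?_ (le_norm_eulerProd (h1.trans_lt h2))
  have := norm_nonneg v
  have : ‖v‖ / (1 - ‖v‖) ≤ s / (1 - s) :=
    div_le_div₀ (by linarith) h1 (by linarith) (by linarith)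
  linarith

lemma le_norm_betaQ {w : ℂ} {r : ℝ} (hw : ‖w‖ ≤ r) (hr : r ≤ 1 / 2) :
    ((1 - r / (1 - r)) * (1 - r ^ 3 / (1 - r ^ 3))) ^ 6 ≤ ‖betaQ w‖ := by
  have h0 := norm_nonneg w
  have hr0 : 0 ≤ r := h0.trans hw
  have hr3 : r ^ 3 ≤ 1 / 2 := by
    calc r ^ 3 ≤ (1 / 2) ^ 3 := by gcongr
      _ ≤ _ := by norm_num
  have hw3 : ‖w ^ 3‖ ≤ r ^ 3 := by rw [norm_pow]; gcongr
  have pos : ∀ s : ℝ, s ≤ 1 / 2 → 0 ≤ 1 - s / (1 - s) := fun s hs => by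
    have : s / (1 - s) ≤ 1 := by rw [div_le_one (by linarith)]; linarith
    linarith
  rw [betaQ, norm_mul, norm_pow, norm_pow, mul_pow]
  have h1 := le_norm_eulerProd_of_le hw (by linarith)
  have h2 := le_norm_eulerProd_of_le hw3 (by linarith)
  have p1 := pos r hr
  have p2 := pos _ hr3
  gcongr

lemma norm_hauptQ_add_le {w : ℂ} {r u₀ : ℝ} (hw : ‖w‖ ≤ r) (hr : r ≤ 1 / 12) (hu : 0 < u₀)
    (hu₀ : u₀ ≤ ‖upsQ w‖) :
    ‖upsQ w‖ + ‖729 * w ^ 2 / upsQ w‖ ≤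
      1 + 12 * r + 54 * r ^ 2 + 600 * r ^ 3 + 729 * r ^ 2 / u₀ := by
  have h0 := norm_nonneg w
  have hr0 : 0 ≤ r := h0.trans hw
  have h1 : ‖upsQ w‖ ≤ 1 + 12 * r + 54 * r ^ 2 + 600 * r ^ 3 := by
    have h := norm_upsQ_sub_le (hw.trans hr)
    have h2 : ‖upsQ w‖ ≤ ‖upsQ w - (1 - 12 * w + 54 * w ^ 2)‖ + ‖(1 - 12 * w + 54 * w ^ 2 : ℂ)‖ :=
      norm_le_norm_sub_add' _ _
    have h3 : ‖(1 - 12 * w + 54 * w ^ 2 : ℂ)‖ ≤ 1 + 12 * ‖w‖ + 54 * ‖w‖ ^ 2 := by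
      refine (norm_add_le _ _).trans ?_
      refine add_le_add ((norm_sub_le _ _).trans ?_) ?_
      · rw [norm_mul, norm_one]; norm_num
      · rw [norm_mul, norm_pow]; norm_num
    calc ‖upsQ w‖ ≤ 600 * ‖w‖ ^ 3 + (1 + 12 * ‖w‖ + 54 * ‖w‖ ^ 2) := by linarith
      _ ≤ 600 * r ^ 3 + (1 + 12 * r + 54 * r ^ 2) := by gcongr
      _ = _ := by ring
  have h2 : ‖729 * w ^ 2 / upsQ w‖ ≤ 729 * r ^ 2 / u₀ := by
    rw [norm_div, norm_mul, norm_pow]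
    norm_num
    gcongr
  linarith

/-- Bounds for the generating forms from a bound for the weight six ones. -/
lemma IsSeed.norm_le {ρ ε : ℤ} {A A' : ℂ → ℂ} (h : IsSeed ρ ε A A') {w : ℂ} {a : ℝ} (ha : 1 ≤ a)
    (h1 : ‖eisQ w‖ ≤ a) (h2 : ‖oddQ w‖ ≤ a ^ 3) (h3 : ‖thetaQ w‖ ≤ a ^ 2) :
    ‖A w‖ ≤ a ^ 4 ∧ ‖A' w‖ ≤ a ^ 4 := by
  have p1 : a ≤ a ^ 4 := le_self_pow₀ ha (by norm_num)
  have p2 : a ^ 2 ≤ a ^ 4 := pow_le_pow_right₀ ha (by norm_num)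
  have p3 : a ^ 3 ≤ a ^ 4 := pow_le_pow_right₀ ha (by norm_num)
  have p0 : 1 ≤ a ^ 4 := one_le_pow₀ ha
  have a0 : 0 ≤ a := by linarith
  have q1 : ‖eisQ w * eisQ w‖ ≤ a ^ 4 := by
    rw [norm_mul]
    calc _ ≤ a * a := by gcongr
      _ = a ^ 2 := by ring
      _ ≤ _ := p2
  have q2 : ‖eisQ w * oddQ w‖ ≤ a ^ 4 := by
    rw [norm_mul]
    calc _ ≤ a * a ^ 3 := by gcongr
      _ = _ := by ring
  cases h <;> constructor <;> first | (simpa using p0) | linarith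

/-- By the relations for e³ and θ², one bound a³ for the weight six quantities B(j ± 54) controls
every form by a to half its weight. -/
lemma eis_theta_bounds {e t a : ℝ} (_ : 0 ≤ e) (_ : 0 ≤ t) (ha : 1 ≤ a) (h1 : e ^ 3 ≤ a ^ 3)
    (h2 : t ^ 2 ≤ a ^ 3 * e) : e ≤ a ∧ t ≤ a ^ 2 := by
  have h3 : e ≤ a := by
    by_contra h
    push Not at h
    have : a ^ 3 < e ^ 3 := by gcongr
    linarith
  refine ⟨h3, ?_⟩
  by_contra h
  push Not at h
  have a0 : 0 ≤ a := by linarith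
  have h4 : (a ^ 2) ^ 2 < t ^ 2 := by gcongr
  have h5 : a ^ 3 * e ≤ a ^ 3 * a := by gcongr
  have : (a ^ 2) ^ 2 = a ^ 3 * a := by ring
  linarith

/-- Bounds near the cusp. -/
lemma forms_norm_le {w : ℂ} (hw : w ∈ ball (0 : ℂ) 1) {a M : ℝ} (ha : 1 ≤ a)
    (hM : ‖betaQ w‖ * (‖upsQ w‖ + ‖729 * w ^ 2 / upsQ w‖ + 54 * ‖w‖) ≤ M) (hMa : M ≤ a ^ 3) :
    ‖eisQ w‖ ≤ a ∧ ‖oddQ w‖ ≤ a ^ 3 ∧ ‖thetaQ w‖ ≤ a ^ 2 := by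
  have hb := norm_nonneg (betaQ w)
  have hι : ‖hauptQ w‖ ≤ ‖upsQ w‖ + ‖729 * w ^ 2 / upsQ w‖ := norm_add_le _ _
  have hδ : ‖upsQ w - 729 * w ^ 2 / upsQ w‖ ≤ ‖upsQ w‖ + ‖729 * w ^ 2 / upsQ w‖ := norm_sub_le _ _
  have h54 : ‖54 * w‖ = 54 * ‖w‖ := by rw [norm_mul]; norm_num
  have hp : ‖hauptQ w + 54 * w‖ ≤ ‖upsQ w‖ + ‖729 * w ^ 2 / upsQ w‖ + 54 * ‖w‖ :=
    (norm_add_le _ _).trans (by linarith)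
  have hm : ‖hauptQ w - 54 * w‖ ≤ ‖upsQ w‖ + ‖729 * w ^ 2 / upsQ w‖ + 54 * ‖w‖ :=
    (norm_sub_le _ _).trans (by linarith)
  have h1 : ‖eisQ w‖ ^ 3 ≤ a ^ 3 := by
    rw [← norm_pow, eisQ_cube hw, norm_mul]
    exact (mul_le_mul_of_nonneg_left hp hb).trans (hM.trans hMa)
  have h2 : ‖thetaQ w‖ ^ 2 ≤ a ^ 3 * ‖eisQ w‖ := by
    rw [← norm_pow, thetaQ_sq hw, norm_mul, norm_mul]
    gcongr
    exact (mul_le_mul_of_nonneg_left hm hb).trans (hM.trans hMa)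
  obtain ⟨h3, h4⟩ := eis_theta_bounds (norm_nonneg _) (norm_nonneg _) ha h1 h2
  refine ⟨h3, ?_, h4⟩
  rw [oddQ, norm_mul]
  refine (mul_le_mul_of_nonneg_left ?_ hb).trans (hM.trans hMa)
  linarith [norm_nonneg w]

/-- Bounds on the arc. -/
lemma forms_norm_le_arc {θ : ℝ} (him : 0 < (arcPt θ).im) {a : ℝ} (ha : 1 ≤ a)
    (hB : 108 * ‖qf 1 betaQ (arcPt θ)‖ ≤ a ^ 3) :
    ‖eisQ (nome (arcPt θ))‖ ≤ a ∧ ‖oddQ (nome (arcPt θ))‖ ≤ a ^ 3 ∧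
      ‖thetaQ (nome (arcPt θ))‖ ≤ a ^ 2 := by
  have hu := norm_hauptU_eq_one him (normSq_arcPt θ)
  have hui : ‖(hauptU (arcPt θ))⁻¹‖ = 1 := by rw [norm_inv, hu, inv_one]
  have hB0 := norm_nonneg (qf 1 betaQ (arcPt θ))
  have hj : ‖hauptJ (arcPt θ)‖ ≤ 54 := by
    rw [hauptJ, norm_mul]
    have := norm_add_le (hauptU (arcPt θ)) (hauptU (arcPt θ))⁻¹
    norm_num
    linarith
  have h54 : ‖(54 : ℂ)‖ = 54 := by norm_num
  have h1 : ‖eisQ (nome (arcPt θ))‖ ^ 3 ≤ a ^ 3 := by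
    rw [← norm_pow, cubic_eis him, norm_mul]
    have := norm_add_le (hauptJ (arcPt θ)) 54
    nlinarith
  have h2 : ‖thetaQ (nome (arcPt θ))‖ ^ 2 ≤ a ^ 3 * ‖eisQ (nome (arcPt θ))‖ := by
    rw [← norm_pow, sq_theta him, norm_mul, norm_mul]
    gcongr
    have := norm_sub_le (hauptJ (arcPt θ)) 54
    nlinarith
  obtain ⟨h3, h4⟩ := eis_theta_bounds (norm_nonneg _) (norm_nonneg _) ha h1 h2
  refine ⟨h3, ?_, h4⟩
  rw [oddQ_eq him, norm_mul, norm_mul]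
  have := norm_sub_le (hauptU (arcPt θ)) (hauptU (arcPt θ))⁻¹
  norm_num
  nlinarith

/-- Distance of `j` from a value on the arc, through `27u`. -/
lemma sq_le_norm_mul_norm_hauptJ_sub {τ : ℂ} (him : 0 < τ.im) {c D : ℝ} (hc : |c| ≤ 1) (hD : 0 ≤ D)
    (h : D ≤ ‖27 * hauptU τ‖ - 27 ∨ D ≤ |(27 * hauptU τ).re - 27 * c|) :
    D ^ 2 ≤ ‖27 * hauptU τ‖ * ‖hauptJ τ - ((54 * c : ℝ) : ℂ)‖ := by
  have hu := hauptU_ne_zero him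
  set s := √(1 - c ^ 2) with hs
  have hc2 : c ^ 2 ≤ 1 := (sq_le_one_iff_abs_le_one c).2 hc
  have hs2 : s ^ 2 = 1 - c ^ 2 := Real.sq_sqrt (by linarith)
  have key : ∀ t : ℝ, t ^ 2 = 1 - c ^ 2 → D ≤ ‖27 * hauptU τ - 27 * (⟨c, t⟩ : ℂ)‖ := by
    intro t ht
    rcases h with h | h
    · have h1 : ‖(27 * (⟨c, t⟩ : ℂ))‖ = 27 := by
        have h2 : ‖(⟨c, t⟩ : ℂ)‖ ^ 2 = 1 := by
          rw [← normSq_eq_norm_sq, normSq_mk]; linarith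
        have h3 : ‖(⟨c, t⟩ : ℂ)‖ = 1 := by nlinarith [norm_nonneg (⟨c, t⟩ : ℂ)]
        rw [norm_mul, h3]; norm_num
      have := norm_sub_norm_le (27 * hauptU τ) (27 * (⟨c, t⟩ : ℂ))
      linarith
    · refine h.trans ?_
      have := abs_re_le_norm (27 * hauptU τ - 27 * (⟨c, t⟩ : ℂ))
      simpa [sub_re, mul_re] using this
  -- u(u + 1/u - 2c) = (u - e^{iφ})(u - e^{-iφ}) with c = cos φ.
  have e : 27 * hauptU τ * (hauptJ τ - ((54 * c : ℝ) : ℂ)) =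
      (27 * hauptU τ - 27 * (⟨c, s⟩ : ℂ)) * (27 * hauptU τ - 27 * (⟨c, -s⟩ : ℂ)) := by
    have e1 : (⟨c, s⟩ : ℂ) + ⟨c, -s⟩ = ((2 * c : ℝ) : ℂ) := by
      apply Complex.ext <;> simp; ring
    have e2 : (⟨c, s⟩ : ℂ) * ⟨c, -s⟩ = 1 := by
      apply Complex.ext
      · simp; nlinarith
      · simp; ring
    rw [hauptJ]
    push_cast at e1 ⊢
    field_simp
    linear_combination (27 * hauptU τ) * e1 - 27 * e2
  rw [← norm_mul, e, norm_mul, sq]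
  have k1 := key s hs2
  have k2 := key (-s) (by rw [neg_sq]; exact hs2)
  gcongr

/-! ### Invariants of the extended group, and high representatives of the contours. -/

/-- Functions on the upper half plane invariant under `τ ↦ -1/(3τ)`, integer translations and
reflection in the imaginary axis. -/
structure IsInvariant (N : ℂ → ℝ) : Prop where
  fricke : ∀ τ : ℂ, 0 < τ.im → N (fricke τ) = N τ
  add_int : ∀ (τ : ℂ) (n : ℤ), N (τ + n) = N τ
  neg_conj : ∀ τ : ℂ, 0 < τ.im → N (-conj τ) = N τ

/-- `τ'` cannot be told from `τ` by an invariant function. -/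
def Related (τ τ' : ℂ) : Prop := ∀ N, IsInvariant N → N τ' = N τ

namespace Related

variable {τ τ' : ℂ}

lemma refl (τ : ℂ) : Related τ τ := fun _ _ => rfl

lemma fricke (h : Related τ τ') (him : 0 < τ'.im) : Related τ (fricke τ') := fun N hN => by
  rw [hN.fricke _ him, h N hN]

lemma add_int (h : Related τ τ') (n : ℤ) : Related τ (τ' + n) := fun N hN => by
  rw [hN.add_int, h N hN]

lemma neg_conj (h : Related τ τ') (him : 0 < τ'.im) : Related τ (-conj τ') := fun N hN => by
  rw [hN.neg_conj _ him, h N hN]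

end Related

lemma norm_three_sq_zpow (τ : ℂ) (κ : ℤ) : ‖(3 * τ ^ 2) ^ κ‖ = (3 * normSq τ) ^ κ := by
  rw [norm_zpow, norm_mul, norm_pow, ← normSq_eq_norm_sq]
  norm_num

/-- Since Im Wτ = Im τ/(3|τ|²), the quantity y^κ|f| forgets the automorphy factor. It carries bounds
from a representative with small nome down to the contour. -/
lemma QForm.isInvariant {κ n : ℤ} {σ : ℂ} {g : ℂ → ℂ} (hg : QForm κ σ n g) (hσ : ‖σ‖ = 1) :
    IsInvariant fun τ => τ.im ^ κ * ‖qf n g τ‖ where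
  fricke τ him := by
    have h0 : 3 * normSq τ ≠ 0 := by
      have := normSq_pos.2 (ne_zero_of_im_pos him)
      positivity
    have h1 := zpow_ne_zero κ h0
    rw [hg.trans τ him, norm_mul, norm_mul, hσ, norm_three_sq_zpow, fricke_im, div_zpow]
    field_simp
  add_int τ n := by simp only [qf, nome_add_int, add_im, intCast_im, add_zero]
  neg_conj τ him := by
    rw [qf_neg_conj hg.toDiscReal _ him, norm_conj, neg_conj_im]

lemma isInvariant_hauptJ_sub (c : ℝ) : IsInvariant fun τ => ‖hauptJ τ - c‖ where
  fricke τ him := by rw [hauptJ_fricke him]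
  add_int τ n := by rw [hauptJ, hauptJ, hauptU_add_int]
  neg_conj τ him := by
    have : hauptJ (-conj τ) - c = conj (hauptJ τ - c) := by
      rw [hauptJ, hauptJ, hauptU_neg_conj him]
      simp [map_ofNat]
    rw [this, norm_conj]

lemma exists_related_strip {τ : ℂ} (him : 0 < τ.im) :
    ∃ τ', Related τ τ' ∧ τ'.im = τ.im ∧ 0 ≤ τ'.re ∧ τ'.re ≤ 1 / 2 := by
  have h := abs_le.1 (abs_sub_round τ.re)
  have h1 := (Related.refl τ).add_int (-round τ.re)
  have e1 : (τ + ((-round τ.re : ℤ) : ℂ)).re = τ.re - round τ.re := by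
    simp [sub_eq_add_neg]
  have e2 : (τ + ((-round τ.re : ℤ) : ℂ)).im = τ.im := by simp
  rcases le_total 0 (τ.re - round τ.re) with h0 | h0
  · exact ⟨_, h1, e2, by rw [e1]; exact h0, by rw [e1]; exact h.2⟩
  · refine ⟨_, h1.neg_conj (by rw [e2]; exact him), by rw [neg_conj_im, e2], ?_, ?_⟩
    · rw [neg_re, conj_re, e1]; linarith
    · rw [neg_re, conj_re, e1]; linarith

lemma fricke_re (τ : ℂ) : (fricke τ).re = -(τ.re / (3 * normSq τ)) := by
  rw [fricke, div_eq_mul_inv, mul_inv]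
  simp [inv_re, neg_mul]
  ring

set_option maxHeartbeats 1000000 in
/-- Representatives of the line `Im τ = 1/9` high in the upper half plane. -/
theorem exists_related_of_im_eq_ninth {τ : ℂ} (him : τ.im = 1 / 9) :
    ∃ τ', Related τ τ' ∧ 11 / 20 ≤ τ'.im ∧ τ'.im ≤ 3 ∧ (59 / 100 ≤ τ'.im ∨ |τ'.re| ≤ 1 / 5) := by
  obtain ⟨σ, hσ, hi, hx0, hx1⟩ := exists_related_strip (τ := τ) (by rw [him]; norm_num)
  rw [him] at hi
  set x := σ.re with hx
  have hpos : 0 < σ.im := by rw [hi]; norm_num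
  have hns : normSq σ = x ^ 2 + 1 / 81 := by rw [normSq_apply, hi, ← hx]; ring
  have hWim : (fricke σ).im = 3 / (81 * x ^ 2 + 1) := by
    rw [fricke_im, hns, hi]; field_simp; ring
  have hWre : (fricke σ).re = -(27 * x / (81 * x ^ 2 + 1)) := by
    rw [fricke_re, hns, ← hx]; field_simp; ring
  have hWpos := fricke_im_pos hpos
  have hW1 : 0 < (fricke σ + (1 : ℤ)).im := by simpa using hWpos
  have hVrel := ((hσ.fricke hpos).add_int 1).fricke hW1
  set V := fricke (fricke σ + (1 : ℤ)) with hV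
  set s := 1 - 3 * x with hs
  have hd : 0 < 81 * x ^ 2 + 1 := by positivity
  have hn1 : normSq (fricke σ + (1 : ℤ)) = (9 * s ^ 2 + 1) / (81 * x ^ 2 + 1) := by
    rw [normSq_apply, add_re, add_im, hWim, hWre, hs]
    simp only [intCast_re, intCast_im]
    push_cast
    field_simp
    ring
  have hVim : V.im = 1 / (9 * s ^ 2 + 1) := by
    rw [hV, fricke_im, hn1, add_im, hWim]
    simp only [intCast_im]
    field_simp
    ring
  have hVre : V.re = -(1 / 3) + 3 * s / (9 * s ^ 2 + 1) := by
    rw [hV, fricke_re, hn1, add_re, hWre]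
    simp only [intCast_re]
    push_cast
    rw [hs]
    field_simp
    ring
  have hVpos := fricke_im_pos hW1
  rw [← hV] at hVpos
  have hds : 0 < 9 * s ^ 2 + 1 := by positivity
  -- Three ranges of x, according to whether the point is close to 0, 1/3 or 1/2. Here one
  -- application of W gives height 3/(81x² + 1). Whenever the height falls below 0.59, a translation
  -- brings the real part within 1/5 of 0 if it is not there already.
  rcases le_total x (234 / 1000) with h1 | h1
  · have ub : (fricke σ).im ≤ 3 := by
      rw [hWim, div_le_iff₀ hd]; nlinarith [sq_nonneg x]
    have lb : 11 / 20 ≤ (fricke σ).im := by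
      rw [hWim, le_div_iff₀ hd]; nlinarith
    rcases le_or_gt (59 / 100) (fricke σ).im with h2 | h2
    · exact ⟨_, hσ.fricke hpos, lb, ub, Or.inl h2⟩
    · have hx2 : 2245 / 10000 ≤ x := by
        rw [hWim, div_lt_iff₀ hd] at h2
        by_contra hc
        push Not at hc
        nlinarith
      refine ⟨_, (hσ.fricke hpos).add_int 1, by simpa using lb, by simpa using ub, Or.inr ?_⟩
      have e : (fricke σ + (1 : ℤ)).re = 1 - 27 * x / (81 * x ^ 2 + 1) := by
        rw [add_re, hWre]; simp only [intCast_re]; push_cast; ring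
      rw [e, abs_le]
      constructor
      · have : 27 * x / (81 * x ^ 2 + 1) ≤ 6 / 5 := by rw [div_le_iff₀ hd]; nlinarith
        linarith
      · have : 4 / 5 ≤ 27 * x / (81 * x ^ 2 + 1) := by rw [le_div_iff₀ hd]; nlinarith
        linarith
  -- Close to 1/3 two applications of W, separated by a translation, give height 1/(9(1 - 3x)² + 1).
  rcases le_total x (4335 / 10000) with h3 | h3
  · have hs1 : s ≤ 298 / 1000 := by linarith
    have hs2 : -(3005 / 10000) ≤ s := by linarith
    have hss : s ^ 2 ≤ (3005 / 10000) ^ 2 := by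
      apply sq_le_sq'
      · linarith
      · linarith
    have ub : V.im ≤ 3 := by
      rw [hVim, div_le_iff₀ hds]; nlinarith [sq_nonneg s]
    have lb : 11 / 20 ≤ V.im := by
      rw [hVim, le_div_iff₀ hds]; nlinarith
    rcases le_or_gt (59 / 100) V.im with h2 | h2
    · exact ⟨_, hVrel, lb, ub, Or.inl h2⟩
    · rw [hVim, div_lt_iff₀ hds] at h2
      rcases le_total 0 s with h4 | h4
      · have h5 : 2778 / 10000 ≤ s := by
          by_contra hc
          push Not at hc
          nlinarith
        refine ⟨_, hVrel, lb, ub, Or.inr ?_⟩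
        rw [hVre, abs_le]
        constructor
        · have : 2 / 15 ≤ 3 * s / (9 * s ^ 2 + 1) := by rw [le_div_iff₀ hds]; nlinarith
          linarith
        · have : 3 * s / (9 * s ^ 2 + 1) ≤ 8 / 15 := by
            rw [div_le_iff₀ hds]; nlinarith [sq_nonneg (s - 3 / 10)]
          linarith
      · have h5 : s ≤ -(2778 / 10000) := by
          by_contra hc
          push Not at hc
          nlinarith
        refine ⟨_, hVrel.add_int 1, by simpa using lb, by simpa using ub, Or.inr ?_⟩
        have e : (V + (1 : ℤ)).re = 2 / 3 + 3 * s / (9 * s ^ 2 + 1) := by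
          rw [add_re, hVre]; simp only [intCast_re]; push_cast; ring
        rw [e, abs_le]
        constructor
        · have : -(13 / 15) ≤ 3 * s / (9 * s ^ 2 + 1) := by
            rw [le_div_iff₀ hds]; nlinarith [sq_nonneg (s + 3 / 10)]
          linarith
        · have : 3 * s / (9 * s ^ 2 + 1) ≤ -(7 / 15) := by rw [div_le_iff₀ hds]; nlinarith
          linarith
  -- Close to 1/2 a further translation and W give height 3/(81p² + 4).
  · set p := 1 - 2 * x with hp
    have hp0 : 0 ≤ p := by linarith
    have hp1 : p ≤ 133 / 1000 := by linarith
    have hdp : 0 < 81 * p ^ 2 + 4 := by positivity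
    have hV1 : 0 < (V + (1 : ℤ)).im := by simpa using hVpos
    have hn2 : normSq (V + (1 : ℤ)) = (81 * p ^ 2 + 4) / (9 * (9 * s ^ 2 + 1)) := by
      rw [normSq_apply, add_re, add_im, hVim, hVre, hp]
      simp only [intCast_re, intCast_im]
      push_cast
      rw [hs] at hds ⊢
      field_simp
      ring
    have hXim : (fricke (V + (1 : ℤ))).im = 3 / (81 * p ^ 2 + 4) := by
      rw [fricke_im, hn2, add_im, hVim]
      simp only [intCast_im]
      field_simp
      ring
    have hXre : (fricke (V + (1 : ℤ))).re = -(1 / 2) + 81 * p / (6 * (81 * p ^ 2 + 4)) := by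
      rw [fricke_re, hn2, add_re, hVre]
      simp only [intCast_re]
      push_cast
      have : s = 3 / 2 * p - 1 / 2 := by rw [hs, hp]; ring
      rw [this] at hds ⊢
      field_simp
      ring
    have ub : (fricke (V + (1 : ℤ))).im ≤ 3 := by
      rw [hXim, div_le_iff₀ hdp]; nlinarith [sq_nonneg p]
    have lb : 11 / 20 ≤ (fricke (V + (1 : ℤ))).im := by
      rw [hXim, le_div_iff₀ hdp]; nlinarith
    refine ⟨_, (hVrel.add_int 1).fricke hV1, lb, ub, ?_⟩
    rcases le_or_gt (59 / 100) (fricke (V + (1 : ℤ))).im with h2 | h2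
    · exact Or.inl h2
    · right
      have hp2 : 1157 / 10000 ≤ p := by
        rw [hXim, div_lt_iff₀ hdp] at h2
        by_contra hc
        push Not at hc
        nlinarith
      have hdp6 : 0 < 6 * (81 * p ^ 2 + 4) := by positivity
      rw [hXre, abs_le]
      constructor
      · have : 3 / 10 ≤ 81 * p / (6 * (81 * p ^ 2 + 4)) := by rw [le_div_iff₀ hdp6]; nlinarith
        linarith
      · have : 81 * p / (6 * (81 * p ^ 2 + 4)) ≤ 7 / 10 := by
          rw [div_le_iff₀ hdp6]; nlinarith [sq_nonneg (p - 1 / 8)]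
        linarith

/-- Representatives of the line `Im τ = 2/5`. -/
theorem exists_related_of_im_eq_two_fifths {τ : ℂ} (him : τ.im = 2 / 5) :
    ∃ τ', Related τ τ' ∧ ((599 / 1000 ≤ τ'.im ∧ τ'.im ≤ 5 / 6) ∨
      (τ'.im = 2 / 5 ∧ 1 / 4 ≤ τ'.re ∧ τ'.re ≤ 1 / 2)) := by
  obtain ⟨σ, hσ, hi, hx0, hx1⟩ := exists_related_strip (τ := τ) (by rw [him]; norm_num)
  rw [him] at hi
  have hpos : 0 < σ.im := by rw [hi]; norm_num
  have hns : normSq σ = σ.re ^ 2 + 4 / 25 := by rw [normSq_apply, hi]; ring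
  have hd : 0 < 3 * (σ.re ^ 2 + 4 / 25) := by positivity
  -- For x ≤ 1/4, W raises the height to between 0.599 (x = 1/4) and 5/6 (x = 0). For larger x the
  -- point is left in place and its real part is exploited.
  rcases le_total (1 / 4) σ.re with h | h
  · exact ⟨σ, hσ, Or.inr ⟨hi, h, hx1⟩⟩
  · refine ⟨_, hσ.fricke hpos, Or.inl ⟨?_, ?_⟩⟩
    · rw [fricke_im, hns, hi, le_div_iff₀ hd]; nlinarith
    · rw [fricke_im, hns, hi, div_le_iff₀ hd]; nlinarith [sq_nonneg σ.re]

/-! ### Numerical bounds on the integrand along the lines Im τ = 1/9 and Im τ = 2/5. -/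

lemma le_exp_of_le {n : ℕ} {t x : ℝ} (ht : 0 ≤ t) (h : n + t ≤ x) :
    2.7182818 ^ n * (1 + t + t ^ 2 / 2 + t ^ 3 / 6) ≤ Real.exp x := by
  refine le_trans ?_ (Real.exp_le_exp.2 h)
  rw [Real.exp_add, ← mul_one (n : ℝ), Real.exp_nat_mul]
  have h1 : (2.7182818 : ℝ) ≤ Real.exp 1 := by have := Real.exp_one_gt_d9; linarith
  have h2 := Real.sum_le_exp_of_nonneg ht 4
  have h3 : ∑ i ∈ Finset.range 4, t ^ i / i.factorial = 1 + t + t ^ 2 / 2 + t ^ 3 / 6 := by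
    simp [Finset.sum_range_succ, Nat.factorial]
  rw [h3] at h2
  gcongr

lemma exp_le_of_le {n : ℕ} {x : ℝ} (h : x ≤ n) : Real.exp x ≤ 2.7182818286 ^ n := by
  refine (Real.exp_le_exp.2 h).trans ?_
  rw [← mul_one (n : ℝ), Real.exp_nat_mul]
  have h1 : Real.exp 1 ≤ 2.7182818286 := by have := Real.exp_one_lt_d9; linarith
  gcongr

lemma norm_nome_eq_inv (τ : ℂ) : ‖nome τ‖ = (Real.exp (2 * Real.pi * τ.im))⁻¹ := by
  rw [norm_nome, Real.exp_neg]

lemma norm_nome_le_of_le {τ : ℂ} {x a : ℝ} (ha : 0 < a) (hx : a ≤ Real.exp x)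
    (h : x ≤ 2 * Real.pi * τ.im) : ‖nome τ‖ ≤ 1 / a := by
  rw [norm_nome_eq_inv, one_div]
  gcongr
  exact hx.trans (Real.exp_le_exp.2 h)

lemma nome_re (τ : ℂ) : (nome τ).re = ‖nome τ‖ * Real.cos (2 * Real.pi * τ.re) := by
  rw [norm_nome, nome, exp_re]
  congr 2 <;> simp

lemma nome_inv_re (τ : ℂ) : (nome τ)⁻¹.re = ‖nome τ‖⁻¹ * Real.cos (2 * Real.pi * τ.re) := by
  have h0 : ‖nome τ‖ ≠ 0 := norm_ne_zero_iff.2 (nome_ne_zero τ)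
  rw [inv_re, normSq_eq_norm_sq, nome_re]
  field_simp

lemma inv_norm_nome_le {τ : ℂ} (hr : ‖nome τ‖ ≤ 1 / 12) :
    ‖nome τ‖⁻¹ ≤ ‖27 * hauptU τ‖ + 12 + 54 * ‖nome τ‖ + 600 * ‖nome τ‖ ^ 2 := by
  have h := norm_hauptU_sub_le hr
  set w := nome τ
  have e : w⁻¹ = 27 * hauptU τ - (27 * hauptU τ - (w⁻¹ - 12 + 54 * w)) + 12 - 54 * w := by ring
  have h1 : ‖w⁻¹‖ ≤ ‖27 * hauptU τ‖ + ‖27 * hauptU τ - (w⁻¹ - 12 + 54 * w)‖ + ‖(12 : ℂ)‖ +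
      ‖54 * w‖ := by
    rw [e]
    refine (norm_sub_le _ _).trans (add_le_add ((norm_add_le _ _).trans
      (add_le_add ((norm_sub_le _ _).trans ?_) le_rfl)) le_rfl)
    rw [← e]
  rw [norm_inv, norm_mul 54] at h1
  norm_num at h1 ⊢
  linarith

lemma norm_hauptU_le {τ : ℂ} (hr : ‖nome τ‖ ≤ 1 / 12) :
    ‖27 * hauptU τ‖ ≤ ‖nome τ‖⁻¹ + 12 + 54 * ‖nome τ‖ + 600 * ‖nome τ‖ ^ 2 := by
  have h := norm_hauptU_sub_le hr
  set w := nome τ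
  have h1 := norm_le_norm_sub_add' (27 * hauptU τ) (w⁻¹ - 12 + 54 * w)
  have h2 : ‖w⁻¹ - 12 + 54 * w‖ ≤ ‖w⁻¹‖ + ‖(12 : ℂ)‖ + ‖54 * w‖ :=
    (norm_add_le _ _).trans (add_le_add (norm_sub_le _ _) le_rfl)
  rw [norm_inv, norm_mul 54] at h2
  norm_num at h2 h1 ⊢
  linarith

lemma abs_re_hauptU_sub_le {τ : ℂ} (hr : ‖nome τ‖ ≤ 1 / 12) :
    |(27 * hauptU τ).re - ((‖nome τ‖⁻¹ + 54 * ‖nome τ‖) * Real.cos (2 * Real.pi * τ.re) - 12)| ≤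
      600 * ‖nome τ‖ ^ 2 := by
  refine le_trans (le_of_eq ?_) ((abs_re_le_norm _).trans (norm_hauptU_sub_le hr))
  congr 1
  have : (54 * nome τ).re = 54 * (nome τ).re := by simp
  rw [sub_re, add_re, sub_re, this, nome_re, nome_inv_re]
  norm_num
  ring

lemma sub_le_norm_hauptU {τ : ℂ} {X : ℝ} (hr : ‖nome τ‖ ≤ 1 / 12)
    (h : X ^ 2 ≤ ‖nome τ‖⁻¹ ^ 2 - 24 * (‖nome τ‖⁻¹ * Real.cos (2 * Real.pi * τ.re)) + 144) :
    X - 54 * ‖nome τ‖ - 600 * ‖nome τ‖ ^ 2 ≤ ‖27 * hauptU τ‖ := by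
  have h0 := norm_hauptU_sub_le hr
  have h1 : X ≤ ‖(nome τ)⁻¹ - 12‖ := by
    refine le_of_sq_le_sq ?_ (norm_nonneg _)
    refine h.trans (le_of_eq ?_)
    rw [← normSq_eq_norm_sq, ← nome_inv_re, ← norm_inv, ← normSq_eq_norm_sq, normSq_apply,
      normSq_apply, sub_re, sub_im]
    norm_num
    ring
  set w := nome τ
  have e : w⁻¹ - 12 = 27 * hauptU τ - (27 * hauptU τ - (w⁻¹ - 12 + 54 * w)) - 54 * w := by ring
  have h2 : ‖w⁻¹ - 12‖ ≤ ‖27 * hauptU τ‖ + ‖27 * hauptU τ - (w⁻¹ - 12 + 54 * w)‖ + ‖54 * w‖ := by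
    conv_lhs => rw [e]
    exact (norm_sub_le _ _).trans (add_le_add (norm_sub_le _ _) le_rfl)
  rw [norm_mul 54] at h2
  norm_num at h2 ⊢
  linarith

/-- The extreme case is cos(2π/5) = (√5 - 1)/4 > 0.3. -/
lemma three_tenths_le_cos {x : ℝ} (h : |x| ≤ 1 / 5) : 3 / 10 ≤ Real.cos (2 * Real.pi * x) := by
  have hpi := Real.pi_pos
  have h5 : (2.2 : ℝ) ≤ √5 := by
    apply Real.le_sqrt_of_sq_le; norm_num
  have h52 : √5 ^ 2 = (5 : ℝ) := Real.sq_sqrt (by norm_num)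
  have h1 : 3 / 10 ≤ Real.cos (2 * Real.pi / 5) := by
    rw [show 2 * Real.pi / 5 = 2 * (Real.pi / 5) by ring, Real.cos_two_mul, Real.cos_pi_div_five]
    nlinarith
  refine h1.trans ?_
  rw [← Real.cos_abs (2 * Real.pi * x)]
  have e : |2 * Real.pi * x| = 2 * Real.pi * |x| := by
    rw [abs_mul, abs_of_pos (by positivity)]
  rw [e]
  apply Real.cos_le_cos_of_nonneg_of_le_pi (by positivity) (by linarith)
  nlinarith

lemma IsSeed.eps_eq_or {ρ ε : ℤ} {A A' : ℂ → ℂ} (h : IsSeed ρ ε A A') : ε = 0 ∨ ε = 1 := by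
  cases h <;> simp

lemma IsSeed.exists_nat {ρ ε : ℤ} {A A' : ℂ → ℂ} (h : IsSeed ρ ε A A') :
    ∃ i : ℕ, i ≤ 4 ∧ 4 - ρ = i := by
  cases h
  exacts [⟨4, by norm_num⟩, ⟨2, by norm_num⟩, ⟨1, by norm_num⟩, ⟨3, by norm_num⟩, ⟨2, by norm_num⟩,
    ⟨0, by norm_num⟩]

/-- Transport of `|B|` and `|A'|` to a related point. -/
lemma IsSeed.norm_of_related {ρ ε : ℤ} {A A' : ℂ → ℂ} (h : IsSeed ρ ε A A') {τ τ' : ℂ}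
    (hrel : Related τ τ') (him : 0 < τ.im) :
    ‖qf 1 betaQ τ‖ = (τ'.im / τ.im) ^ 3 * (‖nome τ'‖ * ‖betaQ (nome τ')‖) ∧
      ∃ i : ℕ, i ≤ 4 ∧ ‖A' (nome τ)‖ = (τ'.im / τ.im) ^ i * ‖A' (nome τ')‖ := by
  obtain ⟨i, hi, hρ⟩ := h.exists_nat
  constructor
  · have := hrel _ (qform_betaQ.isInvariant (by simp))
    simp only [qf, zpow_one, norm_mul] at this ⊢
    rw [div_pow]
    field_simp
    have h3 : τ.im ^ 3 * (‖nome τ‖ * ‖betaQ (nome τ)‖) =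
        τ'.im ^ 3 * (‖nome τ'‖ * ‖betaQ (nome τ')‖) := by exact_mod_cast this.symm
    linear_combination h3
  · refine ⟨i, hi, ?_⟩
    have := hrel _ (h.qform'.isInvariant (by simp))
    simp only [qf, zpow_zero, one_mul, hρ, zpow_natCast] at this
    rw [div_pow]
    field_simp
    linear_combination -this

lemma betaQ_bounds_small {w : ℂ} (hw : ‖w‖ ≤ 1 / 31) : 0.81 ≤ ‖betaQ w‖ ∧ ‖betaQ w‖ ≤ 1.23 := by
  constructor
  · refine le_trans ?_ (le_norm_betaQ hw (by norm_num))
    norm_num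
  · refine (norm_betaQ_le hw (by norm_num)).trans ?_
    have h : (6 * ((1 / 31 : ℝ) / (1 - 1 / 31) + (1 / 31) ^ 3 / (1 - (1 / 31) ^ 3))) ≤ 0.201 := by
      norm_num
    refine (Real.exp_le_exp.2 h).trans ?_
    have h1 := (abs_le.1 (Real.abs_exp_sub_one_sub_id_le (x := 0.0201) (by norm_num [abs_le]))).2
    have h2 : Real.exp 0.0201 ≤ 1.0206 := by norm_num at h1 ⊢; linarith
    calc Real.exp 0.201 = Real.exp 0.0201 ^ 10 := by rw [← Real.exp_nat_mul]; norm_num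
      _ ≤ 1.0206 ^ 10 := by gcongr
      _ ≤ 1.23 := by norm_num

lemma IsSeed.norm_le_small {ρ ε : ℤ} {A A' : ℂ → ℂ} (h : IsSeed ρ ε A A') {w : ℂ}
    (hw : ‖w‖ ≤ 1 / 31) : ‖A' w‖ ≤ 10.5 := by
  have hw1 : w ∈ ball (0 : ℂ) 1 := by rw [mem_ball_zero_iff]; linarith
  have hb := (betaQ_bounds_small hw).2
  have h0 := norm_nonneg w
  have hu : 0.5 ≤ ‖upsQ w‖ := by
    have h1 := norm_upsQ_sub_le (w := w) (by linarith)
    have h2 : ‖(12 * w - 54 * w ^ 2 : ℂ)‖ ≤ 12 * ‖w‖ + 54 * ‖w‖ ^ 2 := by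
      refine (norm_sub_le _ _).trans (le_of_eq ?_)
      rw [norm_mul, norm_mul, norm_pow]; norm_num
    have h3 : ‖(1 : ℂ)‖ ≤ ‖upsQ w‖ + ‖upsQ w - (1 - 12 * w + 54 * w ^ 2)‖ +
        ‖(12 * w - 54 * w ^ 2 : ℂ)‖ := by
      have e : (1 : ℂ) = upsQ w - (upsQ w - (1 - 12 * w + 54 * w ^ 2)) + (12 * w - 54 * w ^ 2) := by
        ring
      conv_lhs => rw [e]
      exact (norm_add_le _ _).trans (add_le_add (norm_sub_le _ _) le_rfl)
    rw [norm_one] at h3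
    have h4 : 600 * ‖w‖ ^ 3 + (12 * ‖w‖ + 54 * ‖w‖ ^ 2) ≤
        600 * (1 / 31) ^ 3 + (12 * (1 / 31) + 54 * (1 / 31) ^ 2) := by gcongr
    norm_num at h4 ⊢
    linarith
  have hM := norm_hauptQ_add_le hw (by norm_num) (by norm_num) hu
  obtain ⟨b1, b2, b3⟩ := forms_norm_le hw1 (a := 1.8) (M := 1.23 * 4.74) (by norm_num) (by
    have : ‖upsQ w‖ + ‖729 * w ^ 2 / upsQ w‖ + 54 * ‖w‖ ≤ 4.74 := by
      norm_num at hM ⊢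
      linarith
    gcongr) (by norm_num)
  have := (h.norm_le (by norm_num) b1 b2 b3).2
  norm_num at this ⊢
  linarith

/-- y³e^{-2πy} is the size of y³|B| near the cusp. It decreases once 2πy ≥ 3. -/
lemma cube_mul_exp_le {a y : ℝ} (ha : 3 ≤ 2 * Real.pi * a) (hay : a ≤ y) :
    y ^ 3 * Real.exp (-(2 * Real.pi * y)) ≤ a ^ 3 * Real.exp (-(2 * Real.pi * a)) := by
  have hpi := Real.pi_pos
  have ha0 : 0 < a := by
    by_contra h
    push Not at h
    nlinarith
  have h1 : y / a ≤ Real.exp (y / a - 1) := by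
    have := Real.add_one_le_exp (y / a - 1)
    linarith
  have h2 : (y / a) ^ 3 ≤ Real.exp (2 * Real.pi * (y - a)) := by
    calc (y / a) ^ 3 ≤ Real.exp (y / a - 1) ^ 3 := by
          have : 0 ≤ y / a := div_nonneg (by linarith) ha0.le
          gcongr
      _ = Real.exp (3 * (y / a - 1)) := by rw [← Real.exp_nat_mul]; norm_num
      _ ≤ _ := by
        apply Real.exp_le_exp.2
        have e : y / a - 1 = (y - a) / a := by field_simp
        rw [e, mul_div_assoc', div_le_iff₀ ha0]
        nlinarith
  have h3 : y ^ 3 = a ^ 3 * (y / a) ^ 3 := by field_simp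
  rw [h3, mul_assoc]
  gcongr
  calc (y / a) ^ 3 * Real.exp (-(2 * Real.pi * y))
      ≤ Real.exp (2 * Real.pi * (y - a)) * Real.exp (-(2 * Real.pi * y)) := by gcongr
    _ = _ := by rw [← Real.exp_add]; congr 1; ring

lemma thirty_one_le_exp {y : ℝ} (hy : 11 / 20 ≤ y) : 31 ≤ Real.exp (2 * Real.pi * y) := by
  have hpi := Real.pi_gt_d4
  refine le_trans ?_ (le_exp_of_le (n := 3) (t := 0.45) (by norm_num) ?_)
  · norm_num
  · push_cast; nlinarith

lemma norm_nome_le_inv_31 {τ : ℂ} (hy : 11 / 20 ≤ τ.im) : ‖nome τ‖ ≤ 1 / 31 :=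
  norm_nome_le_of_le (by norm_num) (thirty_one_le_exp hy) le_rfl

/-- Lower bounds for `|ζ - 27e^{±iφ}|` where `ζ = 27u` and `cos φ ≤ -1/5`. -/
lemma near_dist {τ : ℂ} (h1 : 11 / 20 ≤ τ.im) (h2 : 59 / 100 ≤ τ.im ∨ |τ.re| ≤ 1 / 5) {c : ℝ}
    (hc : c ≤ -(1 / 5)) : 2 ≤ ‖27 * hauptU τ‖ - 27 ∨ 2 ≤ |(27 * hauptU τ).re - 27 * c| := by
  have hr := norm_nome_le_inv_31 h1
  have hr0 : 0 < ‖nome τ‖ := norm_pos_iff.2 (nome_ne_zero τ)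
  have hri : 31 ≤ ‖nome τ‖⁻¹ := by
    rw [norm_nome_eq_inv, inv_inv]; exact thirty_one_le_exp h1
  -- Use 27u ≈ 1/q - 12 + 54q. A large cosine puts Re 27u to the right of -5.4 ≥ 27c. A small one
  -- makes |1/q - 12| large, since 40² - 24 · 40 · 0.3 + 144 > 38².
  by_cases hcos : 3 / 10 ≤ Real.cos (2 * Real.pi * τ.re)
  · right
    have h3 := (abs_le.1 (abs_re_hauptU_sub_le (τ := τ) (by linarith))).1
    have h4 : 31 * (3 / 10) ≤ (‖nome τ‖⁻¹ + 54 * ‖nome τ‖) * Real.cos (2 * Real.pi * τ.re) := by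
      gcongr; linarith
    have h5 : ‖nome τ‖ ^ 2 ≤ (1 / 31) ^ 2 := by gcongr
    refine le_trans ?_ (le_abs_self _)
    norm_num at h5
    linarith
  · left
    push Not at hcos
    have h59 : 59 / 100 ≤ τ.im := by
      rcases h2 with h | h
      · exact h
      · exact absurd (three_tenths_le_cos h) (by linarith)
    have hpi := Real.pi_gt_d4
    have h40 : 40 ≤ ‖nome τ‖⁻¹ := by
      rw [norm_nome_eq_inv, inv_inv]
      refine le_trans ?_ (le_exp_of_le (n := 3) (t := 0.7) (by norm_num) ?_)
      · norm_num
      · push_cast; nlinarith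
    have h3 := sub_le_norm_hauptU (τ := τ) (X := 38) (by linarith) (by nlinarith)
    have h5 : ‖nome τ‖ ^ 2 ≤ (1 / 31) ^ 2 := by gcongr
    norm_num at h5
    linarith

lemma near_arith {Y s b J a a' : ℝ} {i : ℕ} (hY1 : 1 ≤ Y) (hY2 : Y ≤ 27) (hi : i ≤ 4)
    (ha0 : 0 ≤ a') (ha' : a' ≤ 10.5) (ha : a = Y ^ i * a') (hb : 0 < b) (hJ : 0 < J)
    (h1 : Y ^ 3 ≤ b / 0.81 * s) (h2 : s ≤ 5.1 * J) : a ≤ 2000 * b * J := by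
  have h3 : Y ^ 3 ≤ b / 0.81 * (5.1 * J) := h1.trans (by gcongr)
  calc a ≤ Y ^ 4 * 10.5 := by
        rw [ha]
        have := pow_le_pow_right₀ hY1 hi
        gcongr
    _ = Y ^ 3 * (Y * 10.5) := by ring
    _ ≤ (b / 0.81 * (5.1 * J)) * (27 * 10.5) := by gcongr
    _ = b * J * (5.1 * (27 * 10.5) / 0.81) := by ring
    _ ≤ _ := by
      have hbJ : 0 < b * J := by positivity
      norm_num
      linarith

set_option maxHeartbeats 1000000 in
-- Transport to a representative of height at least 11/20, where |A'| ≤ 10.5 and j stays away from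
-- 54c by `near_dist`. The bound is relative to |B|^(ε+1) |j - 54c| because in that form it enters
-- `budget`.
theorem IsSeed.near_bound {ρ ε : ℤ} {A A' : ℂ → ℂ} (h : IsSeed ρ ε A A') {τ : ℂ}
    (him : τ.im = 1 / 9) {c : ℝ} (hc1 : |c| ≤ 1) (hc : c ≤ -(1 / 5)) :
    5 / 100000 ≤ ‖qf 1 betaQ τ‖ ∧ ‖qf 1 betaQ τ‖ ≤ 5 ∧ hauptJ τ - ((54 * c : ℝ) : ℂ) ≠ 0 ∧
      ‖A' (nome τ)‖ ≤
        80000000 * ‖qf 1 betaQ τ‖ ^ (ε + 1) * ‖hauptJ τ - ((54 * c : ℝ) : ℂ)‖ := by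
  have hpi := Real.pi_gt_d4
  have hpi' := Real.pi_lt_d4
  obtain ⟨τ', hrel, y1, y3, hcase⟩ := exists_related_of_im_eq_ninth him
  obtain ⟨hb, i, hi, hA⟩ := h.norm_of_related hrel (by rw [him]; norm_num)
  have hJ := hrel _ (isInvariant_hauptJ_sub (54 * c))
  have hpos : 0 < τ'.im := by linarith
  have hY : τ'.im / τ.im = 9 * τ'.im := by rw [him]; ring
  rw [hY] at hb hA
  rw [← hJ]
  set Y := 9 * τ'.im with hYdef
  set J := ‖hauptJ τ' - ((54 * c : ℝ) : ℂ)‖ with hJdef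
  set b := ‖qf 1 betaQ τ‖ with hbdef
  have hr := norm_nome_le_inv_31 y1
  have hr0 : 0 < ‖nome τ'‖ := norm_pos_iff.2 (nome_ne_zero τ')
  obtain ⟨β1, β2⟩ := betaQ_bounds_small hr
  have hA' := h.norm_le_small hr
  set β := ‖betaQ (nome τ')‖
  clear_value Y J b β
  have hYr : Y ^ 3 * ‖nome τ'‖ = 729 * (τ'.im ^ 3 * Real.exp (-(2 * Real.pi * τ'.im))) := by
    rw [norm_nome, hYdef]; ring
  have hYr1 : Y ^ 3 * ‖nome τ'‖ ≤ 4 := by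
    have h1 := cube_mul_exp_le (a := 11 / 20) (y := τ'.im) (by nlinarith) y1
    have h2 : Real.exp (-(2 * Real.pi * (11 / 20))) ≤ 1 / 31 := by
      rw [Real.exp_neg, one_div]
      have := thirty_one_le_exp (y := 11 / 20) le_rfl
      gcongr
    rw [hYr]
    nlinarith
  have hYr2 : 8 / 100000 ≤ Y ^ 3 * ‖nome τ'‖ := by
    have h1 := cube_mul_exp_le (a := τ'.im) (y := 3) (by nlinarith) y3
    have h2 : 1 / (2.7182818286 ^ 19) ≤ Real.exp (-(2 * Real.pi * 3)) := by
      rw [Real.exp_neg, one_div]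
      have := exp_le_of_le (n := 19) (x := 2 * Real.pi * 3) (by push_cast; linarith)
      gcongr
    rw [hYr]
    norm_num at h2
    nlinarith
  have hbeq : b = (Y ^ 3 * ‖nome τ'‖) * β := by rw [hb]; ring
  have hb1 : 5 / 100000 ≤ b := by
    rw [hbeq]
    calc (5 / 100000 : ℝ) ≤ (8 / 100000) * 0.81 := by norm_num
      _ ≤ _ := by gcongr
  have hb2 : b ≤ 5 := by
    rw [hbeq]
    calc _ ≤ (4 : ℝ) * 1.23 := by gcongr
      _ ≤ _ := by norm_num
  have hY1 : 4.95 ≤ Y := by rw [hYdef]; norm_num; linarith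
  have hY2 : Y ≤ 27 := by rw [hYdef]; linarith
  have hd := near_dist y1 hcase hc
  have hsq := sq_le_norm_mul_norm_hauptJ_sub hpos hc1 (D := 2) (by norm_num) hd
  rw [← hJdef] at hsq
  have hJ0 : 0 < J := by
    have hn := norm_nonneg (27 * hauptU τ')
    by_contra hcon
    have : J = 0 := le_antisymm (not_lt.1 hcon) (hJdef ▸ norm_nonneg _)
    rw [this] at hsq
    norm_num at hsq
  refine ⟨hb1, hb2, fun h0 => ?_, ?_⟩
  · rw [h0, norm_zero] at hJ
    linarith
  have hinv := inv_norm_nome_le (τ := τ') (by linarith)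
  have hinv' : ‖nome τ'‖⁻¹ ≤ ‖27 * hauptU τ'‖ + 14.4 := by
    have h5 : ‖nome τ'‖ ^ 2 ≤ (1 / 31) ^ 2 := by gcongr
    norm_num at h5 hinv ⊢
    linarith
  set Z := ‖27 * hauptU τ'‖ with hZ
  clear_value Z
  have hYi : Y ^ i ≤ Y ^ 4 := pow_le_pow_right₀ (by linarith) hi
  -- If Z = |27u| is large, then |j - 54c| ≥ Z/4 is comparable to 1/|q| and compensates the
  -- smallness of B. Otherwise |q| is bounded below, hence |B| ≥ 1 and crude bounds suffice.
  rcases le_total 54 Z with hcaseA | hcaseB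
  · have hsq2 := sq_le_norm_mul_norm_hauptJ_sub hpos hc1 (D := Z - 27) (by linarith)
      (Or.inl (by rw [hZ]))
    rw [← hJdef, ← hZ] at hsq2
    have hJZ : Z / 4 ≤ J := by
      have h9 : Z * (Z / 4) ≤ Z * J := by
        refine le_trans ?_ hsq2
        nlinarith only [hcaseA]
      exact le_of_mul_le_mul_left h9 (by linarith)
    have h6 : ‖nome τ'‖⁻¹ ≤ 5.1 * J := by norm_num at hinv' ⊢; linarith
    have h7 : Y ^ 3 ≤ b / 0.81 * ‖nome τ'‖⁻¹ := by
      rw [div_mul_eq_mul_div, ← div_eq_mul_inv, div_div, le_div_iff₀ (by positivity), hbeq]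
      rw [← mul_assoc]
      exact mul_le_mul_of_nonneg_left β1 (by positivity)
    have h8 : ‖A' (nome τ)‖ ≤ 2000 * b * J :=
      near_arith (by linarith) hY2 hi (norm_nonneg _) hA' hA (by linarith) hJ0 h7 h6
    have hbJ : 0 < b * J := mul_pos (by linarith) hJ0
    rcases h.eps_eq_or with rfl | rfl
    · rw [zero_add, zpow_one]
      linarith
    · rw [show (1 : ℤ) + 1 = (2 : ℕ) by norm_num, zpow_natCast]
      have := mul_le_mul_of_nonneg_right hb1 hbJ.le
      linarith [show b ^ 2 * J = b * (b * J) by ring]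
  · have hJ' : 4 / 54 ≤ J := by
      have h9 : Z * J ≤ 54 * J := by gcongr
      linarith
    have hb3 : 1 ≤ b := by
      have h9 : 1 / 68.4 ≤ ‖nome τ'‖ := by
        rw [div_le_iff₀ (by norm_num)]
        have : ‖nome τ'‖⁻¹ ≤ 68.4 := by norm_num at hinv' ⊢; linarith
        have h10 : ‖nome τ'‖ * ‖nome τ'‖⁻¹ = 1 := mul_inv_cancel₀ hr0.ne'
        rw [← h10]
        gcongr
      rw [hbeq]
      calc (1 : ℝ) ≤ 4.95 ^ 3 * (1 / 68.4) * 0.81 := by norm_num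
        _ ≤ _ := by gcongr
    have h8 : ‖A' (nome τ)‖ ≤ 27 ^ 4 * 10.5 := by
      rw [hA]
      calc Y ^ i * ‖A' (nome τ')‖ ≤ Y ^ 4 * 10.5 := by gcongr
        _ ≤ _ := by gcongr
    have h9 : 1 ≤ b ^ (ε + 1) := by
      rcases h.eps_eq_or with rfl | rfl
      · simpa using hb3
      · rw [show (1 : ℤ) + 1 = (2 : ℕ) by norm_num, zpow_natCast]
        exact one_le_pow₀ hb3
    calc ‖A' (nome τ)‖ ≤ 80000000 * 1 * (4 / 54) := by norm_num at h8 ⊢; linarith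
      _ ≤ _ := by gcongr

lemma far_dist {τ : ℂ} (h1 : 599 / 1000 ≤ τ.im) : 28.9 ≤ ‖27 * hauptU τ‖ := by
  have hpi := Real.pi_gt_d4
  have h43 : 42.7 ≤ Real.exp (2 * Real.pi * τ.im) := by
    refine le_trans ?_ (le_exp_of_le (n := 3) (t := 0.763) (by norm_num) ?_)
    · norm_num
    · push_cast; nlinarith
  have hr : ‖nome τ‖ ≤ 1 / 42.7 := norm_nome_le_of_le (by norm_num) h43 le_rfl
  have hi : 42.7 ≤ ‖nome τ‖⁻¹ := by rw [norm_nome_eq_inv, inv_inv]; exact h43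
  have h := inv_norm_nome_le (τ := τ) (hr.trans (by norm_num))
  have h5 : ‖nome τ‖ ^ 2 ≤ (1 / 42.7) ^ 2 := by gcongr
  norm_num at h5 h hr hi ⊢
  linarith

lemma cos_nonpos_of_quarter {x : ℝ} (h1 : 1 / 4 ≤ x) (h2 : x ≤ 1 / 2) :
    Real.cos (2 * Real.pi * x) ≤ 0 := by
  have := Real.pi_pos
  exact Real.cos_nonpos_of_pi_div_two_le_of_le (by nlinarith) (by nlinarith)

set_option maxHeartbeats 1000000 in
-- A representative either reaches height 0.599, where |27u| ≥ 28.9 > 27, or stays at height 2/5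
-- with real part in [1/4, 1/2]. In the second case the cosine is nonpositive and Re 27u ≤ -7.8,
-- well below 27c ≥ -5.4.
theorem IsSeed.far_bound {ρ ε : ℤ} {A A' : ℂ → ℂ} (h : IsSeed ρ ε A A') {τ : ℂ}
    (him : τ.im = 2 / 5) {c : ℝ} (hc1 : |c| ≤ 1) (hc : -(1 / 5) ≤ c) :
    1 / 100 ≤ ‖qf 1 betaQ τ‖ ∧ ‖qf 1 betaQ τ‖ ≤ 1 ∧ hauptJ τ - ((54 * c : ℝ) : ℂ) ≠ 0 ∧
      ‖A' (nome τ)‖ ≤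
        300000 * 20 ^ ε * ‖qf 1 betaQ τ‖ ^ (ε + 1) * ‖hauptJ τ - ((54 * c : ℝ) : ℂ)‖ := by
  have hpi := Real.pi_gt_d4
  have hpi' := Real.pi_lt_d4
  suffices hs : 17 / 1000 ≤ ‖qf 1 betaQ τ‖ ∧ ‖qf 1 betaQ τ‖ ≤ 1 ∧
      0 < ‖hauptJ τ - ((54 * c : ℝ) : ℂ)‖ ∧
      ‖A' (nome τ)‖ ≤ 1600 * ‖hauptJ τ - ((54 * c : ℝ) : ℂ)‖ by
    obtain ⟨s1, s2, s3, s4⟩ := hs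
    refine ⟨by linarith, s2, norm_pos_iff.1 s3, ?_⟩
    set b := ‖qf 1 betaQ τ‖
    set J := ‖hauptJ τ - ((54 * c : ℝ) : ℂ)‖
    have hb0 : 0 < b := by linarith
    -- The powers 20^ε are matched to b ≥ 17/1000, so both values of ε reduce to one crude constant.
    have h2 : 1600 ≤ 300000 * 20 ^ ε * b ^ (ε + 1) := by
      rcases h.eps_eq_or with rfl | rfl
      · rw [zero_add, zpow_one, zpow_zero]
        linarith
      · rw [show (1 : ℤ) + 1 = (2 : ℕ) by norm_num, zpow_natCast, zpow_one]
        nlinarith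
    exact s4.trans (by gcongr)
  obtain ⟨τ', hrel, hcase⟩ := exists_related_of_im_eq_two_fifths him
  obtain ⟨hb, i, hi, hA⟩ := h.norm_of_related hrel (by rw [him]; norm_num)
  have hJ := hrel _ (isInvariant_hauptJ_sub (54 * c))
  rw [← hJ]
  set J := ‖hauptJ τ' - ((54 * c : ℝ) : ℂ)‖ with hJdef
  set b := ‖qf 1 betaQ τ‖ with hbdef
  have hr0 : 0 < ‖nome τ'‖ := norm_pos_iff.2 (nome_ne_zero τ')
  rcases hcase with ⟨y1, y2⟩ | ⟨y1, x1, x2⟩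
  · have hpos : 0 < τ'.im := by linarith
    have hY : τ'.im / τ.im = 5 / 2 * τ'.im := by rw [him]; ring
    rw [hY] at hb hA
    set Y := 5 / 2 * τ'.im with hYdef
    have y1' : 11 / 20 ≤ τ'.im := by linarith
    have hr := norm_nome_le_inv_31 y1'
    obtain ⟨β1, β2⟩ := betaQ_bounds_small hr
    have hA' := h.norm_le_small hr
    set β := ‖betaQ (nome τ')‖
    clear_value Y β b J
    have hYr : Y ^ 3 * ‖nome τ'‖ = 125 / 8 * (τ'.im ^ 3 * Real.exp (-(2 * Real.pi * τ'.im))) := by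
      rw [norm_nome, hYdef]; ring
    have hYr2 : 22 / 1000 ≤ Y ^ 3 * ‖nome τ'‖ := by
      have h1 := cube_mul_exp_le (a := τ'.im) (y := 5 / 6) (by nlinarith) y2
      have h2 : 1 / (2.7182818286 ^ 6) ≤ Real.exp (-(2 * Real.pi * (5 / 6))) := by
        rw [Real.exp_neg, one_div]
        have := exp_le_of_le (n := 6) (x := 2 * Real.pi * (5 / 6)) (by push_cast; linarith)
        gcongr
      rw [hYr]
      norm_num at h2 h1 ⊢
      linarith
    have hY2 : Y ≤ 25 / 12 := by rw [hYdef]; linarith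
    have hY1 : 1 ≤ Y := by rw [hYdef]; linarith
    have hY0 : 0 < Y := by linarith
    have hYr1 : Y ^ 3 * ‖nome τ'‖ ≤ 1 / 2 := by
      calc Y ^ 3 * ‖nome τ'‖ ≤ (25 / 12) ^ 3 * (1 / 31) := by gcongr
        _ ≤ _ := by norm_num
    have hbeq : b = (Y ^ 3 * ‖nome τ'‖) * β := by rw [hb]; ring
    have hZ := far_dist y1
    have hsq := sq_le_norm_mul_norm_hauptJ_sub hpos hc1 (D := ‖27 * hauptU τ'‖ - 27)
      (by norm_num at hZ ⊢; linarith) (Or.inl le_rfl)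
    rw [← hJdef] at hsq
    set Z := ‖27 * hauptU τ'‖ with hZdef
    have hJ1 : 124 / 1000 ≤ J := by
      by_contra hcon
      push Not at hcon
      norm_num at hZ
      nlinarith
    have hb1 : 17 / 1000 ≤ b := by
      rw [hbeq]
      calc (17 / 1000 : ℝ) ≤ (22 / 1000) * 0.81 := by norm_num
        _ ≤ _ := by gcongr
    have hb2 : b ≤ 1 := by
      rw [hbeq]
      calc _ ≤ (1 / 2 : ℝ) * 1.23 := by gcongr
        _ ≤ _ := by norm_num
    refine ⟨hb1, hb2, by linarith, ?_⟩
    have hYi : Y ^ i ≤ Y ^ 4 := pow_le_pow_right₀ hY1 hi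
    have h8 : ‖A' (nome τ)‖ ≤ (25 / 12) ^ 4 * 10.5 := by
      rw [hA]
      calc Y ^ i * ‖A' (nome τ')‖ ≤ Y ^ 4 * 10.5 := by gcongr
        _ ≤ _ := by gcongr
    norm_num at h8
    linarith
  · have hpos : 0 < τ'.im := by rw [y1]; norm_num
    have hY : τ'.im / τ.im = 1 := by rw [him, y1]; norm_num
    rw [hY, one_pow, one_mul] at hb hA
    have hexp1 : 12 ≤ Real.exp (2 * Real.pi * τ'.im) := by
      rw [y1]
      refine le_trans ?_ (le_exp_of_le (n := 2) (t := 0.513) (by norm_num) ?_)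
      · norm_num
      · push_cast; linarith
    have hexp2 : Real.exp (2 * Real.pi * τ'.im) ≤ 20.1 := by
      rw [y1]
      refine (exp_le_of_le (n := 3) (by push_cast; linarith)).trans ?_
      norm_num
    have hr : ‖nome τ'‖ ≤ 1 / 12 := norm_nome_le_of_le (by norm_num) hexp1 le_rfl
    have hr' : 1 / 20.1 ≤ ‖nome τ'‖ := by
      rw [norm_nome_eq_inv, one_div]; gcongr
    have hri : ‖nome τ'‖⁻¹ ≤ 20.1 := by rw [norm_nome_eq_inv, inv_inv]; exact hexp2
    have hr2 : ‖nome τ'‖ ^ 2 ≤ (1 / 12) ^ 2 := by gcongr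
    have hcos := cos_nonpos_of_quarter x1 x2
    have hre : (27 * hauptU τ').re ≤ -7.8 := by
      have h3 := (abs_le.1 (abs_re_hauptU_sub_le hr)).2
      have h4 : (‖nome τ'‖⁻¹ + 54 * ‖nome τ'‖) * Real.cos (2 * Real.pi * τ'.re) ≤ 0 :=
        mul_nonpos_of_nonneg_of_nonpos (by positivity) hcos
      norm_num at h3 hr2 ⊢
      linarith
    have hZ1 : 7.8 ≤ ‖27 * hauptU τ'‖ := by
      have := (abs_le.1 (abs_re_le_norm (27 * hauptU τ'))).1
      linarith
    have hZ2 : ‖27 * hauptU τ'‖ ≤ 41 := by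
      have h3 := norm_hauptU_le hr
      norm_num at hr2 h3 hri ⊢
      linarith
    have hups : ‖upsQ (nome τ')‖ = ‖27 * hauptU τ'‖ * ‖nome τ'‖ := by
      rw [← norm_mul, hauptU]
      congr 1
      have := nome_ne_zero τ'
      field_simp
    have hu : 0.38 ≤ ‖upsQ (nome τ')‖ := by
      rw [hups]
      calc (0.38 : ℝ) ≤ 7.8 * (1 / 20.1) := by norm_num
        _ ≤ _ := by gcongr
    have hM := norm_hauptQ_add_le hr le_rfl (by norm_num) hu
    have hβ : ‖betaQ (nome τ')‖ ≤ 1.77 := by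
      refine (norm_betaQ_le hr (by norm_num)).trans ?_
      have h : (6 * ((1 / 12 : ℝ) / (1 - 1 / 12) + (1 / 12) ^ 3 / (1 - (1 / 12) ^ 3))) ≤ 0.55 := by
        norm_num
      refine (Real.exp_le_exp.2 h).trans ?_
      have h1 := (abs_le.1 (Real.abs_exp_sub_one_sub_id_le (x := 0.055) (by norm_num [abs_le]))).2
      have h2 : Real.exp 0.055 ≤ 1.0581 := by norm_num at h1 ⊢; linarith
      calc Real.exp 0.55 = Real.exp 0.055 ^ 10 := by rw [← Real.exp_nat_mul]; norm_num
        _ ≤ 1.0581 ^ 10 := by gcongr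
        _ ≤ 1.77 := by norm_num
    have hβ1 : 0.5 ≤ ‖betaQ (nome τ')‖ := by
      refine le_trans ?_ (le_norm_betaQ hr (by norm_num))
      norm_num
    obtain ⟨b1, b2, b3⟩ := forms_norm_le (nome_mem_ball hpos) (a := 3.5) (M := 1.77 * 21)
      (by norm_num) (by
        have : ‖upsQ (nome τ')‖ + ‖729 * nome τ' ^ 2 / upsQ (nome τ')‖ + 54 * ‖nome τ'‖ ≤ 21 := by
          norm_num at hM ⊢
          linarith
        gcongr) (by norm_num)
    have hA' := (h.norm_le (by norm_num) b1 b2 b3).2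
    have hsq := sq_le_norm_mul_norm_hauptJ_sub hpos hc1 (D := 2.4) (by norm_num) (Or.inr (by
      rw [abs_sub_comm]
      refine le_trans ?_ (le_abs_self _)
      norm_num at hre ⊢
      linarith))
    rw [← hJdef] at hsq
    have hJ1 : 0.14 ≤ J := by
      by_contra hcon
      push Not at hcon
      have hJ0 : 0 ≤ J := norm_nonneg _
      have h9 := mul_le_mul hZ2 hcon.le hJ0 (by norm_num)
      norm_num at hsq h9
      linarith
    refine ⟨?_, ?_, by linarith, ?_⟩
    · rw [hb]
      calc (17 / 1000 : ℝ) ≤ (1 / 20.1) * 0.5 := by norm_num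
        _ ≤ _ := by gcongr
    · rw [hb]
      calc ‖nome τ'‖ * ‖betaQ (nome τ')‖ ≤ (1 / 12) * 1.77 := by gcongr
        _ ≤ _ := by norm_num
    · rw [hA]
      norm_num at hA' hJ1 ⊢
      linarith

/-! ### Sizes on the far and near parts of the arc, and the resulting error bounds. -/

lemma arcPt_sq_sum (θ : ℝ) : (arcPt θ).re ^ 2 + (arcPt θ).im ^ 2 = 1 / 3 := by
  have := normSq_arcPt θ
  rw [normSq_apply] at this
  linarith

lemma exists_arcPt_re_eq {x : ℝ} (h1 : -(1 / 2) ≤ x) (h2 : x ≤ 0) :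
    ∃ θ ∈ Icc (Real.pi / 2) (5 * Real.pi / 6), (arcPt θ).re = x := by
  have hy : 0 < 1 / 3 - x ^ 2 := by nlinarith
  obtain ⟨θ, hθ, e⟩ := exists_arcPt (τ := ⟨x, √(1 / 3 - x ^ 2)⟩) (Real.sqrt_pos.2 hy) (by
    rw [normSq_mk, Real.mul_self_sqrt hy.le]; ring) h1 h2
  exact ⟨θ, hθ, by rw [← e]⟩

lemma twenty_six_le_exp {y : ℝ} (hy : 0.52 ≤ y) : 26 ≤ Real.exp (2 * Real.pi * y) := by
  have hpi := Real.pi_gt_d4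
  refine le_trans ?_ (le_exp_of_le (n := 3) (t := 0.267) (by norm_num) ?_)
  · norm_num
  · norm_num at hy ⊢; nlinarith

lemma norm_nome_le_inv_26 {τ : ℂ} (hy : 0.52 ≤ τ.im) : ‖nome τ‖ ≤ 1 / 26 :=
  norm_nome_le_of_le (by norm_num) (twenty_six_le_exp hy) le_rfl

lemma le_arcPt_im {θ : ℝ} (h : 0 < (arcPt θ).im) {a : ℝ}
    (ha : a ^ 2 ≤ 1 / 3 - (arcPt θ).re ^ 2) : a ≤ (arcPt θ).im := by
  have := arcPt_sq_sum θ
  by_contra hcon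
  push Not at hcon
  nlinarith

/-- The far part of the arc. -/
lemma neg_quarter_le_arcPt_re {θ : ℝ} (hθ : θ ∈ Icc (Real.pi / 2) (5 * Real.pi / 6))
    (hc : -(1 / 5) ≤ (hauptU (arcPt θ)).re) : -(1 / 4) ≤ (arcPt θ).re := by
  by_contra hcon
  push Not at hcon
  -- At x = -1/4 the cosine vanishes and Re 27u is about -12, already below -27/5. Monotonicity
  -- along the arc does the rest.
  obtain ⟨θ₀, hθ₀, hx⟩ := exists_arcPt_re_eq (x := -(1 / 4)) (by norm_num) (by norm_num)
  have hlt : θ₀ < θ := by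
    refine (arcPt_re_strictAnti.lt_iff_gt hθ hθ₀).1 ?_
    linarith
  have h1 := re_hauptU_strictAnti hθ₀ hθ hlt
  simp only at h1
  have hy : 0.52 ≤ (arcPt θ₀).im := by
    refine le_arcPt_im (arcPt_im_pos hθ₀.1 hθ₀.2) ?_
    rw [hx]; norm_num
  have hr := norm_nome_le_inv_26 hy
  have h2 := (abs_le.1 (abs_re_hauptU_sub_le (τ := arcPt θ₀) (by linarith))).2
  have hcos : Real.cos (2 * Real.pi * (arcPt θ₀).re) = 0 := by
    rw [hx, show 2 * Real.pi * (-(1 / 4)) = -(Real.pi / 2) by ring, Real.cos_neg, Real.cos_pi_div_two]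
  have h5 : ‖nome (arcPt θ₀)‖ ^ 2 ≤ (1 / 26) ^ 2 := by gcongr
  have h6 : (27 * hauptU (arcPt θ₀)).re = 27 * (hauptU (arcPt θ₀)).re := by simp
  rw [hcos, mul_zero, h6] at h2
  norm_num at h5
  linarith

/-- The near part of the arc. -/
lemma arcPt_re_le_neg_fifth {θ : ℝ} (hθ : θ ∈ Icc (Real.pi / 2) (5 * Real.pi / 6))
    (hc : (hauptU (arcPt θ)).re ≤ -(1 / 5)) : (arcPt θ).re ≤ -(1 / 5) := by
  by_contra hcon
  push Not at hcon
  -- At x = -1/5 the estimate gives Re 27u > -5.1, still above -27/5.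
  obtain ⟨θ₀, hθ₀, hx⟩ := exists_arcPt_re_eq (x := -(1 / 5)) (by norm_num) (by norm_num)
  have hlt : θ < θ₀ := by
    refine (arcPt_re_strictAnti.lt_iff_gt hθ₀ hθ).1 ?_
    linarith
  have h1 := re_hauptU_strictAnti hθ hθ₀ hlt
  simp only at h1
  have hy : 0.54 ≤ (arcPt θ₀).im := by
    refine le_arcPt_im (arcPt_im_pos hθ₀.1 hθ₀.2) ?_
    rw [hx]; norm_num
  have hy' : 0.52 ≤ (arcPt θ₀).im := by norm_num at hy ⊢; linarith
  have hr := norm_nome_le_inv_26 hy'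
  have hri : 26 ≤ ‖nome (arcPt θ₀)‖⁻¹ := by
    rw [norm_nome_eq_inv, inv_inv]; exact twenty_six_le_exp hy'
  have h2 := (abs_le.1 (abs_re_hauptU_sub_le (τ := arcPt θ₀) (by linarith))).1
  have hcos := three_tenths_le_cos (x := (arcPt θ₀).re) (by rw [hx]; norm_num [abs_le])
  have h4 : 26 * (3 / 10) ≤ (‖nome (arcPt θ₀)‖⁻¹ + 54 * ‖nome (arcPt θ₀)‖) *
      Real.cos (2 * Real.pi * (arcPt θ₀).re) := by
    gcongr
    have := norm_nonneg (nome (arcPt θ₀))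
    linarith
  have h5 : ‖nome (arcPt θ₀)‖ ^ 2 ≤ (1 / 26) ^ 2 := by gcongr
  have h6 : (27 * hauptU (arcPt θ₀)).re = 27 * (hauptU (arcPt θ₀)).re := by simp
  rw [h6] at h2
  norm_num at h5
  linarith

lemma norm_qf_one (g : ℂ → ℂ) (τ : ℂ) : ‖qf 1 g τ‖ = ‖nome τ‖ * ‖g (nome τ)‖ := by
  rw [qf, zpow_one, norm_mul]

lemma exp_le_tenth_pow {x : ℝ} (h0 : 0 ≤ x) (h : x ≤ 1) :
    Real.exp x ≤ (1 + x / 10 + (x / 10) ^ 2) ^ 10 := by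
  have h1 := (abs_le.1 (Real.abs_exp_sub_one_sub_id_le (x := x / 10)
    (by rw [abs_of_nonneg (by positivity)]; linarith))).2
  calc Real.exp x = Real.exp (x / 10) ^ 10 := by rw [← Real.exp_nat_mul]; congr 1; push_cast; ring
    _ ≤ _ := by gcongr; linarith

/-- Size of the forms on the far part of the arc. -/
lemma IsSeed.far_arc {ρ ε : ℤ} {A A' : ℂ → ℂ} (h : IsSeed ρ ε A A') {θ : ℝ}
    (hy : 0.52 ≤ (arcPt θ).im) :
    0.02 ≤ ‖qf 1 betaQ (arcPt θ)‖ ∧ ‖qf 1 betaQ (arcPt θ)‖ ≤ 0.05 ∧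
      ‖A (nome (arcPt θ))‖ ≤ 10.5 := by
  have hpi := Real.pi_lt_d4
  have hr := norm_nome_le_inv_26 hy
  have hpos : 0 < (arcPt θ).im := by norm_num at hy; linarith
  have hy2 : (arcPt θ).im ≤ 0.578 := by
    have := arcPt_sq_sum θ
    norm_num
    nlinarith [sq_nonneg (arcPt θ).re]
  have hβ : ‖betaQ (nome (arcPt θ))‖ ≤ 1.28 := by
    refine (norm_betaQ_le hr (by norm_num)).trans ?_
    have h : (6 * ((1 / 26 : ℝ) / (1 - 1 / 26) + (1 / 26) ^ 3 / (1 - (1 / 26) ^ 3))) ≤ 0.241 := by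
      norm_num
    refine (Real.exp_le_exp.2 h).trans ((exp_le_tenth_pow (by norm_num) (by norm_num)).trans ?_)
    norm_num
  have hβ1 : 0.78 ≤ ‖betaQ (nome (arcPt θ))‖ := by
    refine le_trans ?_ (le_norm_betaQ hr (by norm_num))
    norm_num
  have hr' : 1 / 38.5 ≤ ‖nome (arcPt θ)‖ := by
    rw [norm_nome_eq_inv, one_div]
    have : Real.exp (2 * Real.pi * (arcPt θ).im) ≤ 38.5 := by
      have h1 : 2 * Real.pi * (arcPt θ).im ≤ 3 + 0.632 := by
        norm_num at hy2 hpi ⊢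
        nlinarith
      refine (Real.exp_le_exp.2 h1).trans ?_
      rw [Real.exp_add]
      have h2 := exp_le_of_le (n := 3) (x := 3) (by norm_num)
      have h3 := exp_le_tenth_pow (x := 0.632) (by norm_num) (by norm_num)
      calc Real.exp 3 * Real.exp 0.632
          ≤ 2.7182818286 ^ 3 * (1 + 0.632 / 10 + (0.632 / 10) ^ 2) ^ 10 := by gcongr
        _ ≤ 38.5 := by norm_num
    gcongr
  rw [norm_qf_one]
  have hb2 : ‖nome (arcPt θ)‖ * ‖betaQ (nome (arcPt θ))‖ ≤ 0.05 := by
    calc _ ≤ (1 / 26) * 1.28 := by gcongr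
      _ ≤ (0.05 : ℝ) := by norm_num
  refine ⟨?_, hb2, ?_⟩
  · calc (0.02 : ℝ) ≤ (1 / 38.5) * 0.78 := by norm_num
      _ ≤ _ := by gcongr
  · obtain ⟨b1, b2, b3⟩ := forms_norm_le_arc hpos (a := 1.8) (by norm_num) (by
      rw [norm_qf_one]
      norm_num at hb2 ⊢
      linarith)
    have := (h.norm_le (by norm_num) b1 b2 b3).1
    norm_num at this ⊢
    linarith

/-- Size of the forms on the arc. -/
lemma IsSeed.near_arc {ρ ε : ℤ} {A A' : ℂ → ℂ} (h : IsSeed ρ ε A A') {θ : ℝ}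
    (hy : 0.2886 ≤ (arcPt θ).im) :
    0.2 * ‖nome (arcPt θ)‖ ≤ ‖qf 1 betaQ (arcPt θ)‖ ∧ ‖qf 1 betaQ (arcPt θ)‖ ≤ 0.59 ∧
      ‖A (nome (arcPt θ))‖ ≤ 256 := by
  have hpi := Real.pi_gt_d4
  have hpos : 0 < (arcPt θ).im := by norm_num at hy; linarith
  have hr : ‖nome (arcPt θ)‖ ≤ 1 / 6.05 := by
    refine norm_nome_le_of_le (by norm_num)
      (le_trans ?_ (le_exp_of_le (n := 1) (t := 0.813) (by norm_num) ?_)) le_rfl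
    · norm_num
    · norm_num at hy ⊢; nlinarith
  have hβ : ‖betaQ (nome (arcPt θ))‖ ≤ 3.5 := by
    refine (norm_betaQ_le hr (by norm_num)).trans ?_
    have h : (6 * ((1 / 6.05 : ℝ) / (1 - 1 / 6.05) + (1 / 6.05) ^ 3 / (1 - (1 / 6.05) ^ 3))) ≤
        1 + 0.216 := by norm_num
    refine (Real.exp_le_exp.2 h).trans ?_
    rw [Real.exp_add]
    have h2 := exp_le_of_le (n := 1) (x := 1) (by norm_num)
    have h3 := exp_le_tenth_pow (x := 0.216) (by norm_num) (by norm_num)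
    calc Real.exp 1 * Real.exp 0.216
        ≤ 2.7182818286 ^ 1 * (1 + 0.216 / 10 + (0.216 / 10) ^ 2) ^ 10 := by gcongr
      _ ≤ 3.5 := by norm_num
  have hβ1 : 0.2 ≤ ‖betaQ (nome (arcPt θ))‖ := by
    refine le_trans ?_ (le_norm_betaQ hr (by norm_num))
    norm_num
  rw [norm_qf_one]
  have hb2 : ‖nome (arcPt θ)‖ * ‖betaQ (nome (arcPt θ))‖ ≤ 0.59 := by
    calc _ ≤ (1 / 6.05) * 3.5 := by gcongr
      _ ≤ (0.59 : ℝ) := by norm_num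
  refine ⟨?_, hb2, ?_⟩
  · rw [mul_comm]
    gcongr
  · obtain ⟨b1, b2, b3⟩ := forms_norm_le_arc hpos (a := 4) (by norm_num) (by
      rw [norm_qf_one]
      norm_num at hb2 ⊢
      linarith)
    have := (h.norm_le (by norm_num) b1 b2 b3).1
    norm_num at this ⊢
    linarith

/-- Bookkeeping of the powers of `|B|`. -/
lemma budget {B b a a' J K d : ℝ} {ℓ ε m : ℤ} (hB : 0 < B) (hb : 0 < b) (ha : 0 ≤ a)
    (hJ : 0 ≤ J) (hK : 0 ≤ K) (hd : 0 ≤ d) (hm : 18 * |ℓ| + 23 ≤ m)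
    (h1 : B ≤ b * Real.exp (18 * Real.pi * d)) (h2 : b ≤ B * Real.exp (18 * Real.pi * d))
    (h3 : B ^ ε * a * K ≤ 1 / 5 * Real.exp (46 * Real.pi * d)) (h4 : a' ≤ K * b ^ (ε + 1) * J) :
    B ^ (2 * ℓ + ε) * a * (b ^ (-(2 * ℓ + ε) - 1) * a') ≤
      1 / 5 * Real.exp (2 * Real.pi * m * d) * J := by
  have hpi := Real.pi_pos
  set X := Real.exp (18 * Real.pi * d) with hX
  have hX0 : 0 < X := Real.exp_pos _
  -- Both B/b and b/B are at most e^{18πd}, so either sign of ℓ costs the same.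
  have key : (B / b) ^ (2 * ℓ) ≤ Real.exp (36 * Real.pi * d * (|ℓ| : ℤ)) := by
    have hXX : ∀ n : ℕ, X ^ (2 * n) = Real.exp (36 * Real.pi * d * n) := fun n => by
      rw [hX, ← Real.exp_nat_mul]; congr 1; push_cast; ring
    have q1 : B / b ≤ X := by rw [div_le_iff₀ hb]; linarith
    have q2 : b / B ≤ X := by rw [div_le_iff₀ hB]; linarith
    rcases le_total 0 ℓ with hℓ | hℓ
    · obtain ⟨n, rfl⟩ := Int.eq_ofNat_of_zero_le hℓ
      rw [abs_of_nonneg hℓ]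
      have e : (2 * (n : ℤ)) = ((2 * n : ℕ) : ℤ) := by push_cast; ring
      rw [e, zpow_natCast, Int.cast_natCast, ← hXX]
      have : 0 ≤ B / b := by positivity
      gcongr
    · obtain ⟨n, hn⟩ := Int.eq_ofNat_of_zero_le (neg_nonneg.2 hℓ)
      rw [abs_of_nonpos hℓ, hn]
      have e : (2 * ℓ) = -((2 * n : ℕ) : ℤ) := by push_cast; omega
      rw [e, zpow_neg, zpow_natCast, Int.cast_natCast, ← hXX, ← inv_pow, inv_div]
      have : 0 ≤ b / B := by positivity
      gcongr
  have e1 : B ^ (2 * ℓ + ε) * a * (b ^ (-(2 * ℓ + ε) - 1) * a') =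
      (B / b) ^ (2 * ℓ) * (B ^ ε * a) * (a' / b ^ (ε + 1)) := by
    rw [zpow_add₀ hB.ne', div_zpow, show -(2 * ℓ + ε) - 1 = -(2 * ℓ) + -(ε + 1) by ring,
      zpow_add₀ hb.ne', zpow_neg, zpow_neg]
    field_simp
  have h5 : a' / b ^ (ε + 1) ≤ K * J := by
    rw [div_le_iff₀ (zpow_pos hb _)]
    linarith
  have hBa : 0 ≤ B ^ ε * a := mul_nonneg (zpow_pos hB _).le ha
  rw [e1]
  calc (B / b) ^ (2 * ℓ) * (B ^ ε * a) * (a' / b ^ (ε + 1))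
      ≤ (B / b) ^ (2 * ℓ) * (B ^ ε * a) * (K * J) := by
        refine mul_le_mul_of_nonneg_left h5 (mul_nonneg (zpow_pos (by positivity) _).le hBa)
    _ = (B / b) ^ (2 * ℓ) * ((B ^ ε * a * K) * J) := by ring
    _ ≤ Real.exp (36 * Real.pi * d * (|ℓ| : ℤ)) * ((1 / 5 * Real.exp (46 * Real.pi * d)) * J) := by
        refine mul_le_mul key (mul_le_mul_of_nonneg_right h3 hJ) ?_ (Real.exp_pos _).le
        exact mul_nonneg (mul_nonneg hBa hK) hJ
    _ = 1 / 5 * Real.exp (36 * Real.pi * d * (|ℓ| : ℤ) + 46 * Real.pi * d) * J := by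
        rw [Real.exp_add]; ring
    _ ≤ _ := by
        -- The hypothesis on m is consumed here: 18|ℓ| pays for (B/b)^{2ℓ}, and 23 pays for the
        -- constants independent of ℓ.
        have hm' : (18 * ((|ℓ| : ℤ) : ℝ) + 23) ≤ m := by exact_mod_cast hm
        have : 36 * Real.pi * d * ((|ℓ| : ℤ) : ℝ) + 46 * Real.pi * d ≤ 2 * Real.pi * m * d := by
          have : 0 ≤ 2 * Real.pi * d := by positivity
          nlinarith
        gcongr

lemma norm_qf_mul_zpow {A : ℂ → ℂ} (E : ℤ) (τ : ℂ) :
    ‖qf E (fun w => betaQ w ^ E * A w) τ‖ = ‖qf 1 betaQ τ‖ ^ E * ‖A (nome τ)‖ := by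
  rw [qf, qf, zpow_one, norm_mul, norm_mul, norm_mul, norm_zpow, norm_zpow, mul_zpow]
  ring

/-- The integrand on the line `Im τ = 2/5`. -/
theorem IsSeed.far_error {ρ ε : ℤ} {A A' : ℂ → ℂ} (h : IsSeed ρ ε A A') {ℓ m : ℤ}
    (hm : 18 * |ℓ| + 23 ≤ m) {θ : ℝ} (hθ : θ ∈ Icc (Real.pi / 2) (5 * Real.pi / 6))
    (hc : -(1 / 5) ≤ (hauptU (arcPt θ)).re) {τ : ℂ} (him : τ.im = 2 / 5) :
    hauptJ τ - hauptJ (arcPt θ) ≠ 0 ∧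
    ‖qf (2 * ℓ + ε) (fun w => betaQ w ^ (2 * ℓ + ε) * A w) (arcPt θ)‖ *
      ‖qf (-(2 * ℓ + ε) - 1) (fun w => betaQ w ^ (-(2 * ℓ + ε) - 1) * A' w) τ‖ ≤
      1 / 5 * Real.exp (2 * Real.pi * m * ((arcPt θ).im - 2 / 5)) *
        ‖hauptJ τ - hauptJ (arcPt θ)‖ := by
  have hpi := Real.pi_gt_d4
  have hpos := arcPt_im_pos hθ.1 hθ.2
  have hx := neg_quarter_le_arcPt_re hθ hc
  have hx' := arcPt_re_nonpos hθ.1 hθ.2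
  have hy : 0.52 ≤ (arcPt θ).im := le_arcPt_im hpos (by nlinarith)
  have hc1 : |(hauptU (arcPt θ)).re| ≤ 1 :=
    (abs_re_le_norm _).trans (norm_hauptU_eq_one hpos (normSq_arcPt θ)).le
  obtain ⟨b1, b2, b3, b4⟩ := h.far_bound him hc1 hc
  obtain ⟨a1, a2, a3⟩ := h.far_arc hy
  rw [hauptJ_arc hpos, norm_qf_mul_zpow, norm_qf_mul_zpow]
  refine ⟨b3, ?_⟩
  set d := (arcPt θ).im - 2 / 5 with hd
  have hd1 : 0.12 ≤ d := by norm_num at hy ⊢; linarith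
  have hd0 : 0 ≤ d := by norm_num at hd1; linarith
  set B := ‖qf 1 betaQ (arcPt θ)‖
  set b := ‖qf 1 betaQ τ‖
  clear_value B b d
  have hB0 : 0 < B := by norm_num at a1; linarith
  have hX : 400 ≤ Real.exp (18 * Real.pi * d) := by
    refine le_trans ?_ (le_exp_of_le (n := 6) (t := 0) (by norm_num) ?_)
    · norm_num
    · norm_num at hd1 ⊢; nlinarith
  -- 46π · 0.12 > 17, and 5 · 10.5 · 300000 < 2 · 10⁷ < e¹⁷.
  have hX2 : 20000000 ≤ Real.exp (46 * Real.pi * d) := by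
    refine le_trans ?_ (le_exp_of_le (n := 17) (t := 0) (by norm_num) ?_)
    · norm_num
    · norm_num at hd1 ⊢; nlinarith
  refine budget (K := 300000 * 20 ^ ε) hB0 (by linarith) (norm_nonneg _) (norm_nonneg _)
    (by positivity) hd0 hm ?_ ?_ ?_ b4
  · norm_num at a2; nlinarith
  · norm_num at a1; nlinarith
  · have e : B ^ ε * 20 ^ ε ≤ 1 := by
      rcases h.eps_eq_or with rfl | rfl
      · simp
      · rw [zpow_one, zpow_one]; norm_num at a2; linarith
    calc B ^ ε * ‖A (nome (arcPt θ))‖ * (300000 * 20 ^ ε)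
        = (B ^ ε * 20 ^ ε) * (‖A (nome (arcPt θ))‖ * 300000) := by ring
      _ ≤ 1 * (10.5 * 300000) := by gcongr
      _ ≤ _ := by norm_num; linarith

/-- The integrand on the line `Im τ = 1/9`. -/
theorem IsSeed.near_error {ρ ε : ℤ} {A A' : ℂ → ℂ} (h : IsSeed ρ ε A A') {ℓ m : ℤ}
    (hm : 18 * |ℓ| + 23 ≤ m) {θ : ℝ} (hθ : θ ∈ Icc (Real.pi / 2) (5 * Real.pi / 6))
    (hc : (hauptU (arcPt θ)).re ≤ -(1 / 5)) {τ : ℂ} (him : τ.im = 1 / 9) :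
    hauptJ τ - hauptJ (arcPt θ) ≠ 0 ∧
    ‖qf (2 * ℓ + ε) (fun w => betaQ w ^ (2 * ℓ + ε) * A w) (arcPt θ)‖ *
      ‖qf (-(2 * ℓ + ε) - 1) (fun w => betaQ w ^ (-(2 * ℓ + ε) - 1) * A' w) τ‖ ≤
      1 / 5 * Real.exp (2 * Real.pi * m * ((arcPt θ).im - 1 / 9)) *
        ‖hauptJ τ - hauptJ (arcPt θ)‖ := by
  have hpi := Real.pi_gt_d4
  have hpos := arcPt_im_pos hθ.1 hθ.2
  have hx := neg_half_le_arcPt_re hθ.1 hθ.2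
  have hx' := arcPt_re_nonpos hθ.1 hθ.2
  have hy : 0.28866 ≤ (arcPt θ).im := le_arcPt_im hpos (by norm_num; nlinarith)
  have hc1 : |(hauptU (arcPt θ)).re| ≤ 1 :=
    (abs_re_le_norm _).trans (norm_hauptU_eq_one hpos (normSq_arcPt θ)).le
  obtain ⟨b1, b2, b3, b4⟩ := h.near_bound him hc1 hc
  obtain ⟨a1, a2, a3⟩ := h.near_arc (θ := θ) (by norm_num at hy ⊢; linarith)
  rw [hauptJ_arc hpos, norm_qf_mul_zpow, norm_qf_mul_zpow]
  refine ⟨b3, ?_⟩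
  have hr0 : 0 < ‖nome (arcPt θ)‖ := norm_pos_iff.2 (nome_ne_zero _)
  have hrexp : ‖nome (arcPt θ)‖ * Real.exp (2 * Real.pi * (arcPt θ).im) = 1 := by
    rw [norm_nome_eq_inv, inv_mul_cancel₀ (Real.exp_pos _).ne']
  set y := (arcPt θ).im
  set d := y - 1 / 9 with hd
  have hd1 : 0.17754 ≤ d := by norm_num at hy ⊢; linarith
  have hd0 : 0 ≤ d := by norm_num at hd1; linarith
  set B := ‖qf 1 betaQ (arcPt θ)‖
  set b := ‖qf 1 betaQ τ‖
  clear_value B b y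
  have hB0 : 0 < B := by norm_num at a1; nlinarith
  have hX : 20000 ≤ Real.exp (18 * Real.pi * d) := by
    refine le_trans ?_ (le_exp_of_le (n := 10) (t := 0) (by norm_num) ?_)
    · norm_num
    · norm_num at hd1 ⊢; nlinarith
  -- On the contour b ≤ 5, while on the arc B is only known to be at least |q|/5 = e^{-2πy}/5. This
  -- compares the two.
  have hX1 : 25 * Real.exp (2 * Real.pi * y) ≤ Real.exp (18 * Real.pi * d) := by
    have h1 : 18 * Real.pi * d = 2 * Real.pi * y + (16 * Real.pi * y - 2 * Real.pi) := by
      rw [hd]; ring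
    rw [h1, Real.exp_add, mul_comm]
    gcongr
    refine le_trans ?_ (le_exp_of_le (n := 4) (t := 0) (by norm_num) ?_)
    · norm_num
    · norm_num at hy ⊢; nlinarith
  -- The tightest point, at the corner: d is close to 1/(2√3) - 1/9, so 46πd > 25.6, and the
  -- constants to be absorbed are 5 · 256 · 8 · 10⁷ = 1.024 · 10¹¹.
  have hX2 : 105000000000 ≤ Real.exp (46 * Real.pi * d) := by
    refine le_trans ?_ (le_exp_of_le (n := 25) (t := 0.6) (by norm_num) ?_)
    · norm_num
    · norm_num at hd1 hpi ⊢; nlinarith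
  refine budget (K := 80000000) hB0 (by linarith) (norm_nonneg _) (norm_nonneg _)
    (by positivity) hd0 hm ?_ ?_ ?_ b4
  · norm_num at a2; nlinarith
  · have h1 : 0.2 * ‖nome (arcPt θ)‖ * (25 * Real.exp (2 * Real.pi * y)) ≤
        B * Real.exp (18 * Real.pi * d) := by gcongr
    have h2 : 0.2 * ‖nome (arcPt θ)‖ * (25 * Real.exp (2 * Real.pi * y)) = 5 := by
      linear_combination 5 * hrexp
    linarith
  · have e : B ^ ε ≤ 1 := by
      rcases h.eps_eq_or with rfl | rfl
      · simp
      · rw [zpow_one]; norm_num at a2; linarith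
    calc B ^ ε * ‖A (nome (arcPt θ))‖ * 80000000
        ≤ 1 * 256 * 80000000 := by gcongr
      _ ≤ _ := by linarith

/-! ### The form on the arc as a sum over poles with a small error. -/

variable {κ E : ℤ} {φ₁ φ₂ : ℂ → ℂ}

/-- The form `f_k P(j)` up to the contribution of the points over `j(z)` above height `A`. -/
theorem DualPair.norm_sub_sum_le (h : DualPair κ E φ₁ φ₂) {N : ℕ} {m : ℤ} (hN : (N : ℤ) = m + E)
    {P : Polynomial ℝ} {g : ℂ → ℂ} (hg : DiscReal g)
    (hP : ∀ w ∈ ball (0 : ℂ) 1, w ≠ 0 →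
      w ^ N * Polynomial.aeval (hauptQ w / w) P * φ₁ w = 1 + w ^ (N + 1) * g w)
    {z : ℂ} {A C : ℝ} (hA : 0 < A) (S : Finset ℂ)
    (hS : ∀ p ∈ S, A < p.im ∧ hauptJ p = hauptJ z ∧ φ₁ (nome p) ≠ 0 ∧ φ₂ (nome p) ≠ 0)
    (hinj : Set.InjOn nome S)
    (hzero : ∀ τ : ℂ, A ≤ τ.im → hauptJ τ = hauptJ z → ∃ p ∈ S, nome τ = nome p)
    (herr : ∀ τ : ℂ, τ.im = A → hauptJ τ - hauptJ z ≠ 0 ∧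
      ‖qf E φ₁ z‖ * ‖qf (-E - 1) φ₂ τ‖ ≤
        C * Real.exp (2 * Real.pi * m * (z.im - A)) * ‖hauptJ τ - hauptJ z‖) :
    ‖qf E φ₁ z * Polynomial.aeval (hauptJ z) P -
      ∑ p ∈ S, qf E φ₁ z / qf E φ₁ p * nome p ^ (-m)‖ ≤ C * Real.exp (2 * Real.pi * m * z.im) := by
  classical
  have hpi := Real.pi_pos
  set R := Real.exp (-(2 * Real.pi * A)) with hR
  have hR0 : 0 < R := Real.exp_pos _
  have hR1 : R < 1 := by
    rw [hR, Real.exp_lt_one_iff, neg_lt_zero]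
    positivity
  have hj : ∀ τ : ℂ, 0 < τ.im → hauptQ (nome τ) = hauptJ τ * nome τ := fun τ hτ => by
    have := nome_ne_zero τ
    rw [hauptJ_eq hτ, qf, zpow_neg_one]
    field_simp
  have hlift : ∀ w, ‖w‖ ≤ R → w ≠ 0 → ∃ τ : ℂ, A ≤ τ.im ∧ nome τ = w ∧ (‖w‖ = R → τ.im = A) := by
    intro w hw h0
    obtain ⟨τ, hτ, -, rfl⟩ := exists_nome_eq h0 (hw.trans_lt hR1)
    rw [norm_nome, hR] at hw
    refine ⟨τ, ?_, rfl, fun he => ?_⟩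
    · have := Real.exp_le_exp.1 hw
      have h2 : 2 * Real.pi * A ≤ 2 * Real.pi * τ.im := by linarith
      exact le_of_mul_le_mul_left h2 (by positivity)
    · rw [norm_nome, hR] at he
      have := Real.exp_injective he
      have h2 : 2 * Real.pi * τ.im = 2 * Real.pi * A := by linarith
      exact mul_left_cancel₀ (by positivity) h2
  have hfab := h.faber_eq hg hP (hauptJ z) hR0 hR1 (S.image nome) (by
    intro s hs
    obtain ⟨p, hp, rfl⟩ := Finset.mem_image.1 hs
    obtain ⟨p1, p2, p3, p4⟩ := hS p hp
    refine ⟨?_, by rw [hj p (hA.trans p1), p2], p3, p4⟩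
    rw [norm_nome, hR]
    apply Real.exp_lt_exp.2
    have : 2 * Real.pi * A < 2 * Real.pi * p.im := by gcongr
    linarith) (by
    intro w hw hQ
    have h0 : w ≠ 0 := by
      rintro rfl
      rw [hauptQ_zero, mul_zero] at hQ
      exact one_ne_zero hQ
    obtain ⟨τ, hτ, rfl, -⟩ := hlift w hw h0
    rw [hj τ (hA.trans_le hτ)] at hQ
    obtain ⟨p, hp, e⟩ := hzero τ hτ (mul_right_cancel₀ h0 hQ)
    exact Finset.mem_image.2 ⟨p, hp, e.symm⟩)
  rw [Finset.sum_image hinj] at hfab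
  have hterm : ∀ p ∈ S, qf E φ₁ z / qf E φ₁ p * nome p ^ (-m) =
      qf E φ₁ z * (nome p ^ N * φ₁ (nome p))⁻¹ := by
    intro p hp
    have h0 := nome_ne_zero p
    rw [qf, qf, zpow_neg, ← zpow_natCast, hN, zpow_add₀ h0]
    have := (hS p hp).2.2.1
    have := zpow_ne_zero m h0
    have := zpow_ne_zero E h0
    field_simp
  rw [Finset.sum_congr rfl hterm, ← Finset.mul_sum, hfab, mul_add, add_sub_cancel_left, norm_mul]
  set I₀ := (2 * Real.pi * I : ℂ)⁻¹ •
    ∮ w in C(0, R), φ₂ w / w ^ (N + 1) / (hauptQ w - hauptJ z * w) with hI₀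
  -- The bound on the integral is divided by |F(z)| below. If F(z) = 0 only C ≥ 0 is needed, and it
  -- follows from the error hypothesis at any point of the contour.
  by_cases hF : qf E φ₁ z = 0
  · rw [hF, norm_zero, zero_mul]
    have h1 := (herr ⟨0, A⟩ rfl).2
    rw [hF, norm_zero, zero_mul] at h1
    have h2 : 0 < ‖hauptJ ⟨0, A⟩ - hauptJ z‖ := norm_pos_iff.2 (herr ⟨0, A⟩ rfl).1
    have hC : 0 ≤ C := by
      have h3 := nonneg_of_mul_nonneg_left h1 h2
      exact nonneg_of_mul_nonneg_left h3 (Real.exp_pos _)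
    positivity
  have hF0 : 0 < ‖qf E φ₁ z‖ := norm_pos_iff.2 hF
  have hbound : ‖I₀‖ ≤ R * (C * Real.exp (2 * Real.pi * m * (z.im - A)) * R ^ (-m - 1) /
      ‖qf E φ₁ z‖) := by
    refine norm_two_pi_I_inv_smul_circleIntegral_le hR0 fun w hw => ?_
    have h0 : w ≠ 0 := norm_pos_iff.1 (by rw [hw]; exact hR0)
    obtain ⟨τ, hτ, rfl, hτ2⟩ := hlift w hw.le h0
    obtain ⟨e1, e2⟩ := herr τ (hτ2 hw)
    have e3 : φ₂ (nome τ) / nome τ ^ (N + 1) / (hauptQ (nome τ) - hauptJ z * nome τ) =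
        nome τ ^ (-m - 1) * (qf (-E - 1) φ₂ τ / (hauptJ τ - hauptJ z)) := by
      rw [hj τ (hA.trans_le hτ), ← sub_mul, qf, ← zpow_natCast,
        show ((N + 1 : ℕ) : ℤ) = m + E + 1 by push_cast; omega,
        show -m - 1 = -(m + 1) by ring, show -E - 1 = -(E + 1) by ring, zpow_neg, zpow_neg,
        zpow_add₀ h0, zpow_add₀ h0, zpow_add₀ h0, zpow_add₀ h0, zpow_one]
      have := zpow_ne_zero m h0
      have := zpow_ne_zero E h0
      field_simp
    rw [e3, norm_mul, norm_zpow, hw, norm_div, div_eq_mul_inv _ ‖qf E φ₁ z‖]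
    have e4 : ‖qf (-E - 1) φ₂ τ‖ / ‖hauptJ τ - hauptJ z‖ ≤
        C * Real.exp (2 * Real.pi * m * (z.im - A)) * ‖qf E φ₁ z‖⁻¹ := by
      rw [div_le_iff₀ (norm_pos_iff.2 e1)]
      have : ‖qf (-E - 1) φ₂ τ‖ = (‖qf E φ₁ z‖ * ‖qf (-E - 1) φ₂ τ‖) * ‖qf E φ₁ z‖⁻¹ := by
        field_simp
      rw [this]
      calc _ ≤ (C * Real.exp (2 * Real.pi * m * (z.im - A)) * ‖hauptJ τ - hauptJ z‖) *
            ‖qf E φ₁ z‖⁻¹ := by gcongr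
        _ = _ := by ring
    calc _ ≤ R ^ (-m - 1) *
          (C * Real.exp (2 * Real.pi * m * (z.im - A)) * ‖qf E φ₁ z‖⁻¹) := by gcongr
      _ = _ := by ring
  refine (mul_le_mul_of_nonneg_left hbound hF0.le).trans (le_of_eq ?_)
  -- The length of the circle and |w|^{-m-1} combine to e^{2πmA}, which turns e^{2πm(y-A)} into
  -- e^{2πmy}.
  have e5 : R * R ^ (-m - 1) = Real.exp (2 * Real.pi * m * A) := by
    rw [← zpow_one_add₀ hR0.ne', show 1 + (-m - 1) = -m by ring, hR, ← Real.rpow_intCast, ← Real.exp_mul]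
    congr 1
    push_cast
    ring
  have e6 : Real.exp (2 * Real.pi * m * z.im) =
      Real.exp (2 * Real.pi * m * (z.im - A)) * Real.exp (2 * Real.pi * m * A) := by
    rw [← Real.exp_add]; congr 1; ring
  rw [e6, ← e5]
  field_simp

/-- A pole and its mirror image are then distinct poles in the disc, so each is counted once. -/
lemma nome_ne_nome_neg_conj {p : ℂ} (h0 : p.re ≠ 0) (h1 : |p.re| < 1 / 2) :
    nome p ≠ nome (-conj p) := by
  intro h
  obtain ⟨n, hn⟩ := nome_eq_iff.1 h
  have h2 := congrArg re hn
  rw [add_re, neg_re, conj_re, intCast_re] at h2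
  rw [abs_lt] at h1
  have h3 : ((n : ℤ) : ℝ) = 2 * p.re := by linarith
  have h4 : n < 1 := by exact_mod_cast (show (n : ℝ) < 1 by linarith)
  have h5 : -1 < n := by exact_mod_cast (show (-1 : ℝ) < n by linarith)
  have h6 : n = 0 := by omega
  rw [h6] at h3
  apply h0
  norm_num at h3
  linarith

lemma im_eq_of_nome_eq {p p' : ℂ} (h : nome p = nome p') : p.im = p'.im := by
  obtain ⟨n, hn⟩ := nome_eq_iff.1 h
  simpa using congrArg im hn

/-- `p i` or its mirror image. -/
def mirror {n : ℕ} (p : Fin n → ℂ) (i : Fin n × Bool) : ℂ := if i.2 then p i.1 else -conj (p i.1)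

lemma mirror_im {n : ℕ} (p : Fin n → ℂ) (i : Fin n × Bool) : (mirror p i).im = (p i.1).im := by
  rw [mirror]; split_ifs <;> simp

lemma nome_mirror_injective {n : ℕ} {p : Fin n → ℂ} (hinj : Function.Injective fun i => (p i).im)
    (hre : ∀ i, (p i).re ≠ 0 ∧ |(p i).re| < 1 / 2) :
    Function.Injective fun i => nome (mirror p i) := by
  rintro ⟨i, b⟩ ⟨i', b'⟩ h
  have h1 := im_eq_of_nome_eq h
  rw [mirror_im, mirror_im] at h1
  obtain rfl : i = i' := hinj h1
  have h2 := nome_ne_nome_neg_conj (hre i).1 (hre i).2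
  cases b <;> cases b' <;> simp [mirror] at h ⊢
  · exact h2 h.symm
  · exact h2 h

/-- By the cubic relation e vanishes only where j = -54, and δ vanishes only where u = ±1. Both
seeds divide e δ. -/
lemma IsSeed.ne_zero {ρ ε : ℤ} {A A' : ℂ → ℂ} (h : IsSeed ρ ε A A') {τ : ℂ} (him : 0 < τ.im)
    (h1 : hauptJ τ ≠ 54) (h2 : hauptJ τ ≠ -54) : A (nome τ) ≠ 0 ∧ A' (nome τ) ≠ 0 := by
  have hB : qf 1 betaQ τ ≠ 0 := by
    rw [qf, zpow_one]
    exact mul_ne_zero (nome_ne_zero τ) (betaQ_ne_zero (nome_mem_ball him))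
  have hu := hauptU_ne_zero him
  have he : eisQ (nome τ) ≠ 0 := by
    intro h0
    have := cubic_eis him
    rw [h0, zero_pow (by norm_num), eq_comm, mul_eq_zero] at this
    exact h2 (eq_neg_of_add_eq_zero_left (this.resolve_left hB))
  have hd : oddQ (nome τ) ≠ 0 := by
    rw [oddQ_eq him]
    refine mul_ne_zero (mul_ne_zero (by norm_num) hB) fun h0 => ?_
    have h3 : hauptU τ ^ 2 = 1 := by
      field_simp at h0
      linear_combination h0
    rcases mul_self_eq_one_iff.1 ((_root_.sq _).symm.trans h3) with h4 | h4
    · exact h1 (by rw [hauptJ, h4]; norm_num)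
    · exact h2 (by rw [hauptJ, h4]; norm_num)
  have h3 := h.mul_eq (nome_mem_ball him)
  constructor
  · intro h0
    rw [h0, zero_mul] at h3
    exact mul_ne_zero he hd h3.symm
  · intro h0
    rw [h0, mul_zero] at h3
    exact mul_ne_zero he hd h3.symm

/-- The real function `e^{iκθ} f(e^{iθ}/√3)` on the arc, for `f = F P(j)`. -/
def arcForm (κ : ℤ) (F : ℂ → ℂ) (P : Polynomial ℝ) (θ : ℝ) : ℝ :=
  (cexp (I * κ * θ) * (F (arcPt θ) * Polynomial.aeval (hauptJ (arcPt θ)) P)).re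

/-- The contribution of the pole `p`. -/
def polePart (κ m : ℤ) (F : ℂ → ℂ) (θ : ℝ) (p : ℂ) : ℂ :=
  cexp (I * κ * θ) * (F (arcPt θ) / F p * nome p ^ (-m))

/-- The phase of the main term. -/
def arcPhase (κ m : ℤ) (θ : ℝ) : ℝ := κ * θ - 2 * Real.pi * m * (arcPt θ).re

lemma three_sq_arcPt_zpow (κ : ℤ) (θ : ℝ) : (3 * arcPt θ ^ 2) ^ κ = cexp (I * κ * θ) ^ 2 := by
  have h : ((√3 : ℝ) : ℂ) ^ 2 = 3 := by
    rw [← ofReal_pow, Real.sq_sqrt (by norm_num)]; norm_num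
  have h0 : ((√3 : ℝ) : ℂ) ≠ 0 := by
    rw [ofReal_ne_zero]; positivity
  have e : 3 * arcPt θ ^ 2 = cexp (2 * (I * θ)) := by
    rw [arcPt, mul_pow, ← Complex.exp_nat_mul, div_pow, h]
    push_cast
    ring
  rw [e, ← Complex.exp_int_mul, ← Complex.exp_nat_mul]
  congr 1
  push_cast
  ring

lemma conj_cexp_phase (κ : ℤ) (θ : ℝ) : conj (cexp (I * κ * θ)) * cexp (I * κ * θ) = 1 := by
  rw [← exp_conj, ← Complex.exp_add, map_mul, map_mul, conj_I, conj_ofReal, map_intCast,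
    ← Complex.exp_zero]
  congr 1
  ring

section

variable {κ E m : ℤ} {φ : ℂ → ℂ}

/-- On the arc conjugation is the action of W, whose automorphy factor (3τ²)^κ is e^{2iκθ}. Half of
this phase makes the form real. -/
lemma conj_phase_mul (hφ : QForm κ 1 E φ) {θ : ℝ} (him : 0 < (arcPt θ).im) :
    conj (cexp (I * κ * θ) * qf E φ (arcPt θ)) = cexp (I * κ * θ) * qf E φ (arcPt θ) := by
  rw [map_mul, qf_arc_conj hφ him (normSq_arcPt θ), three_sq_arcPt_zpow]
  linear_combination (cexp (I * κ * θ) * qf E φ (arcPt θ)) * conj_cexp_phase κ θ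

lemma arcForm_eq (hφ : QForm κ 1 E φ) (P : Polynomial ℝ) {θ : ℝ} (him : 0 < (arcPt θ).im) :
    ((arcForm κ (qf E φ) P θ : ℝ) : ℂ) =
      cexp (I * κ * θ) * (qf E φ (arcPt θ) * Polynomial.aeval (hauptJ (arcPt θ)) P) := by
  rw [arcForm]
  refine conj_eq_iff_re.1 ?_
  rw [← mul_assoc, map_mul, conj_phase_mul hφ him]
  congr 1
  rw [hauptJ_arc him]
  have := Polynomial.aeval_algebraMap_apply ℂ (54 * (hauptU (arcPt θ)).re) P
  rw [Complex.coe_algebraMap] at this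
  rw [this, conj_ofReal]

/-- A pole and its mirror image thus contribute twice a real part. -/
lemma polePart_neg_conj (hφ : QForm κ 1 E φ) {θ : ℝ} (him : 0 < (arcPt θ).im) {p : ℂ}
    (hp : 0 < p.im) :
    polePart κ m (qf E φ) θ (-conj p) = conj (polePart κ m (qf E φ) θ p) := by
  have h := conj_phase_mul hφ him
  rw [polePart, polePart, qf_neg_conj hφ.toDiscReal E hp, nome_neg_conj, div_eq_mul_inv,
    div_eq_mul_inv, ← mul_assoc, ← mul_assoc, ← mul_assoc, ← mul_assoc, map_mul, map_mul, h, map_inv₀, map_zpow₀]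

lemma polePart_self {θ : ℝ} (h0 : qf E φ (arcPt θ) ≠ 0) :
    (polePart κ m (qf E φ) θ (arcPt θ)).re =
      Real.cos (arcPhase κ m θ) * Real.exp (2 * Real.pi * m * (arcPt θ).im) := by
  have e : polePart κ m (qf E φ) θ (arcPt θ) =
      cexp (((2 * Real.pi * m * (arcPt θ).im : ℝ) : ℂ) + (arcPhase κ m θ : ℝ) * I) := by
    rw [polePart, div_self h0, one_mul, nome, ← Complex.exp_int_mul, ← Complex.exp_add]
    congr 1
    rw [arcPhase]
    conv_lhs => rw [← re_add_im (arcPt θ)]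
    push_cast
    linear_combination (-(2 * Real.pi * m * ((arcPt θ).im : ℂ))) * I_sq
  rw [e, exp_re]
  simp
  ring

/-- |F(z)/F(p)| is a power of the ratio of heights, by invariance of y^κ|F|. -/
lemma norm_polePart (hφ : QForm κ 1 E φ) {θ : ℝ} (him : 0 < (arcPt θ).im) {p : ℂ} (hp : 0 < p.im)
    (hrel : Related (arcPt θ) p) (h0 : qf E φ (arcPt θ) ≠ 0) :
    ‖polePart κ m (qf E φ) θ p‖ =
      (p.im / (arcPt θ).im) ^ κ * Real.exp (2 * Real.pi * m * p.im) := by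
  have h1 := hrel _ (hφ.isInvariant (by simp))
  have h2 : ‖cexp (I * κ * θ)‖ = 1 := by
    rw [norm_exp]; simp
  have h3 : ‖nome p ^ (-m)‖ = Real.exp (2 * Real.pi * m * p.im) := by
    rw [norm_zpow, norm_nome, ← Real.rpow_intCast, ← Real.exp_mul]
    congr 1
    push_cast
    ring
  have hy := zpow_ne_zero κ him.ne'
  have hpi := zpow_ne_zero κ hp.ne'
  have h4 : ‖qf E φ p‖ ≠ 0 := by
    intro h
    rw [h, mul_zero] at h1
    exact mul_ne_zero hy (norm_ne_zero_iff.2 h0) h1.symm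
  rw [polePart, norm_mul, h2, one_mul, norm_mul, norm_div, h3, div_zpow]
  congr 1
  rw [div_eq_div_iff h4 hy]
  linear_combination -h1

end

lemma hauptJ_arc_ne {θ : ℝ} (hθ : θ ∈ Ioo (Real.pi / 2) (5 * Real.pi / 6)) :
    hauptJ (arcPt θ) ≠ 54 ∧ hauptJ (arcPt θ) ≠ -54 := by
  have hpi := Real.pi_pos
  have him := arcPt_im_pos hθ.1.le hθ.2.le
  have h1 := re_hauptU_strictAnti ⟨le_rfl, by linarith⟩ ⟨hθ.1.le, hθ.2.le⟩ hθ.1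
  have h2 := re_hauptU_strictAnti ⟨hθ.1.le, hθ.2.le⟩ ⟨by linarith, le_rfl⟩ hθ.2
  simp only [hauptU_arc_start, arcPt_five, hauptU_rho, one_re, neg_re] at h1 h2
  rw [hauptJ_arc him]
  constructor
  · intro h
    have : 54 * (hauptU (arcPt θ)).re = 54 := by exact_mod_cast h
    linarith
  · intro h
    have : 54 * (hauptU (arcPt θ)).re = -54 := by exact_mod_cast h
    linarith

/-- j(z) is real on the arc, so |j - j(z)| is itself an invariant, and it vanishes at z. -/
lemma hauptJ_eq_of_related {θ : ℝ} (him : 0 < (arcPt θ).im) {p : ℂ} (h : Related (arcPt θ) p) :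
    hauptJ p = hauptJ (arcPt θ) := by
  have h1 := h _ (isInvariant_hauptJ_sub (54 * (hauptU (arcPt θ)).re))
  rw [hauptJ_arc him, sub_self, norm_zero, norm_eq_zero, sub_eq_zero] at h1
  rw [h1, hauptJ_arc him]

lemma mirror_related {n : ℕ} {p : Fin n → ℂ} {z : ℂ} (h : ∀ i, Related z (p i))
    (hp : ∀ i, 0 < (p i).im) (i : Fin n × Bool) : Related z (mirror p i) := by
  rw [mirror]
  split_ifs
  · exact h _
  · exact (h _).neg_conj (hp _)

lemma IsSeed.qf_ne_zero {ρ ε : ℤ} {A A' : ℂ → ℂ} (h : IsSeed ρ ε A A') (E : ℤ) {τ : ℂ}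
    (him : 0 < τ.im) (h1 : hauptJ τ ≠ 54) (h2 : hauptJ τ ≠ -54) :
    qf E (fun w => betaQ w ^ E * A w) τ ≠ 0 :=
  mul_ne_zero (zpow_ne_zero _ (nome_ne_zero τ)) (mul_ne_zero
    (zpow_ne_zero _ (betaQ_ne_zero (nome_mem_ball him))) (h.ne_zero him h1 h2).1)

/-- The form on the arc as the sum of the contributions of the poles, with an error term. -/
theorem IsSeed.abs_arcForm_sub_le {ρ ε : ℤ} {A A' : ℂ → ℂ} (h : IsSeed ρ ε A A') {ℓ m : ℤ}
    {N : ℕ} (hN : (N : ℤ) = m + (2 * ℓ + ε))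
    {P : Polynomial ℝ} {g : ℂ → ℂ} (hg : DiscReal g)
    (hP : ∀ w ∈ ball (0 : ℂ) 1, w ≠ 0 →
      w ^ N * Polynomial.aeval (hauptQ w / w) P * (betaQ w ^ (2 * ℓ + ε) * A w) =
        1 + w ^ (N + 1) * g w)
    {θ : ℝ} (hθ : θ ∈ Ioo (Real.pi / 2) (5 * Real.pi / 6)) {a C : ℝ} (ha : 0 < a) {n : ℕ}
    (p : Fin n → ℂ) (hp : ∀ i, a < (p i).im) (hrel : ∀ i, Related (arcPt θ) (p i))
    (hinj : Function.Injective fun i => (p i).im) (hre : ∀ i, (p i).re ≠ 0 ∧ |(p i).re| < 1 / 2)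
    (hzero : ∀ τ : ℂ, a ≤ τ.im → hauptJ τ = hauptJ (arcPt θ) →
      ∃ i, nome τ = nome (p i) ∨ nome τ = nome (-conj (p i)))
    (herr : ∀ τ : ℂ, τ.im = a → hauptJ τ - hauptJ (arcPt θ) ≠ 0 ∧
      ‖qf (2 * ℓ + ε) (fun w => betaQ w ^ (2 * ℓ + ε) * A w) (arcPt θ)‖ *
        ‖qf (-(2 * ℓ + ε) - 1) (fun w => betaQ w ^ (-(2 * ℓ + ε) - 1) * A' w) τ‖ ≤
        C * Real.exp (2 * Real.pi * m * ((arcPt θ).im - a)) * ‖hauptJ τ - hauptJ (arcPt θ)‖) :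
    |arcForm (6 * ℓ + 3 * ε + ρ) (qf (2 * ℓ + ε) fun w => betaQ w ^ (2 * ℓ + ε) * A w) P θ -
      ∑ i, 2 * (polePart (6 * ℓ + 3 * ε + ρ) m
        (qf (2 * ℓ + ε) fun w => betaQ w ^ (2 * ℓ + ε) * A w) θ (p i)).re| ≤
      C * Real.exp (2 * Real.pi * m * (arcPt θ).im) := by
  classical
  have hd := h.dualPair ℓ
  set κ := 6 * ℓ + 3 * ε + ρ
  set E := 2 * ℓ + ε
  set φ := fun w => betaQ w ^ E * A w
  have him := arcPt_im_pos hθ.1.le hθ.2.le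
  obtain ⟨hj1, hj2⟩ := hauptJ_arc_ne hθ
  have hp0 : ∀ i, 0 < (p i).im := fun i => ha.trans (hp i)
  have hminj := nome_mirror_injective hinj hre
  have hmj : ∀ i, hauptJ (mirror p i) = hauptJ (arcPt θ) := fun i =>
    hauptJ_eq_of_related him (mirror_related hrel hp0 i)
  have hmim : ∀ i, a < (mirror p i).im := fun i => by rw [mirror_im]; exact hp _
  have hminj' : Function.Injective (mirror p) := fun i i' e => hminj (congrArg nome e)
  have key := hd.norm_sub_sum_le hN hg hP (z := arcPt θ) ha (Finset.univ.image (mirror p)) (by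
      intro q hq
      obtain ⟨i, -, rfl⟩ := Finset.mem_image.1 hq
      have h0 := ha.trans (hmim i)
      obtain ⟨n1, n2⟩ := h.ne_zero h0 (by rw [hmj]; exact hj1) (by rw [hmj]; exact hj2)
      have hB := betaQ_ne_zero (nome_mem_ball h0)
      exact ⟨hmim i, hmj i, mul_ne_zero (zpow_ne_zero _ hB) n1,
        mul_ne_zero (zpow_ne_zero _ hB) n2⟩)
    (by
      intro q hq q' hq' e
      simp only [Finset.coe_image, Finset.coe_univ, image_univ, mem_range] at hq hq'
      obtain ⟨i, rfl⟩ := hq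
      obtain ⟨i', rfl⟩ := hq'
      rw [hminj e])
    (by
      intro τ hτ hJ
      obtain ⟨i, e | e⟩ := hzero τ hτ hJ
      · exact ⟨_, Finset.mem_image_of_mem _ (Finset.mem_univ (i, true)), by simpa [mirror] using e⟩
      · exact ⟨_, Finset.mem_image_of_mem _ (Finset.mem_univ (i, false)), by
          simpa [mirror] using e⟩) herr
  rw [Finset.sum_image fun i _ i' _ e => hminj' e, Fintype.sum_prod_type] at key
  have e : ((arcForm κ (qf E φ) P θ - ∑ i, 2 * (polePart κ m (qf E φ) θ (p i)).re : ℝ) : ℂ) =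
      cexp (I * κ * θ) * (qf E φ (arcPt θ) * Polynomial.aeval (hauptJ (arcPt θ)) P -
        ∑ x, ∑ y, qf E φ (arcPt θ) / qf E φ (mirror p (x, y)) * nome (mirror p (x, y)) ^ (-m)) := by
    rw [ofReal_sub, arcForm_eq hd.qform₁ P him, mul_sub, Finset.mul_sum, ofReal_sum]
    congr 1
    refine Finset.sum_congr rfl fun i _ => ?_
    rw [Fintype.sum_bool, mul_add]
    have h1 := polePart_neg_conj (m := m) hd.qform₁ him (hp0 i)
    change _ = polePart κ m (qf E φ) θ (p i) + polePart κ m (qf E φ) θ (-conj (p i))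
    rw [h1, add_conj]
  have h2 : ‖cexp (I * κ * θ)‖ = 1 := by
    rw [norm_exp]; simp
  rw [← Real.norm_eq_abs, ← Complex.norm_real, e, norm_mul, h2, one_mul]
  exact key

lemma im_add_int_pos {z : ℂ} (hz : 0 < z.im) (n : ℤ) : 0 < (z + (n : ℂ)).im := by simpa using hz

/-- Writing the poles through W, translations and the reflection gives both their coordinates and
the fact that they are related to z. -/
lemma pole₁_eq {z : ℂ} (hz : 0 < z.im) (hn : normSq z = 1 / 3) :
    pole₁ z = -conj (fricke (z + (1 : ℤ))) := by
  have h := neg_conj_pole₁ hz hn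
  have : fricke (z + (1 : ℤ)) = -conj (pole₁ z) := by rw [h, fricke]; push_cast; rfl
  rw [this]
  simp

lemma pole₂_eq {z : ℂ} (hz : 0 < z.im) (hn : normSq z = 1 / 3) :
    pole₂ z = -conj (fricke (pole₁ z + (-1 : ℤ))) := by
  have h := neg_conj_pole₂ hz hn
  have h1 := three_mul_add_ne_zero hz 1
  have h2 := two_mul_add_ne_zero hz
  push_cast at h1
  have : fricke (pole₁ z + (-1 : ℤ)) = -conj (pole₂ z) := by
    have e : pole₁ z + (-1 : ℤ) = -(2 * z + 1) / (3 * z + 1) := by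
      rw [pole₁]
      push_cast
      rw [eq_div_iff h1, add_mul, div_mul_cancel₀ _ h1]
      ring
    rw [h, fricke, e]
    field_simp
  rw [this]
  simp

/-- Position of the first pole. -/
lemma pole₁_re_im {z : ℂ} (hz : 0 < z.im) (hn : normSq z = 1 / 3) :
    (pole₁ z).re = (1 + z.re) / (4 + 6 * z.re) ∧ (pole₁ z).im = z.im / (4 + 6 * z.re) := by
  have h1 : normSq (z + (1 : ℤ)) = (4 + 6 * z.re) / 3 := by
    have := normSq_row hn 1 1
    push_cast at this ⊢
    rw [one_mul] at this
    rw [this]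
    ring
  rw [pole₁_eq hz hn, neg_re, neg_im, conj_re, conj_im, fricke_re, fricke_im, h1]
  constructor
  · rw [add_re]; simp; congr 1 <;> ring
  · simp; congr 1; ring

/-- Position of the second pole. -/
lemma pole₂_re_im {z : ℂ} (hz : 0 < z.im) (hn : normSq z = 1 / 3) (h4 : 0 < 4 + 6 * z.re) :
    (pole₂ z).re = -((3 + 5 * z.re) / (7 + 12 * z.re)) ∧
      (pole₂ z).im = z.im / (7 + 12 * z.re) := by
  obtain ⟨hr, hi⟩ := pole₁_re_im hz hn
  have hxy : z.re ^ 2 + z.im ^ 2 = 1 / 3 := by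
    rw [normSq_apply] at hn; linarith
  have h1 : normSq (pole₁ z + (-1 : ℤ)) = (7 + 12 * z.re) / (3 * (4 + 6 * z.re)) := by
    rw [normSq_apply, add_re, add_im, hr, hi]
    simp only [intCast_re, intCast_im]
    push_cast
    have e : ((1 + z.re) / (4 + 6 * z.re) + -1) * ((1 + z.re) / (4 + 6 * z.re) + -1) +
        (z.im / (4 + 6 * z.re) + 0) * (z.im / (4 + 6 * z.re) + 0) =
        ((3 + 5 * z.re) ^ 2 + z.im ^ 2) / (4 + 6 * z.re) ^ 2 := by
      have e1 : (1 + z.re) / (4 + 6 * z.re) + -1 = -(3 + 5 * z.re) / (4 + 6 * z.re) := by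
        rw [eq_div_iff h4.ne', add_mul, div_mul_cancel₀ _ h4.ne']; ring
      rw [e1]
      generalize 4 + 6 * z.re = D
      ring
    rw [e, div_eq_div_iff (by positivity) (by positivity)]
    linear_combination (3 * (4 + 6 * z.re)) * hxy
  rw [pole₂_eq hz hn, neg_re, neg_im, conj_re, conj_im, fricke_re, fricke_im, h1, add_re, add_im,
    hr, hi]
  simp only [intCast_re, intCast_im]
  push_cast
  have e1 : (1 + z.re) / (4 + 6 * z.re) + -1 = -(3 + 5 * z.re) / (4 + 6 * z.re) := by
    rw [eq_div_iff h4.ne', add_mul, div_mul_cancel₀ _ h4.ne']; ring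
  rw [e1]
  have h4' := h4.ne'
  generalize 4 + 6 * z.re = D at h4'
  constructor
  · by_cases h7 : 7 + 12 * z.re = 0
    · rw [h7]; simp
    · field_simp
  · by_cases h7 : 7 + 12 * z.re = 0
    · rw [h7]; simp
    · field_simp
      ring

lemma related_pole₁ {z : ℂ} (hz : 0 < z.im) (hn : normSq z = 1 / 3) : Related z (pole₁ z) := by
  rw [pole₁_eq hz hn]
  have h1 := im_add_int_pos hz 1
  exact (((Related.refl z).add_int 1).fricke h1).neg_conj (fricke_im_pos h1)

lemma related_pole₂ {z : ℂ} (hz : 0 < z.im) (hn : normSq z = 1 / 3) (h4 : 0 < 4 + 6 * z.re) :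
    Related z (pole₂ z) := by
  rw [pole₂_eq hz hn]
  have h0 : 0 < (pole₁ z).im := by
    rw [(pole₁_re_im hz hn).2]; positivity
  have h1 := im_add_int_pos h0 (-1)
  exact (((related_pole₁ hz hn).add_int (-1)).fricke h1).neg_conj (fricke_im_pos h1)

section approx

variable {ρ ε : ℤ} {A A' : ℂ → ℂ} {ℓ m : ℤ} {N : ℕ} {P : Polynomial ℝ} {g : ℂ → ℂ}

lemma arcPt_re_neg {θ : ℝ} (hθ : θ ∈ Ioo (Real.pi / 2) (5 * Real.pi / 6)) : (arcPt θ).re < 0 := by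
  have hpi := Real.pi_pos
  rw [arcPt_re]
  exact div_neg_of_neg_of_pos
    (Real.cos_neg_of_pi_div_two_lt_of_lt hθ.1 (by linarith [hθ.2])) (by positivity)

/-- The form on the far part of the arc. -/
theorem IsSeed.far_approx (h : IsSeed ρ ε A A') (hm : 18 * |ℓ| + 23 ≤ m)
    (hN : (N : ℤ) = m + (2 * ℓ + ε)) (hg : DiscReal g)
    (hP : ∀ w ∈ ball (0 : ℂ) 1, w ≠ 0 →
      w ^ N * Polynomial.aeval (hauptQ w / w) P * (betaQ w ^ (2 * ℓ + ε) * A w) =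
        1 + w ^ (N + 1) * g w)
    {θ : ℝ} (hθ : θ ∈ Ioo (Real.pi / 2) (5 * Real.pi / 6))
    (hc : -(1 / 5) ≤ (hauptU (arcPt θ)).re) :
    |arcForm (6 * ℓ + 3 * ε + ρ) (qf (2 * ℓ + ε) fun w => betaQ w ^ (2 * ℓ + ε) * A w) P θ -
      2 * Real.cos (arcPhase (6 * ℓ + 3 * ε + ρ) m θ) *
        Real.exp (2 * Real.pi * m * (arcPt θ).im)| ≤
      1 / 5 * Real.exp (2 * Real.pi * m * (arcPt θ).im) := by
  have hθ' : θ ∈ Icc (Real.pi / 2) (5 * Real.pi / 6) := ⟨hθ.1.le, hθ.2.le⟩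
  have him := arcPt_im_pos hθ.1.le hθ.2.le
  have hx := neg_quarter_le_arcPt_re hθ' hc
  have hx0 := arcPt_re_neg hθ
  have hy : 0.52 ≤ (arcPt θ).im := le_arcPt_im him (by nlinarith)
  obtain ⟨hj1, hj2⟩ := hauptJ_arc_ne hθ
  have := h.abs_arcForm_sub_le hN hg hP hθ (a := 2 / 5) (C := 1 / 5) (by norm_num)
    (fun _ : Fin 1 => arcPt θ) (fun _ => by norm_num at hy ⊢; linarith) (fun _ => Related.refl _)
    (fun _ _ _ => Subsingleton.elim _ _)
    (fun _ => ⟨hx0.ne, by rw [abs_lt]; constructor <;> linarith⟩)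
    (fun τ hτ hJ => ⟨0, nome_eq_of_hauptJ_eq_of_le_im hτ hθ' hJ⟩)
    (fun τ hτ => h.far_error hm hθ' hc hτ)
  rw [Fin.sum_univ_one, polePart_self (h.qf_ne_zero _ him hj1 hj2), ← mul_assoc] at this
  exact this

/-- The form on the near part of the arc. -/
theorem IsSeed.near_approx (h : IsSeed ρ ε A A') (hm : 18 * |ℓ| + 23 ≤ m)
    (hN : (N : ℤ) = m + (2 * ℓ + ε)) (hg : DiscReal g)
    (hP : ∀ w ∈ ball (0 : ℂ) 1, w ≠ 0 →
      w ^ N * Polynomial.aeval (hauptQ w / w) P * (betaQ w ^ (2 * ℓ + ε) * A w) =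
        1 + w ^ (N + 1) * g w)
    {θ : ℝ} (hθ : θ ∈ Ioo (Real.pi / 2) (5 * Real.pi / 6))
    (hc : (hauptU (arcPt θ)).re ≤ -(1 / 5)) :
    |arcForm (6 * ℓ + 3 * ε + ρ) (qf (2 * ℓ + ε) fun w => betaQ w ^ (2 * ℓ + ε) * A w) P θ -
      (2 * (polePart (6 * ℓ + 3 * ε + ρ) m (qf (2 * ℓ + ε) fun w => betaQ w ^ (2 * ℓ + ε) * A w) θ
          (arcPt θ)).re +
        2 * (polePart (6 * ℓ + 3 * ε + ρ) m (qf (2 * ℓ + ε) fun w => betaQ w ^ (2 * ℓ + ε) * A w) θ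
          (pole₁ (arcPt θ))).re +
        2 * (polePart (6 * ℓ + 3 * ε + ρ) m (qf (2 * ℓ + ε) fun w => betaQ w ^ (2 * ℓ + ε) * A w) θ
          (pole₂ (arcPt θ))).re)| ≤
      1 / 5 * Real.exp (2 * Real.pi * m * (arcPt θ).im) := by
  have hθ' : θ ∈ Icc (Real.pi / 2) (5 * Real.pi / 6) := ⟨hθ.1.le, hθ.2.le⟩
  have him := arcPt_im_pos hθ.1.le hθ.2.le
  have hx := arcPt_re_le_neg_fifth hθ' hc
  have hx1 := neg_half_lt_arcPt_re hθ.1.le hθ.2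
  have hns := normSq_arcPt θ
  have hxy := arcPt_sq_sum θ
  have h4 : 0 < 4 + 6 * (arcPt θ).re := by linarith
  have h7 : 0 < 7 + 12 * (arcPt θ).re := by linarith
  obtain ⟨r1, i1⟩ := pole₁_re_im him hns
  obtain ⟨r2, i2⟩ := pole₂_re_im him hns h4
  have R1 := related_pole₁ him hns
  have R2 := related_pole₂ him hns h4
  set z := arcPt θ with hz
  have hlt1 : (pole₁ z).im < z.im := by
    rw [i1, div_lt_iff₀ h4]; nlinarith
  have hlt2 : (pole₂ z).im < (pole₁ z).im := by
    rw [i1, i2, div_lt_div_iff₀ h7 h4]; nlinarith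
  have hA : 1 / 9 < (pole₂ z).im := by
    rw [i2, lt_div_iff₀ h7]
    by_contra hcon
    push Not at hcon
    nlinarith
  have hre1 : (pole₁ z).re ≠ 0 ∧ |(pole₁ z).re| < 1 / 2 := by
    have h0 : 0 < (pole₁ z).re := by rw [r1]; apply div_pos <;> linarith
    refine ⟨h0.ne', ?_⟩
    rw [abs_of_pos h0, r1, div_lt_iff₀ h4]
    linarith
  have hre2 : (pole₂ z).re ≠ 0 ∧ |(pole₂ z).re| < 1 / 2 := by
    have h0 : 0 < (3 + 5 * z.re) / (7 + 12 * z.re) := by apply div_pos <;> linarith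
    rw [r2, abs_neg, abs_of_pos h0]
    refine ⟨(neg_neg_of_pos h0).ne, ?_⟩
    rw [div_lt_iff₀ h7]
    linarith
  have := h.abs_arcForm_sub_le hN hg hP hθ (a := 1 / 9) (C := 1 / 5) (by norm_num)
    ![z, pole₁ z, pole₂ z]
    (fun i => by fin_cases i <;> simp <;> linarith)
    (fun i => by
      fin_cases i
      · exact Related.refl _
      · exact R1
      · exact R2)
    (by
      intro i i' hii
      fin_cases i <;> fin_cases i' <;> simp at hii ⊢ <;> linarith)
    (fun i => by
      fin_cases i
      · refine ⟨?_, ?_⟩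
        · simp; linarith
        · simp [abs_lt]; constructor <;> linarith
      · exact hre1
      · exact hre2)
    (fun τ hτ hJ => by
      obtain ⟨p, hp, e⟩ := nome_mem_of_hauptJ_eq hτ hθ' hx hJ
      simp only [mem_insert_iff, mem_singleton_iff] at hp
      rcases hp with rfl | rfl | rfl
      · exact ⟨0, e⟩
      · exact ⟨1, e⟩
      · exact ⟨2, e⟩)
    (fun τ hτ => h.near_error hm hθ' hc hτ)
  rw [Fin.sum_univ_three] at this
  exact this

end approx

/-! ### Signs of the form at the sample points. -/

/-- The mean value theorem for the real part on the arc. -/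
lemma arcPt_re_sub {a b : ℝ} (ha : Real.pi / 2 ≤ a) (hab : a < b) (hb : b ≤ 5 * Real.pi / 6) :
    ∃ s : ℝ, 1 / 2 ≤ s ∧ s ≤ Real.sin a ∧ √3 * ((arcPt a).re - (arcPt b).re) = s * (b - a) := by
  have hpi := Real.pi_pos
  obtain ⟨c, hc, e⟩ := exists_hasDerivAt_eq_slope Real.cos (fun x => -Real.sin x) hab
    Real.continuous_cos.continuousOn fun x _ => Real.hasDerivAt_cos x
  refine ⟨Real.sin c, sin_ge_half_of_arc (by linarith [hc.1]) (by linarith [hc.2]), ?_, ?_⟩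
  · rw [← Real.sin_pi_sub c, ← Real.sin_pi_sub a]
    exact Real.sin_le_sin_of_le_of_le_pi_div_two (by linarith [hc.2]) (by linarith)
      (by linarith [hc.1])
  · have hne : b - a ≠ 0 := by linarith
    have h3 : √3 ≠ (0 : ℝ) := by positivity
    rw [eq_div_iff hne] at e
    rw [arcPt_re, arcPt_re, ← sub_div, mul_div_cancel₀ _ h3]
    linarith

lemma sqrt_three_le : √3 ≤ (1.7321 : ℝ) := by
  rw [Real.sqrt_le_left (by norm_num)]; norm_num

/-- Here M = 2πm, K = κ, η = x + 1/2 and φ = 5π/6 - θ. The first extra pole has height y/(1 + 6η),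
and the quantity bounded is the exponent by which its term is smaller than e^{My}. As η → 0 it
behaves like √3(Kφ + Mη), √3 times the phase gap, so a gap of π/6 yields about 0.9. -/
lemma log_mul_add_ge {η y φ M K : ℝ} (hη : 0 < η) (hη3 : η ≤ 3 / 10) (hy0 : 0 < y)
    (hy : y ^ 2 = 1 / 12 + η - η ^ 2) (h1 : η ≤ y * φ) (h2 : φ ≤ 3.4642 * η) (hM : 144 ≤ M)
    (hK : -(0.05306 * M) ≤ K) (hgap : 0.523 ≤ K * φ + M * η) :
    0.83 ≤ K * Real.log (1 + 6 * η) + M * y * (1 - 1 / (1 + 6 * η)) := by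
  have hQ : 0 < 1 + 6 * η := by linarith
  have e : M * y * (1 - 1 / (1 + 6 * η)) = 6 * (M * η) * (y / (1 + 6 * η)) := by
    field_simp; ring
  rw [e]
  have hyQ : 0.1925 ≤ y / (1 + 6 * η) := by
    rw [le_div_iff₀ hQ]
    by_contra hcon
    push Not at hcon
    have : y ^ 2 < (0.1925 * (1 + 6 * η)) ^ 2 := by gcongr
    rw [hy] at this
    norm_num at this
    nlinarith
  have hμ : 0 < M * η := by nlinarith
  have hy1 : 0.28867 ≤ y := by
    by_contra hcon
    push Not at hcon
    have : y ^ 2 < 0.28867 ^ 2 := by gcongr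
    norm_num at this
    nlinarith
  have hφ : 0 ≤ φ := by
    by_contra hcon
    push Not at hcon
    nlinarith
  set L := Real.log (1 + 6 * η) with hL
  have hL1 : L ≤ 6 * η := by
    have := Real.log_le_sub_one_of_pos hQ
    linarith
  have hL0 : 0 ≤ L := Real.log_nonneg (by linarith)
  set v := y / (1 + 6 * η) with hv
  have hsmall : ∀ c : ℝ, 0 < c → η ≤ c → 0.28867 / (1 + 6 * c) ≤ v := by
    intro c hc0 hc
    rw [hv]
    gcongr
  set μ := M * η with hμdef
  have hmul : ∀ c : ℝ, c ≤ v → 6 * μ * c ≤ 6 * μ * v := fun c hc =>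
    mul_le_mul_of_nonneg_left hc (by positivity)
  clear_value L v
  -- For large Mη the height difference alone suffices. For small Mη the point is so close to the
  -- corner that both summands are replaced by their linear parts and the phase gap is used.
  rcases le_total 0 K with hK0 | hK0
  · rcases le_total 0.75 μ with hμ1 | hμ1
    · have := mul_nonneg hK0 hL0
      have h6 := hmul _ hyQ
      norm_num at hμ1 h6 ⊢
      linarith
    · have hηs : η ≤ 0.00521 := by
        norm_num at hμ1 ⊢
        nlinarith
      have hvs := hsmall 0.00521 (by norm_num) hηs
      have hLs : 5.818 * η ≤ L := by
        have h3 := Real.one_sub_inv_le_log_of_pos hQ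
        rw [← hL] at h3
        refine le_trans ?_ h3
        have e2 : 1 - (1 + 6 * η)⁻¹ = 6 * η / (1 + 6 * η) := by field_simp; ring
        rw [e2, le_div_iff₀ hQ]
        norm_num at hηs ⊢
        nlinarith
      have h4 : 1.679 * φ ≤ L := by norm_num at hLs h2 ⊢; linarith
      have h5 : K * (1.679 * φ) ≤ K * L := mul_le_mul_of_nonneg_left h4 hK0
      have h6 : 1.679 * μ ≤ 6 * μ * v := by
        refine le_trans ?_ (hmul _ hvs)
        norm_num
        linarith
      have e3 : K * (1.679 * φ) = 1.679 * (K * φ) := by ring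
      norm_num at h5 h6 hgap e3 ⊢
      linarith
  · have h3 : K * (6 * η) ≤ K * L := mul_le_mul_of_nonpos_left hL1 hK0
    rcases le_total 1 μ with hμ1 | hμ1
    · have h4 : -(0.05306 * M) * (6 * η) ≤ K * (6 * η) :=
        mul_le_mul_of_nonneg_right hK (by positivity)
      have h5 : -(0.05306 * M) * (6 * η) = -0.31836 * μ := by rw [hμdef]; ring
      have h6 := hmul _ hyQ
      norm_num at h4 h5 h6 ⊢
      linarith
    · have hηs : η ≤ 0.00695 := by
        norm_num at hμ1 ⊢
        nlinarith
      have hvs := hsmall 0.00695 (by norm_num) hηs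
      have hy2 : y ≤ 0.3005 := by
        by_contra hcon
        push Not at hcon
        have : 0.3005 ^ 2 < y ^ 2 := by gcongr
        norm_num at this hηs
        nlinarith
      have h4 : η ≤ 0.3005 * φ := h1.trans (by gcongr)
      have h5 : K * (1.803 * φ) ≤ K * (6 * η) := by
        refine mul_le_mul_of_nonpos_left ?_ hK0
        norm_num at h4 ⊢
        linarith
      have h6 : 1.6626 * μ ≤ 6 * μ * v := by
        refine le_trans ?_ (hmul _ hvs)
        norm_num
        linarith
      have h7 : -(0.05306 * M) * φ ≤ K * φ := mul_le_mul_of_nonneg_right hK hφ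
      have h8 : -0.1839 * μ ≤ K * φ := by
        refine le_trans ?_ h7
        have h9 : M * φ ≤ M * (3.4642 * η) := by gcongr
        rw [hμdef]
        norm_num at h9 ⊢
        linarith
      have e3 : K * (1.803 * φ) = 1.803 * (K * φ) := by ring
      norm_num at h5 h6 h8 hgap h3 e3 ⊢
      linarith

/-- The derivative in Q is (KQ + My)/Q². This carries the bound from the first extra pole, Q = 1 +
6η, to the lower one, Q = 1 + 12η. -/
lemma log_mul_add_mono {y M K Q Q' : ℝ} (hQ : 1 ≤ Q) (hQQ' : Q ≤ Q') (hy : 0 ≤ y) (hM : 0 ≤ M)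
    (hK : -(M * y) ≤ K * Q') :
    K * Real.log Q + M * y * (1 - 1 / Q) ≤ K * Real.log Q' + M * y * (1 - 1 / Q') := by
  have h0 : 0 < Q := by linarith
  have h0' : 0 < Q' := by linarith
  have hMy : 0 ≤ M * y := mul_nonneg hM hy
  have hl : Real.log Q' - Real.log Q ≤ (Q' - Q) / Q := by
    rw [← Real.log_div h0'.ne' h0.ne']
    refine (Real.log_le_sub_one_of_pos (by positivity)).trans (le_of_eq ?_)
    field_simp
  have hl0 : 0 ≤ Real.log Q' - Real.log Q := by
    have := Real.log_le_log h0 hQQ'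
    linarith
  have e : (1 - 1 / Q') - (1 - 1 / Q) = (Q' - Q) / Q / Q' := by field_simp; ring
  have hd : 0 ≤ (Q' - Q) / Q := div_nonneg (by linarith) h0.le
  have key : 0 ≤ K * (Real.log Q' - Real.log Q) + M * y * ((Q' - Q) / Q / Q') := by
    rcases le_total 0 K with hK0 | hK0
    · positivity
    · have h1 : K * ((Q' - Q) / Q) ≤ K * (Real.log Q' - Real.log Q) :=
        mul_le_mul_of_nonpos_left hl hK0
      have h2 : 0 ≤ (K * Q' + M * y) * ((Q' - Q) / Q / Q') :=
        mul_nonneg (by linarith) (div_nonneg hd h0'.le)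
      have h3 : (K * Q' + M * y) * ((Q' - Q) / Q / Q') =
          K * ((Q' - Q) / Q) + M * y * ((Q' - Q) / Q / Q') := by
        field_simp
      linarith
  rw [← e] at key
  linarith

lemma zpow_mul_exp_le {Q y M X : ℝ} {κ : ℤ} (hQ : 0 < Q) (hy : 0 < y)
    (h : X ≤ κ * Real.log Q + M * y * (1 - 1 / Q)) :
    (y / Q / y) ^ κ * Real.exp (M * (y / Q)) ≤ Real.exp (-X) * Real.exp (M * y) := by
  have e1 : (y / Q / y) ^ κ = Real.exp (-(κ * Real.log Q)) := by
    have : y / Q / y = Q⁻¹ := by field_simp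
    rw [this, inv_zpow, Real.exp_neg, mul_comm, ← Real.rpow_intCast, Real.rpow_def_of_pos hQ]
  rw [e1, ← Real.exp_add, ← Real.exp_add]
  apply Real.exp_le_exp.2
  have : M * y * (1 - 1 / Q) = M * y - M * (y / Q) := by field_simp
  linarith

lemma exp_neg_le : Real.exp (-0.83) ≤ 0.441 := by
  have h := le_exp_of_le (n := 0) (t := 0.83) (x := 0.83) (by norm_num) (by norm_num)
  rw [Real.exp_neg]
  refine (inv_anti₀ (by norm_num) h).trans ?_
  norm_num

lemma continuousAt_qf {g : ℂ → ℂ} (hg : DiscReal g) (n : ℤ) {τ : ℂ} (him : 0 < τ.im) :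
    ContinuousAt (qf n g) τ := by
  have h1 : ContinuousAt nome τ := continuous_nome.continuousAt
  have h2 : ContinuousAt g (nome τ) :=
    (hg.differentiableAt (norm_nome_lt_one him)).continuousAt
  exact (h1.zpow₀ n (Or.inl (nome_ne_zero τ))).mul (ContinuousAt.comp (f := nome) h2 h1)

lemma continuousAt_hauptJ {τ : ℂ} (him : 0 < τ.im) : ContinuousAt hauptJ τ := by
  have h := (differentiableAt_hauptU him).continuousAt
  exact continuousAt_const.mul (h.add (h.inv₀ (hauptU_ne_zero him)))

lemma continuousAt_phase (κ : ℤ) (θ : ℝ) : ContinuousAt (fun t : ℝ => cexp (I * κ * t)) θ := by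
  fun_prop

lemma continuousAt_arcForm {φ : ℂ → ℂ} (hφ : DiscReal φ) (κ E : ℤ) (P : Polynomial ℝ) {θ : ℝ}
    (him : 0 < (arcPt θ).im) : ContinuousAt (arcForm κ (qf E φ) P) θ := by
  have h1 : ContinuousAt (fun t => qf E φ (arcPt t)) θ :=
    ContinuousAt.comp (f := arcPt) (continuousAt_qf hφ E him) continuous_arcPt.continuousAt
  have h2 : ContinuousAt (fun t => hauptJ (arcPt t)) θ :=
    ContinuousAt.comp (f := arcPt) (continuousAt_hauptJ him) continuous_arcPt.continuousAt
  have h3 : ContinuousAt (fun t => Polynomial.aeval (hauptJ (arcPt t)) P) θ :=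
    ContinuousAt.comp (f := fun t => hauptJ (arcPt t)) (P.continuous_aeval.continuousAt) h2
  exact continuous_re.continuousAt.comp ((continuousAt_phase κ θ).mul (h1.mul h3))

lemma continuous_arcPhase (κ m : ℤ) : Continuous (arcPhase κ m) := by
  have := Complex.continuous_re.comp continuous_arcPt
  exact (continuous_const.mul continuous_id).sub (continuous_const.mul this)

lemma continuousAt_polePart {φ : ℂ → ℂ} (hφ : DiscReal φ) (κ m E : ℤ) {p : ℝ → ℂ} {θ : ℝ}
    (him : 0 < (arcPt θ).im) (hp : ContinuousAt p θ) (hpim : 0 < (p θ).im)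
    (h0 : qf E φ (p θ) ≠ 0) :
    ContinuousAt (fun t => (polePart κ m (qf E φ) t (p t)).re) θ := by
  have h1 : ContinuousAt (fun t => qf E φ (arcPt t)) θ :=
    ContinuousAt.comp (f := arcPt) (continuousAt_qf hφ E him) continuous_arcPt.continuousAt
  have h2 : ContinuousAt (fun t => qf E φ (p t)) θ :=
    ContinuousAt.comp (f := p) (continuousAt_qf hφ E hpim) hp
  have h3 : ContinuousAt (fun t => nome (p t) ^ (-m)) θ :=
    (ContinuousAt.comp (f := p) continuous_nome.continuousAt hp).zpow₀ _ (Or.inl (nome_ne_zero _))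
  exact continuous_re.continuousAt.comp
    ((continuousAt_phase κ θ).mul ((h1.div h2 h0).mul h3))

lemma continuousAt_exp_im (m : ℤ) (θ : ℝ) :
    ContinuousAt (fun t => Real.exp (2 * Real.pi * m * (arcPt t).im)) θ := by
  have : Continuous fun t => (arcPt t).im := Complex.continuous_im.comp continuous_arcPt
  fun_prop

/-- At the corner both extra poles are translates of z, so the contributions reinforce each other.
-/
lemma pole₁_rho : pole₁ rho = rho + 1 ∧ pole₂ rho = rho := by
  have h1 := three_mul_add_ne_zero rho_im_pos 1
  have h2 := three_mul_add_ne_zero rho_im_pos 2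
  have h0 := ne_zero_of_im_pos rho_im_pos
  push_cast at h1 h2
  have h : 3 * (rho * (rho + 1)) = -1 := by
    have := fricke_rho
    rw [fricke, div_eq_iff (mul_ne_zero (by norm_num) h0)] at this
    linear_combination -this
  constructor
  · rw [pole₁, div_eq_iff h1]
    linear_combination -h
  · rw [pole₂, div_eq_iff h2]
    linear_combination -h

section sample

variable {ρ ε : ℤ} {A A' : ℂ → ℂ} {ℓ m : ℤ} {N : ℕ} {P : Polynomial ℝ} {g : ℂ → ℂ}

lemma IsSeed.kappa_ge (h : IsSeed ρ ε A A') : 6 * ℓ ≤ 6 * ℓ + 3 * ε + ρ := by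
  cases h <;> omega

lemma sign_of_abs_sub_le {H c e δ a : ℝ} (he : 0 < e) (hc : |c| = 1) (ha : δ < a)
    (h : |H - a * c * e| ≤ δ * e) : 0 < H * c := by
  have hcc : c * c = 1 := by
    rw [← abs_mul_abs_self, hc, one_mul]
  have h1 : |(H - a * c * e) * c| ≤ δ * e := by rw [abs_mul, hc, mul_one]; exact h
  have h2 := (abs_le.1 h1).1
  have h3 : (H - a * c * e) * c = H * c - a * e := by linear_combination (-(a * e)) * hcc
  rw [h3] at h2
  nlinarith

/-- The sign of the form at the far sample points. -/
lemma IsSeed.far_sign (h : IsSeed ρ ε A A') (hm : 18 * |ℓ| + 23 ≤ m)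
    (hN : (N : ℤ) = m + (2 * ℓ + ε)) (hg : DiscReal g)
    (hP : ∀ w ∈ ball (0 : ℂ) 1, w ≠ 0 →
      w ^ N * Polynomial.aeval (hauptQ w / w) P * (betaQ w ^ (2 * ℓ + ε) * A w) =
        1 + w ^ (N + 1) * g w)
    {θ : ℝ} (hθ : θ ∈ Ico (Real.pi / 2) (5 * Real.pi / 6))
    (hc : -(1 / 5) ≤ (hauptU (arcPt θ)).re)
    (hcos : |Real.cos (arcPhase (6 * ℓ + 3 * ε + ρ) m θ)| = 1) :
    0 < arcForm (6 * ℓ + 3 * ε + ρ) (qf (2 * ℓ + ε) fun w => betaQ w ^ (2 * ℓ + ε) * A w) P θ *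
      Real.cos (arcPhase (6 * ℓ + 3 * ε + ρ) m θ) := by
  have hpi := Real.pi_pos
  refine sign_of_abs_sub_le (Real.exp_pos (2 * Real.pi * m * (arcPt θ).im)) hcos
    (a := 2) (δ := 1 / 5) (by norm_num) ?_
  -- At θ = π/2 the point is its own mirror image and the residue count degenerates, so the estimate
  -- is obtained as a limit from the right.
  rcases hθ.1.eq_or_lt with h0 | h0
  · have him := arcPt_im_pos hθ.1 hθ.2.le
    have hcu : ContinuousAt (fun t => (hauptU (arcPt t)).re) θ :=
      continuous_re.continuousAt.comp (ContinuousAt.comp (f := arcPt)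
        (differentiableAt_hauptU him).continuousAt continuous_arcPt.continuousAt)
    have hev : ∀ᶠ t in 𝓝[>] θ, t ∈ Ioo (Real.pi / 2) (5 * Real.pi / 6) ∧
        -(1 / 5) ≤ (hauptU (arcPt t)).re := by
      have e1 : ∀ᶠ t in 𝓝[>] θ, -(1 / 5) < (hauptU (arcPt t)).re := by
        refine (hcu.tendsto.mono_left nhdsWithin_le_nhds).eventually (lt_mem_nhds ?_)
        rw [← h0, hauptU_arc_start]
        norm_num
      filter_upwards [e1, Ioo_mem_nhdsGT hθ.2] with t h1 h2
      exact ⟨⟨by linarith [h2.1], h2.2⟩, h1.le⟩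
    have hF := continuousAt_arcForm (h.dualPair ℓ).qform₁.toDiscReal (6 * ℓ + 3 * ε + ρ)
      (2 * ℓ + ε) P him
    have hcosc : ContinuousAt
        (fun t => Real.cos (arcPhase (6 * ℓ + 3 * ε + ρ) m t)) θ :=
      (Real.continuous_cos.comp (continuous_arcPhase _ _)).continuousAt
    have hexp := continuousAt_exp_im m θ
    have hl := ((hF.sub ((continuousAt_const (y := (2 : ℝ))).mul hcosc |>.mul hexp)).abs).tendsto.mono_left
      (nhdsWithin_le_nhds (s := Ioi θ))
    have hr := ((continuousAt_const (y := (1 / 5 : ℝ))).mul hexp).tendsto.mono_left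
      (nhdsWithin_le_nhds (s := Ioi θ))
    exact le_of_tendsto_of_tendsto hl hr (hev.mono fun t ht => h.far_approx hm hN hg hP ht.1 ht.2)
  · exact h.far_approx hm hN hg hP ⟨h0, hθ.2⟩ hc

set_option maxHeartbeats 1000000 in
/-- The sign of the form at the near sample points. -/
lemma IsSeed.near_sign (h : IsSeed ρ ε A A') (hm : 18 * |ℓ| + 23 ≤ m)
    (hN : (N : ℤ) = m + (2 * ℓ + ε)) (hg : DiscReal g)
    (hP : ∀ w ∈ ball (0 : ℂ) 1, w ≠ 0 →
      w ^ N * Polynomial.aeval (hauptQ w / w) P * (betaQ w ^ (2 * ℓ + ε) * A w) =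
        1 + w ^ (N + 1) * g w)
    {θ : ℝ} (hθ : θ ∈ Ioo (Real.pi / 2) (5 * Real.pi / 6))
    (hc : (hauptU (arcPt θ)).re ≤ -(1 / 5))
    (hcos : |Real.cos (arcPhase (6 * ℓ + 3 * ε + ρ) m θ)| = 1)
    (hgap : Real.pi / 6 ≤ arcPhase (6 * ℓ + 3 * ε + ρ) m (5 * Real.pi / 6) -
      arcPhase (6 * ℓ + 3 * ε + ρ) m θ) :
    0 < arcForm (6 * ℓ + 3 * ε + ρ) (qf (2 * ℓ + ε) fun w => betaQ w ^ (2 * ℓ + ε) * A w) P θ *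
      Real.cos (arcPhase (6 * ℓ + 3 * ε + ρ) m θ) := by
  have hpi := Real.pi_gt_d4
  have hθ' : θ ∈ Icc (Real.pi / 2) (5 * Real.pi / 6) := ⟨hθ.1.le, hθ.2.le⟩
  have him := arcPt_im_pos hθ.1.le hθ.2.le
  have hx := arcPt_re_le_neg_fifth hθ' hc
  have hx1 := neg_half_lt_arcPt_re hθ.1.le hθ.2
  have hns := normSq_arcPt θ
  have hxy := arcPt_sq_sum θ
  have h4 : 0 < 4 + 6 * (arcPt θ).re := by linarith
  have h7 : 0 < 7 + 12 * (arcPt θ).re := by linarith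
  have happ := h.near_approx hm hN hg hP hθ hc
  obtain ⟨hj1, hj2⟩ := hauptJ_arc_ne hθ
  have hF0 := h.qf_ne_zero (2 * ℓ + ε) him hj1 hj2
  have hφ := (h.dualPair ℓ).qform₁
  obtain ⟨-, i1⟩ := pole₁_re_im him hns
  obtain ⟨-, i2⟩ := pole₂_re_im him hns h4
  have n1 := norm_polePart (m := m) hφ him (by rw [i1]; positivity) (related_pole₁ him hns) hF0
  have n2 := norm_polePart (m := m) hφ him (by rw [i2]; positivity) (related_pole₂ him hns h4) hF0
  rw [polePart_self hF0] at happ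
  obtain ⟨s, s1, s2, s3⟩ := arcPt_re_sub hθ.1.le hθ.2 le_rfl
  have hrho : (arcPt (5 * Real.pi / 6)).re = -(1 / 2) := by
    rw [arcPt_five]; norm_num [rho]
  have hκ := h.kappa_ge (ℓ := ℓ)
  set κ := 6 * ℓ + 3 * ε + ρ
  set F := qf (2 * ℓ + ε) fun w => betaQ w ^ (2 * ℓ + ε) * A w
  rw [arcPhase, arcPhase, hrho] at hgap
  have hsin : Real.sin θ = √3 * (arcPt θ).im := by
    rw [arcPt_im]; field_simp
  rw [hrho] at s3
  rw [hsin] at s2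
  rw [i1] at n1
  rw [i2] at n2
  set x := (arcPt θ).re
  set y := (arcPt θ).im
  have h3 : (0 : ℝ) < √3 := by positivity
  have h3' := sqrt_three_le
  have h33 : √3 * √3 = (3 : ℝ) := Real.mul_self_sqrt (by norm_num)
  obtain ⟨η, hη⟩ : ∃ η, η = x + 1 / 2 := ⟨_, rfl⟩
  obtain ⟨ψ, hψ⟩ : ∃ ψ, ψ = 5 * Real.pi / 6 - θ := ⟨_, rfl⟩
  have hη0 : 0 < η := by linarith
  have hψ0 : 0 < ψ := by linarith [hθ.2]
  have hs3 : √3 * η = s * ψ := by rw [hη, hψ, ← s3]; ring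
  have hmR : (18 * |(ℓ : ℝ)| + 23) ≤ m := by exact_mod_cast hm
  have hκR : (6 * (ℓ : ℝ)) ≤ κ := by exact_mod_cast hκ
  have hℓ := neg_abs_le (ℓ : ℝ)
  have hm0 : (23 : ℝ) ≤ m := by linarith [abs_nonneg (ℓ : ℝ)]
  have hMm : 3.1415 * (m : ℝ) ≤ Real.pi * m := by gcongr
  have hM : 144 ≤ 2 * Real.pi * m := by norm_num at hMm; linarith
  -- κ ≥ 6ℓ ≥ -(m - 23)/3 > -m/3, and 1/(6π) < 0.05306.
  have hK : -(0.05306 * (2 * Real.pi * m)) ≤ κ := by norm_num at hMm ⊢; linarith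
  have hψ1 : η ≤ y * ψ := by
    have : √3 * η ≤ √3 * (y * ψ) := by
      rw [hs3, ← mul_assoc]; gcongr
    exact le_of_mul_le_mul_left this h3
  have hψ2 : ψ ≤ 3.4642 * η := by
    have h5 : 1 / 2 * ψ ≤ √3 * η := by rw [hs3]; gcongr
    have h6 : √3 * η ≤ 1.7321 * η := by gcongr
    norm_num at h6 ⊢
    linarith
  have hy2 : y ^ 2 = 1 / 12 + η - η ^ 2 := by rw [hη]; linarith
  have hgap' : 0.523 ≤ κ * ψ + 2 * Real.pi * m * η := by
    have : (κ : ℝ) * ψ + 2 * Real.pi * m * η =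
        κ * (5 * Real.pi / 6) - 2 * Real.pi * m * -(1 / 2) - (κ * θ - 2 * Real.pi * m * x) := by
      rw [hψ, hη]; ring
    rw [this]
    norm_num at hpi ⊢
    linarith
  have X1 := log_mul_add_ge hη0 (by linarith) him hy2 hψ1 hψ2 hM hK hgap'
  have X2 := log_mul_add_mono (y := y) (M := 2 * Real.pi * m) (K := κ) (Q := 1 + 6 * η)
    (Q' := 1 + 12 * η) (by linarith) (by linarith) him.le (by linarith) (by
      have hy1 : 0.28 ≤ y := by
        by_contra hcon
        push Not at hcon
        have : y ^ 2 < 0.28 ^ 2 := by gcongr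
        norm_num at this
        nlinarith
      have e1 : -(0.05306 * (2 * Real.pi * m)) * (1 + 12 * η) ≤ κ * (1 + 12 * η) := by gcongr
      have e2 : 0.05306 * (2 * Real.pi * m) * (1 + 12 * η) ≤ 2 * Real.pi * m * y := by
        calc 0.05306 * (2 * Real.pi * m) * (1 + 12 * η)
            = (2 * Real.pi * m) * (0.05306 * (1 + 12 * η)) := by ring
          _ ≤ 2 * Real.pi * m * y := by
            gcongr
            norm_num at hy1 ⊢
            linarith
      linarith)
  have eQ1 : 4 + 6 * x = 1 + 6 * η := by rw [hη]; ring
  have eQ2 : 7 + 12 * x = 1 + 12 * η := by rw [hη]; ring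
  rw [eQ1] at n1
  rw [eQ2] at n2
  have b1 := zpow_mul_exp_le (κ := κ) (M := 2 * Real.pi * m) (by linarith) him X1
  have b2 := zpow_mul_exp_le (κ := κ) (M := 2 * Real.pi * m) (by linarith) him (X1.trans X2)
  rw [← n1] at b1
  rw [← n2] at b2
  set e := Real.exp (2 * Real.pi * m * y)
  have he : 0 < e := Real.exp_pos _
  have hex : Real.exp (-0.83) * e ≤ 0.441 * e := by
    have := exp_neg_le
    gcongr
  have r1 := abs_re_le_norm (polePart κ m F θ (pole₁ (arcPt θ)))
  have r2 := abs_re_le_norm (polePart κ m F θ (pole₂ (arcPt θ)))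
  -- Each extra pole contributes at most 2 · 0.441 and the error at most 0.2, in total 1.964 < 2.
  refine sign_of_abs_sub_le he hcos (a := 2) (δ := 1.97) (by norm_num) ?_
  have q1 := abs_le.1 (r1.trans (b1.trans hex))
  have q2 := abs_le.1 (r2.trans (b2.trans hex))
  have q3 := abs_le.1 happ
  rw [abs_le]
  norm_num at q1 q2 q3 ⊢
  constructor
  · linarith [q1.1, q2.1, q3.1]
  · linarith [q1.2, q2.2, q3.2]

/-- The sign of the form at the corner of the arc, for the seed without zeros. -/
lemma corner_sign (hm : 18 * |ℓ| + 23 ≤ m)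
    (hN : (N : ℤ) = m + (2 * ℓ + 0)) (hg : DiscReal g)
    (hP : ∀ w ∈ ball (0 : ℂ) 1, w ≠ 0 →
      w ^ N * Polynomial.aeval (hauptQ w / w) P * (betaQ w ^ (2 * ℓ + 0) * 1) =
        1 + w ^ (N + 1) * g w)
    (hcos : |Real.cos (arcPhase (6 * ℓ + 3 * 0 + 0) m (5 * Real.pi / 6))| = 1) :
    0 < arcForm (6 * ℓ + 3 * 0 + 0) (qf (2 * ℓ + 0) fun w => betaQ w ^ (2 * ℓ + 0) * 1) P
        (5 * Real.pi / 6) *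
      Real.cos (arcPhase (6 * ℓ + 3 * 0 + 0) m (5 * Real.pi / 6)) := by
  have hpi := Real.pi_pos
  have h := IsSeed.one
  obtain ⟨p1, p2⟩ := pole₁_rho
  have hφ := (h.dualPair ℓ).qform₁.toDiscReal
  have h5 : Real.pi / 2 ≤ 5 * Real.pi / 6 := by linarith
  have him := arcPt_im_pos h5 le_rfl
  have hF : ∀ τ : ℂ, 0 < τ.im → qf (2 * ℓ + 0) (fun w => betaQ w ^ (2 * ℓ + 0) * 1) τ ≠ 0 :=
    fun τ hτ => mul_ne_zero (zpow_ne_zero _ (nome_ne_zero τ))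
      (mul_ne_zero (zpow_ne_zero _ (betaQ_ne_zero (nome_mem_ball hτ))) one_ne_zero)
  -- Three poles and their mirror images contribute equally, hence the factor 6.
  refine sign_of_abs_sub_le (Real.exp_pos (2 * Real.pi * m * (arcPt (5 * Real.pi / 6)).im)) hcos
    (a := 6) (δ := 1 / 5) (by norm_num) ?_
  have hcu : ContinuousAt (fun t => (hauptU (arcPt t)).re) (5 * Real.pi / 6) :=
    continuous_re.continuousAt.comp (ContinuousAt.comp (f := arcPt)
      (differentiableAt_hauptU him).continuousAt continuous_arcPt.continuousAt)
  -- At the corner itself the six poles collapse to one nome, so the three-pole estimate is passed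
  -- to the limit from inside the arc.
  have hev : ∀ᶠ t in 𝓝[<] (5 * Real.pi / 6), t ∈ Ioo (Real.pi / 2) (5 * Real.pi / 6) ∧
      (hauptU (arcPt t)).re ≤ -(1 / 5) := by
    have e1 : ∀ᶠ t in 𝓝[<] (5 * Real.pi / 6), (hauptU (arcPt t)).re < -(1 / 5) := by
      refine (hcu.tendsto.mono_left nhdsWithin_le_nhds).eventually (gt_mem_nhds ?_)
      rw [arcPt_five, hauptU_rho]
      norm_num
    filter_upwards [e1, Ioo_mem_nhdsLT (show Real.pi / 2 < 5 * Real.pi / 6 by linarith)] with t h1 h2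
    exact ⟨h2, h1.le⟩
  have hcF := continuousAt_arcForm hφ (6 * ℓ + 3 * 0 + 0) (2 * ℓ + 0) P him
  have hexp := continuousAt_exp_im m (5 * Real.pi / 6)
  have hz : ContinuousAt arcPt (5 * Real.pi / 6) := continuous_arcPt.continuousAt
  have c0 := continuousAt_polePart hφ (6 * ℓ + 3 * 0 + 0) m (2 * ℓ + 0) him hz him (hF _ him)
  have him1 : 0 < (pole₁ (arcPt (5 * Real.pi / 6))).im := by
    rw [arcPt_five, p1]; simpa using rho_im_pos
  have him2 : 0 < (pole₂ (arcPt (5 * Real.pi / 6))).im := by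
    rw [arcPt_five, p2]; exact rho_im_pos
  have d1 := three_mul_add_ne_zero him 1
  have d2 := three_mul_add_ne_zero him 2
  push_cast at d1 d2
  have hp1 : ContinuousAt (fun t => pole₁ (arcPt t)) (5 * Real.pi / 6) :=
    hz.div ((continuousAt_const.mul hz).add continuousAt_const) d1
  have hp2 : ContinuousAt (fun t => pole₂ (arcPt t)) (5 * Real.pi / 6) :=
    (hz.add continuousAt_const).neg.div ((continuousAt_const.mul hz).add continuousAt_const) d2
  have c1 := continuousAt_polePart hφ (6 * ℓ + 3 * 0 + 0) m (2 * ℓ + 0) him hp1 him1 (hF _ him1)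
  have c2 := continuousAt_polePart hφ (6 * ℓ + 3 * 0 + 0) m (2 * ℓ + 0) him hp2 him2 (hF _ him2)
  have hl := ((hcF.sub ((((continuousAt_const (y := (2 : ℝ))).mul c0).add
    ((continuousAt_const (y := (2 : ℝ))).mul c1)).add
    ((continuousAt_const (y := (2 : ℝ))).mul c2))).abs).tendsto.mono_left
    (nhdsWithin_le_nhds (s := Iio (5 * Real.pi / 6)))
  have hr := ((continuousAt_const (y := (1 / 5 : ℝ))).mul hexp).tendsto.mono_left
    (nhdsWithin_le_nhds (s := Iio (5 * Real.pi / 6)))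
  have hle := le_of_tendsto_of_tendsto hl hr
    (hev.mono fun t ht => h.near_approx hm hN hg hP ht.1 ht.2)
  have e0 := polePart_self (κ := 6 * ℓ + 3 * 0 + 0) (m := m) (hF _ him)
  have e1 : polePart (6 * ℓ + 3 * 0 + 0) m (qf (2 * ℓ + 0) fun w => betaQ w ^ (2 * ℓ + 0) * 1)
      (5 * Real.pi / 6) (pole₁ (arcPt (5 * Real.pi / 6))) =
      polePart (6 * ℓ + 3 * 0 + 0) m (qf (2 * ℓ + 0) fun w => betaQ w ^ (2 * ℓ + 0) * 1)
      (5 * Real.pi / 6) (arcPt (5 * Real.pi / 6)) := by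
    simp only [polePart, arcPt_five, p1, qf, nome_add_one]
  have e2 : pole₂ (arcPt (5 * Real.pi / 6)) = arcPt (5 * Real.pi / 6) := by rw [arcPt_five, p2]
  simp only [Pi.sub_apply, Pi.add_apply, Pi.mul_apply] at hle
  rw [e2, e1, e0] at hle
  refine le_trans (le_of_eq ?_) hle
  congr 1
  ring

end sample

end Fricke3

end

/-! ### Counting zeros on the arc. -/

noncomputable section
namespace Fricke3
open Complex Metric Set Filter Topology ComplexConjugate
open scoped UpperHalfPlane

/-- A function whose sign agrees with that of `cos Ψ` where `Ψ` is a multiple of `π` has as many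
zeros as `Ψ` has half-turns. -/
lemma exists_zeros_of_sign {Ψ H : ℝ → ℝ} {a b : ℝ} {n₀ : ℤ} {N : ℕ} (hab : a ≤ b)
    (hΨ : ContinuousOn Ψ (Icc a b)) (hmono : StrictMonoOn Ψ (Icc a b))
    (ha : Ψ a ≤ n₀ * Real.pi) (hb : (n₀ + N) * Real.pi ≤ Ψ b) (hH : ContinuousOn H (Icc a b))
    (hs : ∀ θ ∈ Icc a b, ∀ n : ℤ, n ≤ n₀ + N → Ψ θ = n * Real.pi → 0 < H θ * Real.cos (Ψ θ)) :
    ∃ s : Finset ℝ, s.card = N ∧ ∀ x ∈ s, x ∈ Ioo a b ∧ H x = 0 := by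
  have hpi := Real.pi_pos
  have hex : ∀ i : ℕ, ∃ t, i ≤ N → t ∈ Icc a b ∧ Ψ t = (n₀ + i) * Real.pi := by
    intro i
    by_cases hi : i ≤ N
    · have hiR : (i : ℝ) ≤ N := by exact_mod_cast hi
      obtain ⟨t, ht, e⟩ := intermediate_value_Icc hab hΨ
        (show (n₀ + i) * Real.pi ∈ Icc (Ψ a) (Ψ b) from
          ⟨ha.trans (by gcongr; simp), le_trans (by gcongr) hb⟩)
      exact ⟨t, fun _ => ⟨ht, e⟩⟩
    · exact ⟨0, fun h => absurd h hi⟩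
  choose t ht using hex
  have hz : ∀ i : ℕ, ∃ x, i < N → x ∈ Ioo (t i) (t (i + 1)) ∧ H x = 0 := by
    intro i
    by_cases hi : i < N
    · obtain ⟨h1, e1⟩ := ht i hi.le
      obtain ⟨h2, e2⟩ := ht (i + 1) hi
      have e3 : Ψ (t (i + 1)) = Ψ (t i) + Real.pi := by rw [e1, e2]; push_cast; ring
      have hlt : t i < t (i + 1) := (hmono.lt_iff_lt h1 h2).1 (by rw [e3]; linarith)
      have s1 := hs _ h1 (n₀ + i) (by omega) (by rw [e1]; push_cast; ring)
      have s2 := hs _ h2 (n₀ + (i + 1 : ℕ)) (by omega) (by rw [e2]; push_cast; ring)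
      rw [e3, Real.cos_add_pi] at s2
      have hc : ContinuousOn H (Icc (t i) (t (i + 1))) := hH.mono (Icc_subset_Icc h1.1 h2.2)
      -- The phase increases by π between consecutive samples, so the cosine, and with it H, changes
      -- sign.
      have key : (0 : ℝ) ∈ H '' Ioo (t i) (t (i + 1)) := by
        rcases lt_or_ge 0 (Real.cos (Ψ (t i))) with h | h
        · exact intermediate_value_Ioo' hlt.le hc ⟨by nlinarith, by nlinarith⟩
        · exact intermediate_value_Ioo hlt.le hc ⟨by nlinarith, by nlinarith⟩
      obtain ⟨x, hx, e⟩ := key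
      exact ⟨x, fun _ => ⟨hx, e⟩⟩
    · exact ⟨0, fun h => absurd h hi⟩
  choose z hz using hz
  have hlt : ∀ i j, i < j → j < N → z i < z j := by
    intro i j hij hj
    obtain ⟨h1, e1⟩ := ht (i + 1) (by omega)
    obtain ⟨h2, e2⟩ := ht j hj.le
    have hle : t (i + 1) ≤ t j := (hmono.le_iff_le h1 h2).1 (by
      rw [e1, e2]
      have : ((i + 1 : ℕ) : ℝ) ≤ j := by exact_mod_cast hij
      gcongr)
    exact (hz i (hij.trans hj)).1.2.trans (hle.trans_lt (hz j hj).1.1)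
  refine ⟨(Finset.range N).image z, ?_, ?_⟩
  · rw [Finset.card_image_of_injOn, Finset.card_range]
    intro i hi j hj hij
    simp only [Finset.coe_range, mem_Iio] at hi hj
    rcases lt_trichotomy i j with h | h | h
    · exact absurd hij (hlt i j h hj).ne
    · exact h
    · exact absurd hij (hlt j i h hi).ne'
  · simp only [Finset.mem_image, Finset.mem_range]
    rintro _ ⟨i, hi, rfl⟩
    obtain ⟨h1, h2⟩ := hz i hi
    exact ⟨⟨(ht i hi.le).1.1.trans_lt h1.1, h1.2.trans_le (ht (i + 1) hi).1.2⟩, h2⟩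

/-- A polynomial of degree `N` with `N` known roots has no others. -/
lemma mem_of_aeval_eq_zero {P : Polynomial ℝ} (hP : P.Monic) {s : Finset ℂ}
    (hcard : s.card = P.natDegree) (hs : ∀ x ∈ s, Polynomial.aeval x P = 0) {x : ℂ}
    (hx : Polynomial.aeval x P = 0) : x ∈ s := by
  have h0 : P.map (algebraMap ℝ ℂ) ≠ 0 := (hP.map _).ne_zero
  have hr : ∀ y : ℂ, Polynomial.aeval y P = 0 → y ∈ (P.map (algebraMap ℝ ℂ)).roots := fun y hy => by
    rw [Polynomial.mem_roots h0, Polynomial.IsRoot.def, Polynomial.eval_map_algebraMap]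
    exact hy
  by_contra hxs
  have hsub : (insert x s).val ⊆ (P.map (algebraMap ℝ ℂ)).roots := by
    intro y hy
    rcases Finset.mem_insert.1 hy with rfl | h
    · exact hr _ hx
    · exact hr _ (hs _ h)
  have := Polynomial.card_le_degree_of_subset_roots hsub
  rw [Finset.card_insert_of_notMem hxs, hP.natDegree_map, hcard] at this
  omega

lemma arcPhase_start (κ m : ℤ) : arcPhase κ m (Real.pi / 2) = κ * Real.pi / 2 := by
  rw [arcPhase, arcPt_re, Real.cos_pi_div_two]; ring

lemma arcPhase_end (κ m : ℤ) :
    arcPhase κ m (5 * Real.pi / 6) = (5 * κ + 6 * m) * Real.pi / 6 := by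
  have hrho : (arcPt (5 * Real.pi / 6)).re = -(1 / 2) := by
    rw [arcPt_five]; norm_num [rho]
  rw [arcPhase, hrho]; ring

/-- The slope is κ + 2πm sin θ/√3 with sin θ ≥ 1/2, and π/√3 > 1/3. -/
lemma arcPhase_strictMonoOn {κ m : ℤ} (hm : 0 < m) (hκ : -m ≤ 3 * κ) :
    StrictMonoOn (arcPhase κ m) (Icc (Real.pi / 2) (5 * Real.pi / 6)) := by
  intro a ha b hb hab
  obtain ⟨s, s1, -, s3⟩ := arcPt_re_sub ha.1 hab hb.2
  have hpi := Real.pi_gt_three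
  have h3 : (0 : ℝ) < √3 := by positivity
  have h3' := sqrt_three_le
  have hmR : (0 : ℝ) < m := by exact_mod_cast hm
  have hκR : -(m : ℝ) ≤ 3 * κ := by exact_mod_cast hκ
  have e : √3 * (arcPhase κ m b - arcPhase κ m a) = (b - a) * (√3 * κ + 2 * Real.pi * m * s) := by
    rw [arcPhase, arcPhase]
    linear_combination (2 * Real.pi * m) * s3
  have h1 : √3 * -(m / 3 : ℝ) ≤ √3 * κ := by gcongr; linarith
  have h2 : √3 * (m / 3 : ℝ) ≤ 1.7321 * (m / 3) := by gcongr
  have h4 : 2 * 3 * m * (1 / 2 : ℝ) ≤ 2 * Real.pi * m * s := by gcongr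
  have h5 : 0 < √3 * κ + 2 * Real.pi * m * s := by norm_num at h2; linarith
  have h6 : 0 < √3 * (arcPhase κ m b - arcPhase κ m a) := by
    rw [e]; exact mul_pos (by linarith) h5
  have := (mul_pos_iff_of_pos_left h3).1 h6
  linarith

section zeros

variable {ρ ε : ℤ} {A A' : ℂ → ℂ} {ℓ m : ℤ} {N : ℕ} {P : Polynomial ℝ} {g : ℂ → ℂ}

/-- The sign of the form at a sample point which is not too close to the corner. -/
lemma IsSeed.sample_sign (h : IsSeed ρ ε A A') (hm : 18 * |ℓ| + 23 ≤ m)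
    (hN : (N : ℤ) = m + (2 * ℓ + ε)) (hg : DiscReal g)
    (hP : ∀ w ∈ ball (0 : ℂ) 1, w ≠ 0 →
      w ^ N * Polynomial.aeval (hauptQ w / w) P * (betaQ w ^ (2 * ℓ + ε) * A w) =
        1 + w ^ (N + 1) * g w)
    {θ : ℝ} (hθ : θ ∈ Icc (Real.pi / 2) (5 * Real.pi / 6))
    (hcos : |Real.cos (arcPhase (6 * ℓ + 3 * ε + ρ) m θ)| = 1)
    (hgap : Real.pi / 6 ≤ arcPhase (6 * ℓ + 3 * ε + ρ) m (5 * Real.pi / 6) -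
      arcPhase (6 * ℓ + 3 * ε + ρ) m θ) :
    0 < arcForm (6 * ℓ + 3 * ε + ρ) (qf (2 * ℓ + ε) fun w => betaQ w ^ (2 * ℓ + ε) * A w) P θ *
      Real.cos (arcPhase (6 * ℓ + 3 * ε + ρ) m θ) := by
  have hpi := Real.pi_pos
  have h2 : θ < 5 * Real.pi / 6 := by
    refine hθ.2.lt_of_ne ?_
    rintro rfl
    linarith
  rcases le_total (-(1 / 5)) (hauptU (arcPt θ)).re with hc | hc
  · exact h.far_sign hm hN hg hP ⟨hθ.1, h2⟩ hc hcos
  · refine h.near_sign hm hN hg hP ⟨hθ.1.lt_of_ne ?_, h2⟩ hc hcos hgap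
    rintro rfl
    rw [hauptU_arc_start] at hc
    norm_num at hc

/-- n₀π is the first sample phase, at least κπ/2. The second expression is, in units of π/6, the
distance from the last sample phase (n₀ + N)π to the phase at the corner. It vanishes only for r =
0. -/
lemma IsSeed.exists_start (h : IsSeed ρ ε A A') (ℓ : ℤ) :
    ∃ n₀ : ℤ, 6 * ℓ + 3 * ε + ρ ≤ 2 * n₀ ∧
      (1 ≤ 5 * (6 * ℓ + 3 * ε + ρ) - 6 * n₀ - 6 * (2 * ℓ + ε) ∨
        0 = 5 * (6 * ℓ + 3 * ε + ρ) - 6 * n₀ - 6 * (2 * ℓ + ε) ∧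
          ρ = 0 ∧ ε = 0 ∧ A = fun _ => 1) := by
  cases h
  · exact ⟨3 * ℓ, by omega, Or.inr ⟨by omega, rfl, rfl, rfl⟩⟩
  · exact ⟨3 * ℓ + 1, by omega, Or.inl (by omega)⟩
  · exact ⟨3 * ℓ + 2, by omega, Or.inl (by omega)⟩
  · exact ⟨3 * ℓ + 2, by omega, Or.inl (by omega)⟩
  · exact ⟨3 * ℓ + 3, by omega, Or.inl (by omega)⟩
  · exact ⟨3 * ℓ + 4, by omega, Or.inl (by omega)⟩

lemma IsSeed.neg_le_kappa (h : IsSeed ρ ε A A') (hm : 18 * |ℓ| + 23 ≤ m) :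
    0 < m ∧ -m ≤ 3 * (6 * ℓ + 3 * ε + ρ) := by
  have h1 := h.kappa_ge (ℓ := ℓ)
  have h2 := neg_abs_le ℓ
  have h3 := abs_nonneg ℓ
  omega

/-- The form changes sign between consecutive sample points, so it has `N` zeros on the arc. -/
theorem IsSeed.exists_arc_zeros (h : IsSeed ρ ε A A') (hm : 18 * |ℓ| + 23 ≤ m)
    (hN : (N : ℤ) = m + (2 * ℓ + ε)) (hg : DiscReal g)
    (hP : ∀ w ∈ ball (0 : ℂ) 1, w ≠ 0 →
      w ^ N * Polynomial.aeval (hauptQ w / w) P * (betaQ w ^ (2 * ℓ + ε) * A w) =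
        1 + w ^ (N + 1) * g w) :
    ∃ s : Finset ℝ, s.card = N ∧ ∀ θ ∈ s, θ ∈ Ioo (Real.pi / 2) (5 * Real.pi / 6) ∧
      arcForm (6 * ℓ + 3 * ε + ρ) (qf (2 * ℓ + ε) fun w => betaQ w ^ (2 * ℓ + ε) * A w) P θ = 0 := by
  have hpi := Real.pi_pos
  obtain ⟨hm0, hκ⟩ := h.neg_le_kappa hm
  have hmono := arcPhase_strictMonoOn hm0 hκ
  obtain ⟨n₀, hn, hv⟩ := h.exists_start ℓ
  have hNR : (N : ℝ) = m + (2 * ℓ + ε) := by exact_mod_cast hN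
  have hend : arcPhase (6 * ℓ + 3 * ε + ρ) m (5 * Real.pi / 6) - (n₀ + N) * Real.pi =
      ((5 * (6 * ℓ + 3 * ε + ρ) - 6 * n₀ - 6 * (2 * ℓ + ε) : ℤ) : ℝ) * (Real.pi / 6) := by
    rw [arcPhase_end, hNR]; push_cast; ring
  obtain ⟨v, hvd⟩ : ∃ v, v = 5 * (6 * ℓ + 3 * ε + ρ) - 6 * n₀ - 6 * (2 * ℓ + ε) := ⟨_, rfl⟩
  rw [← hvd] at hend hv
  have hv0 : 0 ≤ v := by rcases hv with hv | hv <;> omega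
  have hvR : (0 : ℝ) ≤ v := by exact_mod_cast hv0
  refine exists_zeros_of_sign (n₀ := n₀) (by linarith) (continuous_arcPhase _ _).continuousOn hmono
    ?_ ?_ ?_ ?_
  · rw [arcPhase_start]
    have : ((6 * ℓ + 3 * ε + ρ : ℤ) : ℝ) ≤ 2 * n₀ := by exact_mod_cast hn
    nlinarith
  · have : 0 ≤ (v : ℝ) * (Real.pi / 6) := by positivity
    linarith
  · exact fun θ hθ => (continuousAt_arcForm (h.dualPair ℓ).qform₁.toDiscReal _ _ P
      (arcPt_im_pos hθ.1 hθ.2)).continuousWithinAt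
  · intro θ hθ n hnN e
    have hcos : |Real.cos (arcPhase (6 * ℓ + 3 * ε + ρ) m θ)| = 1 := by
      rw [e, Real.abs_cos_int_mul_pi]
    -- Either every sample is at least π/6 short of the corner phase, or the seed is 1 and the last
    -- sample is the corner.
    rcases hv with hv | ⟨hv, rfl, rfl, rfl⟩
    · refine h.sample_sign hm hN hg hP hθ hcos ?_
      have h1 : (1 : ℝ) ≤ v := by exact_mod_cast hv
      have h2 : (n : ℝ) ≤ n₀ + N := by exact_mod_cast hnN
      have h3 : (n : ℝ) * Real.pi ≤ (n₀ + N) * Real.pi := by gcongr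
      rw [e]
      nlinarith
    · rw [← hv, Int.cast_zero, zero_mul] at hend
      rcases hnN.lt_or_eq with hlt | heq
      · refine h.sample_sign hm hN hg hP hθ hcos ?_
        have h2 : (n : ℝ) + 1 ≤ n₀ + N := by exact_mod_cast hlt
        have h3 : ((n : ℝ) + 1) * Real.pi ≤ (n₀ + N) * Real.pi := by gcongr
        rw [e]
        linarith
      · have hθe : θ = 5 * Real.pi / 6 := by
          refine hmono.injOn hθ ⟨by linarith, le_rfl⟩ ?_
          rw [e, heq]
          push_cast
          linarith
        rw [hθe] at hcos ⊢
        exact corner_sign hm hN hg hP hcos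

/-- All zeros of the Faber polynomial lie in `[-54, 54]`. -/
theorem IsSeed.exists_of_aeval_eq_zero (h : IsSeed ρ ε A A') (hm : 18 * |ℓ| + 23 ≤ m)
    (hN : (N : ℤ) = m + (2 * ℓ + ε)) (hg : DiscReal g) (hmonic : P.Monic) (hdeg : P.natDegree = N)
    (hP : ∀ w ∈ ball (0 : ℂ) 1, w ≠ 0 →
      w ^ N * Polynomial.aeval (hauptQ w / w) P * (betaQ w ^ (2 * ℓ + ε) * A w) =
        1 + w ^ (N + 1) * g w)
    {x : ℂ} (hx : Polynomial.aeval x P = 0) :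
    ∃ c : ℝ, |c| ≤ 1 ∧ x = ((54 * c : ℝ) : ℂ) := by
  obtain ⟨s, hcard, hs⟩ := h.exists_arc_zeros hm hN hg hP
  have hI : ∀ θ ∈ s, θ ∈ Icc (Real.pi / 2) (5 * Real.pi / 6) := fun θ hθ =>
    Ioo_subset_Icc_self (hs θ hθ).1
  have him : ∀ θ ∈ s, 0 < (arcPt θ).im := fun θ hθ => arcPt_im_pos (hI θ hθ).1 (hI θ hθ).2
  -- The N zeros on the arc have distinct values of j, all of them roots of P because F does not
  -- vanish on the open arc. They exhaust the degree.
  have hmem : x ∈ s.image fun θ => hauptJ (arcPt θ) := by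
    refine mem_of_aeval_eq_zero hmonic ?_ ?_ hx
    · rw [Finset.card_image_of_injOn, hcard, hdeg]
      intro a ha b hb hab
      simp only [hauptJ_arc (him a ha), hauptJ_arc (him b hb), ofReal_inj] at hab
      exact re_hauptU_strictAnti.injOn (hI a ha) (hI b hb) (by linarith)
    · simp only [Finset.mem_image]
      rintro _ ⟨θ, hθ, rfl⟩
      have e := arcForm_eq (h.dualPair ℓ).qform₁ P (him θ hθ)
      rw [(hs θ hθ).2, ofReal_zero, eq_comm] at e
      obtain ⟨h1, h2⟩ := hauptJ_arc_ne (hs θ hθ).1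
      exact (mul_eq_zero.1 ((mul_eq_zero.1 e).resolve_left (exp_ne_zero _))).resolve_left
        (h.qf_ne_zero _ (him θ hθ) h1 h2)
  obtain ⟨θ, hθ, rfl⟩ := Finset.mem_image.1 hmem
  refine ⟨(hauptU (arcPt θ)).re, ?_, hauptJ_arc (him θ hθ)⟩
  rw [← norm_hauptU_eq_one (him θ hθ) (normSq_arcPt θ)]
  exact abs_re_le_norm _

end zeros

/-- The points of the fundamental domain where `j` takes values in `[-54, 54]` lie on the arc. -/
theorem mem_arc_of_hauptJ_eq {z : ℍ} (hz : z ∈ fundamentalDomain) {c : ℝ} (hc : |c| ≤ 1)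
    (hj : hauptJ z = ((54 * c : ℝ) : ℂ)) : (z : ℂ) ∈ arc := by
  have him : 0 < (z : ℂ).im := z.im_pos
  have hu : ‖hauptU z‖ = 1 := by
    refine (norm_eq_one_of_add_inv (hauptU_ne_zero him) hc ?_).1
    rw [hauptJ] at hj
    push_cast at hj ⊢
    linear_combination hj / 27
  have hns : |(z : ℂ).re| ≤ 1 / 2 → normSq (z : ℂ) ≤ 1 / 3 := fun hre => by
    by_contra! hcon
    exact (one_lt_norm_hauptU him hre hcon).ne' hu
  have h3 : (1 / √3) ^ 2 = (1 / 3 : ℝ) := by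
    rw [div_pow, Real.sq_sqrt (by norm_num)]; norm_num
  have hre : z.re = (z : ℂ).re := rfl
  rcases hz with ⟨h1, h2, h4⟩ | ⟨h1, h2, h4⟩
  · rw [hre] at h2 h4
    have hle : (1 / √3) ^ 2 ≤ ‖(z : ℂ)‖ ^ 2 := by gcongr
    rw [h3, ← normSq_eq_norm_sq] at hle
    obtain ⟨θ, hθ, e⟩ := exists_arcPt him
      (le_antisymm (hns (abs_le.2 ⟨h2, by linarith⟩)) hle) h2 h4
    exact ⟨θ, hθ.1, hθ.2, e⟩
  · rw [hre] at h2 h4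
    have hle : (1 / √3) ^ 2 < ‖(z : ℂ)‖ ^ 2 := by gcongr
    rw [h3, ← normSq_eq_norm_sq] at hle
    have := hns (abs_le.2 ⟨by linarith, h4.le⟩)
    linarith

lemma IsSeed.isCanonicalBasisElement_unique {ρ ε ℓ k r m : ℤ} {A A' : ℂ → ℂ} (h : IsSeed ρ ε A A')
    (hr : r = 2 * ρ + 6 * ε) (hk : k = 12 * ℓ + r) {f f' : ℍ → ℂ}
    (hf : IsCanonicalBasisElement k ℓ r m f) (hf' : IsCanonicalBasisElement k ℓ r m f') :
    f = f' := by
  obtain ⟨h1, a, ha, ha'⟩ := hf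
  obtain ⟨h2, b, hb, hb'⟩ := hf'
  have hk' : k = 2 * (6 * ℓ + 3 * ε + ρ) := by rw [hk, hr]; ring
  rw [eps_eq h hr] at ha' hb'
  refine sub_eq_zero.1 ((h.dualPair ℓ).eq_zero (a := a - b) (hk' ▸ sub_mem h1 h2) (ha.sub hb)
    fun i hi => ?_)
  rw [Pi.sub_apply, ha' i hi, hb' i hi, sub_self]

end Fricke3

end

theorem theorem1p1 (k ℓ r m : ℤ)
    (hr : r ∈ ({0, 4, 6, 8, 10, 14} : Set ℤ)) (hk : k = 12 * ℓ + r)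
    (hm : 18 * |ℓ| + 23 ≤ m) :
    (∃! f : UpperHalfPlane → ℂ, Fricke3.IsCanonicalBasisElement k ℓ r m f) ∧
      ∀ f : UpperHalfPlane → ℂ, Fricke3.IsCanonicalBasisElement k ℓ r m f →
        ∀ z ∈ Fricke3.fundamentalDomain, f z = 0 → (z : ℂ) ∈ Fricke3.arc := by
  obtain ⟨ρ, ε, A, A', h, hρ⟩ := Fricke3.exists_isSeed hr
  have hk' : k = 2 * (6 * ℓ + 3 * ε + ρ) := by rw [hk, hρ]; ring
  obtain ⟨N, hN⟩ : ∃ N : ℕ, (N : ℤ) = m + (2 * ℓ + ε) := by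
    have h1 := neg_abs_le ℓ
    have h2 := abs_nonneg ℓ
    have h3 : ε = 0 ∨ ε = 1 := h.eps_eq_or
    exact ⟨(m + (2 * ℓ + ε)).toNat, Int.toNat_of_nonneg (by omega)⟩
  obtain ⟨P, hmonic, hdeg, ⟨g, hg, hP⟩, hmem, a, ha, ha'⟩ :=
    (h.dualPair ℓ).exists_canonical hN
  rw [← hk'] at hmem
  rw [← Fricke3.eps_eq h hρ] at ha'
  have hcan : Fricke3.IsCanonicalBasisElement k ℓ r m _ := ⟨hmem, a, ha, ha'⟩
  refine ⟨⟨_, hcan, fun f hf => h.isCanonicalBasisElement_unique hρ hk hf hcan⟩, ?_⟩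
  intro f hf z hz hfz
  rw [h.isCanonicalBasisElement_unique hρ hk hf hcan] at hfz
  -- A zero of F has j = ±54, the endpoints of the interval; a zero of P(j) has j in [-54, 54].
  rcases mul_eq_zero.1 hfz with h0 | h0
  · by_cases h1 : Fricke3.hauptJ z = 54
    · exact Fricke3.mem_arc_of_hauptJ_eq hz (c := 1) (by simp) (by rw [h1]; norm_num)
    · by_cases h2 : Fricke3.hauptJ z = -54
      · exact Fricke3.mem_arc_of_hauptJ_eq hz (c := -1) (by simp) (by rw [h2]; norm_num)
      · exact absurd h0 (h.qf_ne_zero _ z.im_pos h1 h2)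
  · obtain ⟨c, hc, e⟩ := h.exists_of_aeval_eq_zero hm hN hg hmonic hdeg hP h0
    exact Fricke3.mem_arc_of_hauptJ_eq hz hc e
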